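/- Let $d\ge 1$. Cubes are closed cubes with sides parallel to the coordinate axes and positive side length, and a weight on a cube $Q\subset\mathbb R^d$ is a measurable function $Q\to(0,\infty)$. For $p\in[1,\infty)$ let $p'\in(1,\infty]$ be given by $\frac1p+\frac1{p'}=1$. For $r\in[1,\infty)$, $s\in(0,1)$ and measurable $f\colon Q\to\mathbb C$ put $$\|f\|_{L^p_\sigma(Q)}=\Big(\int_Q|f|^p\sigma^p\,dx\Big)^{1/p},\qquad [f]_{F^{s,\sigma}_{p,r}(Q)}=\Big(\int_Q\Big(\int_Q\frac{|f(x)-f(y)|^r}{|x-y|^{d+sr}}\,dy\Big)^{p/r}\sigma(x)^p\,dx\Big)^{1/p},$$ and let $F^{s,\sigma}_{p,r}(Q)$ be the space of all $f$ for which both are finite. Let $\langle f\rangle_Q=\frac1{|Q|}\int_Q f$, let $\langle g\rangle_{t,R}=\langle |g|^t\rangle_R^{1/t}$ for $t<\infty$ and $\langle g\rangle_{\infty,R}=\|g\|_{L^\infty(R)}$. For weights $\omega,\sigma,w$ on $Q$ define $$[\omega,\sigma]_{A^\alpha_{p,q}(Q)}=\sup_{R\subseteq Q}|R|^\alpha\langle\omega\rangle_{q,R}\langle\sigma^{-1}\rangle_{p',R},\qquad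 [w]_{A_\infty(Q)}=\sup_{R\subseteq Q}\frac1{w(R)}\int_R\sup_{S\subseteq R}\langle w\rangle_{1,S}\mathbf 1_S(x)\,dx,$$ with $w(R)=\int_R w$ and suprema over cubes; write $(\omega,\sigma)\in A^\alpha_{p,q}(Q)$, respectively $w\in A_\infty(Q)$, if the characteristic is finite. **Theorem.** Let $Q\subset\mathbb R^d$ be a cube, $1\le p\le q<\infty$, $r\in[1,\infty)$, $s\in(0,1)$, $0\le\alpha<\frac1q+\frac1{p'}$, $(\omega,\sigma)\in A^\alpha_{p,q}(Q)$, and assume $$\varepsilon=\tfrac sd-\big(\tfrac1p-\tfrac1q\big)-\alpha\ge 0.$$ Then the following hold for all $f\in F^{s,\sigma}_{p,r}(Q)$. (i) (Subcritical case) If $\varepsilon>0$, then $$\|f-\langle f\rangle_Q\|_{L^q_\omega(Q)}\le C\,[\omega,\sigma]_{A^\alpha_{p,q}(Q)}\,(1-s)^{1/r}\,\frac{|Q|^\varepsilon}{\varepsilon}\,[f]_{F^{s,\sigma}_{p,r}(Q)},$$ where $C$ depends only on $d$. (ii) (Critical case I) If $\varepsilon=0$, $p\ge r$ and $\omega^q\in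 A_\infty(Q)$, then $$\|f-\langle f\rangle_Q\|_{L^q_\omega(Q)}\le C\,[\omega,\sigma]_{A^\alpha_{p,q}(Q)}\,(1-s)^{1/r}\,[f]_{F^{s,\sigma}_{p,r}(Q)}\cdot\begin{cases}[\omega^q]_{A_\infty(Q)}^{1/p'} & \text{if } 1<p<q,\\ [\omega^q]_{A_\infty(Q)} & \text{otherwise,}\end{cases}$$ where $C$ depends only on $p,q,r,d$. (iii) (Critical case II) If $\varepsilon=0$, $p>1$ and $\omega^q,\sigma^{-p'}\in A_\infty(Q)$, then $$\|f-\langle f\rangle_Q\|_{L^q_\omega(Q)}\le C\,[\omega,\sigma]_{A^\alpha_{p,q}(Q)}\,(1-s)^{1/r}\,[f]_{F^{s,\sigma}_{p,r}(Q)}\cdot\begin{cases}[\omega^q]_{A_\infty(Q)}^{1/p'}+[\sigma^{-p'}]_{A_\infty(Q)}^{1/q} & \text{if } p<q,\\ [\omega^q]_{A_\infty(Q)}^{1/p'}\cdot[\sigma^{-p'}]_{A_\infty(Q)}^{1/q} & \text{if } p=q,\end{cases}$$ where $C$ depends only on $p,q,r,d$. -/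

import Mathlib

open MeasureTheory Set
open scoped ENNReal NNReal

noncomputable section

/-- A nondegenerate closed cube in `ℝ^d` with sides parallel to the coordinate axes. -/
structure Cube (d : ℕ) where
  /-- The corner with smallest coordinates. -/
  corner : EuclideanSpace ℝ (Fin d)
  /-- The side length. -/
  side : ℝ
  side_pos : 0 < side

/-- The set of points of a cube, `∏ i, [corner i, corner i + side]`. -/
def Cube.toSet {d : ℕ} (Q : Cube d) : Set (EuclideanSpace ℝ (Fin d)) :=
  {x | ∀ i, x i ∈ Icc (Q.corner i) (Q.corner i + Q.side)}

/-- A weight on `Q`: a (Lebesgue) measurable function that is strictly positive on `Q`.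
Its values off `Q` are irrelevant. -/
def IsWeightOn {d : ℕ} (Q : Cube d) (σ : EuclideanSpace ℝ (Fin d) → ℝ) : Prop :=
  AEMeasurable σ (volume.restrict Q.toSet) ∧ ∀ x ∈ Q.toSet, 0 < σ x

/-- The average `⟨g⟩_{p,R}`: the `L^p` norm of `g` on `R` with respect to normalized Lebesgue
measure, which is the essential supremum of `|g|` on `R` if `p = ∞`. -/
def pAverage {d : ℕ} (p : ℝ≥0∞) (R : Cube d) (g : EuclideanSpace ℝ (Fin d) → ℝ) : ℝ≥0∞ :=
  eLpNorm g p ((volume R.toSet)⁻¹ • volume.restrict R.toSet)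

/-- The two-weight characteristic
`[ω,σ]_{A_{p,q}^α(Q)} = sup_{R ⊆ Q} |R|^α ⟨ω⟩_{q,R} ⟨σ⁻¹⟩_{p',R}`, where `1/p + 1/p' = 1`,
with `p' = ∞` if `p = 1`. -/
def apqChar {d : ℕ} (p q α : ℝ) (Q : Cube d) (ω σ : EuclideanSpace ℝ (Fin d) → ℝ) : ℝ≥0∞ :=
  ⨆ (R : Cube d) (_ : R.toSet ⊆ Q.toSet),
    (volume R.toSet) ^ α * pAverage (ENNReal.ofReal q) R ω *
      pAverage (ENNReal.conjExponent (ENNReal.ofReal p)) R (fun x => (σ x)⁻¹)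

/-- The local Fujii–Wilson characteristic
`[w]_{A_∞(Q)} = sup_{R ⊆ Q} w(R)⁻¹ ∫_R sup_{S ⊆ R} ⟨w⟩_{1,S} 1_S(x) dx`,
for a weight `w` that is integrable on `Q`. -/
def aInftyChar {d : ℕ} (Q : Cube d) (w : EuclideanSpace ℝ (Fin d) → ℝ) : ℝ≥0∞ :=
  ⨆ (R : Cube d) (_ : R.toSet ⊆ Q.toSet),
    (∫⁻ x in R.toSet, ⨆ (S : Cube d) (_ : S.toSet ⊆ R.toSet),
        S.toSet.indicator (fun _ => pAverage 1 S w) x) /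
      ∫⁻ x in R.toSet, ENNReal.ofReal (w x)

/-- The weighted norm `‖f‖_{L^p_σ(Q)} = (∫_Q |f|^p σ^p)^{1/p}` (the weight is a multiplier). -/
def wLpNorm {d : ℕ} (p : ℝ) (Q : Cube d) (σ : EuclideanSpace ℝ (Fin d) → ℝ)
    (f : EuclideanSpace ℝ (Fin d) → ℂ) : ℝ≥0∞ :=
  (∫⁻ x in Q.toSet, ‖f x‖ₑ ^ p * ENNReal.ofReal (σ x) ^ p) ^ (1 / p)

/-- The fractional (difference) seminorm
`[f]_{F^{s,σ}_{p,r}(Q)} =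
  (∫_Q (∫_Q |f(x) - f(y)|^r / |x - y|^{d + s r} dy)^{p/r} σ(x)^p dx)^{1/p}`. -/
def tlSeminorm {d : ℕ} (s p r : ℝ) (Q : Cube d) (σ : EuclideanSpace ℝ (Fin d) → ℝ)
    (f : EuclideanSpace ℝ (Fin d) → ℂ) : ℝ≥0∞ :=
  (∫⁻ x in Q.toSet,
      (∫⁻ y in Q.toSet, ‖f x - f y‖ₑ ^ r / edist x y ^ ((d : ℝ) + s * r)) ^ (p / r) *
        ENNReal.ofReal (σ x) ^ p) ^ (1 / p)

/-- Membership in the weighted Triebel–Lizorkin space `F^{s,σ}_{p,r}(Q)`: `f` is measurable on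
`Q`, lies in `L^p_σ(Q)`, and has finite seminorm. -/
structure MemTL {d : ℕ} (s p r : ℝ) (Q : Cube d) (σ : EuclideanSpace ℝ (Fin d) → ℝ)
    (f : EuclideanSpace ℝ (Fin d) → ℂ) : Prop where
  aestronglyMeasurable : AEStronglyMeasurable f (volume.restrict Q.toSet)
  wLpNorm_lt_top : wLpNorm p Q σ f < ∞
  tlSeminorm_lt_top : tlSeminorm s p r Q σ f < ∞

/-- The quantity `‖f - ⟨f⟩_Q‖_{L^q_ω(Q)}`, with the unweighted average `⟨f⟩_Q`. -/
def oscNorm {d : ℕ} (q : ℝ) (Q : Cube d) (ω : EuclideanSpace ℝ (Fin d) → ℝ)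
    (f : EuclideanSpace ℝ (Fin d) → ℂ) : ℝ≥0∞ :=
  wLpNorm q Q ω (fun x => f x - ⨍ y in Q.toSet, f y)

/-- The scaling deficit `ε = s/d - (1/p - 1/q) - α`. -/
def scalingDeficit (d : ℕ) (s p q α : ℝ) : ℝ :=
  s / d - (1 / p - 1 / q) - α

/-- The standing assumptions: `1 ≤ p ≤ q < ∞`, `1 ≤ r < ∞`, `0 < s < 1`,
`0 ≤ α < 1/q + 1/p'`, the functions `ω`, `σ` are weights on `Q` with
`(ω, σ) ∈ A_{p,q}^α(Q)`, and `f ∈ F^{s,σ}_{p,r}(Q)`. -/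
structure Setting {d : ℕ} (p q r s α : ℝ) (Q : Cube d)
    (ω σ : EuclideanSpace ℝ (Fin d) → ℝ) (f : EuclideanSpace ℝ (Fin d) → ℂ) : Prop where
  one_le_p : 1 ≤ p
  p_le_q : p ≤ q
  one_le_r : 1 ≤ r
  s_pos : 0 < s
  s_lt_one : s < 1
  α_nonneg : 0 ≤ α
  α_lt : α < 1 / q + (1 - 1 / p)
  weight_ω : IsWeightOn Q ω
  weight_σ : IsWeightOn Q σ
  apq : apqChar p q α Q ω σ < ∞
  memTL : MemTL s p r Q σ f

end

/-!
# Weighted Poincaré–Sobolev inequalities on cubes for fractional Triebel–Lizorkin seminorms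

All estimates start from one local inequality. Let `g(x)` be the inner integral of the seminorm over
`Q` to the power `1/r`, and `G` a dimensional multiple of `(1-s)^{1/r} g`. Then the mean oscillation
of `f` over a dyadic cube `R ⊆ Q` of side `ℓ` is at most `ℓ^{-(d-s)} ∫_R G`, up to a dimensional
factor (`osc_le_oscMajorant`). The factor `(1-s)^{1/r}` is the Bourgain–Brezis–Mironescu gain
(`lintegral_enorm_sub_le_diffFn`): for every `n`, the oscillation is controlled by the differences
of `f` at distance about `ℓ/n`, and averaging over `n` gives the seminorm. As the weighted norm of
`G` is the seminorm of `f`, the theorem is a two-weight problem. By Hölder's inequality, the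
`A^α_{p,q}` condition says `w(R)^{1/q} ∫_R G ≤ K ℓ^{d-s} |R|^ε ‖G‖_{L^p_σ(R)}` for `w = ω^q`
(`twoWeightOn_of_apqChar`).

* *Subcritical case*: telescoping over the dyadic cubes containing `x` bounds `f - ⟨f⟩_Q` by a sum
  over generations, whose terms have norms decaying like `2^{-kdε}` (`Regular.subcritical`).
* *Critical case I*: by Maz'ya's truncation method, a weak type estimate for all truncations of
  `|f - ⟨f⟩_Q|` implies the strong one (`Regular.strongType_of_weakType`); here `p ≥ r` serves to
  add up the seminorms of the truncations. The weak type estimate follows from sparse domination and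
  the Carleson embedding property that the Fujii–Wilson condition gives (`Regular.weakType_sparse`),
  with a constant linear in the characteristic. If `1 < p < q`, it follows instead, with a better
  power, from a dual testing condition for dyadic fractional integrals (`Regular.weakType_frac`).
* *Critical case II*: for `p = q`, the bilinear form of the sparse operator is estimated directly
  (`Regular.strongType_sparse`). For `p < q`, a fractional integral is bounded as soon as it is on
  indicators of cells, in both directions (`PartitionTree.strongType_of_testing`), and the testing
  constants come from the two-weight condition and the Fujii–Wilson condition (`TwoWeight.testing`).

The constants in the critical cases must not depend on `s`, while the fractional integrals in the
case `p < q` carry the exponent `b = d - s` of the kernel as a coefficient. In dimension `d ≥ 2`,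
`b ≥ d/2`, and telescoping suffices. In dimension one `b = 1 - s` degenerates as `s → 1`; there
`f - ⟨f⟩_Q` is bounded by the Riesz potential of `G`, by means of disjoint shells on one side of `x`
(`Regular.ae_enorm_sub_average_le_potential`), and the kernel of the potential by those of fractional
integrals on two dyadic grids, shifted by one third (`edist_rpow_neg_le`).

Dyadic grids are treated as trees of measurable partitions (`PartitionTree`), and weights that are
positive and measurable on `Q` only are first replaced by regular ones (`exists_niceSetting`).
-/

/-! ### Nested countable partitions -/

/-- A sequence of nested countable measurable partitions of a measurable space. The cell of
generation `k` that contains `x` is the fibre of `idx k` through `x`. -/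
structure PartitionTree (X ι : Type*) [MeasurableSpace X] where
  /-- The label of the cell of generation `k` containing a given point. -/
  idx : ℕ → X → ι
  measurableSet_fiber : ∀ k i, MeasurableSet (idx k ⁻¹' {i})
  refine' : ∀ k x y, idx (k + 1) x = idx (k + 1) y → idx k x = idx k y

namespace PartitionTree

variable {X ι : Type*} [MeasurableSpace X] (t : PartitionTree X ι)

/-- The cell of generation `k` containing `x`. -/
def cell (k : ℕ) (x : X) : Set X := {y | t.idx k y = t.idx k x}

/-- A function is adapted to generation `k` if it is constant on the cells of generation `k`. -/
def Adapted {β : Type*} (k : ℕ) (a : X → β) : Prop := ∀ x y, t.idx k x = t.idx k y → a x = a y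

variable {t}

lemma mem_cell {k : ℕ} {x y : X} : y ∈ t.cell k x ↔ t.idx k y = t.idx k x := Iff.rfl

lemma self_mem_cell (k : ℕ) (x : X) : x ∈ t.cell k x := rfl

lemma measurableSet_cell (k : ℕ) (x : X) : MeasurableSet (t.cell k x) :=
  t.measurableSet_fiber k (t.idx k x)

lemma cell_eq {k : ℕ} {x y : X} (h : t.idx k x = t.idx k y) : t.cell k x = t.cell k y := by
  ext z; simp [mem_cell, h]

lemma idx_eq_of_le {j k : ℕ} (hjk : j ≤ k) {x y : X} (h : t.idx k x = t.idx k y) :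
    t.idx j x = t.idx j y := by
  induction k, hjk using Nat.le_induction with
  | base => exact h
  | succ k _ ih => exact ih (t.refine' k x y h)

lemma cell_subset {j k : ℕ} (hjk : j ≤ k) {x y : X} (h : y ∈ t.cell j x) :
    t.cell k y ⊆ t.cell j x := fun _ hz => (idx_eq_of_le hjk hz).trans h

lemma Adapted.mono {β : Type*} {j k : ℕ} (hjk : j ≤ k) {a : X → β} (ha : t.Adapted j a) :
    t.Adapted k a := fun x y h => ha x y (idx_eq_of_le hjk h)

lemma adapted_cell (k : ℕ) {β : Type*} (F : Set X → β) : t.Adapted k fun x => F (t.cell k x) :=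
  fun _ _ h => congrArg F (cell_eq h)

variable [Countable ι]

lemma Adapted.measurable {β : Type*} [MeasurableSpace β] {k : ℕ} {a : X → β}
    (ha : t.Adapted k a) : Measurable a := by
  intro s _
  have : a ⁻¹' s = ⋃ i ∈ {i | ∃ x, t.idx k x = i ∧ a x ∈ s}, t.idx k ⁻¹' {i} := by
    ext y
    simp only [mem_preimage, mem_ofPred_eq, mem_iUnion, mem_singleton_iff, exists_prop]
    constructor
    · intro h; exact ⟨_, ⟨y, rfl, h⟩, rfl⟩
    · rintro ⟨i, ⟨x, hx, hxs⟩, hy⟩; rwa [ha y x (hy.trans hx.symm)]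
  rw [this]
  exact MeasurableSet.biUnion (to_countable _) fun i _ => t.measurableSet_fiber k i

lemma Adapted.measurableSet {k : ℕ} {A : X → Prop} (hA : t.Adapted k A) :
    MeasurableSet {x | A x} := hA.measurable (measurableSet_singleton True) |>.congr (by ext; simp)

lemma lintegral_eq_tsum_fiber (k : ℕ) (ν : Measure X) (f : X → ℝ≥0∞) :
    ∫⁻ x, f x ∂ν = ∑' i, ∫⁻ x in t.idx k ⁻¹' {i}, f x ∂ν := by
  rw [← lintegral_iUnion (fun i => t.measurableSet_fiber k i), ← preimage_iUnion]
  · simp [iUnion_of_singleton]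
  · intro i j hij
    exact Disjoint.preimage _ (by simpa using hij)

/-- An inequality between integrals may be checked on the cells of a fixed generation. -/
lemma setLIntegral_le_of_cells {k : ℕ} {A : Set X} (hA : t.Adapted k (· ∈ A)) {ν μ : Measure X}
    {f g : X → ℝ≥0∞}
    (h : ∀ x ∈ A, ∫⁻ y in t.cell k x, f y ∂ν ≤ ∫⁻ y in t.cell k x, g y ∂μ) :
    ∫⁻ x in A, f x ∂ν ≤ ∫⁻ x in A, g x ∂μ := by
  rw [lintegral_eq_tsum_fiber (t := t) k, lintegral_eq_tsum_fiber (t := t) k]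
  refine ENNReal.tsum_le_tsum fun i => ?_
  rw [Measure.restrict_restrict (t.measurableSet_fiber k i),
    Measure.restrict_restrict (t.measurableSet_fiber k i)]
  by_cases hi : ∃ x ∈ A, t.idx k x = i
  · obtain ⟨x, hx, rfl⟩ := hi
    have : t.idx k ⁻¹' {t.idx k x} ∩ A = t.cell k x := by
      ext y
      simp only [mem_inter_iff, mem_preimage, mem_singleton_iff, mem_cell, and_iff_left_iff_imp]
      intro hy
      exact (hA y x hy).mpr hx
    rw [this]; exact h x hx
  · have : t.idx k ⁻¹' {i} ∩ A = ∅ := by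
      ext y
      simp only [mem_inter_iff, mem_preimage, mem_singleton_iff, mem_empty_iff_false, iff_false,
        not_and]
      exact fun hy hyA => hi ⟨y, hyA, hy⟩
    simp [this]

lemma lintegral_le_of_cells (k : ℕ) {ν μ : Measure X} {f g : X → ℝ≥0∞}
    (h : ∀ x, ∫⁻ y in t.cell k x, f y ∂ν ≤ ∫⁻ y in t.cell k x, g y ∂μ) :
    ∫⁻ x, f x ∂ν ≤ ∫⁻ x, g x ∂μ := by
  have := setLIntegral_le_of_cells (t := t) (k := k) (A := univ) (ν := ν) (μ := μ) (f := f) (g := g)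
    (fun _ _ _ => rfl) (fun x _ => h x)
  simpa using this

omit [Countable ι] in
lemma adapted_mem_cell {j k : ℕ} (hjk : j ≤ k) (x : X) : t.Adapted k (· ∈ t.cell j x) :=
  fun y z h => by simp only [mem_cell, idx_eq_of_le hjk h]

omit [Countable ι] in
/-- On a cell, a function constant on that cell can be pulled out of the integral. -/
lemma setLIntegral_adapted_mul {k : ℕ} {a : X → ℝ≥0∞} (ha : t.Adapted k a) {f : X → ℝ≥0∞}
    (hf : Measurable f) (ν : Measure X) (x : X) :
    ∫⁻ y in t.cell k x, a y * f y ∂ν = a x * ∫⁻ y in t.cell k x, f y ∂ν := by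
  rw [← lintegral_const_mul _ hf]
  exact setLIntegral_congr_fun (measurableSet_cell k x) fun y hy => by rw [ha y x hy]

omit [Countable ι] in
lemma setLIntegral_adapted {k : ℕ} {a : X → ℝ≥0∞} (ha : t.Adapted k a) (ν : Measure X) (x : X) :
    ∫⁻ y in t.cell k x, a y ∂ν = a x * ν (t.cell k x) := by
  rw [← setLIntegral_const]
  exact setLIntegral_congr_fun (measurableSet_cell k x) fun y hy => ha y x hy

/-! ### Averages and the maximal function of a partition tree -/

variable (t) in
/-- The `ν`-average of `h` over the cell of generation `k` containing `x`; it is `0` on cells of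
`ν`-measure `0`. -/
noncomputable def avg (ν : Measure X) (h : X → ℝ≥0∞) (k : ℕ) (x : X) : ℝ≥0∞ :=
  (∫⁻ y in t.cell k x, h y ∂ν) / ν (t.cell k x)

omit [Countable ι] in
lemma adapted_avg (ν : Measure X) (h : X → ℝ≥0∞) (k : ℕ) : t.Adapted k (t.avg ν h k) :=
  adapted_cell k fun C => (∫⁻ y in C, h y ∂ν) / ν C

omit [Countable ι] in
lemma avg_mul_measure (ν : Measure X) [IsFiniteMeasure ν] (h : X → ℝ≥0∞) (k : ℕ) (x : X) :
    t.avg ν h k x * ν (t.cell k x) = ∫⁻ y in t.cell k x, h y ∂ν := by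
  rcases eq_or_ne (ν (t.cell k x)) 0 with h0 | h0
  · rw [h0, mul_zero, setLIntegral_measure_zero _ _ h0]
  · exact ENNReal.div_mul_cancel h0 (measure_ne_top _ _)

/-- The index `k` is the first one at which the condition `A k` holds at the point `x`. -/
def First (A : ℕ → X → Prop) (k : ℕ) (x : X) : Prop := A k x ∧ ∀ j < k, ¬ A j x

omit [Countable ι] [MeasurableSpace X] in
lemma First.eq {A : ℕ → X → Prop} {j k : ℕ} {x : X} (hj : First A j x) (hk : First A k x) :
    j = k := by
  rcases lt_trichotomy j k with h | h | h
  · exact absurd hj.1 (hk.2 j h)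
  · exact h
  · exact absurd hk.1 (hj.2 k h)

omit [Countable ι] [MeasurableSpace X] in
lemma exists_first {A : ℕ → X → Prop} {x : X} (h : ∃ k, A k x) : ∃ k, First A k x := by
  classical
  exact ⟨Nat.find h, Nat.find_spec h, fun j hj => Nat.find_min h hj⟩

omit [Countable ι] in
lemma adapted_first {A : ℕ → X → Prop} (hA : ∀ k, t.Adapted k (A k)) (k : ℕ) :
    t.Adapted k (First A k) := by
  intro x y h
  simp only [First]
  rw [hA k x y h]
  congr 1
  refine propext (forall₂_congr fun j hj => ?_)
  rw [(hA j).mono hj.le x y h]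

/-- Decomposition of an integral over the event that some `A k` holds, according to the first
such `k`, estimated cell by cell. -/
lemma setLIntegral_exists_le {A : ℕ → X → Prop} (hA : ∀ k, t.Adapted k (A k))
    {ν μ : Measure X} {f g : X → ℝ≥0∞}
    (h : ∀ k x, First A k x → ∫⁻ y in t.cell k x, f y ∂ν ≤ ∫⁻ y in t.cell k x, g y ∂μ) :
    ∫⁻ x in {x | ∃ k, A k x}, f x ∂ν ≤ ∫⁻ x in {x | ∃ k, A k x}, g x ∂μ := by
  have hU : {x | ∃ k, A k x} = ⋃ k, {x | First A k x} := by
    ext x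
    simp only [mem_ofPred_eq, mem_iUnion]
    exact ⟨exists_first, fun ⟨k, hk⟩ => ⟨k, hk.1⟩⟩
  have hm : ∀ k, MeasurableSet {x | First A k x} := fun k => (adapted_first hA k).measurableSet
  have hd : Pairwise (Function.onFun Disjoint fun k => {x | First A k x}) := by
    intro i j hij
    rw [Function.onFun, Set.disjoint_left]
    exact fun x hi hj => hij (First.eq hi hj)
  rw [hU, lintegral_iUnion hm hd, lintegral_iUnion hm hd]
  refine ENNReal.tsum_le_tsum fun k => ?_
  exact setLIntegral_le_of_cells (t := t) (k := k) (adapted_first hA k) fun x hx => h k x hx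

/-- Weak type `(1,1)` of the maximal function of a partition tree, started at generation `m`. -/
lemma mul_measure_exists_avg_lt_le (ν : Measure X) [IsFiniteMeasure ν] (h : X → ℝ≥0∞) (m : ℕ)
    (x : X) (l : ℝ≥0∞) :
    l * ν (t.cell m x ∩ {y | ∃ k, m ≤ k ∧ l < t.avg ν h k y}) ≤ ∫⁻ y in t.cell m x, h y ∂ν := by
  set A : ℕ → X → Prop := fun k y => (m ≤ k ∧ y ∈ t.cell m x) ∧ l < t.avg ν h k y with hAdef
  have hA : ∀ k, t.Adapted k (A k) := by
    intro k y z hyz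
    simp only [hAdef]
    by_cases hk : m ≤ k
    · rw [show (y ∈ t.cell m x) = (z ∈ t.cell m x) from adapted_mem_cell hk x y z hyz,
        adapted_avg ν h k y z hyz]
    · simp [hk]
  have hS : t.cell m x ∩ {y | ∃ k, m ≤ k ∧ l < t.avg ν h k y} = {y | ∃ k, A k y} := by
    ext y
    simp only [hAdef, mem_inter_iff, mem_ofPred_eq]
    tauto
  have key := setLIntegral_exists_le hA (ν := ν) (μ := ν) (f := fun _ => l) (g := h) ?_
  · rw [hS, ← setLIntegral_const]
    refine key.trans (lintegral_mono_set ?_)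
    rintro y ⟨k, hk⟩
    exact hk.1.2
  · intro k y hy
    rw [setLIntegral_const, ← avg_mul_measure ν h k y]
    exact mul_le_mul_left hy.1.2.le _

variable (t) in
/-- The maximal function of a partition tree with respect to the measure `ν`. -/
noncomputable def maxFn (ν : Measure X) (h : X → ℝ≥0∞) (x : X) : ℝ≥0∞ := ⨆ k, t.avg ν h k x

lemma measurable_maxFn (ν : Measure X) (h : X → ℝ≥0∞) : Measurable (t.maxFn ν h) :=
  .iSup fun k => (adapted_avg ν h k).measurable

lemma mul_measure_lt_maxFn_le (ν : Measure X) [IsFiniteMeasure ν] (h : X → ℝ≥0∞) (l : ℝ≥0∞) :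
    l * ν {x | l < t.maxFn ν h x} ≤ ∫⁻ x, h x ∂ν := by
  set A : ℕ → X → Prop := fun k y => l < t.avg ν h k y with hAdef
  have hA : ∀ k, t.Adapted k (A k) := fun k y z hyz => by
    simp only [hAdef, adapted_avg ν h k y z hyz]
  have hS : {x | l < t.maxFn ν h x} = {y | ∃ k, A k y} := by
    ext y; simp [hAdef, maxFn, lt_iSup_iff]
  have key := setLIntegral_exists_le hA (ν := ν) (μ := ν) (f := fun _ => l) (g := h) ?_
  · rw [hS, ← setLIntegral_const]
    exact key.trans (setLIntegral_le_lintegral _ _)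
  · intro k y hy
    rw [setLIntegral_const, ← avg_mul_measure ν h k y]
    exact mul_le_mul_left hy.1.le _

end PartitionTree

/-! ### The strong maximal inequality -/

/-- Layer cake formula for a single extended nonnegative number. -/
lemma ENNReal.rpow_eq_lintegral_indicator (y : ℝ≥0∞) {p : ℝ} (hp : 0 < p) :
    y ^ p = ENNReal.ofReal p *
      ∫⁻ s in Ioi (0 : ℝ), {s : ℝ | ENNReal.ofReal s < y}.indicator
        (fun s => ENNReal.ofReal (s ^ (p - 1))) s := by
  have fin : ∀ z : ℝ≥0, (z : ℝ≥0∞) ^ p = ENNReal.ofReal p *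
      ∫⁻ s in Ioi (0 : ℝ), {s : ℝ | ENNReal.ofReal s < z}.indicator
        (fun s => ENNReal.ofReal (s ^ (p - 1))) s := by
    intro z
    have h := lintegral_rpow_eq_lintegral_meas_lt_mul (Measure.dirac ())
      (f := fun _ => (z : ℝ)) (by filter_upwards with _ using z.2) (by fun_prop) hp
    simp only [lintegral_dirac] at h
    rw [← ENNReal.ofReal_rpow_of_nonneg (NNReal.coe_nonneg z) hp.le, ENNReal.ofReal_coe_nnreal] at h
    rw [h]
    congr 1
    refine setLIntegral_congr_fun measurableSet_Ioi fun s hs => ?_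
    by_cases hz : s < z
    · have : ENNReal.ofReal s < z := by
        rw [← ENNReal.ofReal_coe_nnreal]; exact (ENNReal.ofReal_lt_ofReal_iff_of_nonneg (le_of_lt hs)).2 hz
      simp [hz, this, indicator]
    · have : ¬ ENNReal.ofReal s < z := by
        rw [← ENNReal.ofReal_coe_nnreal]
        exact fun h => hz ((ENNReal.ofReal_lt_ofReal_iff_of_nonneg (le_of_lt hs)).1 h)
      simp [hz, this, indicator]
  rcases eq_or_ne y ∞ with rfl | hy
  · rw [ENNReal.top_rpow_of_pos hp]
    symm
    refine ENNReal.eq_top_of_forall_nnreal_le fun r => ?_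
    have hr : (r : ℝ≥0∞) = ((r ^ (1 / p) : ℝ≥0) : ℝ≥0∞) ^ p := by
      rw [← ENNReal.coe_rpow_of_nonneg _ hp.le, ← NNReal.rpow_mul, one_div_mul_cancel hp.ne',
        NNReal.rpow_one]
    rw [hr, fin]
    gcongr
    simp
  · lift y to ℝ≥0 using hy
    exact fin y

/-- Layer cake formula for powers of extended nonnegative functions. -/
lemma lintegral_rpow_eq_lintegral_meas_ofReal_lt {X : Type*} [MeasurableSpace X] (ν : Measure X)
    [SFinite ν] {F : X → ℝ≥0∞} (hF : Measurable F) {p : ℝ} (hp : 0 < p) (H : X → ℝ≥0∞)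
    (hH : Measurable H) :
    ∫⁻ x, F x ^ p * H x ∂ν = ENNReal.ofReal p *
      ∫⁻ s in Ioi (0 : ℝ), (∫⁻ x in {x | ENNReal.ofReal s < F x}, H x ∂ν) *
        ENNReal.ofReal (s ^ (p - 1)) := by
  have hmS : MeasurableSet {z : X × ℝ | ENNReal.ofReal z.2 < F z.1} :=
    measurableSet_lt (by fun_prop) (by fun_prop)
  have hmeas : Measurable fun z : X × ℝ => {z : X × ℝ | ENNReal.ofReal z.2 < F z.1}.indicator
        (fun z => ENNReal.ofReal (z.2 ^ (p - 1)) * H z.1) z := by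
    exact Measurable.indicator (by fun_prop) hmS
  have h1 : ∀ x, F x ^ p * H x = ENNReal.ofReal p * ∫⁻ s in Ioi (0 : ℝ),
      {z : X × ℝ | ENNReal.ofReal z.2 < F z.1}.indicator
        (fun z => ENNReal.ofReal (z.2 ^ (p - 1)) * H z.1) (x, s) := by
    intro x
    rw [ENNReal.rpow_eq_lintegral_indicator (F x) hp, mul_assoc, ← lintegral_mul_const]
    · congr 1
      refine lintegral_congr fun s => ?_
      by_cases h : ENNReal.ofReal s < F x <;> simp [indicator, h]
    · exact Measurable.indicator (by fun_prop) (measurableSet_lt (by fun_prop) (by fun_prop))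
  simp_rw [h1]
  rw [lintegral_const_mul _ (hmeas.lintegral_prod_right'), lintegral_lintegral_swap hmeas.aemeasurable]
  congr 1
  refine lintegral_congr fun s => ?_
  rw [← lintegral_mul_const _ hH, ← lintegral_indicator (measurableSet_lt (by fun_prop) hF)]
  refine lintegral_congr fun x => ?_
  by_cases h : ENNReal.ofReal s < F x <;> simp [indicator, h, mul_comm]

lemma ENNReal.tsum_eq_sum_range_add_tsum (b : ℕ → ℝ≥0∞) (k : ℕ) :
    ∑' j, b j = ∑ j ∈ Finset.range k, b j + ∑' j, b (k + j) := by
  have h2 := Summable.sum_add_tsum_nat_add' (f := b) (k := k) ENNReal.summable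
  rw [← h2]
  simp_rw [add_comm k]

namespace PartitionTree

variable {X ι : Type*} [MeasurableSpace X] {t : PartitionTree X ι} [Countable ι]

omit [Countable ι] in
lemma avg_le_avg_indicator_add (ν : Measure X) [IsFiniteMeasure ν] (h : X → ℝ≥0∞)
    (s : ℝ≥0∞) (k : ℕ) (x : X) :
    t.avg ν h k x ≤ t.avg ν ({x | s < h x}.indicator h) k x + s := by
  unfold avg
  rcases eq_or_ne (ν (t.cell k x)) 0 with h0 | h0
  · rw [setLIntegral_measure_zero _ _ h0]; simp
  have : ∫⁻ y in t.cell k x, h y ∂ν ≤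
      (∫⁻ y in t.cell k x, {x | s < h x}.indicator h y ∂ν) + s * ν (t.cell k x) := by
    rw [← setLIntegral_const, ← lintegral_add_right _ measurable_const]
    refine lintegral_mono fun y => ?_
    by_cases hy : s < h y
    · simp [indicator, hy]
    · simp only [indicator, mem_ofPred_eq, hy, if_false, zero_add]; exact not_lt.mp hy
  calc _ ≤ ((∫⁻ y in t.cell k x, {x | s < h x}.indicator h y ∂ν) + s * ν (t.cell k x)) /
        ν (t.cell k x) := by gcongr
    _ = _ := by rw [ENNReal.add_div, ENNReal.mul_div_cancel_right h0 (measure_ne_top _ _)]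

/-- The `L^p` bound for the maximal function, `1 < p`. -/
lemma lintegral_maxFn_rpow_le (ν : Measure X) [IsFiniteMeasure ν] {h : X → ℝ≥0∞}
    (hh : Measurable h) {p : ℝ} (hp : 1 < p) :
    ∫⁻ x, t.maxFn ν h x ^ p ∂ν ≤
      ENNReal.ofReal (2 ^ p * p / (p - 1)) * ∫⁻ x, h x ^ p ∂ν := by
  -- weak type `(1,1)`, applied to the part of `h` above `s / 2`
  have hweak : ∀ s : ℝ, 0 < s → ν {x | ENNReal.ofReal s < t.maxFn ν h x} ≤
      ENNReal.ofReal (2 / s) * ∫⁻ x in {x | ENNReal.ofReal s < 2 * h x}, h x ∂ν := by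
    intro s hs
    set g : X → ℝ≥0∞ := {x | ENNReal.ofReal (s / 2) < h x}.indicator h with hg
    have hsub : {x | ENNReal.ofReal s < t.maxFn ν h x} ⊆
        {x | ENNReal.ofReal (s / 2) < t.maxFn ν g x} := by
      intro x hx
      simp only [mem_ofPred_eq, maxFn, lt_iSup_iff] at hx ⊢
      obtain ⟨k, hk⟩ := hx
      refine ⟨k, ?_⟩
      have h1 := hk.trans_le (avg_le_avg_indicator_add ν h (ENNReal.ofReal (s / 2)) k x)
      have h2 : ENNReal.ofReal s = ENNReal.ofReal (s / 2) + ENNReal.ofReal (s / 2) := by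
        rw [← ENNReal.ofReal_add (by positivity) (by positivity)]; congr 1; ring
      rw [h2] at h1
      exact (ENNReal.add_lt_add_iff_right ENNReal.ofReal_ne_top).mp h1
    have h3 := mul_measure_lt_maxFn_le (t := t) ν g (ENNReal.ofReal (s / 2))
    have h4 : ∫⁻ x, g x ∂ν = ∫⁻ x in {x | ENNReal.ofReal s < 2 * h x}, h x ∂ν := by
      rw [hg, lintegral_indicator (measurableSet_lt measurable_const hh)]
      congr 2
      ext x
      simp only [mem_ofPred_eq]
      have h2 : ENNReal.ofReal s = 2 * ENNReal.ofReal (s / 2) := by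
        rw [show (2 : ℝ≥0∞) = ENNReal.ofReal 2 by simp, ← ENNReal.ofReal_mul (by norm_num)]
        congr 1; ring
      rw [h2, ENNReal.mul_lt_mul_iff_right (by norm_num) (by norm_num)]
    rw [← h4]
    calc _ ≤ ν {x | ENNReal.ofReal (s / 2) < t.maxFn ν g x} := measure_mono hsub
      _ = ENNReal.ofReal (2 / s) * (ENNReal.ofReal (s / 2) *
          ν {x | ENNReal.ofReal (s / 2) < t.maxFn ν g x}) := by
        rw [← mul_assoc, ← ENNReal.ofReal_mul (by positivity),
          show 2 / s * (s / 2) = 1 by field_simp]; simp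
      _ ≤ _ := by gcongr
  -- integration of the weak type estimate over the levels, and Fubini's theorem
  have e1 := lintegral_rpow_eq_lintegral_meas_ofReal_lt ν (measurable_maxFn (t := t) ν h)
    (by linarith : 0 < p) (fun _ => 1) measurable_const
  have e2 := lintegral_rpow_eq_lintegral_meas_ofReal_lt ν (F := fun x => 2 * h x)
    (by fun_prop) (by linarith : 0 < p - 1) h hh
  simp only [mul_one, lintegral_const, Measure.restrict_apply_univ, one_mul]
    at e1
  rw [e1]
  set I := ∫⁻ s in Ioi (0 : ℝ), (∫⁻ x in {x | ENNReal.ofReal s < 2 * h x}, h x ∂ν) *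
        ENNReal.ofReal (s ^ (p - 1 - 1)) with hI
  have h5 : ∫⁻ s in Ioi (0 : ℝ), ν {x | ENNReal.ofReal s < t.maxFn ν h x} *
      ENNReal.ofReal (s ^ (p - 1)) ≤ 2 * I := by
    rw [hI, ← lintegral_const_mul' _ _ (by norm_num)]
    refine setLIntegral_mono' measurableSet_Ioi fun s hs => ?_
    calc _ ≤ (ENNReal.ofReal (2 / s) * ∫⁻ x in {x | ENNReal.ofReal s < 2 * h x}, h x ∂ν) *
          ENNReal.ofReal (s ^ (p - 1)) := by gcongr; exact hweak s hs
      _ = (∫⁻ x in {x | ENNReal.ofReal s < 2 * h x}, h x ∂ν) *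
          (ENNReal.ofReal (2 / s) * ENNReal.ofReal (s ^ (p - 1))) := by ring
      _ = (∫⁻ x in {x | ENNReal.ofReal s < 2 * h x}, h x ∂ν) *
          (2 * ENNReal.ofReal (s ^ (p - 1 - 1))) := by
        congr 1
        have hs' : (0 : ℝ) < s := hs
        rw [← ENNReal.ofReal_mul (by positivity), show (2 : ℝ≥0∞) = ENNReal.ofReal 2 by simp,
          ← ENNReal.ofReal_mul (by positivity)]
        congr 1
        rw [Real.rpow_sub_one hs'.ne' (p - 1)]; ring
      _ = _ := by ring
  have h6 : ∫⁻ x, (2 * h x) ^ (p - 1) * h x ∂ν = ENNReal.ofReal (2 ^ (p - 1)) * ∫⁻ x, h x ^ p ∂ν := by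
    rw [← lintegral_const_mul _ (by fun_prop)]
    refine lintegral_congr fun x => ?_
    rw [ENNReal.mul_rpow_of_nonneg _ _ (by linarith), mul_assoc,
      ← ENNReal.ofReal_rpow_of_pos (by norm_num)]
    congr 1
    · simp
    · conv_lhs => rw [← ENNReal.rpow_one (h x), ← ENNReal.rpow_mul, one_mul,
        ← ENNReal.rpow_add_of_nonneg _ _ (by linarith) (by norm_num)]
      congr 1; ring
  rw [h6] at e2
  have h7 : I = ENNReal.ofReal (1 / (p - 1)) * (ENNReal.ofReal (2 ^ (p - 1)) * ∫⁻ x, h x ^ p ∂ν) := by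
    rw [e2, ← mul_assoc, ← ENNReal.ofReal_mul (by have : 0 < p - 1 := by linarith
                                                  positivity),
      one_div_mul_cancel (by linarith)]; simp
  calc _ ≤ ENNReal.ofReal p * (2 * I) := by gcongr
    _ = _ := by
      rw [h7, show (2 : ℝ≥0∞) = ENNReal.ofReal 2 by simp]
      have : 0 < p - 1 := by linarith
      simp only [← mul_assoc]
      rw [← ENNReal.ofReal_mul (by positivity), ← ENNReal.ofReal_mul (by positivity),
        ← ENNReal.ofReal_mul (by positivity)]
      congr 2
      rw [Real.rpow_sub_one (by norm_num)]; field_simp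

/-! ### Stopping times -/

open Classical in
/-- The last stopping generation up to generation `k`, for the rule that stopping occurs again at
generation `k + 1` when `bad j (k + 1)` holds, `j` being the previous stopping generation. -/
noncomputable def lastStop (bad : ℕ → ℕ → X → Prop) : ℕ → X → ℕ
  | 0, _ => 0
  | k + 1, x => if bad (lastStop bad k x) (k + 1) x then k + 1 else lastStop bad k x

/-- The generation `k` is a stopping generation at the point `x`. -/
def IsStop (bad : ℕ → ℕ → X → Prop) (k : ℕ) (x : X) : Prop := lastStop bad k x = k

section Stop

variable {bad : ℕ → ℕ → X → Prop}

omit [MeasurableSpace X] in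
lemma lastStop_le (k : ℕ) (x : X) : lastStop bad k x ≤ k := by
  induction k with
  | zero => simp [lastStop]
  | succ k ih => rw [lastStop]; split_ifs <;> omega

omit [MeasurableSpace X] in
lemma isStop_zero (x : X) : IsStop bad 0 x := rfl

omit [MeasurableSpace X] in
lemma lastStop_succ_of_bad {k : ℕ} {x : X} (h : bad (lastStop bad k x) (k + 1) x) :
    lastStop bad (k + 1) x = k + 1 := by rw [lastStop, if_pos h]

omit [MeasurableSpace X] in
lemma lastStop_succ_of_not_bad {k : ℕ} {x : X} (h : ¬ bad (lastStop bad k x) (k + 1) x) :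
    lastStop bad (k + 1) x = lastStop bad k x := by rw [lastStop, if_neg h]

omit [MeasurableSpace X] in
lemma isStop_succ_iff {k : ℕ} {x : X} :
    IsStop bad (k + 1) x ↔ bad (lastStop bad k x) (k + 1) x := by
  refine ⟨fun h => ?_, lastStop_succ_of_bad⟩
  by_contra hb
  have := lastStop_succ_of_not_bad hb
  rw [IsStop] at h
  have h2 := lastStop_le (bad := bad) k x
  omega

omit [MeasurableSpace X] in
lemma lastStop_mono {j k : ℕ} (h : j ≤ k) (x : X) : lastStop bad j x ≤ lastStop bad k x := by
  induction k, h using Nat.le_induction with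
  | base => exact le_rfl
  | succ k _ ih =>
    refine ih.trans ?_
    have := lastStop_le (bad := bad) k x
    rw [lastStop]; split_ifs <;> omega

omit [MeasurableSpace X] in
/-- Stopping does not occur between the last stopping generation and the current one. -/
lemma lastStop_eq_of_le {j k : ℕ} {x : X} (h1 : lastStop bad k x ≤ j) (h2 : j ≤ k) :
    lastStop bad j x = lastStop bad k x := by
  induction k, h2 using Nat.le_induction with
  | base => rfl
  | succ k hk ih =>
    by_cases hb : bad (lastStop bad k x) (k + 1) x
    · rw [lastStop_succ_of_bad hb] at h1; omega
    · rw [lastStop_succ_of_not_bad hb] at h1 ⊢; exact ih h1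

omit [MeasurableSpace X] in
lemma isStop_lastStop (k : ℕ) (x : X) : IsStop bad (lastStop bad k x) x :=
  lastStop_eq_of_le le_rfl (lastStop_le k x)

omit [MeasurableSpace X] in
lemma not_bad_of_lastStop_lt {j k : ℕ} {x : X} (h1 : lastStop bad k x < j) (h2 : j ≤ k) :
    ¬ bad (lastStop bad k x) j x := by
  obtain ⟨i, rfl⟩ : ∃ i, j = i + 1 := ⟨j - 1, by omega⟩
  intro hb
  rw [← lastStop_eq_of_le (by omega : lastStop bad k x ≤ i) (by omega)] at hb
  have h3 := lastStop_succ_of_bad hb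
  have h4 := lastStop_mono (bad := bad) h2 x
  omega

omit [MeasurableSpace X] in
lemma le_lastStop {j k : ℕ} {x : X} (hj : IsStop bad j x) (h : j ≤ k) : j ≤ lastStop bad k x := by
  have := lastStop_mono (bad := bad) h x
  rwa [hj] at this

omit [Countable ι] in
lemma adapted_lastStop (hbad : ∀ j k, j ≤ k → t.Adapted k (bad j k)) (k : ℕ) :
    t.Adapted k (lastStop bad k) := by
  induction k with
  | zero => intro x y _; rfl
  | succ k ih =>
    intro x y h
    have h1 := ih x y (t.refine' k x y h)
    rw [lastStop, lastStop, h1,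
      hbad _ (k + 1) ((lastStop_le k y).trans (Nat.le_succ k)) x y h]

omit [Countable ι] in
lemma adapted_isStop (hbad : ∀ j k, j ≤ k → t.Adapted k (bad j k)) (k : ℕ) :
    t.Adapted k (IsStop bad k) := fun x y h => by
  simp only [IsStop, adapted_lastStop hbad k x y h]

end Stop

/-! ### A good-`λ` inequality -/

/-- If the tails of a sum of adapted functions are controlled on every cell, up to a small
proportion of the cell, by a measure of total mass `O(λ^{-q})`, then the sum is in weak `L^q`. -/
lemma mul_measure_lt_tsum_le {a : ℕ → X → ℝ≥0∞} (ha : ∀ k, t.Adapted k (a k)) {ν : Measure X}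
    [IsFiniteMeasure ν] {q : ℝ} (hq : 0 < q) {D : ℝ≥0∞}
    (H : ∀ l : ℝ≥0, 0 < l → ∃ μ : Measure X, (l : ℝ≥0∞) ^ q * μ univ ≤ D ∧
      ∀ k x, ν (t.cell k x ∩ {y | l < ∑' j, a (k + j) y}) ≤
        (2⁻¹ : ℝ≥0∞) ^ (q + 1) * ν (t.cell k x) + μ (t.cell k x))
    (l : ℝ≥0) : (l : ℝ≥0∞) ^ q * ν {x | l < ∑' k, a k x} ≤ 2 ^ (q + 1) * D := by
  have hmeas : ∀ k, Measurable (a k) := fun k => (ha k).measurable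
  have hmS : Measurable fun x => ∑' k, a k x := Measurable.tsum hmeas
  set Φ : ℝ≥0 → ℝ≥0∞ := fun l => (l : ℝ≥0∞) ^ q * ν {x | l < ∑' k, a k x} with hΦ
  -- one step of the good-`λ` argument
  have step : ∀ l : ℝ≥0, 0 < l → Φ (2 * l) ≤ 2⁻¹ * Φ l + 2 ^ q * D := by
    intro l hl
    obtain ⟨μ, hμ, hcell⟩ := H l hl
    -- The cells on which the partial sums first exceed `l` cover `{l < ∑ a}`. If the sum exceeds
    -- `2 l` at a point of such a cell, then its tail from that generation on exceeds `l`.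
    set A : ℕ → X → Prop := fun k x => (l : ℝ≥0∞) < ∑ j ∈ Finset.range (k + 1), a j x with hAdef
    have hA : ∀ k, t.Adapted k (A k) := by
      intro k x y h
      simp only [hAdef]
      rw [Finset.sum_congr rfl fun j hj => (ha j).mono (Finset.mem_range_succ_iff.mp hj) x y h]
    have hS : {x | (l : ℝ≥0∞) < ∑' k, a k x} = {x | ∃ k, A k x} := by
      ext x
      simp only [mem_ofPred_eq, hAdef]
      constructor
      · intro h
        rw [ENNReal.tsum_eq_iSup_nat, lt_iSup_iff] at h
        obtain ⟨n, hn⟩ := h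
        exact ⟨n, hn.trans_le (Finset.sum_le_sum_of_subset (Finset.range_mono (Nat.le_succ n)))⟩
      · rintro ⟨k, hk⟩
        exact hk.trans_le (ENNReal.sum_le_tsum _)
    have hbig : MeasurableSet {x | (2 * l : ℝ≥0∞) < ∑' k, a k x} :=
      measurableSet_lt measurable_const hmS
    have key := setLIntegral_exists_le hA (ν := ν) (μ := (2⁻¹ : ℝ≥0∞) ^ (q + 1) • ν + μ)
      (f := {x | (2 * l : ℝ≥0∞) < ∑' k, a k x}.indicator 1) (g := fun _ => 1) ?_
    · rw [← hS, setLIntegral_one, lintegral_indicator_one hbig,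
        Measure.restrict_apply hbig, Measure.add_apply, Measure.smul_apply, smul_eq_mul] at key
      have hsub : {x | (2 * l : ℝ≥0∞) < ∑' k, a k x} ⊆ {x | (l : ℝ≥0∞) < ∑' k, a k x} := by
        intro x hx
        rw [mem_ofPred_eq] at hx ⊢
        refine lt_of_le_of_lt ?_ hx
        rw [two_mul]; exact le_self_add
      rw [inter_eq_left.mpr hsub] at key
      simp only [hΦ]
      calc _ = 2 ^ q * ((l : ℝ≥0∞) ^ q * ν {x | (2 * l : ℝ≥0∞) < ∑' k, a k x}) := by
            rw [ENNReal.coe_mul, ENNReal.coe_ofNat, ENNReal.mul_rpow_of_nonneg _ _ hq.le]; ring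
        _ ≤ 2 ^ q * ((l : ℝ≥0∞) ^ q * ((2⁻¹ : ℝ≥0∞) ^ (q + 1) *
              ν {x | (l : ℝ≥0∞) < ∑' k, a k x} + μ univ)) := by
            gcongr
            exact key.trans (by gcongr; exact subset_univ _)
        _ = (2 ^ q * (2⁻¹ : ℝ≥0∞) ^ (q + 1)) * ((l : ℝ≥0∞) ^ q *
              ν {x | (l : ℝ≥0∞) < ∑' k, a k x}) + 2 ^ q * ((l : ℝ≥0∞) ^ q * μ univ) := by ring
        _ ≤ _ := by
            gcongr
            rw [ENNReal.rpow_add _ _ (by simp) (by simp), ENNReal.rpow_one, ← mul_assoc,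
              ← ENNReal.mul_rpow_of_nonneg _ _ hq.le, ENNReal.mul_inv_cancel (by simp) (by simp),
              ENNReal.one_rpow, one_mul]
    · intro k x hx
      rw [setLIntegral_one, lintegral_indicator_one hbig, Measure.restrict_apply hbig,
        Measure.add_apply, Measure.smul_apply, smul_eq_mul]
      refine le_trans (measure_mono ?_) (hcell k x)
      rintro y ⟨hy1, hy2⟩
      refine ⟨hy2, ?_⟩
      rw [mem_cell] at hy2
      rw [mem_ofPred_eq] at hy1
      -- the partial sum before the first generation is at most `l`, and it is constant on the cell
      have hlow : ∑ j ∈ Finset.range k, a j y ≤ l := by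
        rw [Finset.sum_congr rfl fun j hj => (ha j).mono (Finset.mem_range.mp hj).le y x hy2]
        rcases Nat.eq_zero_or_pos k with rfl | hk
        · simp
        · have := hx.2 (k - 1) (by omega)
          simp only [hAdef, not_lt] at this
          rwa [Nat.sub_add_cancel hk] at this
      have hsplit : ∑' j, a j y = ∑ j ∈ Finset.range k, a j y + ∑' j, a (k + j) y :=
        ENNReal.tsum_eq_sum_range_add_tsum (fun j => a j y) k
      rw [hsplit, two_mul] at hy1
      by_contra hcon
      simp only [mem_ofPred_eq, not_lt] at hcon
      exact absurd (add_le_add hlow hcon) (not_le.mpr hy1)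
  -- finiteness of the supremum over bounded `l`, which allows absorbing half of it on the left
  have htop : ∀ L : ℝ≥0, ⨆ l ∈ Iic L, Φ l ≠ ∞ := by
    intro L
    refine ne_top_of_le_ne_top (b := (L : ℝ≥0∞) ^ q * ν univ) ?_ ?_
    · exact ENNReal.mul_ne_top (ENNReal.rpow_ne_top_of_nonneg hq.le ENNReal.coe_ne_top)
        (measure_ne_top _ _)
    · refine iSup₂_le fun l hl => ?_
      simp only [hΦ]
      gcongr
      · exact hl
      · exact subset_univ _
  have hsup : ⨆ m ∈ Iic l, Φ m ≤ 2⁻¹ * (⨆ m ∈ Iic l, Φ m) + 2 ^ q * D := by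
    refine iSup₂_le fun m hm => ?_
    rcases eq_or_ne m 0 with rfl | hm0
    · simp [hΦ, hq]
    · have h1 := step (m / 2) (by positivity)
      rw [mul_div_cancel₀ _ (by norm_num : (2 : ℝ≥0) ≠ 0)] at h1
      refine h1.trans ?_
      gcongr
      exact le_iSup₂ (f := fun m (_ : m ∈ Iic l) => Φ m) (m / 2)
        ((half_le_self m.2).trans hm)
  set S := ⨆ m ∈ Iic l, Φ m with hS
  have h2 : S ≤ 2 * (2 ^ q * D) := by
    have e : S = 2⁻¹ * S + 2⁻¹ * S := by
      rw [← two_mul, ← mul_assoc, ENNReal.mul_inv_cancel (by simp) (by simp), one_mul]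
    have h3 : 2⁻¹ * S ≤ 2 ^ q * D := by
      have h4 : 2⁻¹ * S + 2⁻¹ * S ≤ 2⁻¹ * S + 2 ^ q * D := by rw [← e]; exact hsup
      exact (ENNReal.add_le_add_iff_left
        (ENNReal.mul_ne_top (by simp) (htop l))).mp h4
    calc S = 2 * (2⁻¹ * S) := by
          rw [← mul_assoc, ENNReal.mul_inv_cancel (by simp) (by simp), one_mul]
      _ ≤ _ := by gcongr
  calc _ ≤ S := le_iSup₂ (f := fun m (_ : m ∈ Iic l) => Φ m) l (le_refl l)
    _ ≤ _ := h2
    _ = _ := by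
      rw [ENNReal.rpow_add _ _ (by simp) (by simp), ENNReal.rpow_one]; ring

end PartitionTree

/-! ### Inequalities for extended nonnegative numbers -/

namespace ENNReal

lemma rpow_mul_rpow_le_weighted {x y : ℝ} (hx : 0 < x) (hy : 0 < y) (hxy : x + y = 1)
    (a b : ℝ≥0∞) : a ^ x * b ^ y ≤ ENNReal.ofReal x * a + ENNReal.ofReal y * b := by
  have hpq : (x⁻¹).HolderConjugate y⁻¹ :=
    ⟨by rw [inv_inv, inv_inv, hxy, inv_one], by positivity, by positivity⟩
  have := ENNReal.young_inequality (a ^ x) (b ^ y) hpq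
  rw [← ENNReal.rpow_mul, ← ENNReal.rpow_mul, mul_inv_cancel₀ hx.ne', mul_inv_cancel₀ hy.ne',
    ENNReal.rpow_one, ENNReal.rpow_one, ENNReal.ofReal_inv_of_pos hx, ENNReal.ofReal_inv_of_pos hy,
    div_eq_mul_inv, div_eq_mul_inv, inv_inv, inv_inv] at this
  rwa [mul_comm _ a, mul_comm _ b]

/-- A discrete chain rule: `(b + y)^r - y^r ≤ r b (b + y)^{r-1}`. -/
lemma add_rpow_le_rpow_add_mul (b y : ℝ≥0∞) {r : ℝ} (hr : 1 ≤ r) :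
    (b + y) ^ r ≤ y ^ r + ENNReal.ofReal r * b * (b + y) ^ (r - 1) := by
  have hr0 : 0 < r := by linarith
  rcases eq_or_ne y ∞ with rfl | hy
  · simp [hr0]
  rcases eq_or_ne b ∞ with rfl | hb
  · have h1 : ENNReal.ofReal r * ∞ = ∞ := ENNReal.mul_top (by simpa using hr0)
    have h2 : (∞ : ℝ≥0∞) ^ (r - 1) ≠ 0 := by
      rcases hr.eq_or_lt with rfl | h
      · simp
      · rw [ENNReal.top_rpow_of_pos (by linarith)]; simp
    rw [top_add, h1, ENNReal.top_mul h2]; simp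
  lift y to ℝ≥0 using hy
  lift b to ℝ≥0 using hb
  rcases eq_or_ne (b + y) 0 with h0 | h0
  · rw [← ENNReal.coe_add, h0]; simp [hr0]
  have hpos : (0 : ℝ) < b + y := by exact_mod_cast pos_iff_ne_zero.mpr h0
  have hreal : ((b : ℝ) + y) ^ r ≤ (y : ℝ) ^ r + r * b * ((b : ℝ) + y) ^ (r - 1) := by
    have h1 : (-1 : ℝ) ≤ -(b / (b + y)) := by
      rw [neg_le_neg_iff, div_le_one hpos]; linarith [NNReal.coe_nonneg y]
    have h2 := one_add_mul_self_le_rpow_one_add h1 hr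
    have h3 : 1 + -((b : ℝ) / (b + y)) = y / (b + y) := by field_simp; ring
    rw [h3, Real.div_rpow (NNReal.coe_nonneg y) hpos.le, le_div_iff₀ (by positivity)] at h2
    have h4 : ((b : ℝ) + y) ^ r = ((b : ℝ) + y) ^ (r - 1) * (b + y) := by
      rw [← Real.rpow_add_one hpos.ne']; congr 1; ring
    have h5 : (1 + r * -((b : ℝ) / (b + y))) * ((b : ℝ) + y) ^ r =
        ((b : ℝ) + y) ^ r - r * b * ((b : ℝ) + y) ^ (r - 1) := by
      rw [h4]; field_simp; ring
    linarith
  have e1 : ((b : ℝ≥0∞) + y) ^ r = ENNReal.ofReal (((b : ℝ) + y) ^ r) := by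
    rw [← ENNReal.ofReal_rpow_of_pos hpos]; congr 1
    rw [← NNReal.coe_add, ENNReal.ofReal_coe_nnreal, ENNReal.coe_add]
  have e2 : ((b : ℝ≥0∞) + y) ^ (r - 1) = ENNReal.ofReal (((b : ℝ) + y) ^ (r - 1)) := by
    rw [← ENNReal.ofReal_rpow_of_pos hpos]; congr 1
    rw [← NNReal.coe_add, ENNReal.ofReal_coe_nnreal, ENNReal.coe_add]
  have e3 : (y : ℝ≥0∞) ^ r = ENNReal.ofReal ((y : ℝ) ^ r) := by
    rw [← ENNReal.ofReal_rpow_of_nonneg (NNReal.coe_nonneg y) hr0.le, ENNReal.ofReal_coe_nnreal]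
  have e4 : (b : ℝ≥0∞) = ENNReal.ofReal (b : ℝ) := by rw [ENNReal.ofReal_coe_nnreal]
  rw [e1, e2, e3, e4, ← ENNReal.ofReal_mul hr0.le, ← ENNReal.ofReal_mul (by positivity),
    ← ENNReal.ofReal_add (by positivity) (by positivity)]
  exact ENNReal.ofReal_le_ofReal hreal

/-- Summation by parts for the power of a sum with finitely many terms. -/
lemma tsum_tail_rpow_le {b : ℕ → ℝ≥0∞} {N : ℕ} (hN : ∀ j, N ≤ j → b j = 0) {r : ℝ} (hr : 1 ≤ r)
    (k : ℕ) : (∑' j, b (k + j)) ^ r ≤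
      ENNReal.ofReal r * ∑' j, b (k + j) * (∑' i, b (k + j + i)) ^ (r - 1) := by
  have hr0 : 0 < r := by linarith
  have hstep : ∀ m, ∑' i, b (m + i) = b m + ∑' i, b (m + 1 + i) := by
    intro m
    have := ENNReal.tsum_eq_sum_range_add_tsum (fun i => b (m + i)) 1
    simp only [Finset.sum_range_one, add_zero] at this
    rw [this]; congr 1
    exact tsum_congr fun i => by congr 1; ring
  have hind : ∀ n, (∑' j, b (k + j)) ^ r ≤ ENNReal.ofReal r *
      ∑ j ∈ Finset.range n, b (k + j) * (∑' i, b (k + j + i)) ^ (r - 1) +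
      (∑' i, b (k + n + i)) ^ r := by
    intro n
    induction n with
    | zero => simp
    | succ n ih =>
      refine ih.trans ?_
      have h1 := add_rpow_le_rpow_add_mul (b (k + n)) (∑' i, b (k + n + 1 + i)) hr
      rw [← hstep (k + n)] at h1
      rw [Finset.sum_range_succ, mul_add, add_assoc]
      gcongr
      rw [show k + (n + 1) = k + n + 1 by ring, ← mul_assoc]
      exact h1.trans_eq (add_comm _ _)
  refine (hind N).trans ?_
  have : ∑' i, b (k + N + i) = 0 := by
    rw [ENNReal.tsum_eq_zero]; intro i; exact hN _ (by omega)
  rw [this, ENNReal.zero_rpow_of_pos hr0, add_zero]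
  gcongr
  exact ENNReal.sum_le_tsum _

lemma rpow_mul_rpow_mul_rpow_le {ρ s w K : ℝ≥0∞} (hρ0 : ρ ≠ 0) (hρ : ρ ≠ ∞) (hs0 : s ≠ 0)
    (hs : s ≠ ∞) (hw0 : w ≠ 0) (hw : w ≠ ∞) {u v : ℝ} (hK : ρ * s ^ u * w ^ v ≤ K) {τ : ℝ}
    (hτ : 0 ≤ τ) (e₁ e₂ e₃ : ℝ) :
    ρ ^ e₁ * s ^ e₂ * w ^ e₃ ≤
      K ^ τ * (ρ ^ (e₁ - τ) * s ^ (e₂ - τ * u) * w ^ (e₃ - τ * v)) := by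
  calc ρ ^ e₁ * s ^ e₂ * w ^ e₃
      = (ρ * s ^ u * w ^ v) ^ τ * (ρ ^ (e₁ - τ) * s ^ (e₂ - τ * u) * w ^ (e₃ - τ * v)) := by
        have h1 : ρ ^ e₁ = ρ ^ τ * ρ ^ (e₁ - τ) := by
          rw [← ENNReal.rpow_add _ _ hρ0 hρ]; congr 1; ring
        have h2 : s ^ e₂ = (s ^ u) ^ τ * s ^ (e₂ - τ * u) := by
          rw [← ENNReal.rpow_mul, ← ENNReal.rpow_add _ _ hs0 hs]; congr 1; ring
        have h3 : w ^ e₃ = (w ^ v) ^ τ * w ^ (e₃ - τ * v) := by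
          rw [← ENNReal.rpow_mul, ← ENNReal.rpow_add _ _ hw0 hw]; congr 1; ring
        rw [h1, h2, h3, ENNReal.mul_rpow_of_nonneg _ _ hτ, ENNReal.mul_rpow_of_nonneg _ _ hτ]
        ring
    _ ≤ _ := by gcongr

/-- The sum of a geometric progression in which every term is repeated `n` times. -/
lemma tsum_pow_div_le (z : ℝ≥0∞) {n : ℕ} (hn : 0 < n) :
    ∑' j : ℕ, z ^ (j / n) = n * (1 - z)⁻¹ := by
  have : NeZero n := ⟨hn.ne'⟩
  rw [← (Nat.divModEquiv n).symm.tsum_eq, ENNReal.tsum_prod']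
  have : ∀ (i : ℕ) (j : Fin n), ((Nat.divModEquiv n).symm (i, j)) / n = i := by
    intro i j
    simp only [Nat.divModEquiv_symm_apply]
    rw [Nat.add_div_of_dvd_right (Dvd.intro_left i rfl), Nat.mul_div_cancel _ hn,
      Nat.div_eq_of_lt j.2, add_zero]
  simp_rw [this]
  rw [← ENNReal.tsum_geometric, ← ENNReal.tsum_mul_left]
  simp

end ENNReal

namespace PartitionTree

variable {X ι : Type*} [MeasurableSpace X] {t : PartitionTree X ι} [Countable ι]

/-- Superadditivity of `R ↦ σ(R)^x ω(R)^y` for `x + y ≥ 1`, as a cellwise comparison of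
integrals. -/
lemma setLIntegral_le_rpow_mul_rpow {σ ω : Measure X} [IsFiniteMeasure σ] [IsFiniteMeasure ω]
    {x y : ℝ} (hx : 0 < x) (hy : 0 < y) (hxy : 1 ≤ x + y) {m k : ℕ} (hmk : m ≤ k) (x₀ : X)
    {M : ℝ≥0∞} {f : X → ℝ≥0∞}
    (h : ∀ z ∈ t.cell m x₀,
      ∫⁻ y in t.cell k z, f y ∂ω ≤ M * (σ (t.cell k z) ^ x * ω (t.cell k z) ^ y)) :
    ∫⁻ y in t.cell m x₀, f y ∂ω ≤ M * (σ (t.cell m x₀) ^ x * ω (t.cell m x₀) ^ y) := by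
  set S := σ (t.cell m x₀) with hS
  set W := ω (t.cell m x₀) with hW
  have hsub : ∀ z ∈ t.cell m x₀, t.cell k z ⊆ t.cell m x₀ := fun z hz => cell_subset hmk hz
  have hA := adapted_mem_cell (t := t) hmk x₀
  by_cases h0 : S = 0 ∨ W = 0
  · have : ∫⁻ y in t.cell m x₀, f y ∂ω ≤ ∫⁻ y in t.cell m x₀, 0 ∂ω := by
      refine setLIntegral_le_of_cells (t := t) (k := k) hA fun z hz => ?_
      refine (h z hz).trans ?_
      rcases h0 with h0 | h0
      · rw [measure_mono_null (hsub z hz) (by rw [← hS]; exact h0), ENNReal.zero_rpow_of_pos hx]; simp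
      · rw [measure_mono_null (hsub z hz) (by rw [← hW]; exact h0 : ω (t.cell m x₀) = 0), ENNReal.zero_rpow_of_pos hy]; simp
    refine this.trans ?_
    simp
  push Not at h0
  have hST : S ≠ ∞ := measure_ne_top _ _
  have hWT : W ≠ ∞ := measure_ne_top _ _
  have hθ : 0 < x + y := by linarith
  set x' := x / (x + y) with hx'
  set y' := y / (x + y) with hy'
  have hx'0 : 0 < x' := by positivity
  have hy'0 : 0 < y' := by positivity
  have hsum : x' + y' = 1 := by rw [hx', hy']; field_simp
  -- By the inequality between weighted arithmetic and geometric means, `σ(R)^x ω(R)^y` is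
  -- dominated on the subcells by a measure whose mass on the large cell is the right-hand side.
  set c := M * (S ^ x * W ^ y) with hc
  set μ : Measure X := (c * ENNReal.ofReal x' * S⁻¹) • σ + (c * ENNReal.ofReal y' * W⁻¹) • ω with hμ
  have key : ∫⁻ y in t.cell m x₀, f y ∂ω ≤ ∫⁻ y in t.cell m x₀, 1 ∂μ := by
    refine setLIntegral_le_of_cells (t := t) (k := k) hA fun z hz => ?_
    refine (h z hz).trans ?_
    rw [setLIntegral_one, hμ, Measure.add_apply, Measure.smul_apply, Measure.smul_apply,
      smul_eq_mul, smul_eq_mul]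
    set s := σ (t.cell k z)
    set w := ω (t.cell k z)
    have hsS : S⁻¹ * s ≤ 1 := by
      rw [mul_comm, ← div_eq_mul_inv]; exact ENNReal.div_le_of_le_mul (by
        rw [one_mul]; exact measure_mono (hsub z hz))
    have hwW : W⁻¹ * w ≤ 1 := by
      rw [mul_comm, ← div_eq_mul_inv]; exact ENNReal.div_le_of_le_mul (by
        rw [one_mul]; exact measure_mono (hsub z hz))
    have e1 : s ^ x = S ^ x * (S⁻¹ * s) ^ x := by
      rw [← ENNReal.mul_rpow_of_nonneg _ _ hx.le, ← mul_assoc, ENNReal.mul_inv_cancel h0.1 hST,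
        one_mul]
    have e2 : w ^ y = W ^ y * (W⁻¹ * w) ^ y := by
      rw [← ENNReal.mul_rpow_of_nonneg _ _ hy.le, ← mul_assoc, ENNReal.mul_inv_cancel h0.2 hWT,
        one_mul]
    have e3 : (S⁻¹ * s) ^ x * (W⁻¹ * w) ^ y ≤
        ENNReal.ofReal x' * (S⁻¹ * s) + ENNReal.ofReal y' * (W⁻¹ * w) := by
      refine le_trans ?_ (ENNReal.rpow_mul_rpow_le_weighted hx'0 hy'0 hsum _ _)
      gcongr ?_ * ?_
      · refine ENNReal.rpow_le_rpow_of_exponent_ge hsS ?_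
        rw [hx']; exact div_le_self hx.le hxy
      · refine ENNReal.rpow_le_rpow_of_exponent_ge hwW ?_
        rw [hy']; exact div_le_self hy.le hxy
    calc M * (s ^ x * w ^ y) = c * ((S⁻¹ * s) ^ x * (W⁻¹ * w) ^ y) := by rw [e1, e2, hc]; ring
      _ ≤ c * (ENNReal.ofReal x' * (S⁻¹ * s) + ENNReal.ofReal y' * (W⁻¹ * w)) := by gcongr
      _ = _ := by ring
  refine key.trans (le_of_eq ?_)
  rw [setLIntegral_one, hμ, Measure.add_apply, Measure.smul_apply, Measure.smul_apply,
    smul_eq_mul, smul_eq_mul, ← hS, ← hW, mul_assoc, ENNReal.inv_mul_cancel h0.1 hST,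
    mul_assoc _ W⁻¹, ENNReal.inv_mul_cancel h0.2 hWT, mul_one, mul_one, ← mul_add,
    ← ENNReal.ofReal_add hx'0.le hy'0.le, hsum]
  simp

/-! ### Testing conditions for dyadic fractional integrals -/

variable (t) in
/-- The tail `∑_{j ≥ k} γ_j σ(cell j x)` of the operator with coefficients `γ` applied to `σ`. -/
noncomputable def tail (γ : ℕ → ℝ≥0∞) (σ : Measure X) (k : ℕ) (x : X) : ℝ≥0∞ :=
  ∑' j, γ (k + j) * σ (t.cell (k + j) x)

lemma measurable_tail (γ : ℕ → ℝ≥0∞) (σ : Measure X) (k : ℕ) : Measurable (t.tail γ σ k) :=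
  Measurable.tsum fun j =>
    (adapted_cell (t := t) (k + j) fun C => γ (k + j) * σ C).measurable

/-- The coefficients `γ` of a dyadic fractional integral: they are dominated by `c ρ`, only
finitely many of them are nonzero, and `c ρ` is summable to powers `-τ`, `τ ≥ τ₀`, with constant
`Γ`. The sequence `ρ` satisfies the two-weight condition with exponents `u`, `v` and
constant `K`. -/
structure TwoWeight (t : PartitionTree X ι) (σ ω : Measure X) (ρ γ : ℕ → ℝ≥0∞) (u v τ₀ : ℝ)
    (c Γ K : ℝ≥0∞) : Prop where
  ne_zero : ∀ k, ρ k ≠ 0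
  ne_top : ∀ k, ρ k ≠ ∞
  le : ∀ k, γ k ≤ c * ρ k
  finite : ∃ N, ∀ k, N ≤ k → γ k = 0
  sum_le : ∀ k τ, τ₀ ≤ τ → c * ∑' j, ρ (k + j) ^ (-τ) ≤ Γ * ρ k ^ (-τ)
  char_le : ∀ k x, ρ k * σ (t.cell k x) ^ u * ω (t.cell k x) ^ v ≤ K

section Testing

variable {σ ω : Measure X} [IsFiniteMeasure σ] [IsFiniteMeasure ω] {ρ γ : ℕ → ℝ≥0∞}
  {u v τ₀ : ℝ} {c Γ K : ℝ≥0∞}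

omit [Countable ι] [IsFiniteMeasure σ] [IsFiniteMeasure ω] in
lemma TwoWeight.symm (h : TwoWeight t σ ω ρ γ u v τ₀ c Γ K) :
    TwoWeight t ω σ ρ γ v u τ₀ c Γ K :=
  { h with char_le := fun k x => by rw [mul_assoc, mul_comm (_ ^ v), ← mul_assoc]
                                    exact h.char_le k x }

omit [IsFiniteMeasure σ] [IsFiniteMeasure ω] in
lemma TwoWeight.lintegral_tail_rpow_le (h : TwoWeight t σ ω ρ γ u v τ₀ c Γ K) {r : ℝ} (hr : 1 ≤ r)
    (k : ℕ) (x : X) :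
    ∫⁻ y in t.cell k x, t.tail γ σ k y ^ r ∂ω ≤ ENNReal.ofReal r *
      ∑' j, ∫⁻ y in t.cell k x,
        γ (k + j) * σ (t.cell (k + j) y) * t.tail γ σ (k + j) y ^ (r - 1) ∂ω := by
  obtain ⟨N, hN⟩ := h.finite
  rw [← lintegral_tsum, ← lintegral_const_mul']
  · refine lintegral_mono fun y => ?_
    have := ENNReal.tsum_tail_rpow_le (b := fun j => γ j * σ (t.cell j y)) (N := N)
      (fun j hj => by simp [hN j hj]) hr k
    exact this
  · simp
  · intro j
    have h1 := (adapted_cell (t := t) (k + j) fun C => γ (k + j) * σ C).measurable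
    exact (h1.mul ((measurable_tail γ σ (k + j)).pow_const _)).aemeasurable

/-- The moments of the tails, by induction on the order of the moment. The parameter `τ > 1`
leaves room for summing a geometric series at every step. -/
lemma TwoWeight.lintegral_tail_pow_le {τ : ℝ} (h : TwoWeight t σ ω ρ γ u v (τ - 1) c Γ K)
    (hτ : 1 < τ) (hv : 0 < v) (huv : τ * (u + v) ≤ 1) {n : ℕ} (hn : n * (τ * v) < 1) {m : ℕ}
    (hmn : m ≤ n) (k : ℕ) (x : X) :
    ∫⁻ y in t.cell k x, t.tail γ σ k y ^ (m : ℝ) ∂ω ≤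
      (m.factorial * Γ ^ m) * (K ^ (τ * m) * (ρ k ^ (-((τ - 1) * m)) *
        σ (t.cell k x) ^ (m * (1 - τ * u)) * ω (t.cell k x) ^ (1 - m * (τ * v)))) := by
  induction m generalizing k x with
  | zero => simp
  | succ m ih =>
    have hτv : 0 < τ * v := by positivity
    have hm1 : ((m : ℝ) + 1) * (τ * v) < 1 := by
      refine lt_of_le_of_lt ?_ hn
      gcongr; exact_mod_cast hmn
    have hxpos : 0 < 1 - τ * u := by nlinarith
    set L : ℝ≥0∞ := m.factorial * Γ ^ m with hL
    set e := (τ - 1) * ((m + 1 : ℕ) : ℝ) with he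
    -- the contribution of generation `k + j`, by the induction hypothesis on the cells of that
    -- generation and superadditivity
    have hcell : ∀ j, ∫⁻ y in t.cell k x,
        γ (k + j) * σ (t.cell (k + j) y) * t.tail γ σ (k + j) y ^ (((m + 1 : ℕ) : ℝ) - 1) ∂ω ≤
        (c * L * K ^ (τ * (m + 1 : ℕ)) * ρ (k + j) ^ (-e)) *
          (σ (t.cell k x) ^ ((m + 1 : ℕ) * (1 - τ * u)) *
            ω (t.cell k x) ^ (1 - (m + 1 : ℕ) * (τ * v))) := by
      intro j
      refine setLIntegral_le_rpow_mul_rpow (t := t) (by positivity) ?_ ?_ (Nat.le_add_right k j) x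
        fun z _ => ?_
      · push_cast; linarith
      · push_cast
        have : (0 : ℝ) ≤ m + 1 := by positivity
        nlinarith
      rw [setLIntegral_adapted_mul (adapted_cell (k + j) fun C => γ (k + j) * σ C)
        ((measurable_tail γ σ (k + j)).pow_const _)]
      have hexp : (((m + 1 : ℕ) : ℝ) - 1) = m := by push_cast; ring
      rw [hexp]
      have hih := ih (Nat.le_of_succ_le hmn) (k + j) z
      set s := σ (t.cell (k + j) z)
      set w := ω (t.cell (k + j) z)
      set R := ρ (k + j)
      rcases eq_or_ne s 0 with hs | hs
      · simp [hs]
      rcases eq_or_ne w 0 with hw | hw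
      · rw [setLIntegral_measure_zero _ _ hw]; simp
      -- the two-weight condition to the power `τ`: it turns one factor `ρ σ(R)` into smaller powers
      -- of `ω(R)` and into the summable power of `ρ`
      have hsc := ENNReal.rpow_mul_rpow_mul_rpow_le (h.ne_zero (k + j)) (h.ne_top (k + j)) hs
        (measure_ne_top _ _) hw (measure_ne_top _ _) (h.char_le (k + j) z)
        (by linarith : 0 ≤ τ) (1 - (τ - 1) * m) (1 + m * (1 - τ * u)) (1 - m * (τ * v))
      have e1 : R ^ (1 - (τ - 1) * m) = R * R ^ (-((τ - 1) * m)) := by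
        rw [sub_eq_add_neg, ENNReal.rpow_add _ _ (h.ne_zero _) (h.ne_top _), ENNReal.rpow_one]
      have e2 : s ^ (1 + m * (1 - τ * u)) = s * s ^ (m * (1 - τ * u)) := by
        rw [ENNReal.rpow_add _ _ hs (measure_ne_top _ _), ENNReal.rpow_one]
      rw [e1, e2] at hsc
      have e3 : 1 - (τ - 1) * m - τ = -e := by rw [he]; push_cast; ring
      have e4 : 1 + m * (1 - τ * u) - τ * u = (m + 1 : ℕ) * (1 - τ * u) := by push_cast; ring
      have e5 : 1 - m * (τ * v) - τ * v = 1 - (m + 1 : ℕ) * (τ * v) := by push_cast; ring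
      rw [e3, e4, e5] at hsc
      calc γ (k + j) * s * ∫⁻ y in t.cell (k + j) z, t.tail γ σ (k + j) y ^ (m : ℝ) ∂ω
          ≤ c * R * s * (L * (K ^ (τ * m) * (R ^ (-((τ - 1) * m)) *
              s ^ (m * (1 - τ * u)) * w ^ (1 - m * (τ * v))))) := by
            gcongr
            exact h.le _
        _ = c * L * K ^ (τ * m) * (R * R ^ (-((τ - 1) * m)) *
              (s * s ^ (m * (1 - τ * u))) * w ^ (1 - m * (τ * v))) := by ring
        _ ≤ c * L * K ^ (τ * m) * (K ^ τ * (R ^ (-e) * s ^ ((m + 1 : ℕ) * (1 - τ * u)) *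
              w ^ (1 - (m + 1 : ℕ) * (τ * v)))) := by gcongr
        _ = _ := by
            have : K ^ (τ * (m + 1 : ℕ)) = K ^ (τ * m) * K ^ τ := by
              rw [← ENNReal.rpow_add_of_nonneg _ _ (by positivity) (by positivity)]
              congr 1; push_cast; ring
            rw [this]; ring
    refine (h.lintegral_tail_rpow_le (by push_cast; linarith [(Nat.cast_nonneg m : (0 : ℝ) ≤ m)])
      k x).trans ?_
    calc _ ≤ ENNReal.ofReal ((m + 1 : ℕ) : ℝ) * ∑' j,
          (c * L * K ^ (τ * (m + 1 : ℕ)) * ρ (k + j) ^ (-e)) *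
          (σ (t.cell k x) ^ ((m + 1 : ℕ) * (1 - τ * u)) *
            ω (t.cell k x) ^ (1 - (m + 1 : ℕ) * (τ * v))) := by
          gcongr with j
          exact hcell j
      _ = ((m + 1 : ℕ) : ℝ≥0∞) * L * K ^ (τ * (m + 1 : ℕ)) * (c * ∑' j, ρ (k + j) ^ (-e)) *
          (σ (t.cell k x) ^ ((m + 1 : ℕ) * (1 - τ * u)) *
            ω (t.cell k x) ^ (1 - (m + 1 : ℕ) * (τ * v))) := by
          rw [ENNReal.tsum_mul_right, ENNReal.tsum_mul_left, ENNReal.ofReal_natCast]; ring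
      _ ≤ ((m + 1 : ℕ) : ℝ≥0∞) * L * K ^ (τ * (m + 1 : ℕ)) * (Γ * ρ k ^ (-e)) *
          (σ (t.cell k x) ^ ((m + 1 : ℕ) * (1 - τ * u)) *
            ω (t.cell k x) ^ (1 - (m + 1 : ℕ) * (τ * v))) := by
          gcongr _ * ?_ * _
          refine h.sum_le k e ?_
          rw [he]
          have : (1 : ℝ) ≤ ((m + 1 : ℕ) : ℝ) := by
            push_cast; linarith [(Nat.cast_nonneg m : (0 : ℝ) ≤ m)]
          nlinarith
      _ = _ := by
          rw [hL, Nat.factorial_succ, pow_succ]; push_cast; ring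

end Testing

end PartitionTree

lemma ENNReal.rpow_sub_one_mul {x : ℝ≥0∞} (h0 : x ≠ 0) (ht : x ≠ ∞) (r : ℝ) :
    x ^ (r - 1) * x = x ^ r := by
  conv_lhs => rw [← ENNReal.rpow_one x, ← ENNReal.rpow_mul, one_mul, ← ENNReal.rpow_add _ _ h0 ht]
  congr 1; ring

namespace PartitionTree

variable {X ι : Type*} [MeasurableSpace X] {t : PartitionTree X ι} [Countable ι]
variable {σ ω : Measure X} [IsFiniteMeasure σ] [IsFiniteMeasure ω] {ρ γ : ℕ → ℝ≥0∞}
  {u v τ₀ : ℝ} {c Γ K : ℝ≥0∞}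

omit [Countable ι] [IsFiniteMeasure ω] [IsFiniteMeasure σ] in
lemma measure_cell_add_le {n : ℕ}
    (hdecay : ∀ k x, σ (t.cell (k + n) x) ≤ 2⁻¹ * σ (t.cell k x)) (k j : ℕ) (x : X) :
    σ (t.cell (k + j) x) ≤ 2⁻¹ ^ (j / n) * σ (t.cell k x) := by
  have h1 : ∀ i, σ (t.cell (k + n * i) x) ≤ 2⁻¹ ^ i * σ (t.cell k x) := by
    intro i
    induction i with
    | zero => simp
    | succ i ih =>
      have h2 := hdecay (k + n * i) x
      rw [show k + n * i + n = k + n * (i + 1) by ring] at h2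
      refine h2.trans ?_
      rw [pow_succ', mul_assoc]
      gcongr
  refine le_trans (measure_mono ?_) (h1 (j / n))
  exact cell_subset (by have := Nat.mul_div_le j n; omega) (self_mem_cell _ x)

/-- The testing condition for a dyadic fractional integral with respect to a two-weight pair with
`u + v < 1`. Only the weight `σ` has to decay along the tree, and the norm is proportional to the
power `1 / q` of the number `n₀` of generations in which `σ` is halved. -/
theorem TwoWeight.lintegral_tail_testing {τ q : ℝ} (h : TwoWeight t σ ω ρ γ u v (τ - 1) c Γ K)
    (hτ : 1 < τ) (hq : 1 < q) (hqv : q * v = 1) (huv : τ * (u + v) ≤ 1) {n : ℕ} (hn0 : 0 < n)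
    (hqn : q - 1 ≤ n) (hn : n * (τ * v) < 1) {n₀ : ℕ} (hn₀ : 0 < n₀)
    (hdecay : ∀ k x, σ (t.cell (k + n₀) x) ≤ 2⁻¹ * σ (t.cell k x)) (k : ℕ) (x : X) :
    ∫⁻ y in t.cell k x, t.tail γ σ k y ^ q ∂ω ≤
      (ENNReal.ofReal q * c * (n.factorial * Γ ^ n) ^ ((q - 1) / n) *
        (1 - 2⁻¹ ^ (q * (1 - u) - 1))⁻¹ * n₀) * K ^ q * σ (t.cell k x) ^ (q * (1 - u)) := by
  have hv : 0 < v := by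
    by_contra hv; push Not at hv; nlinarith
  have hnR : (0 : ℝ) < n := by exact_mod_cast hn0
  set L : ℝ≥0∞ := n.factorial * Γ ^ n with hL
  set θ : ℝ := (q - 1) / n with hθ
  have hθ0 : 0 ≤ θ := div_nonneg (by linarith) hnR.le
  have hθ1 : 0 ≤ 1 - θ := by rw [hθ, sub_nonneg, div_le_one hnR]; exact hqn
  have hnθ : n * θ = q - 1 := by rw [hθ]; field_simp
  set κ := q * (1 - u) with hκ
  have hκ1 : 1 ≤ κ := by nlinarith
  set z : ℝ≥0∞ := 2⁻¹ ^ (κ - 1) with hz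
  set A := t.cell k x with hA
  -- the contribution of generation `k + j`; the decay of `σ` produces the factor `z ^ (j / n₀)`
  have hcell : ∀ j, ∫⁻ y in A, γ (k + j) * σ (t.cell (k + j) y) *
      t.tail γ σ (k + j) y ^ (q - 1) ∂ω ≤ z ^ (j / n₀) * (c * L ^ θ * K ^ q * σ A ^ κ) := by
    intro j
    have hcmp : ∫⁻ y in A, γ (k + j) * σ (t.cell (k + j) y) *
        t.tail γ σ (k + j) y ^ (q - 1) ∂ω ≤
        ∫⁻ y in A, 1 ∂((c * L ^ θ * K ^ q * (z ^ (j / n₀) * σ A ^ (κ - 1))) • σ) := by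
      refine setLIntegral_le_of_cells (t := t) (k := k + j)
        (adapted_mem_cell (Nat.le_add_right k j) x) fun y hy => ?_
      rw [setLIntegral_adapted_mul (adapted_cell (k + j) fun C => γ (k + j) * σ C)
        ((measurable_tail γ σ (k + j)).pow_const _), setLIntegral_one, Measure.smul_apply,
        smul_eq_mul]
      have hpow := h.lintegral_tail_pow_le hτ hv huv hn le_rfl (k + j) y
      -- the moment of order `q - 1` is interpolated between the orders `0` and `n`
      have hjen : ∫⁻ y in t.cell (k + j) y, t.tail γ σ (k + j) y ^ (q - 1) ∂ω ≤
          (∫⁻ y in t.cell (k + j) y, t.tail γ σ (k + j) y ^ (n : ℝ) ∂ω) ^ θ *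
            ω (t.cell (k + j) y) ^ (1 - θ) := by
        have := ENNReal.lintegral_mul_norm_pow_le (μ := ω.restrict (t.cell (k + j) y))
          (f := fun y => t.tail γ σ (k + j) y ^ (n : ℝ)) (g := fun _ => 1)
          ((measurable_tail γ σ (k + j)).pow_const _).aemeasurable aemeasurable_const hθ0 hθ1
          (by ring)
        simpa only [← ENNReal.rpow_mul, hnθ, ENNReal.one_rpow, mul_one, lintegral_const, one_mul,
          Measure.restrict_apply_univ] using this
      have hscell : σ (t.cell (k + j) y) ≤ 2⁻¹ ^ (j / n₀) * σ A := by
        refine (measure_cell_add_le hdecay k j y).trans ?_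
        rw [cell_eq (t := t) (k := k) (x := y) (y := x) hy]
      set s := σ (t.cell (k + j) y)
      set w := ω (t.cell (k + j) y)
      set R := ρ (k + j)
      rcases eq_or_ne s 0 with hs | hs
      · simp [hs]
      rcases eq_or_ne w 0 with hw | hw
      · rw [setLIntegral_measure_zero _ _ hw]; simp
      have hτq : 0 ≤ q - (q - 1) * τ := by
        have h1 : (q - 1) * τ * v ≤ n * τ * v := by gcongr
        nlinarith
      -- the exponents are such that the powers of `ρ` and of `ω(R)` cancel, and only a power
      -- `κ ≥ 1` of `σ(R)` remains
      have hsc := ENNReal.rpow_mul_rpow_mul_rpow_le (h.ne_zero (k + j)) (h.ne_top (k + j)) hs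
        (measure_ne_top _ _) hw (measure_ne_top _ _) (h.char_le (k + j) y)
        hτq (1 - (τ - 1) * (q - 1)) (1 + (q - 1) * (1 - τ * u)) (1 - (q - 1) * (τ * v))
      have e3 : 1 - (τ - 1) * (q - 1) - (q - (q - 1) * τ) = 0 := by ring
      have e4 : 1 + (q - 1) * (1 - τ * u) - (q - (q - 1) * τ) * u = κ := by rw [hκ]; ring
      have e5 : 1 - (q - 1) * (τ * v) - (q - (q - 1) * τ) * v = 0 := by linear_combination -hqv
      rw [e3, e4, e5, ENNReal.rpow_zero, ENNReal.rpow_zero, one_mul, mul_one] at hsc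
      have hkap : s ^ κ ≤ (z ^ (j / n₀) * σ A ^ (κ - 1)) * s := by
        calc s ^ κ = s ^ (κ - 1) * s := (ENNReal.rpow_sub_one_mul hs (measure_ne_top _ _) _).symm
          _ ≤ (2⁻¹ ^ (j / n₀) * σ A) ^ (κ - 1) * s := by gcongr
          _ = _ := by
              rw [ENNReal.mul_rpow_of_nonneg _ _ (by linarith), hz, ← ENNReal.rpow_natCast,
                ← ENNReal.rpow_mul, ← ENNReal.rpow_natCast, ← ENNReal.rpow_mul,
                mul_comm (κ - 1) _]
      have hexp : (K ^ (τ * n) * (R ^ (-((τ - 1) * n)) * s ^ (n * (1 - τ * u)) *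
          w ^ (1 - n * (τ * v)))) ^ θ = K ^ (τ * (q - 1)) * (R ^ (-((τ - 1) * (q - 1))) *
          s ^ ((q - 1) * (1 - τ * u)) * w ^ (θ - (q - 1) * (τ * v))) := by
        simp only [ENNReal.mul_rpow_of_nonneg _ _ hθ0, ← ENNReal.rpow_mul]
        rw [show τ * n * θ = τ * (q - 1) by rw [← hnθ]; ring,
          show -((τ - 1) * n) * θ = -((τ - 1) * (q - 1)) by rw [← hnθ]; ring,
          show n * (1 - τ * u) * θ = (q - 1) * (1 - τ * u) by rw [← hnθ]; ring,
          show (1 - n * (τ * v)) * θ = θ - (q - 1) * (τ * v) by rw [← hnθ]; ring]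
      have e1 : R ^ (1 - (τ - 1) * (q - 1)) = R * R ^ (-((τ - 1) * (q - 1))) := by
        rw [sub_eq_add_neg, ENNReal.rpow_add _ _ (h.ne_zero _) (h.ne_top _), ENNReal.rpow_one]
      have e2 : s ^ (1 + (q - 1) * (1 - τ * u)) = s * s ^ ((q - 1) * (1 - τ * u)) := by
        rw [ENNReal.rpow_add _ _ hs (measure_ne_top _ _), ENNReal.rpow_one]
      have e6 : w ^ (1 - (q - 1) * (τ * v)) = w ^ (θ - (q - 1) * (τ * v)) * w ^ (1 - θ) := by
        rw [← ENNReal.rpow_add _ _ hw (measure_ne_top _ _)]; congr 1; ring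
      rw [e1, e2, e6] at hsc
      calc γ (k + j) * s * ∫⁻ y in t.cell (k + j) y, t.tail γ σ (k + j) y ^ (q - 1) ∂ω
          ≤ c * R * s * ((L * (K ^ (τ * n) * (R ^ (-((τ - 1) * n)) * s ^ (n * (1 - τ * u)) *
              w ^ (1 - n * (τ * v))))) ^ θ * w ^ (1 - θ)) := by
            gcongr
            · exact h.le _
            · refine hjen.trans ?_
              gcongr
        _ = c * L ^ θ * K ^ (τ * (q - 1)) * (R * R ^ (-((τ - 1) * (q - 1))) *
              (s * s ^ ((q - 1) * (1 - τ * u))) *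
              (w ^ (θ - (q - 1) * (τ * v)) * w ^ (1 - θ))) := by
            rw [ENNReal.mul_rpow_of_nonneg L _ hθ0, hexp]; ring
        _ ≤ c * L ^ θ * K ^ (τ * (q - 1)) * (K ^ (q - (q - 1) * τ) *
              ((z ^ (j / n₀) * σ A ^ (κ - 1)) * s)) := by
            exact mul_le_mul' le_rfl (hsc.trans (by gcongr))
        _ = _ := by
            have : K ^ q = K ^ (τ * (q - 1)) * K ^ (q - (q - 1) * τ) := by
              rw [← ENNReal.rpow_add_of_nonneg _ _ (by nlinarith) hτq]; congr 1; ring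
            rw [this]; ring
    refine hcmp.trans ?_
    rw [setLIntegral_one, Measure.smul_apply, smul_eq_mul]
    rcases eq_or_ne (σ A) 0 with hs | hs
    · simp [hs]
    rw [← ENNReal.rpow_sub_one_mul hs (measure_ne_top _ _) κ]
    exact le_of_eq (by ring)
  refine (h.lintegral_tail_rpow_le hq.le k x).trans ?_
  calc _ ≤ ENNReal.ofReal q * ∑' j : ℕ, z ^ (j / n₀) * (c * L ^ θ * K ^ q * σ A ^ κ) := by
        gcongr with j; exact hcell j
    _ = ENNReal.ofReal q * (n₀ * (1 - z)⁻¹ * (c * L ^ θ * K ^ q * σ A ^ κ)) := by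
        rw [ENNReal.tsum_mul_right, ENNReal.tsum_pow_div_le z hn₀]
    _ = _ := by ring

/-! ### Weak type estimates -/

omit [IsFiniteMeasure σ] [IsFiniteMeasure ω] in
/-- Averaging over cells is symmetric. -/
lemma setLIntegral_mul_setLIntegral_comm {m k : ℕ} (hmk : m ≤ k) (x : X) {f g : X → ℝ≥0∞}
    (hf : Measurable f) (hg : Measurable g) :
    ∫⁻ y in t.cell m x, (∫⁻ z in t.cell k y, f z ∂σ) * g y ∂ω =
      ∫⁻ y in t.cell m x, f y * ∫⁻ z in t.cell k y, g z ∂ω ∂σ := by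
  have key : ∀ z, ∫⁻ y in t.cell k z, (∫⁻ z in t.cell k y, f z ∂σ) * g y ∂ω =
      ∫⁻ y in t.cell k z, f y * ∫⁻ z in t.cell k y, g z ∂ω ∂σ := by
    intro z
    simp_rw [mul_comm (f _)]
    rw [setLIntegral_adapted_mul (adapted_cell k fun C => ∫⁻ z in C, f z ∂σ) hg,
      setLIntegral_adapted_mul (adapted_cell k fun C => ∫⁻ z in C, g z ∂ω) hf, mul_comm]
  exact le_antisymm
    (setLIntegral_le_of_cells (t := t) (adapted_mem_cell hmk x) fun z _ => (key z).le)
    (setLIntegral_le_of_cells (t := t) (adapted_mem_cell hmk x) fun z _ => (key z).ge)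

variable (t) in
/-- The terms `γ_k ∫_{cell k x} f dσ` of a dyadic fractional integral of `f σ`. -/
noncomputable def term (γ : ℕ → ℝ≥0∞) (σ : Measure X) (f : X → ℝ≥0∞) (k : ℕ) (x : X) : ℝ≥0∞ :=
  γ k * ∫⁻ z in t.cell k x, f z ∂σ

omit [Countable ι] [IsFiniteMeasure σ] in
lemma adapted_term (γ : ℕ → ℝ≥0∞) (f : X → ℝ≥0∞) (k : ℕ) : t.Adapted k (t.term γ σ f k) :=
  adapted_cell k fun C => γ k * ∫⁻ z in C, f z ∂σ

omit [IsFiniteMeasure σ] [IsFiniteMeasure ω] in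
lemma setLIntegral_tsum_term {f : X → ℝ≥0∞} (hf : Measurable f) (γ : ℕ → ℝ≥0∞) (k : ℕ) (x : X) :
    ∫⁻ y in t.cell k x, ∑' j, t.term γ σ f (k + j) y ∂ω =
      ∫⁻ y in t.cell k x, f y * t.tail γ ω k y ∂σ := by
  simp_rw [tail, ← ENNReal.tsum_mul_left]
  rw [lintegral_tsum fun j => (adapted_term γ f (k + j)).measurable.aemeasurable, lintegral_tsum]
  · refine tsum_congr fun j => ?_
    have := setLIntegral_mul_setLIntegral_comm (t := t) (σ := σ) (ω := ω)
      (Nat.le_add_right k j) x hf (g := fun _ => γ (k + j)) measurable_const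
    simp only [setLIntegral_const] at this
    rw [← this]
    exact lintegral_congr fun y => by rw [term, mul_comm]
  · intro j
    exact (hf.mul (adapted_cell (t := t) (k + j)
      fun C => γ (k + j) * ω C).measurable).aemeasurable

/-- `a b^{1-1/q} ≤ η b + η^{1-q} a^q`. -/
lemma _root_.ENNReal.mul_rpow_one_sub_le {q : ℝ} (hq : 1 < q) {η : ℝ≥0∞} (hη0 : η ≠ 0)
    (hη : η ≠ ∞) (a b : ℝ≥0∞) :
    a * b ^ (1 - 1 / q) ≤ η * b + η ^ (1 - q) * a ^ q := by
  have hq0 : 0 < q := by linarith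
  have hq1 : 0 < 1 - 1 / q := by rw [sub_pos, div_lt_one hq0]; exact hq
  have := ENNReal.rpow_mul_rpow_le_weighted hq1 (one_div_pos.mpr hq0) (by ring) (η * b)
    (η ^ (1 - q) * a ^ q)
  calc a * b ^ (1 - 1 / q) = (η * b) ^ (1 - 1 / q) * (η ^ (1 - q) * a ^ q) ^ (1 / q) := by
        rw [ENNReal.mul_rpow_of_nonneg _ _ hq1.le, ENNReal.mul_rpow_of_nonneg _ _ (by positivity),
          ← ENNReal.rpow_mul, ← ENNReal.rpow_mul, mul_one_div_cancel hq0.ne', ENNReal.rpow_one]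
        have : η ^ (1 - 1 / q) * η ^ ((1 - q) * (1 / q)) = 1 := by
          rw [← ENNReal.rpow_add _ _ hη0 hη, show 1 - 1 / q + (1 - q) * (1 / q) = 0 by field_simp; ring,
            ENNReal.rpow_zero]
        calc a * b ^ (1 - 1 / q) = (η ^ (1 - 1 / q) * η ^ ((1 - q) * (1 / q))) *
              (a * b ^ (1 - 1 / q)) := by rw [this, one_mul]
          _ = _ := by ring
    _ ≤ _ := this
    _ ≤ _ := by
        refine add_le_add (mul_le_of_le_one_left' (ENNReal.ofReal_le_one.mpr ?_))
          (mul_le_of_le_one_left' (ENNReal.ofReal_le_one.mpr ?_))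
        · rw [sub_le_self_iff]; positivity
        · rw [div_le_one hq0]; exact hq.le

/-- `(∫_A g)^θ ≤ (∫ g)^{θ-1} ∫_A g` for `θ ≥ 1`. -/
lemma _root_.MeasureTheory.setLIntegral_rpow_le {X : Type*} [MeasurableSpace X] (ν : Measure X)
    (g : X → ℝ≥0∞) (A : Set X) {θ : ℝ} (hθ : 1 ≤ θ) :
    (∫⁻ x in A, g x ∂ν) ^ θ ≤ (∫⁻ x, g x ∂ν) ^ (θ - 1) * ∫⁻ x in A, g x ∂ν := by
  rcases eq_or_ne (∫⁻ x in A, g x ∂ν) 0 with h0 | h0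
  · rw [h0, ENNReal.zero_rpow_of_pos (by linarith)]; simp
  rcases eq_or_ne (∫⁻ x in A, g x ∂ν) ∞ with ht | ht
  · have : ∫⁻ x, g x ∂ν = ∞ := top_le_iff.mp (ht ▸ setLIntegral_le_lintegral A g)
    rw [this, ht]
    rcases hθ.eq_or_lt with rfl | h
    · simp
    · rw [ENNReal.top_rpow_of_pos (by linarith : 0 < θ - 1)]; simp
  · calc _ = (∫⁻ x in A, g x ∂ν) ^ (θ - 1) * ∫⁻ x in A, g x ∂ν :=
          (ENNReal.rpow_sub_one_mul h0 ht θ).symm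
      _ ≤ _ := mul_le_mul' (ENNReal.rpow_le_rpow (setLIntegral_le_lintegral A g) (by linarith))
          le_rfl

omit [IsFiniteMeasure σ] in
/-- The dual testing condition implies the weak type estimate: on a cell, the tail of the sum is
estimated in `L^1(ω)` by duality, Hölder's inequality and the testing condition, and the good-`λ`
inequality applies. -/
theorem weakType_of_testing {p p' q : ℝ} (hpp : p.HolderConjugate p') (hpq : p ≤ q)
    {T : ℝ≥0∞}
    (htest : ∀ k x, (∫⁻ y in t.cell k x, t.tail γ ω k y ^ p' ∂σ) ^ (1 / p') ≤
      T * ω (t.cell k x) ^ (1 - 1 / q))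
    {f : X → ℝ≥0∞} (hf : Measurable f) (l : ℝ≥0) :
    (l : ℝ≥0∞) ^ q * ω {x | l < ∑' k, t.term γ σ f k x} ≤
      2 ^ ((q + 1) * q) * (T ^ q * (∫⁻ x, f x ^ p ∂σ) ^ (q / p)) := by
  have hp1 : 1 < p := hpp.lt
  have hq1 : 1 < q := hp1.trans_le hpq
  have hq0 : 0 < q := by linarith
  have hp0 : 0 < p := by linarith
  set η : ℝ≥0∞ := 2⁻¹ ^ (q + 1) with hη
  have hη0 : η ≠ 0 := by
    rw [hη]; exact (ENNReal.rpow_pos (by simp) (by simp)).ne'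
  have hηt : η ≠ ∞ := ENNReal.rpow_ne_top_of_nonneg (by linarith) (by simp)
  set N := ∫⁻ x, f x ^ p ∂σ with hN
  have main := mul_measure_lt_tsum_le (t := t) (a := t.term γ σ f) (ν := ω) (q := q)
    (D := η ^ (1 - q) * (T ^ q * N ^ (q / p))) (fun k => adapted_term γ f k) hq0 ?_ l
  · refine main.trans (le_of_eq ?_)
    rw [← mul_assoc]
    congr 1
    rw [hη, ENNReal.inv_rpow, ← ENNReal.rpow_neg, ← ENNReal.rpow_mul,
      ← ENNReal.rpow_add _ _ (by simp) (by simp)]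
    congr 1; ring
  · intro l hl
    have hl0 : (l : ℝ≥0∞) ≠ 0 := by simpa using hl.ne'
    set C := η ^ (1 - q) * (T ^ q * (N ^ (q / p - 1) * ((l : ℝ≥0∞) ^ q)⁻¹)) with hC
    -- the exceptional measure of the good-`λ` inequality has a density proportional to `f ^ p`
    refine ⟨C • σ.withDensity fun x => f x ^ p, ?_, fun k x => ?_⟩
    · rw [Measure.smul_apply, smul_eq_mul, withDensity_apply _ MeasurableSet.univ,
        Measure.restrict_univ, ← hN, hC]
      calc _ = ((l : ℝ≥0∞) ^ q * ((l : ℝ≥0∞) ^ q)⁻¹) * (η ^ (1 - q) * (T ^ q *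
            (N ^ (q / p - 1) * N))) := by ring
        _ ≤ 1 * (η ^ (1 - q) * (T ^ q * N ^ (q / p))) := by
          gcongr
          · exact ENNReal.mul_inv_le_one _
          · rcases eq_or_ne N 0 with h0 | h0
            · simp [h0]
            rcases eq_or_ne N ∞ with h1 | h1
            · rw [h1, ENNReal.top_rpow_of_pos (div_pos hq0 hp0)]; simp
            · rw [ENNReal.rpow_sub_one_mul h0 h1]
        _ = _ := by rw [one_mul]
    · rw [Measure.smul_apply, smul_eq_mul, withDensity_apply _ (measurableSet_cell k x)]
      set R := t.cell k x with hR
      set F := ∫⁻ y in R, f y ^ p ∂σ with hF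
      have hmeas : Measurable fun y => ∑' j, t.term γ σ f (k + j) y :=
        Measurable.tsum fun j => (adapted_term γ f (k + j)).measurable
      have h1 : (l : ℝ≥0∞) * ω (R ∩ {y | l < ∑' j, t.term γ σ f (k + j) y}) ≤
          F ^ (1 / p) * (T * ω R ^ (1 - 1 / q)) := by
        calc _ ≤ ∫⁻ y in R, ∑' j, t.term γ σ f (k + j) y ∂ω := by
              rw [inter_comm, ← Measure.restrict_apply (measurableSet_lt measurable_const hmeas)]
              refine le_trans ?_ (mul_meas_ge_le_lintegral hmeas l)
              gcongr
              exact fun hy => le_of_lt hy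
          _ = ∫⁻ y in R, f y * t.tail γ ω k y ∂σ := setLIntegral_tsum_term hf γ k x
          _ ≤ F ^ (1 / p) * (∫⁻ y in R, t.tail γ ω k y ^ p' ∂σ) ^ (1 / p') :=
              ENNReal.lintegral_mul_le_Lp_mul_Lq _ hpp hf.aemeasurable
                (measurable_tail γ ω k).aemeasurable
          _ ≤ _ := by gcongr; exact htest k x
      have h2 : ω (R ∩ {y | l < ∑' j, t.term γ σ f (k + j) y}) ≤
          ((l : ℝ≥0∞)⁻¹ * (F ^ (1 / p) * T)) * ω R ^ (1 - 1 / q) := by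
        calc _ = (l : ℝ≥0∞)⁻¹ * (l * ω (R ∩ {y | l < ∑' j, t.term γ σ f (k + j) y})) := by
              rw [← mul_assoc, ENNReal.inv_mul_cancel hl0 ENNReal.coe_ne_top, one_mul]
          _ ≤ _ := by
              rw [mul_assoc, mul_assoc]; gcongr
      -- a small multiple of `ω(R)` is split off, which is the room that the good-`λ` inequality
      -- allows
      refine h2.trans ((ENNReal.mul_rpow_one_sub_le hq1 hη0 hηt _ _).trans ?_)
      refine add_le_add le_rfl ?_
      rw [ENNReal.mul_rpow_of_nonneg _ _ hq0.le, ENNReal.mul_rpow_of_nonneg _ _ hq0.le,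
        ← ENNReal.rpow_mul F, show 1 / p * q = q / p by ring, ENNReal.inv_rpow, hC]
      have h3 := setLIntegral_rpow_le σ (fun x => f x ^ p) R (θ := q / p)
        (by rw [le_div_iff₀ hp0]; linarith)
      calc _ = η ^ (1 - q) * (T ^ q * ((l : ℝ≥0∞) ^ q)⁻¹) * F ^ (q / p) := by ring
        _ ≤ η ^ (1 - q) * (T ^ q * ((l : ℝ≥0∞) ^ q)⁻¹) * (N ^ (q / p - 1) * F) := by gcongr
        _ = _ := by ring

end PartitionTree

namespace PartitionTree

variable {X ι : Type*} [MeasurableSpace X] {t : PartitionTree X ι} [Countable ι]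
variable {σ ω : Measure X} [IsFiniteMeasure σ] [IsFiniteMeasure ω] {γ : ℕ → ℝ≥0∞}

section Weak

omit [Countable ι] in
lemma adapted_lt_const {a : ℕ → X → ℝ≥0∞} (ha : ∀ k, t.Adapted k (a k)) (l : ℝ≥0∞) (k : ℕ) :
    t.Adapted k fun x => l < a k x := fun x y h => by simp only [ha k x y h]

omit [IsFiniteMeasure ω] in
/-- Weak type estimate for the fractional maximal function. -/
lemma rpow_mul_measure_exists_lt_le {a : ℕ → X → ℝ≥0∞} (ha : ∀ k, t.Adapted k (a k)) {p q : ℝ}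
    (hp : 0 < p) (hpq : p ≤ q) {K : ℝ≥0∞} {n : X → ℝ≥0∞} {μ : Measure X}
    (h : ∀ k x, a k x * ω (t.cell k x) ^ (1 / q) ≤ K * (∫⁻ y in t.cell k x, n y ∂μ) ^ (1 / p))
    (l : ℝ≥0∞) :
    l ^ q * ω {x | ∃ k, l < a k x} ≤ K ^ q * (∫⁻ x, n x ∂μ) ^ (q / p) := by
  have hq : 0 < q := hp.trans_le hpq
  set N := ∫⁻ x, n x ∂μ with hN
  have key := setLIntegral_exists_le (t := t) (adapted_lt_const ha l) (ν := ω)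
    (μ := (K ^ q * N ^ (q / p - 1)) • μ) (f := fun _ => l ^ q) (g := n) ?_
  · rw [setLIntegral_const] at key
    refine key.trans ((setLIntegral_le_lintegral _ _).trans ?_)
    rw [lintegral_smul_measure, smul_eq_mul, mul_assoc, ← hN]
    gcongr
    rcases eq_or_ne N 0 with h0 | h0
    · simp [h0]
    rcases eq_or_ne N ∞ with h1 | h1
    · rw [h1, ENNReal.top_rpow_of_pos (div_pos hq hp)]; simp
    · rw [ENNReal.rpow_sub_one_mul h0 h1]
  · intro k x hx
    rw [setLIntegral_const, Measure.restrict_smul, lintegral_smul_measure, smul_eq_mul]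
    calc l ^ q * ω (t.cell k x) ≤ (a k x * ω (t.cell k x) ^ (1 / q)) ^ q := by
          rw [ENNReal.mul_rpow_of_nonneg _ _ hq.le, ← ENNReal.rpow_mul, one_div_mul_cancel hq.ne',
            ENNReal.rpow_one]
          gcongr
          exact hx.1.le
      _ ≤ (K * (∫⁻ y in t.cell k x, n y ∂μ) ^ (1 / p)) ^ q :=
          ENNReal.rpow_le_rpow (h k x) hq.le
      _ = K ^ q * (∫⁻ y in t.cell k x, n y ∂μ) ^ (q / p) := by
          rw [ENNReal.mul_rpow_of_nonneg _ _ hq.le, ← ENNReal.rpow_mul]; congr 2; ring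
      _ ≤ K ^ q * (N ^ (q / p - 1) * ∫⁻ y in t.cell k x, n y ∂μ) := by
          gcongr
          exact setLIntegral_rpow_le μ n _ (by rw [le_div_iff₀ hp]; linarith)
      _ = _ := by ring

open Classical in
/-- Weak type estimate for sparse sums: the constant is linear in the Carleson constant `B` of the
family of stopping cells. -/
theorem weakType_sparse {a : ℕ → X → ℝ≥0∞} (ha : ∀ k, t.Adapted k (a k)) {st : ℕ → X → Prop}
    (hst : ∀ k, t.Adapted k (st k)) {p q : ℝ} (hp : 0 < p) (hpq : p ≤ q) {K B : ℝ≥0∞}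
    (hB0 : B ≠ 0) (hB : B ≠ ∞)
    (hcar : ∀ k x, ∫⁻ y in t.cell k x, ∑' j, (if st (k + j) y then 1 else 0) ∂ω ≤
      B * ω (t.cell k x))
    {n : X → ℝ≥0∞} {μ : Measure X}
    (h : ∀ k x, a k x * ω (t.cell k x) ^ (1 / q) ≤ K * (∫⁻ y in t.cell k x, n y ∂μ) ^ (1 / p))
    (l : ℝ≥0) :
    (l : ℝ≥0∞) ^ q * ω {x | l < ∑' k, (if st k x then a k x else 0)} ≤
      2 ^ ((q + 1) * (q + 1)) * (B ^ q * (K ^ q * (∫⁻ x, n x ∂μ) ^ (q / p))) := by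
  have hq : 0 < q := hp.trans_le hpq
  have hterm : ∀ k, t.Adapted k fun x => if st k x then a k x else 0 := fun k x y hxy => by
    simp only [hst k x y hxy, ha k x y hxy]
  have hone : ∀ k, t.Adapted k fun x => if st k x then (1 : ℝ≥0∞) else 0 := fun k x y hxy => by
    simp only [hst k x y hxy]
  set D := (2 ^ (q + 1) * B) ^ q * (K ^ q * (∫⁻ x, n x ∂μ) ^ (q / p)) with hD
  have main := mul_measure_lt_tsum_le (t := t) (ν := ω) hterm hq (D := D) ?_ l
  · refine main.trans (le_of_eq ?_)
    have e : (2 : ℝ≥0∞) ^ ((q + 1) * (q + 1)) = 2 ^ (q + 1) * 2 ^ ((q + 1) * q) := by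
      rw [← ENNReal.rpow_add _ _ (by simp) (by simp)]; congr 1; ring
    rw [hD, ENNReal.mul_rpow_of_nonneg _ _ hq.le, ← ENNReal.rpow_mul, e]
    ring
  · intro l hl
    have hl0 : (l : ℝ≥0∞) ≠ 0 := by simpa using hl.ne'
    set η : ℝ≥0∞ := 2 ^ (q + 1) * B with hη
    have h20 : (2 : ℝ≥0∞) ^ (q + 1) ≠ 0 := (ENNReal.rpow_pos (by simp) (by simp)).ne'
    have h2t : (2 : ℝ≥0∞) ^ (q + 1) ≠ ∞ := ENNReal.rpow_ne_top_of_nonneg (by linarith) (by simp)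
    have hη0 : η ≠ 0 := mul_ne_zero h20 hB0
    have hηt : η ≠ ∞ := ENNReal.mul_ne_top h2t hB
    -- the level `g` of the maximal function at which the good set is cut off
    set g : ℝ≥0∞ := l / η with hg
    have hg0 : g ≠ 0 := ENNReal.div_ne_zero.mpr ⟨hl0, hηt⟩
    have hgt : g ≠ ∞ := ENNReal.div_ne_top ENNReal.coe_ne_top hη0
    have hlg : (l : ℝ≥0∞) = η * g := by rw [hg, ENNReal.mul_div_cancel hη0 hηt]
    have hmE : MeasurableSet {x | ∃ k, g < a k x} := by
      have : {x | ∃ k, g < a k x} = ⋃ k, {x | g < a k x} := by ext; simp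
      rw [this]
      exact MeasurableSet.iUnion fun k => measurableSet_lt measurable_const (ha k).measurable
    refine ⟨ω.restrict {x | ∃ k, g < a k x}, ?_, fun k x => ?_⟩
    · rw [Measure.restrict_apply_univ, hD, hlg, ENNReal.mul_rpow_of_nonneg _ _ hq.le, mul_assoc]
      exact mul_le_mul' le_rfl (rpow_mul_measure_exists_lt_le ha hp hpq h g)
    · set R := t.cell k x with hR
      have hmS : Measurable fun y => ∑' j, (if st (k + j) y then (1 : ℝ≥0∞) else 0) :=
        Measurable.tsum fun j => (hone (k + j)).measurable
      -- outside the set where some `a k` exceeds `g`, a large sum needs many stopping cells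
      have hsub : R ∩ {y | (l : ℝ≥0∞) < ∑' j, if st (k + j) y then a (k + j) y else 0} ⊆
          (R ∩ {y | η ≤ ∑' j, if st (k + j) y then (1 : ℝ≥0∞) else 0}) ∪
            (R ∩ {x | ∃ k, g < a k x}) := by
        rintro y ⟨hyR, hy⟩
        by_cases hE : ∃ k, g < a k y
        · exact Or.inr ⟨hyR, hE⟩
        · refine Or.inl ⟨hyR, ?_⟩
          push Not at hE
          rw [mem_ofPred_eq] at hy ⊢
          by_contra hcon
          rw [not_le] at hcon
          have : ∑' j, (if st (k + j) y then a (k + j) y else 0) ≤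
              g * ∑' j, (if st (k + j) y then (1 : ℝ≥0∞) else 0) := by
            rw [← ENNReal.tsum_mul_left]
            refine ENNReal.tsum_le_tsum fun j => ?_
            split_ifs
            · simpa using hE (k + j)
            · simp
          have h2 := hy.trans_le this
          rw [hlg, mul_comm] at h2
          exact absurd ((ENNReal.mul_lt_mul_iff_right hg0 hgt).mp h2) (not_lt.mpr hcon.le)
      -- Chebyshev's inequality and the Carleson condition
      have hsmall : ω (R ∩ {y | η ≤ ∑' j, if st (k + j) y then (1 : ℝ≥0∞) else 0}) ≤
          2⁻¹ ^ (q + 1) * ω R := by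
        have h1 : η * ω (R ∩ {y | η ≤ ∑' j, if st (k + j) y then (1 : ℝ≥0∞) else 0}) ≤
            B * ω R := by
          rw [inter_comm, ← Measure.restrict_apply (measurableSet_le measurable_const hmS)]
          exact (mul_meas_ge_le_lintegral hmS η).trans (hcar k x)
        calc _ = η⁻¹ * (η * ω (R ∩ {y | η ≤ ∑' j, if st (k + j) y then (1 : ℝ≥0∞) else 0})) := by
              rw [← mul_assoc, ENNReal.inv_mul_cancel hη0 hηt, one_mul]
          _ ≤ η⁻¹ * (B * ω R) := by gcongr
          _ = _ := by
              rw [hη, ENNReal.mul_inv (Or.inl h20) (Or.inl h2t), ENNReal.inv_rpow, mul_assoc,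
                ← mul_assoc B⁻¹, ENNReal.inv_mul_cancel hB0 hB, one_mul]
      calc _ ≤ _ := measure_mono hsub
        _ ≤ _ := measure_union_le _ _
        _ ≤ _ := by
          refine add_le_add hsmall ?_
          rw [inter_comm, ← Measure.restrict_apply hmE, Measure.restrict_apply hmE,
            Measure.restrict_apply (measurableSet_cell k x), inter_comm]

end Weak

/-! ### Principal cells and the Carleson embedding -/

section Principal

open Classical

/-- The doubling rule for principal cells: stopping occurs again when `v` has doubled. -/
def Doubled (v : ℕ → X → ℝ≥0∞) (j k : ℕ) (x : X) : Prop := 2 * v j x < v k x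

omit [Countable ι] in
lemma adapted_doubled {v : ℕ → X → ℝ≥0∞} (hv : ∀ k, t.Adapted k (v k)) (j k : ℕ) (hjk : j ≤ k) :
    t.Adapted k (Doubled v j k) := fun x y h => by
  simp only [Doubled, hv k x y h, (hv j).mono hjk x y h]

omit [MeasurableSpace X] in
lemma le_two_mul_lastStop (v : ℕ → X → ℝ≥0∞) (k : ℕ) (x : X) :
    v k x ≤ 2 * v (lastStop (Doubled v) k x) x := by
  rcases (lastStop_le (bad := Doubled v) k x).eq_or_lt with h | h
  · rw [h, two_mul]; exact le_self_add
  · exact not_lt.mp (not_bad_of_lastStop_lt h le_rfl)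

omit [MeasurableSpace X] in
/-- The values of `v` at its principal cells grow geometrically. -/
lemma tsum_isStop_rpow_le (v : ℕ → X → ℝ≥0∞) {p : ℝ} (hp : 1 ≤ p) (x : X) :
    ∑' k, (if IsStop (Doubled v) k x then v k x ^ p else 0) ≤ 2 * (⨆ k, v k x) ^ p := by
  have hp0 : 0 ≤ p := by linarith
  have hind : ∀ n, ∑ k ∈ Finset.range (n + 1),
      (if IsStop (Doubled v) k x then v k x ^ p else 0) ≤
        2 * v (lastStop (Doubled v) n x) x ^ p := by
    intro n
    induction n with
    | zero =>
      simp only [zero_add, Finset.sum_range_one, isStop_zero, if_true, lastStop]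
      rw [two_mul]; exact le_self_add
    | succ n ih =>
      rw [Finset.sum_range_succ]
      by_cases hb : Doubled v (lastStop (Doubled v) n x) (n + 1) x
      · rw [if_pos (isStop_succ_iff.mpr hb), lastStop_succ_of_bad hb, two_mul]
        gcongr
        refine ih.trans ?_
        calc 2 * v (lastStop (Doubled v) n x) x ^ p
            ≤ 2 ^ p * v (lastStop (Doubled v) n x) x ^ p := by
              gcongr
              conv_lhs => rw [← ENNReal.rpow_one 2]
              exact ENNReal.rpow_le_rpow_of_exponent_le (by norm_num) hp
          _ = (2 * v (lastStop (Doubled v) n x) x) ^ p := by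
              rw [ENNReal.mul_rpow_of_nonneg _ _ hp0]
          _ ≤ _ := ENNReal.rpow_le_rpow (le_of_lt hb) hp0
      · rw [if_neg (fun h => hb (isStop_succ_iff.mp h)), lastStop_succ_of_not_bad hb, add_zero]
        exact ih
  rw [ENNReal.tsum_eq_iSup_nat]
  refine iSup_le fun n => ?_
  refine (Finset.sum_le_sum_of_subset (Finset.range_mono (Nat.le_succ n))).trans
    ((hind n).trans ?_)
  gcongr
  exact le_iSup (fun k => v k x) _

/-- The constant in the `L^p` estimate for the values at principal cells. -/
noncomputable def principalConst (p : ℝ) : ℝ≥0∞ := 2 * ENNReal.ofReal (2 ^ p * p / (p - 1))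

lemma principalConst_ne_top (p : ℝ) : principalConst p ≠ ∞ :=
  ENNReal.mul_ne_top (by simp) ENNReal.ofReal_ne_top

omit [IsFiniteMeasure ω] in
lemma tsum_lintegral_isStop_le {v : ℕ → X → ℝ≥0∞} (hv : ∀ k, t.Adapted k (v k)) {f : X → ℝ≥0∞}
    (hf : Measurable f) (hvf : ∀ k x, v k x ≤ t.avg σ f k x) {p : ℝ} (hp : 1 < p) :
    ∑' k, ∫⁻ x, (if IsStop (Doubled v) k x then v k x ^ p else 0) ∂σ ≤
      principalConst p * ∫⁻ x, f x ^ p ∂σ := by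
  rw [← lintegral_tsum]
  · calc _ ≤ ∫⁻ x, 2 * t.maxFn σ f x ^ p ∂σ := by
          refine lintegral_mono fun x => (tsum_isStop_rpow_le v hp.le x).trans ?_
          gcongr
          exact iSup_mono fun k => hvf k x
      _ = 2 * ∫⁻ x, t.maxFn σ f x ^ p ∂σ := lintegral_const_mul' _ _ (by simp)
      _ ≤ _ := by
          rw [principalConst, mul_assoc]
          gcongr
          exact lintegral_maxFn_rpow_le σ hf hp
  · intro k
    refine (Adapted.measurable (t := t) (k := k) fun x y h => ?_).aemeasurable
    simp only [adapted_isStop (adapted_doubled hv) k x y h, hv k x y h]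

/-- Carleson embedding theorem. The stopping cells are grouped by the principal cells of `f`, on
which the averages of `f` are comparable. -/
lemma carleson_embedding {st : ℕ → X → Prop} (hst : ∀ k, t.Adapted k (st k)) {B : ℝ≥0∞}
    (hcar : ∀ k x, ∫⁻ y in t.cell k x, ∑' j, (if st (k + j) y then 1 else 0) ∂σ ≤
      B * σ (t.cell k x)) {f : X → ℝ≥0∞} (hf : Measurable f) {p : ℝ} (hp : 1 < p) :
    ∑' k, ∫⁻ x, (if st k x then t.avg σ f k x ^ p else 0) ∂σ ≤
      2 ^ p * B * (principalConst p * ∫⁻ x, f x ^ p ∂σ) := by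
  have hp0 : 0 ≤ p := by linarith
  set v := t.avg σ f with hvdef
  have hv : ∀ k, t.Adapted k (v k) := adapted_avg σ f
  have hgens := fun k => adapted_isStop (adapted_doubled hv) k
  have hone : ∀ k, t.Adapted k fun x => if st k x then (1 : ℝ≥0∞) else 0 := fun k x y hxy => by
    simp only [hst k x y hxy]
  have hE : ∀ m, t.Adapted m fun x => if IsStop (Doubled v) m x then 2 ^ p * v m x ^ p else 0 :=
    fun m x y hxy => by simp only [hgens m x y hxy, hv m x y hxy]
  have hmS : ∀ m, Measurable fun y => ∑' j, (if st (m + j) y then (1 : ℝ≥0∞) else 0) :=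
    fun m => Measurable.tsum fun j => (hone (m + j)).measurable
  have hpt : ∀ x, ∑' k, (if st k x then v k x ^ p else 0) ≤
      ∑' m, (if IsStop (Doubled v) m x then 2 ^ p * v m x ^ p else 0) *
        ∑' j, (if st (m + j) x then 1 else 0) := by
    intro x
    calc _ ≤ ∑' k, ∑' m, (if lastStop (Doubled v) k x = m ∧ st k x then 2 ^ p * v m x ^ p
          else 0) := by
          refine ENNReal.tsum_le_tsum fun k => ?_
          refine le_trans ?_ (ENNReal.le_tsum (lastStop (Doubled v) k x))
          by_cases h : st k x
          · simp only [h, if_true, and_self]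
            rw [← ENNReal.mul_rpow_of_nonneg _ _ hp0]
            exact ENNReal.rpow_le_rpow (le_two_mul_lastStop v k x) hp0
          · simp [h]
      _ = ∑' m, ∑' k, (if lastStop (Doubled v) k x = m ∧ st k x then 2 ^ p * v m x ^ p
          else 0) := ENNReal.tsum_comm
      _ ≤ _ := by
          refine ENNReal.tsum_le_tsum fun m => ?_
          rw [ENNReal.tsum_eq_sum_range_add_tsum _ m, Finset.sum_eq_zero, zero_add,
            ← ENNReal.tsum_mul_left]
          · refine ENNReal.tsum_le_tsum fun j => ?_
            by_cases h1 : lastStop (Doubled v) (m + j) x = m ∧ st (m + j) x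
            · have h2 : IsStop (Doubled v) m x := by
                have := isStop_lastStop (bad := Doubled v) (m + j) x
                rwa [h1.1] at this
              rw [if_pos h1, if_pos h2, if_pos h1.2, mul_one]
            · simp [h1]
          · intro k hk
            rw [if_neg]
            rintro ⟨h1, -⟩
            have := lastStop_le (bad := Doubled v) k x
            rw [Finset.mem_range] at hk
            omega
  rw [← lintegral_tsum]
  · refine (lintegral_mono hpt).trans ?_
    rw [lintegral_tsum (f := fun m x => (if IsStop (Doubled v) m x then 2 ^ p * v m x ^ p else 0) *
        ∑' j, (if st (m + j) x then 1 else 0))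
      fun m => ((hE m).measurable.mul (hmS m)).aemeasurable]
    calc _ ≤ ∑' m, ∫⁻ x, (2 ^ p * B) * (if IsStop (Doubled v) m x then v m x ^ p else 0) ∂σ := by
          refine ENNReal.tsum_le_tsum fun m => lintegral_le_of_cells (t := t) m fun x => ?_
          have hR : t.Adapted m fun y => (2 ^ p * B) *
              (if IsStop (Doubled v) m y then v m y ^ p else 0) := fun y z hyz => by
            simp only [hgens m y z hyz, hv m y z hyz]
          rw [setLIntegral_adapted_mul (hE m) (hmS m), setLIntegral_adapted hR]
          by_cases h : IsStop (Doubled v) m x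
          · simp only [h, if_true]
            calc _ ≤ 2 ^ p * v m x ^ p * (B * σ (t.cell m x)) :=
                  mul_le_mul' le_rfl (hcar m x)
              _ = _ := by ring
          · simp [h]
      _ = 2 ^ p * B * ∑' m, ∫⁻ x, (if IsStop (Doubled v) m x then v m x ^ p else 0) ∂σ := by
          rw [← ENNReal.tsum_mul_left]
          refine tsum_congr fun m => lintegral_const_mul _ ?_
          exact Adapted.measurable (t := t) (k := m) fun y z hyz => by
            simp only [hgens m y z hyz, hv m y z hyz]
      _ ≤ _ := by
          gcongr
          exact tsum_lintegral_isStop_le hv hf (fun k x => le_rfl) hp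
  · intro k
    exact (Adapted.measurable (t := t) (k := k) fun y z hyz => by
      simp only [hst k y z hyz, hv k y z hyz]).aemeasurable

end Principal

end PartitionTree

/-! ### The bilinear form of a fractional integral and two testing conditions -/

/-- Young's inequality without the constants. -/
lemma ENNReal.mul_le_rpow_add_rpow (a b : ℝ≥0∞) {p q : ℝ} (hpq : p.HolderConjugate q) :
    a * b ≤ a ^ p + b ^ q := by
  refine (ENNReal.young_inequality a b hpq).trans (add_le_add ?_ ?_)
  · exact ENNReal.div_le_of_le_mul (le_mul_of_one_le_right' (by simpa using hpq.lt.le))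
  · exact ENNReal.div_le_of_le_mul (le_mul_of_one_le_right' (by simpa using hpq.symm.lt.le))

namespace PartitionTree

variable {X ι : Type*} [MeasurableSpace X] {t : PartitionTree X ι} [Countable ι]
variable {σ ω : Measure X} [IsFiniteMeasure σ] [IsFiniteMeasure ω] {γ : ℕ → ℝ≥0∞}

open Classical

lemma lintegral_adapted_mul_avg {k : ℕ} {a : X → ℝ≥0∞} (ha : t.Adapted k a) {h : X → ℝ≥0∞}
    (hh : Measurable h) : ∫⁻ x, a x * h x ∂ω = ∫⁻ x, a x * t.avg ω h k x ∂ω := by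
  have key : ∀ x, ∫⁻ y in t.cell k x, a y * h y ∂ω =
      ∫⁻ y in t.cell k x, a y * t.avg ω h k y ∂ω := fun x => by
    rw [setLIntegral_adapted_mul ha hh, setLIntegral_adapted_mul ha
      (adapted_avg ω h k).measurable, setLIntegral_adapted (adapted_avg ω h k), avg_mul_measure]
  exact le_antisymm (lintegral_le_of_cells (t := t) k fun x => (key x).le)
    (lintegral_le_of_cells (t := t) k fun x => (key x).ge)

section NextStop

variable {bad : ℕ → ℕ → X → Prop}

/-- The generation `j + 1` is the first stopping generation after `m`. -/
def NextStop (bad : ℕ → ℕ → X → Prop) (m j : ℕ) (x : X) : Prop :=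
  IsStop bad (j + 1) x ∧ lastStop bad j x = m

/-- The stopping generation `m` is the last one. -/
def FinalStop (bad : ℕ → ℕ → X → Prop) (m : ℕ) (x : X) : Prop :=
  IsStop bad m x ∧ ∀ j, ¬ NextStop bad m j x

omit [MeasurableSpace X] in
lemma NextStop.eq {m i j : ℕ} {x : X} (hi : NextStop bad m i x) (hj : NextStop bad m j x) :
    i = j := by
  have key : ∀ {i j : ℕ}, NextStop bad m i x → NextStop bad m j x → ¬ i < j := by
    intro i j hi hj hlt
    have h1 := le_lastStop hi.1 (Nat.succ_le_of_lt hlt)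
    have h2 := lastStop_le (bad := bad) i x
    rw [hj.2] at h1
    rw [hi.2] at h2
    omega
  exact le_antisymm (not_lt.mp (key hj hi)) (not_lt.mp (key hi hj))

omit [MeasurableSpace X] in
lemma exists_nextStop {m k : ℕ} {x : X} (hm : IsStop bad m x) (hk : IsStop bad k x) (h : m < k) :
    ∃ j, NextStop bad m j x := by
  by_contra! hno
  have : ∀ i, m ≤ i → lastStop bad i x = m := by
    intro i hi
    induction i, hi using Nat.le_induction with
    | base => exact hm
    | succ i _ ih =>
      by_cases hb : bad (lastStop bad i x) (i + 1) x
      · exact absurd ⟨isStop_succ_iff.mpr hb, ih⟩ (hno i)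
      · rw [lastStop_succ_of_not_bad hb, ih]
  have h1 := this k h.le
  rw [hk] at h1
  omega

omit [MeasurableSpace X] in
lemma FinalStop.eq {m k : ℕ} {x : X} (hm : FinalStop bad m x) (hk : FinalStop bad k x) :
    m = k := by
  have key : ∀ {m k : ℕ}, FinalStop bad m x → FinalStop bad k x → ¬ m < k := by
    intro m k hm hk hlt
    obtain ⟨j, hj⟩ := exists_nextStop hm.1 hk.1 hlt
    exact hm.2 j hj
  exact le_antisymm (not_lt.mp (key hk hm)) (not_lt.mp (key hm hk))

omit [Countable ι] in
lemma adapted_nextStop (hbad : ∀ j k, j ≤ k → t.Adapted k (bad j k)) (m j : ℕ) :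
    t.Adapted (j + 1) (NextStop bad m j) := fun x y h => by
  simp only [NextStop, adapted_isStop hbad (j + 1) x y h,
    (adapted_lastStop hbad j).mono (Nat.le_succ j) x y h]

lemma measurableSet_finalStop (hbad : ∀ j k, j ≤ k → t.Adapted k (bad j k)) (m : ℕ) :
    MeasurableSet {x | FinalStop bad m x} := by
  have : {x | FinalStop bad m x} = {x | IsStop bad m x} ∩ ⋂ j, {x | NextStop bad m j x}ᶜ := by
    ext x; simp [FinalStop]
  rw [this]
  exact (adapted_isStop hbad m).measurableSet.inter
    (MeasurableSet.iInter fun j => (adapted_nextStop hbad m j).measurableSet.compl)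

variable (t) in
/-- The function `h`, averaged over the cell of the first stopping generation after `m`. -/
noncomputable def nextAvg (bad : ℕ → ℕ → X → Prop) (ω : Measure X) (h : X → ℝ≥0∞) (m : ℕ)
    (x : X) : ℝ≥0∞ :=
  (if FinalStop bad m x then h x else 0) +
    ∑' j, if NextStop bad m j x then t.avg ω h (j + 1) x else 0

omit [IsFiniteMeasure ω] in
lemma measurable_nextAvg (hbad : ∀ j k, j ≤ k → t.Adapted k (bad j k)) {h : X → ℝ≥0∞}
    (hh : Measurable h) (m : ℕ) : Measurable (t.nextAvg bad ω h m) := by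
  refine Measurable.add (Measurable.ite (measurableSet_finalStop hbad m) hh measurable_const)
    (Measurable.tsum fun j => ?_)
  exact Measurable.ite (adapted_nextStop hbad m j).measurableSet
    (adapted_avg ω h (j + 1)).measurable measurable_const

omit [Countable ι] [IsFiniteMeasure ω] in
/-- Only one of the terms defining `nextAvg` is nonzero. -/
lemma nextAvg_rpow {h : X → ℝ≥0∞} {s : ℝ} (hs : 0 < s) (m : ℕ) (x : X) :
    t.nextAvg bad ω h m x ^ s = (if FinalStop bad m x then h x ^ s else 0) +
      ∑' j, if NextStop bad m j x then t.avg ω h (j + 1) x ^ s else 0 := by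
  have hz : (0 : ℝ≥0∞) ^ s = 0 := ENNReal.zero_rpow_of_pos hs
  by_cases hN : ∃ j, NextStop bad m j x
  · obtain ⟨j, hj⟩ := hN
    have hF : ¬ FinalStop bad m x := fun h => h.2 j hj
    have hne : ∀ i, i ≠ j → ¬ NextStop bad m i x := fun i hi h => hi (h.eq hj)
    rw [nextAvg, if_neg hF, if_neg hF, tsum_eq_single j fun i hi => if_neg (hne i hi),
      tsum_eq_single j fun i hi => if_neg (hne i hi), if_pos hj, if_pos hj, zero_add, zero_add]
  · push Not at hN
    simp only [nextAvg, hN, if_false, tsum_zero, add_zero]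
    split_ifs <;> simp [hz]

/-- Before the next stopping generation, `h` may be replaced by `nextAvg`. -/
lemma lintegral_mul_le_nextAvg (hbad : ∀ j k, j ≤ k → t.Adapted k (bad j k)) {h : X → ℝ≥0∞}
    (hh : Measurable h) {k m : ℕ} {a : X → ℝ≥0∞} (ha : t.Adapted k a)
    (ham : ∀ x, a x ≠ 0 → lastStop bad k x = m) :
    ∫⁻ x, a x * h x ∂ω ≤ ∫⁻ x, a x * t.nextAvg bad ω h m x ∂ω := by
  have hb : ∀ j, t.Adapted (j + 1) fun x => if NextStop bad m j x then a x else 0 := by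
    intro j x y hxy
    have h1 := adapted_nextStop hbad m j x y hxy
    simp only [h1]
    by_cases hP : NextStop bad m j y
    · rw [if_pos hP, if_pos hP]
      rcases le_or_gt k (j + 1) with hk | hk
      · exact ha.mono hk x y hxy
      · have key : ∀ z, NextStop bad m j z → a z = 0 := by
          intro z hz
          by_contra h0
          have h2 := le_lastStop hz.1 hk.le
          have h3 := lastStop_le (bad := bad) j z
          rw [ham z h0] at h2
          rw [hz.2] at h3
          omega
        rw [key y hP, key x (h1.mpr hP)]
    · rw [if_neg hP, if_neg hP]
  have hF : Measurable fun x => if FinalStop bad m x then a x * h x else 0 :=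
    Measurable.ite (measurableSet_finalStop hbad m) (ha.measurable.mul hh) measurable_const
  calc ∫⁻ x, a x * h x ∂ω ≤ ∫⁻ x, (if FinalStop bad m x then a x * h x else 0) +
        ∑' j, (if NextStop bad m j x then a x else 0) * h x ∂ω := by
        refine lintegral_mono fun x => ?_
        by_cases h0 : a x = 0
        · simp [h0]
        have hm : IsStop bad m x := by
          have := isStop_lastStop (bad := bad) k x
          rwa [ham x h0] at this
        by_cases hN : ∃ j, NextStop bad m j x
        · obtain ⟨j, hj⟩ := hN
          refine le_add_left ?_
          refine le_trans ?_ (ENNReal.le_tsum j)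
          rw [if_pos hj]
        · rw [if_pos ⟨hm, not_exists.mp hN⟩]
          exact le_self_add
    _ = ∫⁻ x, (if FinalStop bad m x then a x * h x else 0) ∂ω +
        ∑' j, ∫⁻ x, (if NextStop bad m j x then a x else 0) * h x ∂ω := by
        rw [lintegral_add_left hF, lintegral_tsum fun j =>
          ((hb j).measurable.fun_mul hh).aemeasurable]
    _ = ∫⁻ x, (if FinalStop bad m x then a x * h x else 0) ∂ω +
        ∑' j, ∫⁻ x, (if NextStop bad m j x then a x else 0) * t.avg ω h (j + 1) x ∂ω := by
        congr 1
        exact tsum_congr fun j => lintegral_adapted_mul_avg (hb j) hh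
    _ = _ := by
        rw [← lintegral_tsum fun j =>
          ((hb j).measurable.fun_mul (adapted_avg ω h (j + 1)).measurable).aemeasurable,
          ← lintegral_add_left hF]
        refine lintegral_congr fun x => ?_
        rw [nextAvg, mul_add, ← ENNReal.tsum_mul_left]
        congr 1
        · split_ifs <;> simp
        · refine tsum_congr fun j => ?_
          split_ifs <;> simp

omit [IsFiniteMeasure ω] in
lemma tsum_lintegral_nextAvg_rpow_le (hbad : ∀ j k, j ≤ k → t.Adapted k (bad j k))
    {h : X → ℝ≥0∞} (hh : Measurable h) {s : ℝ} (hs : 0 < s) :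
    ∑' m, ∫⁻ x, t.nextAvg bad ω h m x ^ s ∂ω ≤ ∫⁻ x, h x ^ s ∂ω +
      ∑' j, ∫⁻ x, (if IsStop bad (j + 1) x then t.avg ω h (j + 1) x ^ s else 0) ∂ω := by
  rw [← lintegral_tsum fun m => ((measurable_nextAvg hbad hh m).pow_const s).aemeasurable,
    ← lintegral_tsum, ← lintegral_add_left (hh.pow_const s)]
  · refine lintegral_mono fun x => ?_
    simp_rw [nextAvg_rpow hs]
    rw [ENNReal.tsum_add]
    refine add_le_add ?_ ?_
    · by_cases hF : ∃ m, FinalStop bad m x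
      · obtain ⟨m, hm⟩ := hF
        rw [tsum_eq_single m fun i hi => if_neg fun h => hi (h.eq hm), if_pos hm]
      · push Not at hF
        simp [hF]
    · rw [ENNReal.tsum_comm]
      refine ENNReal.tsum_le_tsum fun j => ?_
      rw [tsum_eq_single (lastStop bad j x) fun m hm => if_neg fun h => hm h.2.symm]
      by_cases hj : IsStop bad (j + 1) x
      · rw [if_pos ⟨hj, rfl⟩, if_pos hj]
      · rw [if_neg fun h => hj h.1]; exact zero_le
  · intro j
    exact (Measurable.ite (adapted_isStop hbad (j + 1)).measurableSet
      ((adapted_avg ω h (j + 1)).measurable.pow_const s) measurable_const).aemeasurable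

end NextStop

/-- One half of the bilinear form of a dyadic fractional integral: the cells on which `f`
dominates `h`. The cells are grouped by the principal cells of `f`; there the averages of `f` are
pulled out, and what is left is the tail, which the testing condition controls, against the
function `nextAvg`, whose `L^s` norm is controlled because `f` dominates `h` on principal cells. -/
lemma tsum_lintegral_term_mul_le {A : ℕ → X → Prop} (hA : ∀ k, t.Adapted k (A k))
    {p p' q s : ℝ} (hp : p.HolderConjugate p') (hq : q.HolderConjugate s) (hpq : p ≤ q)
    {f h : X → ℝ≥0∞} (hf : Measurable f) (hh : Measurable h) (hf1 : ∫⁻ x, f x ^ p ∂σ ≤ 1)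
    (hh1 : ∫⁻ x, h x ^ s ∂ω ≤ 1)
    (hcl : ∀ k x, A k x →
      t.avg ω h k x ^ s * ω (t.cell k x) ≤ t.avg σ f k x ^ p * σ (t.cell k x))
    {T : ℝ≥0∞}
    (htest : ∀ k x, (∫⁻ y in t.cell k x, t.tail γ σ k y ^ q ∂ω) ^ (1 / q) ≤
      T * σ (t.cell k x) ^ (1 / p)) :
    ∑' k, ∫⁻ x, (if A k x then t.term γ σ f k x else 0) * h x ∂ω ≤
      2 * T * (principalConst p + (1 + principalConst p) ^ (p' / s)) := by
  have hp0 : 0 < p := hp.pos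
  have hs0 : 0 < s := hq.symm.pos
  set M := principalConst p with hM
  set v : ℕ → X → ℝ≥0∞ := fun k x => if A k x then t.avg σ f k x else 0 with hvdef
  have hv : ∀ k, t.Adapted k (v k) := fun k x y hxy => by
    simp only [hvdef, hA k x y hxy, adapted_avg σ f k x y hxy]
  have hvf : ∀ k x, v k x ≤ t.avg σ f k x := fun k x => by
    simp only [hvdef]; split_ifs <;> simp
  have hbad := adapted_doubled hv
  set g := t.nextAvg (Doubled v) ω h with hg
  have hgm : ∀ m, Measurable (g m) := measurable_nextAvg hbad hh
  have hgens : ∑' k, ∫⁻ x, (if IsStop (Doubled v) k x then v k x ^ p else 0) ∂σ ≤ M :=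
    (tsum_lintegral_isStop_le hv hf hvf hp.lt).trans (mul_le_of_le_one_right' hf1)
  have hvp : ∀ m, t.Adapted m fun x => if IsStop (Doubled v) m x then v m x ^ p else 0 :=
    fun m x y hxy => by simp only [adapted_isStop hbad m x y hxy, hv m x y hxy]
  -- the `L^s` norms of the functions `g m` sum up
  have hgs : ∑' m, ∫⁻ x, g m x ^ s ∂ω ≤ 1 + M := by
    refine (tsum_lintegral_nextAvg_rpow_le hbad hh hs0).trans (add_le_add hh1 (le_trans ?_ hgens))
    refine le_trans (ENNReal.tsum_le_tsum (g := fun j => ∫⁻ x, (if IsStop (Doubled v) (j + 1) x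
      then v (j + 1) x ^ p else 0) ∂σ) fun j => ?_) ?_
    · refine lintegral_le_of_cells (t := t) (j + 1) fun x => ?_
      rw [setLIntegral_adapted (hvp (j + 1)), setLIntegral_adapted (fun y z hyz => by
        simp only [adapted_isStop hbad (j + 1) y z hyz, adapted_avg ω h (j + 1) y z hyz])]
      by_cases hj : IsStop (Doubled v) (j + 1) x
      · rw [if_pos hj, if_pos hj]
        have hlt : 0 < v (j + 1) x := zero_le.trans_lt (isStop_succ_iff.mp hj)
        have hAj : A (j + 1) x := by
          by_contra hn
          simp [hvdef, hn] at hlt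
        refine (hcl _ _ hAj).trans (le_of_eq ?_)
        simp only [hvdef, if_pos hAj]
      · simp [hj]
    · exact ENNReal.tsum_comp_le_tsum_of_injective (add_left_injective 1) _
  have hterm : ∀ k, t.Adapted k fun x => if A k x then t.term γ σ f k x else 0 :=
    fun k x y hxy => by simp only [hA k x y hxy, adapted_term γ f k x y hxy]
  have hterm' : ∀ k m, t.Adapted k fun x => if lastStop (Doubled v) k x = m then
      (if A k x then t.term γ σ f k x else 0) else 0 :=
    fun k m x y hxy => by simp only [adapted_lastStop hbad k x y hxy, hterm k x y hxy]
  -- grouping the cells by their principal cell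
  have h1 : ∑' k, ∫⁻ x, (if A k x then t.term γ σ f k x else 0) * h x ∂ω ≤
      ∑' m, ∫⁻ x, (if IsStop (Doubled v) m x then 2 * v m x else 0) *
        (t.tail γ σ m x * g m x) ∂ω := by
    calc _ = ∑' k, ∑' m, ∫⁻ x, (if lastStop (Doubled v) k x = m then
          (if A k x then t.term γ σ f k x else 0) else 0) * h x ∂ω := by
          refine tsum_congr fun k => ?_
          rw [← lintegral_tsum fun m => ((hterm' k m).measurable.fun_mul hh).aemeasurable]
          refine lintegral_congr fun x => ?_
          rw [ENNReal.tsum_mul_right, tsum_eq_single (lastStop (Doubled v) k x)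
            fun m hm => if_neg hm.symm, if_pos rfl]
      _ ≤ ∑' k, ∑' m, ∫⁻ x, (if lastStop (Doubled v) k x = m then
          (if A k x then t.term γ σ f k x else 0) else 0) * g m x ∂ω := by
          refine ENNReal.tsum_le_tsum fun k => ENNReal.tsum_le_tsum fun m => ?_
          refine lintegral_mul_le_nextAvg hbad hh (hterm' k m) fun x hx => ?_
          by_contra hn
          exact hx (if_neg hn)
      _ = ∑' m, ∫⁻ x, (∑' k, if lastStop (Doubled v) k x = m then
          (if A k x then t.term γ σ f k x else 0) else 0) * g m x ∂ω := by
          rw [ENNReal.tsum_comm]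
          refine tsum_congr fun m => ?_
          rw [← lintegral_tsum fun k => ((hterm' k m).measurable.fun_mul (hgm m)).aemeasurable]
          exact lintegral_congr fun x => ENNReal.tsum_mul_right
      _ ≤ _ := by
          refine ENNReal.tsum_le_tsum fun m => lintegral_mono fun x => ?_
          rw [← mul_assoc]
          refine mul_le_mul' ?_ le_rfl
          rw [ENNReal.tsum_eq_sum_range_add_tsum _ m, Finset.sum_eq_zero, zero_add, tail,
            ← ENNReal.tsum_mul_left]
          · refine ENNReal.tsum_le_tsum fun j => ?_
            by_cases hl : lastStop (Doubled v) (m + j) x = m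
            · have hm : IsStop (Doubled v) m x := by
                have := isStop_lastStop (bad := Doubled v) (m + j) x
                rwa [hl] at this
              rw [if_pos hl, if_pos hm]
              split_ifs with hAk
              · have h2 := le_two_mul_lastStop v (m + j) x
                rw [hl] at h2
                have h3 : v (m + j) x = t.avg σ f (m + j) x := if_pos hAk
                rw [term, ← avg_mul_measure, ← h3]
                calc _ = v (m + j) x * (γ (m + j) * σ (t.cell (m + j) x)) := by ring
                  _ ≤ _ := mul_le_mul' h2 le_rfl
              · exact zero_le
            · rw [if_neg hl]; exact zero_le
          · intro k hk
            rw [if_neg]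
            intro hl
            have := lastStop_le (bad := Doubled v) k x
            rw [Finset.mem_range] at hk
            omega
  refine h1.trans ?_
  -- Hölder's inequality on every principal cell
  have hθ : 1 ≤ p' / s := by
    rw [le_div_iff₀ hs0, one_mul, hp.conjugate_eq, hq.conjugate_eq,
      div_le_div_iff₀ (by linarith [hq.lt]) (by linarith [hp.lt])]
    nlinarith
  -- as `p' ≥ s`, the power `p' / s` of the integrals of `g m` is summable; the powers beyond the
  -- first one are absorbed into the constant `H`
  set H := (1 + M) ^ (p' / s - 1) with hH
  have h2 : ∀ m, ∫⁻ x, (if IsStop (Doubled v) m x then 2 * v m x else 0) *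
      (t.tail γ σ m x * g m x) ∂ω ≤ 2 * T * (∫⁻ x, (if IsStop (Doubled v) m x then v m x ^ p
        else 0) ∂σ + H * ∫⁻ x, g m x ^ s ∂ω) := by
    intro m
    set μ : Measure X := (2 * T) • (σ.withDensity (fun x => if IsStop (Doubled v) m x then v m x ^ p
        else 0) + H • ω.withDensity fun x => g m x ^ s) with hμ
    have hμR : ∀ R, MeasurableSet R → ∫⁻ x in R, 1 ∂μ = 2 * T * (∫⁻ x in R,
        (if IsStop (Doubled v) m x then v m x ^ p else 0) ∂σ + H * ∫⁻ x in R, g m x ^ s ∂ω) := by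
      intro R hR
      rw [setLIntegral_one, hμ]
      simp only [Measure.smul_apply, Measure.add_apply, smul_eq_mul, withDensity_apply _ hR]
    have hv2 : t.Adapted m fun y => if IsStop (Doubled v) m y then 2 * v m y else 0 :=
      fun y z hyz => by simp only [adapted_isStop hbad m y z hyz, hv m y z hyz]
    have : ∀ x, ∫⁻ y in t.cell m x, (if IsStop (Doubled v) m y then 2 * v m y else 0) *
        (t.tail γ σ m y * g m y) ∂ω ≤ ∫⁻ y in t.cell m x, 1 ∂μ := by
      intro x
      rw [hμR _ (measurableSet_cell m x), setLIntegral_adapted_mul hv2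
        ((measurable_tail γ σ m).fun_mul (hgm m)), setLIntegral_adapted (hvp m)]
      by_cases hm : IsStop (Doubled v) m x
      swap
      · simp [hm]
      rw [if_pos hm, if_pos hm]
      set R := t.cell m x
      set G := ∫⁻ y in R, g m y ^ s ∂ω with hG
      calc 2 * v m x * ∫⁻ y in R, t.tail γ σ m y * g m y ∂ω
          ≤ 2 * v m x * ((∫⁻ y in R, t.tail γ σ m y ^ q ∂ω) ^ (1 / q) * G ^ (1 / s)) := by
            refine mul_le_mul' le_rfl ?_
            exact ENNReal.lintegral_mul_le_Lp_mul_Lq _ hq (measurable_tail γ σ m).aemeasurable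
              (hgm m).aemeasurable
        _ ≤ 2 * v m x * (T * σ R ^ (1 / p) * G ^ (1 / s)) :=
            mul_le_mul' le_rfl (mul_le_mul' (htest m x) le_rfl)
        _ = 2 * T * ((v m x * σ R ^ (1 / p)) * G ^ (1 / s)) := by ring
        _ ≤ 2 * T * ((v m x * σ R ^ (1 / p)) ^ p + (G ^ (1 / s)) ^ p') :=
            mul_le_mul' le_rfl (ENNReal.mul_le_rpow_add_rpow _ _ hp)
        _ ≤ _ := by
            refine mul_le_mul' le_rfl (add_le_add (le_of_eq ?_) ?_)
            · rw [ENNReal.mul_rpow_of_nonneg _ _ hp0.le, ← ENNReal.rpow_mul,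
                one_div_mul_cancel hp0.ne', ENNReal.rpow_one]
            · rw [← ENNReal.rpow_mul, show 1 / s * p' = p' / s by ring]
              refine (setLIntegral_rpow_le ω (fun y => g m y ^ s) R hθ).trans ?_
              refine mul_le_mul' (ENNReal.rpow_le_rpow ?_ (by linarith)) le_rfl
              exact (ENNReal.le_tsum m).trans hgs
    have h3 := lintegral_le_of_cells (t := t) m this
    have h4 := hμR univ MeasurableSet.univ
    simp only [Measure.restrict_univ] at h4
    rwa [h4] at h3
  calc _ ≤ ∑' m, 2 * T * (∫⁻ x, (if IsStop (Doubled v) m x then v m x ^ p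
        else 0) ∂σ + H * ∫⁻ x, g m x ^ s ∂ω) := ENNReal.tsum_le_tsum h2
    _ = 2 * T * (∑' m, ∫⁻ x, (if IsStop (Doubled v) m x then v m x ^ p
        else 0) ∂σ + H * ∑' m, ∫⁻ x, g m x ^ s ∂ω) := by
        rw [ENNReal.tsum_mul_left, ENNReal.tsum_add, ENNReal.tsum_mul_left]
    _ ≤ 2 * T * (M + H * (1 + M)) :=
        mul_le_mul' le_rfl (add_le_add hgens (mul_le_mul' le_rfl hgs))
    _ = _ := by
        rw [hH, ENNReal.rpow_sub_one_mul]
        · exact (zero_lt_one.trans_le le_self_add).ne'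
        · exact ENNReal.add_ne_top.mpr ⟨by simp, principalConst_ne_top p⟩

/-- The bilinear form of a dyadic fractional integral is controlled by the two testing
constants. -/
theorem tsum_lintegral_term_mul_le_of_testing {p p' q s : ℝ} (hp : p.HolderConjugate p')
    (hq : q.HolderConjugate s) (hpq : p ≤ q) {f h : X → ℝ≥0∞} (hf : Measurable f)
    (hh : Measurable h) (hf1 : ∫⁻ x, f x ^ p ∂σ ≤ 1) (hh1 : ∫⁻ x, h x ^ s ∂ω ≤ 1) {T T' : ℝ≥0∞}
    (htest : ∀ k x, (∫⁻ y in t.cell k x, t.tail γ σ k y ^ q ∂ω) ^ (1 / q) ≤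
      T * σ (t.cell k x) ^ (1 / p))
    (htest' : ∀ k x, (∫⁻ y in t.cell k x, t.tail γ ω k y ^ p' ∂σ) ^ (1 / p') ≤
      T' * ω (t.cell k x) ^ (1 / s)) :
    ∫⁻ x, (∑' k, t.term γ σ f k x) * h x ∂ω ≤
      2 * T * (principalConst p + (1 + principalConst p) ^ (p' / s)) +
        2 * T' * (principalConst s + (1 + principalConst s) ^ (q / p)) := by
  obtain ⟨A, hAdef⟩ : ∃ A : ℕ → X → Prop, ∀ k x, A k x =
      (t.avg ω h k x ^ s * ω (t.cell k x) ≤ t.avg σ f k x ^ p * σ (t.cell k x)) :=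
    ⟨_, fun _ _ => rfl⟩
  have hA : ∀ k, t.Adapted k (A k) := fun k x y hxy => by
    simp only [hAdef, adapted_avg ω h k x y hxy, adapted_avg σ f k x y hxy, cell_eq hxy]
  obtain ⟨B, hB⟩ : ∃ B : ℕ → X → Prop, ∀ k x, B k x = ¬ A k x := ⟨_, fun _ _ => rfl⟩
  have hA' : ∀ k, t.Adapted k (B k) := fun k x y hxy => by simp only [hB, hA k x y hxy]
  have hsp : s ≤ p' := by
    rw [hp.conjugate_eq, hq.conjugate_eq,
      div_le_div_iff₀ (by linarith [hq.lt]) (by linarith [hp.lt])]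
    nlinarith
  have hT : ∀ k, t.Adapted k fun x => if A k x then t.term γ σ f k x else 0 := fun k x y hxy => by
    simp only [hA k x y hxy, adapted_term γ f k x y hxy]
  have hT' : ∀ k, t.Adapted k fun x => if B k x then t.term γ σ f k x else 0 :=
    fun k x y hxy => by simp only [hA' k x y hxy, adapted_term γ f k x y hxy]
  have hT'' : ∀ k, t.Adapted k fun x => if B k x then t.term γ ω h k x else 0 :=
    fun k x y hxy => by simp only [hA' k x y hxy, adapted_term γ h k x y hxy]
  have hsplit : ∫⁻ x, (∑' k, t.term γ σ f k x) * h x ∂ω =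
      ∑' k, ∫⁻ x, (if A k x then t.term γ σ f k x else 0) * h x ∂ω +
        ∑' k, ∫⁻ x, (if B k x then t.term γ σ f k x else 0) * h x ∂ω := by
    rw [← ENNReal.tsum_add]
    simp_rw [← ENNReal.tsum_mul_right]
    rw [lintegral_tsum fun k => ((adapted_term γ f k).measurable.fun_mul hh).aemeasurable]
    refine tsum_congr fun k => ?_
    rw [← lintegral_add_left ((hT k).measurable.fun_mul hh)]
    refine lintegral_congr fun x => ?_
    by_cases hk : A k x <;> simp [hB, hk]
  rw [hsplit]
  refine add_le_add (tsum_lintegral_term_mul_le hA hp hq hpq hf hh hf1 hh1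
    (fun k x hk => (hAdef k x).mp hk) htest) ?_
  refine le_trans ?_ (tsum_lintegral_term_mul_le (γ := γ) hA' hq.symm hp.symm hsp hh hf hh1 hf1
    (fun k x hk => (not_le.mp ((hAdef k x) ▸ (hB k x) ▸ hk)).le) htest')
  refine ENNReal.tsum_le_tsum fun k => lintegral_le_of_cells (t := t) k fun x => ?_
  rw [setLIntegral_adapted_mul (hT' k) hh, setLIntegral_adapted_mul (hT'' k) hf]
  split_ifs
  · exact le_of_eq (by rw [term, term]; ring)
  · simp

end PartitionTree

/-! ### Duality and strong type estimates -/

/-- The norm in `L^q` by duality. -/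
lemma MeasureTheory.lintegral_rpow_le_of_forall_mul {X : Type*} [MeasurableSpace X] {ω : Measure X}
    [IsFiniteMeasure ω] {q s : ℝ} (hq : q.HolderConjugate s) {F : X → ℝ≥0∞} (hF : Measurable F)
    {B : ℝ≥0∞}
    (h : ∀ h : X → ℝ≥0∞, Measurable h → ∫⁻ x, h x ^ s ∂ω ≤ 1 → ∫⁻ x, F x * h x ∂ω ≤ B) :
    (∫⁻ x, F x ^ q ∂ω) ^ (1 / q) ≤ B := by
  have hq0 : 0 < q := hq.pos
  have hs0 : 0 < s := hq.symm.pos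
  have hFm : ∀ N : ℕ, Measurable fun x => min (F x) N := fun N => hF.min measurable_const
  -- the truncations have finite norm, so that the extremal function `c F ^ (q - 1)` is available
  have htr : ∀ N : ℕ, ∫⁻ x, min (F x) N ^ q ∂ω ≤ B ^ q := by
    intro N
    set I := ∫⁻ x, min (F x) N ^ q ∂ω with hI
    rcases eq_or_ne I 0 with h0 | h0
    · rw [h0]; exact zero_le
    have hIt : I ≠ ∞ := by
      refine ((lintegral_mono fun x => ENNReal.rpow_le_rpow (min_le_right (F x) (N : ℝ≥0∞))
        hq0.le).trans_lt ?_).ne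
      rw [lintegral_const]
      exact ENNReal.mul_lt_top (ENNReal.rpow_lt_top_of_nonneg hq0.le (by simp))
        (measure_lt_top _ _)
    set c : ℝ≥0∞ := I ^ (-(1 / s)) with hc
    have hct : c ≠ ∞ := by simp [hc, ENNReal.rpow_eq_top_iff, h0, hIt]
    have e1 : (q - 1) * s = q := by rw [hq.sub_one_mul_conj]
    have hmh : Measurable fun x => c * min (F x) N ^ (q - 1) :=
      ((hFm N).pow_const _).const_mul _
    have key := h (fun x => c * min (F x) N ^ (q - 1)) hmh ?_
    · have h2 : c * I ≤ B := by
        refine le_trans ?_ key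
        rw [hI, ← lintegral_const_mul _ ((hFm N).pow_const q)]
        refine lintegral_mono fun x => ?_
        calc c * min (F x) N ^ q ≤ c * (min (F x) N ^ (q - 1) * min (F x) N) := by
              rcases eq_or_ne (min (F x) (N : ℝ≥0∞)) 0 with hm | hm
              · simp [hm, hq0]
              · rw [ENNReal.rpow_sub_one_mul hm
                  ((min_le_right _ _).trans_lt (ENNReal.natCast_lt_top N)).ne]
          _ ≤ c * (min (F x) N ^ (q - 1) * F x) :=
              mul_le_mul' le_rfl (mul_le_mul' le_rfl (min_le_left _ _))
          _ = _ := by ring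
      have h3 : c * I = I ^ (1 / q) := by
        conv_lhs => rw [hc, ← ENNReal.rpow_one I, ← ENNReal.rpow_mul, one_mul,
          ← ENNReal.rpow_add _ _ h0 hIt]
        congr 1
        have := hq.inv_add_inv_eq_one
        rw [one_div, one_div]; linarith
      rw [h3] at h2
      calc I = (I ^ (1 / q)) ^ q := by
            rw [← ENNReal.rpow_mul, one_div_mul_cancel hq0.ne', ENNReal.rpow_one]
        _ ≤ _ := ENNReal.rpow_le_rpow h2 hq0.le
    · have : ∀ x, (c * min (F x) N ^ (q - 1)) ^ s = c ^ s * min (F x) N ^ q := fun x => by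
        rw [ENNReal.mul_rpow_of_nonneg _ _ hs0.le, ← ENNReal.rpow_mul (min (F x) N), e1]
      simp_rw [this]
      rw [lintegral_const_mul _ ((hFm N).pow_const q), ← hI, hc, ← ENNReal.rpow_mul,
        show -(1 / s) * s = -1 by field_simp, ENNReal.rpow_neg_one, ENNReal.inv_mul_cancel h0 hIt]
  have hsup : ∫⁻ x, F x ^ q ∂ω = ⨆ N : ℕ, ∫⁻ x, min (F x) N ^ q ∂ω := by
    rw [← lintegral_iSup fun N => (hFm N).pow_const q]
    · refine lintegral_congr fun x => ?_
      have h1 : F x = ⨆ N : ℕ, min (F x) (N : ℝ≥0∞) := by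
        have := inf_iSup_eq (F x) (fun N : ℕ => (N : ℝ≥0∞))
        rw [ENNReal.iSup_natCast, inf_top_eq] at this
        exact this
      have h2 := (ENNReal.orderIsoRpow q hq0).map_iSup fun N : ℕ => min (F x) (N : ℝ≥0∞)
      rw [← h1] at h2
      exact h2
    · intro M N hMN x
      exact ENNReal.rpow_le_rpow (min_le_min le_rfl (by exact_mod_cast hMN)) hq0.le
  rw [hsup]
  calc _ ≤ (B ^ q) ^ (1 / q) := ENNReal.rpow_le_rpow (iSup_le htr) (by positivity)
    _ = B := by rw [← ENNReal.rpow_mul, mul_one_div_cancel hq0.ne', ENNReal.rpow_one]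

namespace PartitionTree

variable {X ι : Type*} [MeasurableSpace X] {t : PartitionTree X ι} [Countable ι]
variable {σ ω : Measure X} [IsFiniteMeasure σ] [IsFiniteMeasure ω] {γ : ℕ → ℝ≥0∞}

open Classical

omit [IsFiniteMeasure σ] in
/-- A bound for the bilinear form on unit balls gives a strong type estimate. -/
lemma strongType_of_bilinear {st : ℕ → X → Prop} (hst : ∀ k, t.Adapted k (st k)) {p q s : ℝ}
    (hp : 0 < p) (hq : q.HolderConjugate s) {B : ℝ≥0∞}
    (hB : ∀ f h : X → ℝ≥0∞, Measurable f → Measurable h → ∫⁻ x, f x ^ p ∂σ ≤ 1 →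
      ∫⁻ x, h x ^ s ∂ω ≤ 1 →
      ∫⁻ x, (∑' k, if st k x then t.term γ σ f k x else 0) * h x ∂ω ≤ B)
    {f : X → ℝ≥0∞} (hf : Measurable f) (hft : ∫⁻ x, f x ^ p ∂σ ≠ ∞) :
    (∫⁻ x, (∑' k, if st k x then t.term γ σ f k x else 0) ^ q ∂ω) ^ (1 / q) ≤
      B * (∫⁻ x, f x ^ p ∂σ) ^ (1 / p) := by
  set I := ∫⁻ x, f x ^ p ∂σ with hI
  have hq0 : 0 < q := hq.pos
  have hm : ∀ f : X → ℝ≥0∞, Measurable fun x => ∑' k, if st k x then t.term γ σ f k x else 0 :=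
    fun f => Measurable.tsum fun k => Measurable.ite (hst k).measurableSet
      (adapted_term γ f k).measurable measurable_const
  rcases eq_or_ne I 0 with h0 | h0
  · have hf0 : f =ᵐ[σ] 0 := by
      rw [hI, lintegral_eq_zero_iff (hf.pow_const p)] at h0
      filter_upwards [h0] with x hx
      simpa [hp, hp.not_gt] using hx
    have : ∀ k x, t.term γ σ f k x = 0 := fun k x => by
      rw [term, lintegral_congr_ae (ae_restrict_of_ae hf0)]; simp
    simp [this, hq0]
  set c : ℝ≥0∞ := I ^ (1 / p) with hc
  have hc0 : c ≠ 0 := by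
    have : ¬ p < 0 := hp.not_gt
    simp [hc, h0, hft, hp, this]
  have hct : c ≠ ∞ := ENNReal.rpow_ne_top_of_nonneg (by positivity) hft
  have hfc : Measurable fun x => c⁻¹ * f x := hf.const_mul _
  have key := lintegral_rpow_le_of_forall_mul (ω := ω) hq (hm fun x => c⁻¹ * f x)
    (fun h hh hh1 => hB _ h hfc hh ?_ hh1)
  · have hscale : ∀ x, (∑' k, if st k x then t.term γ σ f k x else 0) =
        c * ∑' k, if st k x then t.term γ σ (fun x => c⁻¹ * f x) k x else 0 := by
      intro x
      rw [← ENNReal.tsum_mul_left]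
      refine tsum_congr fun k => ?_
      split_ifs
      · rw [term, term, lintegral_const_mul _ hf]
        calc _ = (c * c⁻¹) * (γ k * ∫⁻ z in t.cell k x, f z ∂σ) := by
              rw [ENNReal.mul_inv_cancel hc0 hct, one_mul]
          _ = _ := by ring
      · simp
    simp_rw [hscale, ENNReal.mul_rpow_of_nonneg _ _ hq0.le]
    rw [lintegral_const_mul _ ((hm _).pow_const q), ENNReal.mul_rpow_of_nonneg _ _ (by positivity),
      ← ENNReal.rpow_mul, mul_one_div_cancel hq0.ne', ENNReal.rpow_one, mul_comm]
    exact mul_le_mul' key le_rfl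
  · simp_rw [ENNReal.mul_rpow_of_nonneg _ _ hp.le]
    rw [lintegral_const_mul _ (hf.pow_const p), ← hI, ENNReal.inv_rpow, hc, ← ENNReal.rpow_mul,
      one_div_mul_cancel hp.ne', ENNReal.rpow_one, ENNReal.inv_mul_cancel h0 hft]

/-- Strong type estimate for a dyadic fractional integral, from the two testing conditions. -/
theorem strongType_of_testing {p p' q s : ℝ} (hp : p.HolderConjugate p')
    (hq : q.HolderConjugate s) (hpq : p ≤ q) {T T' : ℝ≥0∞}
    (htest : ∀ k x, (∫⁻ y in t.cell k x, t.tail γ σ k y ^ q ∂ω) ^ (1 / q) ≤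
      T * σ (t.cell k x) ^ (1 / p))
    (htest' : ∀ k x, (∫⁻ y in t.cell k x, t.tail γ ω k y ^ p' ∂σ) ^ (1 / p') ≤
      T' * ω (t.cell k x) ^ (1 / s))
    {f : X → ℝ≥0∞} (hf : Measurable f) (hft : ∫⁻ x, f x ^ p ∂σ ≠ ∞) :
    (∫⁻ x, (∑' k, t.term γ σ f k x) ^ q ∂ω) ^ (1 / q) ≤
      (2 * T * (principalConst p + (1 + principalConst p) ^ (p' / s)) +
        2 * T' * (principalConst s + (1 + principalConst s) ^ (q / p))) *
        (∫⁻ x, f x ^ p ∂σ) ^ (1 / p) := by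
  have := strongType_of_bilinear (t := t) (σ := σ) (ω := ω) (γ := γ) (st := fun _ _ => True)
    (fun k x y _ => rfl) hp.pos hq (fun f h hf hh hf1 hh1 => by
      simp only [if_true]
      exact tsum_lintegral_term_mul_le_of_testing hp hq hpq hf hh hf1 hh1 htest htest') hf hft
  simpa only [if_true] using this

/-- Strong type estimate for sparse operators. The constants of the two Carleson families
enter through their geometric mean. -/
theorem strongType_sparse {st : ℕ → X → Prop} (hst : ∀ k, t.Adapted k (st k)) {p p' : ℝ}
    (hp : p.HolderConjugate p') {K B B' : ℝ≥0∞} (hB0 : B ≠ 0) (hB : B ≠ ∞) (hB0' : B' ≠ 0)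
    (hB' : B' ≠ ∞)
    (hchar : ∀ k x, γ k * σ (t.cell k x) ^ (1 / p') * ω (t.cell k x) ^ (1 / p) ≤ K)
    (hσ : ∀ k x, ∫⁻ y in t.cell k x, ∑' j, (if st (k + j) y then 1 else 0) ∂σ ≤
      B * σ (t.cell k x))
    (hω : ∀ k x, ∫⁻ y in t.cell k x, ∑' j, (if st (k + j) y then 1 else 0) ∂ω ≤
      B' * ω (t.cell k x))
    {f : X → ℝ≥0∞} (hf : Measurable f) (hft : ∫⁻ x, f x ^ p ∂σ ≠ ∞) :
    (∫⁻ x, (∑' k, if st k x then t.term γ σ f k x else 0) ^ p ∂ω) ^ (1 / p) ≤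
      (2 ^ p * principalConst p + 2 ^ p' * principalConst p') * (K * (B' ^ (1 / p') * B ^ (1 / p)))
        * (∫⁻ x, f x ^ p ∂σ) ^ (1 / p) := by
  have hp0 := hp.pos
  have hp0' := hp.symm.pos
  have hpp := hp.inv_add_inv_eq_one
  refine strongType_of_bilinear hst hp.pos hp (fun f h hf hh hf1 hh1 => ?_) hf hft
  -- the weight that balances the two terms of Young's inequality
  set l : ℝ≥0∞ := (B' * B⁻¹) ^ (1 / (p * p')) with hl
  have hBB0 : B' * B⁻¹ ≠ 0 := mul_ne_zero hB0' (ENNReal.inv_ne_zero.mpr hB)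
  have hBBt : B' * B⁻¹ ≠ ∞ := ENNReal.mul_ne_top hB' (ENNReal.inv_ne_top.mpr hB0)
  have hl0 : l ≠ 0 := (ENNReal.rpow_pos hBB0.bot_lt hBBt).ne'
  have hlt : l ≠ ∞ := ENNReal.rpow_ne_top_of_nonneg (by positivity) hBBt
  have hv := fun k => adapted_avg (t := t) σ f k
  have hw := fun k => adapted_avg (t := t) ω h k
  have hcell : ∀ k, ∫⁻ x, (if st k x then t.term γ σ f k x else 0) * h x ∂ω ≤
      K * (l ^ p * ∫⁻ x, (if st k x then t.avg σ f k x ^ p else 0) ∂σ +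
        l⁻¹ ^ p' * ∫⁻ x, (if st k x then t.avg ω h k x ^ p' else 0) ∂ω) := by
    intro k
    set μ : Measure X := K • (l ^ p • σ.withDensity (fun x => if st k x then t.avg σ f k x ^ p
      else 0) + l⁻¹ ^ p' • ω.withDensity fun x => if st k x then t.avg ω h k x ^ p' else 0) with hμ
    have hμR : ∀ R, MeasurableSet R → ∫⁻ x in R, 1 ∂μ =
        K * (l ^ p * ∫⁻ x in R, (if st k x then t.avg σ f k x ^ p else 0) ∂σ +
        l⁻¹ ^ p' * ∫⁻ x in R, (if st k x then t.avg ω h k x ^ p' else 0) ∂ω) := by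
      intro R hR
      rw [setLIntegral_one, hμ]
      simp only [Measure.smul_apply, Measure.add_apply, smul_eq_mul, withDensity_apply _ hR]
    have h1 : t.Adapted k fun x => if st k x then t.term γ σ f k x else 0 := fun y z hyz => by
      simp only [hst k y z hyz, adapted_term γ f k y z hyz]
    have h2 : t.Adapted k fun x => if st k x then t.avg σ f k x ^ p else 0 := fun y z hyz => by
      simp only [hst k y z hyz, hv k y z hyz]
    have h3 : t.Adapted k fun x => if st k x then t.avg ω h k x ^ p' else 0 := fun y z hyz => by
      simp only [hst k y z hyz, hw k y z hyz]
    have h4 := lintegral_le_of_cells (t := t) (ν := ω) (μ := μ)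
      (f := fun x => (if st k x then t.term γ σ f k x else 0) * h x) (g := fun _ => 1) k fun x => ?_
    · have h5 := hμR univ MeasurableSet.univ
      simp only [Measure.restrict_univ] at h5
      rwa [h5] at h4
    · rw [hμR _ (measurableSet_cell k x), setLIntegral_adapted_mul h1 hh, setLIntegral_adapted h2,
        setLIntegral_adapted h3]
      by_cases hk : st k x
      swap
      · simp [hk]
      rw [if_pos hk, if_pos hk, if_pos hk, term, ← avg_mul_measure σ, ← avg_mul_measure ω]
      set S := σ (t.cell k x)
      set W := ω (t.cell k x)
      set a := t.avg σ f k x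
      set b := t.avg ω h k x
      have hS : S = S ^ (1 / p) * S ^ (1 / p') := by
        rw [← ENNReal.rpow_add_of_nonneg _ _ (by positivity) (by positivity), one_div, one_div, hpp,
          ENNReal.rpow_one]
      have hW : W = W ^ (1 / p) * W ^ (1 / p') := by
        rw [← ENNReal.rpow_add_of_nonneg _ _ (by positivity) (by positivity), one_div, one_div, hpp,
          ENNReal.rpow_one]
      calc γ k * (a * S) * (b * W)
          = γ k * S ^ (1 / p') * W ^ (1 / p) * ((a * S ^ (1 / p)) * (b * W ^ (1 / p'))) := by
            conv_lhs => rw [hS, hW]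
            ring
        _ ≤ K * ((a * S ^ (1 / p)) * (b * W ^ (1 / p'))) := mul_le_mul' (hchar k x) le_rfl
        _ = K * ((l * (a * S ^ (1 / p))) * (l⁻¹ * (b * W ^ (1 / p')))) := by
            congr 1
            calc _ = (l * l⁻¹) * ((a * S ^ (1 / p)) * (b * W ^ (1 / p'))) := by
                  rw [ENNReal.mul_inv_cancel hl0 hlt, one_mul]
              _ = _ := by ring
        _ ≤ K * ((l * (a * S ^ (1 / p))) ^ p + (l⁻¹ * (b * W ^ (1 / p'))) ^ p') :=
            mul_le_mul' le_rfl (ENNReal.mul_le_rpow_add_rpow _ _ hp)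
        _ = _ := by
            rw [ENNReal.mul_rpow_of_nonneg _ _ hp0.le, ENNReal.mul_rpow_of_nonneg _ _ hp0.le,
              ENNReal.mul_rpow_of_nonneg _ _ hp0'.le, ENNReal.mul_rpow_of_nonneg _ _ hp0'.le,
              ← ENNReal.rpow_mul S, ← ENNReal.rpow_mul W, one_div_mul_cancel hp0.ne',
              one_div_mul_cancel hp0'.ne', ENNReal.rpow_one, ENNReal.rpow_one]
  have hm1 : ∀ k, Measurable fun x => if st k x then t.term γ σ f k x else 0 := fun k =>
    Measurable.ite (hst k).measurableSet (adapted_term γ f k).measurable measurable_const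
  simp_rw [← ENNReal.tsum_mul_right]
  rw [lintegral_tsum fun k => ((hm1 k).fun_mul hh).aemeasurable]
  have hE : l ^ p * B = B' ^ (1 / p') * B ^ (1 / p) := by
    rw [hl, ← ENNReal.rpow_mul, show 1 / (p * p') * p = 1 / p' by field_simp,
      ENNReal.mul_rpow_of_nonneg _ _ (by positivity), mul_assoc]
    congr 1
    conv_lhs => rw [← ENNReal.rpow_one B]
    rw [ENNReal.rpow_one, ENNReal.inv_rpow, ← ENNReal.rpow_neg]
    conv_lhs => enter [2]; rw [← ENNReal.rpow_one B]
    rw [← ENNReal.rpow_add _ _ hB0 hB]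
    congr 1
    rw [one_div, one_div]; linarith
  have hE' : l⁻¹ ^ p' * B' = B' ^ (1 / p') * B ^ (1 / p) := by
    rw [hl, ENNReal.inv_rpow, ← ENNReal.rpow_mul, show 1 / (p * p') * p' = 1 / p by field_simp,
      ← ENNReal.inv_rpow, ENNReal.mul_inv (Or.inl hB0') (Or.inl hB'), inv_inv,
      ENNReal.mul_rpow_of_nonneg _ _ (by positivity), mul_right_comm]
    congr 1
    rw [ENNReal.inv_rpow, ← ENNReal.rpow_neg]
    conv_lhs => enter [2]; rw [← ENNReal.rpow_one B']
    rw [← ENNReal.rpow_add _ _ hB0' hB']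
    congr 1
    rw [one_div, one_div]; linarith
  calc _ ≤ ∑' k, K * (l ^ p * ∫⁻ x, (if st k x then t.avg σ f k x ^ p else 0) ∂σ +
        l⁻¹ ^ p' * ∫⁻ x, (if st k x then t.avg ω h k x ^ p' else 0) ∂ω) :=
        ENNReal.tsum_le_tsum hcell
    _ = K * (l ^ p * ∑' k, ∫⁻ x, (if st k x then t.avg σ f k x ^ p else 0) ∂σ +
        l⁻¹ ^ p' * ∑' k, ∫⁻ x, (if st k x then t.avg ω h k x ^ p' else 0) ∂ω) := by
        rw [ENNReal.tsum_mul_left, ENNReal.tsum_add, ENNReal.tsum_mul_left, ENNReal.tsum_mul_left]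
    _ ≤ K * (l ^ p * (2 ^ p * B * (principalConst p * 1)) +
        l⁻¹ ^ p' * (2 ^ p' * B' * (principalConst p' * 1))) := by
        refine mul_le_mul' le_rfl (add_le_add (mul_le_mul' le_rfl ?_) (mul_le_mul' le_rfl ?_))
        · exact (carleson_embedding hst hσ hf hp.lt).trans
            (mul_le_mul' le_rfl (mul_le_mul' le_rfl hf1))
        · exact (carleson_embedding hst hω hh hp.symm.lt).trans
            (mul_le_mul' le_rfl (mul_le_mul' le_rfl hh1))
    _ = K * (2 ^ p * principalConst p * (l ^ p * B) +
          2 ^ p' * principalConst p' * (l⁻¹ ^ p' * B')) := by ring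
    _ = _ := by rw [hE, hE']; ring

end PartitionTree

/-! ### Cubes -/

namespace Cube

variable {d : ℕ}

lemma toSet_eq_preimage (Q : Cube d) : Q.toSet = (WithLp.ofLp : EuclideanSpace ℝ (Fin d) → _) ⁻¹'
    Icc (fun i => Q.corner i) (fun i => Q.corner i + Q.side) := by
  ext x
  simp only [toSet, mem_ofPred_eq, mem_preimage, mem_Icc, Pi.le_def]
  exact forall_and

lemma isClosed_toSet (Q : Cube d) : IsClosed Q.toSet := by
  rw [toSet_eq_preimage]
  exact isClosed_Icc.preimage (PiLp.continuous_ofLp 2 _)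

lemma measurableSet_toSet (Q : Cube d) : MeasurableSet Q.toSet := Q.isClosed_toSet.measurableSet

lemma volume_toSet (Q : Cube d) : volume Q.toSet = ENNReal.ofReal Q.side ^ d := by
  rw [toSet_eq_preimage, (PiLp.volume_preserving_ofLp (Fin d)).measure_preimage
    measurableSet_Icc.nullMeasurableSet, Real.volume_Icc_pi]
  simp

lemma volume_ne_zero (Q : Cube d) : volume Q.toSet ≠ 0 := by
  rw [volume_toSet]
  exact pow_ne_zero _ (by simpa using Q.side_pos)

lemma volume_ne_top (Q : Cube d) : volume Q.toSet ≠ ∞ := by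
  rw [volume_toSet]; exact ENNReal.pow_ne_top ENNReal.ofReal_ne_top

lemma add_smul_sub_mem (Q : Cube d) {x z : EuclideanSpace ℝ (Fin d)} (hx : x ∈ Q.toSet)
    (hz : x + z ∈ Q.toSet) {θ : ℝ} (h0 : 0 ≤ θ) (h1 : θ ≤ 1) : x + θ • z ∈ Q.toSet := by
  intro i
  have h2 := hx i
  have h3 := hz i
  simp only [PiLp.add_apply, PiLp.smul_apply, smul_eq_mul, mem_Icc] at *
  constructor <;> nlinarith

end Cube

/-! ### The Bourgain–Brezis–Mironescu inequality on a cube -/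

/-- Hölder's inequality against a constant. -/
lemma MeasureTheory.lintegral_le_measure_rpow_mul {X : Type*} [MeasurableSpace X] (μ : Measure X)
    {F : X → ℝ≥0∞} (hF : AEMeasurable F μ) {r : ℝ} (hr : 1 ≤ r) :
    ∫⁻ x, F x ∂μ ≤ μ univ ^ (1 - 1 / r) * (∫⁻ x, F x ^ r ∂μ) ^ (1 / r) := by
  rcases hr.eq_or_lt with rfl | hr
  · simp
  · have hc := Real.HolderConjugate.conjExponent hr
    have := ENNReal.lintegral_mul_le_Lp_mul_Lq μ hc hF (aemeasurable_const (b := (1 : ℝ≥0∞)))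
    simp only [Pi.mul_apply, mul_one, ENNReal.one_rpow, lintegral_one] at this
    rw [mul_comm, show 1 - 1 / r = 1 / r.conjExponent by
      have := hc.inv_add_inv_eq_one
      rw [one_div, one_div]; linarith]
    exact this

/-- The inner integral of the fractional seminorm:
`(∫_Q |f(x) - f(y)|^r / |x - y|^{d + s r} dy)^{1/r}`. -/
noncomputable def diffFn {d : ℕ} (s r : ℝ) (Q : Cube d) (f : EuclideanSpace ℝ (Fin d) → ℂ)
    (x : EuclideanSpace ℝ (Fin d)) : ℝ≥0∞ :=
  (∫⁻ y in Q.toSet, ‖f x - f y‖ₑ ^ r / edist x y ^ ((d : ℝ) + s * r)) ^ (1 / r)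

lemma measurable_diffFn {d : ℕ} (s r : ℝ) (Q : Cube d) {f : EuclideanSpace ℝ (Fin d) → ℂ}
    (hf : Measurable f) : Measurable (diffFn s r Q f) := by
  have : Measurable fun p : EuclideanSpace ℝ (Fin d) × EuclideanSpace ℝ (Fin d) =>
      ‖f p.1 - f p.2‖ₑ ^ r / edist p.1 p.2 ^ ((d : ℝ) + s * r) := by fun_prop
  exact this.lintegral_prod_right'.pow_const _

lemma diffFn_mono {d : ℕ} {s r : ℝ} (hr : 0 ≤ r) {Q R : Cube d} (h : R.toSet ⊆ Q.toSet)
    (f : EuclideanSpace ℝ (Fin d) → ℂ) (x : EuclideanSpace ℝ (Fin d)) :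
    diffFn s r R f x ≤ diffFn s r Q f x :=
  ENNReal.rpow_le_rpow (lintegral_mono_set h) (by positivity)

lemma ENNReal.sum_rpow_ite_le {κ : ℝ} (hκ : 1 ≤ κ) {e L : ℝ≥0∞} (he : e ≠ 0) (het : e ≠ ∞)
    (hL : L ≠ ∞) (N : ℕ) :
    ∑ n ∈ Finset.range N, (if ((n + 1 : ℕ) : ℝ≥0∞) * e ≤ L then ((n + 1 : ℕ) : ℝ≥0∞) ^ (κ - 1)
      else 0) ≤ (L / e) ^ κ := by
  set y := L / e with hy
  have hyt : y ≠ ∞ := ENNReal.div_ne_top hL he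
  have hcond : ∀ n : ℕ, ((n + 1 : ℕ) : ℝ≥0∞) * e ≤ L ↔ ((n + 1 : ℕ) : ℝ≥0∞) ≤ y := fun n => by
    rw [hy, ENNReal.le_div_iff_mul_le (Or.inl he) (Or.inl het)]
  simp_rw [hcond]
  rcases eq_or_ne y 0 with h0 | h0
  · have : ∀ n : ℕ, ¬ ((n + 1 : ℕ) : ℝ≥0∞) ≤ y := fun n => by rw [h0]; simp
    simp only [this, if_false, Finset.sum_const_zero]
    exact zero_le
  rw [← Finset.sum_filter]
  calc _ ≤ ∑ n ∈ Finset.range N with ((n + 1 : ℕ) : ℝ≥0∞) ≤ y, y ^ (κ - 1) :=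
        Finset.sum_le_sum fun n hn => ENNReal.rpow_le_rpow (Finset.mem_filter.mp hn).2
          (by linarith)
    _ = ((Finset.range N).filter fun n => ((n + 1 : ℕ) : ℝ≥0∞) ≤ y).card * y ^ (κ - 1) := by
        rw [Finset.sum_const, nsmul_eq_mul]
    _ ≤ y * y ^ (κ - 1) := by
        refine mul_le_mul' ?_ le_rfl
        have h1 : ((Finset.range N).filter fun n => ((n + 1 : ℕ) : ℝ≥0∞) ≤ y) ⊆
            Finset.range ⌊y.toReal⌋₊ := by
          intro n hn
          have h2 := (Finset.mem_filter.mp hn).2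
          rw [Finset.mem_range, ← Nat.succ_le_iff]
          refine Nat.le_floor ?_
          have := ENNReal.toReal_mono hyt h2
          rwa [ENNReal.toReal_natCast] at this
        have h3 := Finset.card_le_card h1
        rw [Finset.card_range] at h3
        calc _ ≤ ((⌊y.toReal⌋₊ : ℕ) : ℝ≥0∞) := by exact_mod_cast h3
          _ = ENNReal.ofReal (⌊y.toReal⌋₊ : ℝ) := by simp
          _ ≤ ENNReal.ofReal y.toReal := ENNReal.ofReal_le_ofReal (Nat.floor_le ENNReal.toReal_nonneg)
          _ = y := ENNReal.ofReal_toReal hyt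
    _ = _ := by rw [mul_comm, ENNReal.rpow_sub_one_mul h0 hyt]

/-- Partial sums of `∑ n^{-1-β}` come within a factor `2` of `1/β`. -/
lemma exists_le_sum_rpow_neg {β : ℝ} (hβ : 0 < β) :
    ∃ N : ℕ, 1 / (2 * β) ≤ ∑ n ∈ Finset.range N, ((n + 1 : ℕ) : ℝ) ^ (-(1 + β)) := by
  have hstep : ∀ n : ℕ, ((n + 1 : ℕ) : ℝ) ^ (-β) - ((n + 2 : ℕ) : ℝ) ^ (-β) ≤
      β * ((n + 1 : ℕ) : ℝ) ^ (-(1 + β)) := by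
    intro n
    set x : ℝ := ((n + 1 : ℕ) : ℝ) with hx
    have hx0 : 0 < x := by rw [hx]; positivity
    have h1 : ((n + 2 : ℕ) : ℝ) = x * (1 + 1 / x) := by rw [hx]; push_cast; field_simp; ring
    have h2 : 1 - β * (1 / x) ≤ (1 + 1 / x) ^ (-β) := by
      rw [Real.rpow_def_of_pos (by positivity)]
      have h3 : Real.log (1 + 1 / x) ≤ 1 / x := by
        have := Real.log_le_sub_one_of_pos (show (0 : ℝ) < 1 + 1 / x by positivity)
        linarith
      have h4 := Real.add_one_le_exp (Real.log (1 + 1 / x) * -β)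
      nlinarith
    rw [h1, Real.mul_rpow hx0.le (by positivity), show -(1 + β) = -β - 1 by ring,
      Real.rpow_sub_one hx0.ne']
    have h5 : 0 < x ^ (-β) := Real.rpow_pos_of_pos hx0 _
    have h6 : β * (x ^ (-β) / x) = x ^ (-β) * (β * (1 / x)) := by ring
    rw [h6]
    nlinarith
  have hsum : ∀ N : ℕ, 1 - ((N + 1 : ℕ) : ℝ) ^ (-β) ≤
      β * ∑ n ∈ Finset.range N, ((n + 1 : ℕ) : ℝ) ^ (-(1 + β)) := by
    intro N
    induction N with
    | zero => simp
    | succ N ih =>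
      rw [Finset.sum_range_succ, mul_add]
      have := hstep N
      push_cast at *
      rw [show (N : ℝ) + 1 + 1 = N + 2 by ring]
      linarith
  have hlim : Filter.Tendsto (fun N : ℕ => ((N + 1 : ℕ) : ℝ) ^ (-β)) Filter.atTop (nhds 0) :=
    (tendsto_rpow_neg_atTop hβ).comp
      (tendsto_natCast_atTop_atTop.comp (Filter.tendsto_add_atTop_nat 1))
  obtain ⟨N, hN⟩ := (hlim.eventually (gt_mem_nhds (show (0 : ℝ) < 1 / 2 by norm_num))).exists
  refine ⟨N, ?_⟩
  have := hsum N
  rw [div_le_iff₀ (by positivity)]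
  linarith

namespace Cube

variable {d : ℕ}

/-- The pairs of points whose coordinates differ by at most `side / n`. -/
def near (R : Cube d) (n : ℕ) : Set (EuclideanSpace ℝ (Fin d) × EuclideanSpace ℝ (Fin d)) :=
  {p | ∀ i, |p.2 i - p.1 i| * n ≤ R.side}

lemma measurableSet_near (R : Cube d) (n : ℕ) : MeasurableSet (R.near n) := by
  have : R.near n = ⋂ i, {p | |p.2 i - p.1 i| * n ≤ R.side} := by ext; simp [near]
  rw [this]
  exact MeasurableSet.iInter fun i => measurableSet_le (by fun_prop) measurable_const

/-- Splitting the segments between two points of a cube into `n` pieces. By translation invariance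
all pieces contribute the same integral; the dilation of the increments gives the factor `n ^ d`. -/
lemma lintegral_lintegral_enorm_sub_le (R : Cube d) {f : EuclideanSpace ℝ (Fin d) → ℂ}
    (hf : Measurable f) {n : ℕ} (hn : 0 < n) :
    ∫⁻ x in R.toSet, ∫⁻ y in R.toSet, ‖f x - f y‖ₑ ≤ (n : ℝ≥0∞) ^ (d + 1) *
      ∫⁻ x in R.toSet, ∫⁻ y in R.toSet,
        (R.near n).indicator (fun p => ‖f p.1 - f p.2‖ₑ) (x, y) := by
  have hnR : (0 : ℝ) < n := by exact_mod_cast hn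
  have hRm := R.measurableSet_toSet
  set U : Set (EuclideanSpace ℝ (Fin d) × EuclideanSpace ℝ (Fin d)) := {p | p.1 ∈ R.toSet ∧ p.1 + p.2 ∈ R.toSet ∧ (p.1, p.1 + p.2) ∈ R.near n}
    with hU
  have hUm : MeasurableSet U :=
    (measurable_fst hRm).inter (((measurable_fst.add measurable_snd) hRm).inter
      ((measurable_fst.prodMk (measurable_fst.add measurable_snd)) (R.measurableSet_near n)))
  set H : EuclideanSpace ℝ (Fin d) × EuclideanSpace ℝ (Fin d) → ℝ≥0∞ := U.indicator fun p => ‖f p.1 - f (p.1 + p.2)‖ₑ with hH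
  have hHm : Measurable H := Measurable.indicator (by fun_prop) hUm
  have e1 : ∫⁻ x in R.toSet, ∫⁻ y in R.toSet,
      (R.near n).indicator (fun p => ‖f p.1 - f p.2‖ₑ) (x, y) = ∫⁻ x, ∫⁻ w, H (x, w) := by
    rw [← lintegral_indicator hRm]
    refine lintegral_congr fun x => ?_
    by_cases hx : x ∈ R.toSet
    · rw [indicator_of_mem hx, ← lintegral_indicator hRm,
        ← lintegral_add_left_eq_self (μ := (volume : Measure (EuclideanSpace ℝ (Fin d)))) _ x]
      refine lintegral_congr fun w => ?_
      by_cases hw : x + w ∈ R.toSet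
      · rw [indicator_of_mem hw, hH]
        by_cases hxw : (x, x + w) ∈ R.near n
        · rw [indicator_of_mem hxw, indicator_of_mem (show (x, w) ∈ U from ⟨hx, hw, hxw⟩)]
        · rw [indicator_of_notMem hxw, indicator_of_notMem fun h : (x, w) ∈ U => hxw h.2.2]
      · rw [indicator_of_notMem hw, hH, indicator_of_notMem fun h : (x, w) ∈ U => hw h.2.1]
    · rw [indicator_of_notMem hx]
      have : ∀ w, H (x, w) = 0 := fun w =>
        indicator_of_notMem (fun h : (x, w) ∈ U => hx h.1) _
      simp [this]
  -- the triangle inequality along the segment from `x` to `x + z`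
  have hpt : ∀ x z, (R.toSet.indicator (fun x => R.toSet.indicator (fun y => ‖f x - f y‖ₑ)
      (x + z)) x) ≤ ∑ i ∈ Finset.range n, H (x + ((i : ℝ) / n) • z, (1 / (n : ℝ)) • z) := by
    intro x z
    by_cases hx : x ∈ R.toSet
    swap
    · rw [indicator_of_notMem hx]; exact zero_le
    by_cases hz : x + z ∈ R.toSet
    swap
    · rw [indicator_of_mem hx, indicator_of_notMem hz]; exact zero_le
    rw [indicator_of_mem hx, indicator_of_mem hz]
    have h1 := edist_le_range_sum_edist (fun i : ℕ => f (x + ((i : ℝ) / n) • z)) n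
    simp only [Nat.cast_zero, zero_div, zero_smul, add_zero, div_self hnR.ne', one_smul,
      edist_eq_enorm_sub] at h1
    refine h1.trans (Finset.sum_le_sum fun i hi => ?_)
    rw [Finset.mem_range] at hi
    have hi' : (i : ℝ) + 1 ≤ n := by exact_mod_cast hi
    have e2 : x + (((i + 1 : ℕ) : ℝ) / n) • z = x + ((i : ℝ) / n) • z + (1 / (n : ℝ)) • z := by
      rw [add_assoc, ← add_smul]; congr 2; push_cast; ring
    have hmem : ((x + ((i : ℝ) / n) • z, (1 / (n : ℝ)) • z) : EuclideanSpace ℝ (Fin d) × EuclideanSpace ℝ (Fin d)) ∈ U := by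
      refine ⟨R.add_smul_sub_mem hx hz (by positivity) ?_, ?_, fun j => ?_⟩
      · rw [div_le_one hnR]; linarith
      · simp only
        rw [← e2]
        refine R.add_smul_sub_mem hx hz (by positivity) ?_
        rw [div_le_one hnR]; push_cast; exact hi'
      · simp only [PiLp.add_apply, PiLp.smul_apply, smul_eq_mul, add_sub_cancel_left]
        rw [abs_mul, abs_of_nonneg (by positivity : (0 : ℝ) ≤ 1 / n)]
        have h3 := hx j
        have h4 := hz j
        simp only [PiLp.add_apply, mem_Icc] at h3 h4
        have h5 : |z j| ≤ R.side := by rw [abs_le]; constructor <;> linarith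
        calc 1 / (n : ℝ) * |z j| * n = |z j| := by field_simp
          _ ≤ _ := h5
    rw [hH, indicator_of_mem hmem, e2]
  rw [e1]
  calc ∫⁻ x in R.toSet, ∫⁻ y in R.toSet, ‖f x - f y‖ₑ
      = ∫⁻ x, ∫⁻ z, R.toSet.indicator (fun x => R.toSet.indicator (fun y => ‖f x - f y‖ₑ)
          (x + z)) x := by
        rw [← lintegral_indicator hRm]
        refine lintegral_congr fun x => ?_
        by_cases hx : x ∈ R.toSet
        · simp only [indicator_of_mem hx]
          rw [← lintegral_indicator hRm,
            ← lintegral_add_left_eq_self (μ := (volume : Measure (EuclideanSpace ℝ (Fin d)))) _ x]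
        · simp only [indicator_of_notMem hx, lintegral_zero]
    _ ≤ ∫⁻ x, ∫⁻ z, ∑ i ∈ Finset.range n, H (x + ((i : ℝ) / n) • z, (1 / (n : ℝ)) • z) :=
        lintegral_mono fun x => lintegral_mono fun z => hpt x z
    _ = ∫⁻ z, ∫⁻ x, ∑ i ∈ Finset.range n, H (x + ((i : ℝ) / n) • z, (1 / (n : ℝ)) • z) := by
        rw [lintegral_lintegral_swap]
        exact (Finset.measurable_sum _ fun i _ => hHm.comp (by fun_prop)).aemeasurable
    _ = ∫⁻ z, ∑ i ∈ Finset.range n, ∫⁻ x, H (x, (1 / (n : ℝ)) • z) := by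
        refine lintegral_congr fun z => ?_
        rw [lintegral_finsetSum (f := fun (i : ℕ) x => H (x + ((i : ℝ) / n) • z, (1 / (n : ℝ)) • z))
          _ fun i _ => hHm.comp (by fun_prop)]
        refine Finset.sum_congr rfl fun i _ => ?_
        exact lintegral_add_right_eq_self (μ := (volume : Measure (EuclideanSpace ℝ (Fin d))))
          (fun x => H (x, (1 / (n : ℝ)) • z)) (((i : ℝ) / n) • z)
    _ = n * ∫⁻ z, ∫⁻ x, H (x, (1 / (n : ℝ)) • z) := by
        simp only [Finset.sum_const, Finset.card_range, nsmul_eq_mul]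
        exact lintegral_const_mul' _ _ (ENNReal.natCast_ne_top n)
    _ = n * ((n : ℝ≥0∞) ^ d * ∫⁻ w, ∫⁻ x, H (x, w)) := by
        congr 1
        have hm : Measurable fun w => ∫⁻ x, H (x, w) := hHm.lintegral_prod_left'
        have h1 := lintegral_map (μ := (volume : Measure (EuclideanSpace ℝ (Fin d)))) hm
          (measurable_const_smul (1 / (n : ℝ)))
        rw [← h1, Measure.map_addHaar_smul _ (by positivity), lintegral_smul_measure, smul_eq_mul]
        congr 1
        rw [finrank_euclideanSpace_fin, one_div, inv_pow, inv_inv, abs_of_nonneg (by positivity),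
          ENNReal.ofReal_pow hnR.le, ENNReal.ofReal_natCast]
    _ = _ := by
        rw [lintegral_lintegral_swap (f := fun w x => H (x, w))
          (hHm.comp measurable_swap).aemeasurable]
        ring

lemma measure_near_le (R : Cube d) {n : ℕ} (hn : 0 < n) (u : EuclideanSpace ℝ (Fin d)) :
    volume {v | (u, v) ∈ R.near n} ≤ (2 * ENNReal.ofReal R.side / n) ^ d := by
  have hnR : (0 : ℝ) < n := by exact_mod_cast hn
  set B : Cube d := ⟨WithLp.toLp 2 fun i => u i - R.side / n, 2 * (R.side / n),
    by have := R.side_pos; positivity⟩ with hB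
  have : {v | (u, v) ∈ R.near n} ⊆ B.toSet := by
    intro v hv i
    have h1 : |v i - u i| * n ≤ R.side := hv i
    rw [← le_div_iff₀ hnR, abs_le] at h1
    simp only [hB, mem_Icc]
    constructor <;> linarith [h1.1, h1.2]
  refine (measure_mono this).trans (le_of_eq ?_)
  rw [volume_toSet, hB]
  simp only
  rw [ENNReal.ofReal_mul (by norm_num), ENNReal.ofReal_div_of_pos hnR, ENNReal.ofReal_natCast,
    ENNReal.ofReal_ofNat, mul_div_assoc]

lemma edist_mul_le_of_near (R : Cube d) {n : ℕ} {u v : EuclideanSpace ℝ (Fin d)}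
    (h : (u, v) ∈ R.near n) : (n : ℝ≥0∞) * edist u v ≤ d * ENNReal.ofReal R.side := by
  have h1 : dist u v * n ≤ d * R.side := by
    have hs := R.side_pos
    rw [EuclideanSpace.dist_eq, ← Real.sqrt_sq (show (0 : ℝ) ≤ n by positivity),
      ← Real.sqrt_mul (by positivity), Finset.sum_mul]
    refine Real.sqrt_le_iff.mpr ⟨by positivity, ?_⟩
    have h2 : ∀ i ∈ Finset.univ, dist (u i) (v i) ^ 2 * (n : ℝ) ^ 2 ≤ R.side ^ 2 := fun i _ => by
      rw [← mul_pow, dist_comm, Real.dist_eq]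
      exact pow_le_pow_left₀ (by positivity) (h i) 2
    refine (Finset.sum_le_card_nsmul _ _ _ h2).trans ?_
    rw [Finset.card_univ, Fintype.card_fin, nsmul_eq_mul, mul_pow]
    refine mul_le_mul_of_nonneg_right ?_ (by positivity)
    exact_mod_cast Nat.le_self_pow (by norm_num) d
  rw [edist_dist, ← ENNReal.ofReal_natCast, ← ENNReal.ofReal_mul (by positivity),
    ← ENNReal.ofReal_natCast, ← ENNReal.ofReal_mul (by positivity), mul_comm]
  exact ENNReal.ofReal_le_ofReal h1

end Cube

/-- The constant in the Bourgain–Brezis–Mironescu inequality on cubes of `ℝ^d`. -/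
noncomputable def bbmConst (d : ℕ) : ℝ≥0∞ := 4 * 2 ^ (d : ℝ) * (d : ℝ≥0∞) ^ ((d : ℝ) + 1)

lemma bbmConst_ne_top (d : ℕ) : bbmConst d ≠ ∞ :=
  ENNReal.mul_ne_top (ENNReal.mul_ne_top (by simp)
    (ENNReal.rpow_ne_top_of_nonneg (by positivity) (by simp)))
    (ENNReal.rpow_ne_top_of_nonneg (by positivity) (by simp))

namespace Cube

variable {d : ℕ}

/-- The part of the inner integral of the seminorm at distance at most `side / n`. -/
noncomputable def nearInt (R : Cube d) (f : EuclideanSpace ℝ (Fin d) → ℂ) (r : ℝ) (n : ℕ)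
    (u : EuclideanSpace ℝ (Fin d)) : ℝ≥0∞ :=
  ∫⁻ v in R.toSet, (R.near n).indicator (fun p => ‖f p.1 - f p.2‖ₑ ^ r) (u, v)

lemma measurable_nearInt (R : Cube d) {f : EuclideanSpace ℝ (Fin d) → ℂ} (hf : Measurable f)
    (r : ℝ) (n : ℕ) : Measurable (R.nearInt f r n) := by
  have : Measurable ((R.near n).indicator fun p : EuclideanSpace ℝ (Fin d) ×
      EuclideanSpace ℝ (Fin d) => ‖f p.1 - f p.2‖ₑ ^ r) :=
    Measurable.indicator (by fun_prop) (R.measurableSet_near n)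
  exact this.lintegral_prod_right'

/-- The oscillation is controlled by the differences at distance at most `side / n`. -/
lemma lintegral_enorm_sub_le_nearInt (R : Cube d) {f : EuclideanSpace ℝ (Fin d) → ℂ}
    (hf : Measurable f) {r : ℝ} (hr : 1 ≤ r) {n : ℕ} (hn : 0 < n) :
    ∫⁻ x in R.toSet, ∫⁻ y in R.toSet, ‖f x - f y‖ₑ ≤
      (2 * ENNReal.ofReal R.side) ^ (d * (1 - 1 / r)) *
        ∫⁻ u in R.toSet, ((n : ℝ≥0∞) ^ (r + d) * R.nearInt f r n u) ^ (1 / r) := by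
  have hr0 : 0 < r := by linarith
  have hr1 : 0 ≤ 1 - 1 / r := by rw [sub_nonneg, div_le_one hr0]; exact hr
  have hn0 : (n : ℝ≥0∞) ≠ 0 := by exact_mod_cast hn.ne'
  have hnt : (n : ℝ≥0∞) ≠ ∞ := ENNReal.natCast_ne_top n
  have hm : ∀ u, MeasurableSet {v | (u, v) ∈ R.near n} := fun u =>
    measurable_prodMk_left (R.measurableSet_near n)
  have hpt : ∀ u, ∫⁻ y in R.toSet, (R.near n).indicator (fun p => ‖f p.1 - f p.2‖ₑ) (u, y) ≤
      ((2 * ENNReal.ofReal R.side / n) ^ d) ^ (1 - 1 / r) * R.nearInt f r n u ^ (1 / r) := by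
    intro u
    have e1 : ∀ F : ℂ → ℝ≥0∞, ∫⁻ y in R.toSet, (R.near n).indicator (fun p => F (f p.1 - f p.2))
        (u, y) = ∫⁻ y in {v | (u, v) ∈ R.near n}, F (f u - f y) ∂(volume.restrict R.toSet) := by
      intro F
      rw [← lintegral_indicator (hm u)]
      rfl
    rw [e1 fun z => ‖z‖ₑ, nearInt, e1 fun z => ‖z‖ₑ ^ r]
    refine (lintegral_le_measure_rpow_mul _ (Measurable.aemeasurable (by fun_prop)) hr).trans ?_
    refine mul_le_mul' (ENNReal.rpow_le_rpow ?_ hr1) le_rfl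
    rw [Measure.restrict_apply_univ]
    exact (Measure.restrict_apply_le _ _).trans (R.measure_near_le hn u)
  have hcoef : (n : ℝ≥0∞) ^ (d + 1) * ((2 * ENNReal.ofReal R.side / n) ^ d) ^ (1 - 1 / r) =
      (2 * ENNReal.ofReal R.side) ^ (d * (1 - 1 / r)) * ((n : ℝ≥0∞) ^ (r + d)) ^ (1 / r) := by
    rw [← ENNReal.rpow_natCast (_ / _), ← ENNReal.rpow_mul,
      ENNReal.div_rpow_of_nonneg _ _ (by positivity), div_eq_mul_inv, ← ENNReal.rpow_neg,
      mul_left_comm, ← ENNReal.rpow_natCast, ← ENNReal.rpow_add _ _ hn0 hnt, ← ENNReal.rpow_mul]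
    congr 2
    push_cast
    field_simp
    ring
  calc _ ≤ _ := R.lintegral_lintegral_enorm_sub_le hf hn
    _ ≤ (n : ℝ≥0∞) ^ (d + 1) * ∫⁻ u in R.toSet,
        ((2 * ENNReal.ofReal R.side / n) ^ d) ^ (1 - 1 / r) * R.nearInt f r n u ^ (1 / r) :=
        mul_le_mul' le_rfl (lintegral_mono hpt)
    _ = _ := by
        simp_rw [ENNReal.mul_rpow_of_nonneg _ _ (show (0 : ℝ) ≤ 1 / r by positivity)]
        rw [lintegral_const_mul _ ((R.measurable_nearInt hf r n).pow_const _), lintegral_const_mul _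
          ((R.measurable_nearInt hf r n).pow_const _), ← mul_assoc, hcoef, mul_assoc]

/-- Summation over the scales `n` recovers the kernel of the seminorm. -/
lemma sum_nearInt_le (R : Cube d) {f : EuclideanSpace ℝ (Fin d) → ℂ} (hf : Measurable f) {r κ : ℝ}
    (hr : 0 < r) (hκ : 1 ≤ κ) (N : ℕ) (u : EuclideanSpace ℝ (Fin d)) :
    ∑ n ∈ Finset.range N, ((n + 1 : ℕ) : ℝ≥0∞) ^ (κ - 1) * R.nearInt f r (n + 1) u ≤
      (d * ENNReal.ofReal R.side) ^ κ *
        ∫⁻ v in R.toSet, ‖f u - f v‖ₑ ^ r / edist u v ^ κ := by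
  have hκ0 : 0 < κ := by linarith
  have hLt : (d : ℝ≥0∞) * ENNReal.ofReal R.side ≠ ∞ :=
    ENNReal.mul_ne_top (by simp) ENNReal.ofReal_ne_top
  have hm : ∀ n, Measurable fun v => (R.near n).indicator (fun p => ‖f p.1 - f p.2‖ₑ ^ r) (u, v) :=
    fun n => (Measurable.indicator (f := fun p : EuclideanSpace ℝ (Fin d) ×
      EuclideanSpace ℝ (Fin d) => ‖f p.1 - f p.2‖ₑ ^ r) (by fun_prop)
      (R.measurableSet_near n)).comp measurable_prodMk_left
  simp_rw [nearInt]
  rw [← lintegral_const_mul _ (by fun_prop)]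
  calc _ = ∫⁻ v in R.toSet, ∑ n ∈ Finset.range N, ((n + 1 : ℕ) : ℝ≥0∞) ^ (κ - 1) *
        (R.near (n + 1)).indicator (fun p => ‖f p.1 - f p.2‖ₑ ^ r) (u, v) := by
        rw [lintegral_finsetSum _ fun n _ => (hm (n + 1)).const_mul _]
        exact Finset.sum_congr rfl fun n _ => (lintegral_const_mul _ (hm (n + 1))).symm
    _ ≤ _ := by
        refine lintegral_mono fun v => ?_
        rcases eq_or_ne u v with rfl | huv
        · have : ∀ n, (R.near n).indicator (fun p => ‖f p.1 - f p.2‖ₑ ^ r) (u, u) = 0 := by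
            intro n
            refine (indicator_apply_eq_zero).mpr fun _ => ?_
            simp [hr]
          simp [this]
        have he0 : edist u v ≠ 0 := by simpa using huv
        have het : edist u v ≠ ∞ := edist_ne_top u v
        calc _ ≤ ∑ n ∈ Finset.range N, (if ((n + 1 : ℕ) : ℝ≥0∞) * edist u v ≤
              d * ENNReal.ofReal R.side then ((n + 1 : ℕ) : ℝ≥0∞) ^ (κ - 1) else 0) *
                ‖f u - f v‖ₑ ^ r := by
              refine Finset.sum_le_sum fun n _ => ?_
              by_cases h : (u, v) ∈ R.near (n + 1)
              · rw [indicator_of_mem h, if_pos (R.edist_mul_le_of_near h)]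
              · rw [indicator_of_notMem h, mul_zero]; exact zero_le
          _ = (∑ n ∈ Finset.range N, (if ((n + 1 : ℕ) : ℝ≥0∞) * edist u v ≤
              d * ENNReal.ofReal R.side then ((n + 1 : ℕ) : ℝ≥0∞) ^ (κ - 1) else 0)) *
                ‖f u - f v‖ₑ ^ r := by rw [Finset.sum_mul]
          _ ≤ (d * ENNReal.ofReal R.side / edist u v) ^ κ * ‖f u - f v‖ₑ ^ r :=
              mul_le_mul' (ENNReal.sum_rpow_ite_le hκ he0 het hLt N) le_rfl
          _ = _ := by
              rw [ENNReal.div_rpow_of_nonneg _ _ hκ0.le, div_eq_mul_inv, div_eq_mul_inv]; ring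

/-- The Bourgain–Brezis–Mironescu inequality on a cube, with the factor `(1 - s)^{1/r}`. The bound by
differences at distance `side / n` holds for every `n`; its average over `n` with the weights
`n ^ (-1 - (1 - s) r)` gives the seminorm on the right, and the total weight is comparable to
`1 / ((1 - s) r)`. -/
theorem lintegral_enorm_sub_le_diffFn (R : Cube d) (hd : 1 ≤ d)
    {f : EuclideanSpace ℝ (Fin d) → ℂ} (hf : Measurable f) {r s : ℝ} (hr : 1 ≤ r) (hs0 : 0 < s)
    (hs1 : s < 1) :
    ∫⁻ x in R.toSet, ∫⁻ y in R.toSet, ‖f x - f y‖ₑ ≤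
      bbmConst d * ENNReal.ofReal ((1 - s) ^ (1 / r)) * ENNReal.ofReal R.side ^ ((d : ℝ) + s) *
        ∫⁻ x in R.toSet, diffFn s r R f x := by
  have hr0 : 0 < r := by linarith
  have hr1 : 0 ≤ 1 - 1 / r := by rw [sub_nonneg, div_le_one hr0]; exact hr
  have hdR : (1 : ℝ) ≤ d := by exact_mod_cast hd
  have hd1 : (1 : ℝ≥0∞) ≤ d := by exact_mod_cast hd
  set β := (1 - s) * r with hβ
  have hβ0 : 0 < β := mul_pos (by linarith) hr0
  set κ := (d : ℝ) + s * r with hκ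
  have hκ1 : 1 ≤ κ := by rw [hκ]; nlinarith
  set l := ENNReal.ofReal R.side with hl
  have hl0 : l ≠ 0 := by simpa [hl] using R.side_pos
  have hlt : l ≠ ∞ := ENNReal.ofReal_ne_top
  set A := ∫⁻ x in R.toSet, ∫⁻ y in R.toSet, ‖f x - f y‖ₑ with hA
  set I := ∫⁻ x in R.toSet, diffFn s r R f x with hI
  -- a finite sum of weights, so that one may divide by it
  obtain ⟨N, hN⟩ := exists_le_sum_rpow_neg hβ0
  set w : ℕ → ℝ≥0∞ := fun n => ((n + 1 : ℕ) : ℝ≥0∞) ^ (-(1 + β)) with hw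
  set S := ∑ n ∈ Finset.range N, w n with hS
  have hwr : ∀ n, w n = ENNReal.ofReal (((n + 1 : ℕ) : ℝ) ^ (-(1 + β))) := fun n => by
    rw [hw, ← ENNReal.ofReal_rpow_of_pos (by positivity), ENNReal.ofReal_natCast]
  have hSl : ENNReal.ofReal (1 / (2 * β)) ≤ S := by
    simp_rw [hS, hwr]
    rw [← ENNReal.ofReal_sum_of_nonneg fun n _ => by positivity]
    exact ENNReal.ofReal_le_ofReal hN
  have hS0 : S ≠ 0 := (lt_of_lt_of_le (by simpa using hβ0) hSl).ne'
  have hSt : S ≠ ∞ := by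
    simp_rw [hS, hwr]
    exact ENNReal.sum_ne_top.mpr fun n _ => ENNReal.ofReal_ne_top
  have hmn := fun n => R.measurable_nearInt hf r n
  have hpow : ∀ n : ℕ, w n * ((n + 1 : ℕ) : ℝ≥0∞) ^ (r + d) = ((n + 1 : ℕ) : ℝ≥0∞) ^ (κ - 1) := by
    intro n
    rw [hw, ← ENNReal.rpow_add _ _ (by positivity) (ENNReal.natCast_ne_top _)]
    congr 1
    rw [hκ, hβ]; ring
  -- Jensen's inequality for the power `1 / r`
  have hpt : ∀ u, ∑ n ∈ Finset.range N,
      w n * (((n + 1 : ℕ) : ℝ≥0∞) ^ (r + d) * R.nearInt f r (n + 1) u) ^ (1 / r) ≤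
        S ^ (1 - 1 / r) * ((d * l) ^ (κ / r) * diffFn s r R f u) := by
    intro u
    have h1 := ENNReal.inner_le_weight_mul_Lp_of_nonneg (Finset.range N) hr w
      fun n => (((n + 1 : ℕ) : ℝ≥0∞) ^ (r + d) * R.nearInt f r (n + 1) u) ^ (1 / r)
    refine h1.trans ?_
    rw [← one_div]
    refine mul_le_mul' le_rfl ?_
    have h2 : (d * l) ^ (κ / r) * diffFn s r R f u = ((d * l) ^ κ *
        ∫⁻ v in R.toSet, ‖f u - f v‖ₑ ^ r / edist u v ^ κ) ^ (1 / r) := by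
      rw [ENNReal.mul_rpow_of_nonneg ((d * l) ^ κ) _ (by positivity), ← ENNReal.rpow_mul, diffFn]
      congr 2; ring
    rw [h2]
    refine ENNReal.rpow_le_rpow (le_trans (le_of_eq ?_) (R.sum_nearInt_le hf hr0 hκ1 N u))
      (by positivity)
    refine Finset.sum_congr rfl fun n _ => ?_
    rw [← ENNReal.rpow_mul, one_div_mul_cancel hr0.ne', ENNReal.rpow_one, ← mul_assoc, hpow]
  have hSA : S * A ≤ S * (S ^ (-(1 / r)) * ((2 * l) ^ (d * (1 - 1 / r)) * (d * l) ^ (κ / r) * I)) := by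
    calc S * A = ∑ n ∈ Finset.range N, w n * A := by rw [hS, Finset.sum_mul]
      _ ≤ ∑ n ∈ Finset.range N, w n * ((2 * l) ^ (d * (1 - 1 / r)) *
          ∫⁻ u in R.toSet, (((n + 1 : ℕ) : ℝ≥0∞) ^ (r + d) * R.nearInt f r (n + 1) u) ^ (1 / r)) :=
          Finset.sum_le_sum fun n _ => mul_le_mul' le_rfl
            (R.lintegral_enorm_sub_le_nearInt hf hr (Nat.succ_pos n))
      _ = (2 * l) ^ (d * (1 - 1 / r)) * ∫⁻ u in R.toSet, ∑ n ∈ Finset.range N,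
          w n * (((n + 1 : ℕ) : ℝ≥0∞) ^ (r + d) * R.nearInt f r (n + 1) u) ^ (1 / r) := by
          rw [lintegral_finsetSum _ fun n _ =>
            (((hmn (n + 1)).const_mul _).pow_const _).const_mul _, Finset.mul_sum]
          refine Finset.sum_congr rfl fun n _ => ?_
          rw [lintegral_const_mul _ (((hmn (n + 1)).const_mul _).pow_const _)]
          ring
      _ ≤ (2 * l) ^ (d * (1 - 1 / r)) *
          ∫⁻ u in R.toSet, S ^ (1 - 1 / r) * ((d * l) ^ (κ / r) * diffFn s r R f u) :=
          mul_le_mul' le_rfl (lintegral_mono hpt)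
      _ = _ := by
          rw [lintegral_const_mul _ ((measurable_diffFn s r R hf).const_mul _),
            lintegral_const_mul _ (measurable_diffFn s r R hf), sub_eq_add_neg 1 (1 / r),
            ENNReal.rpow_add _ _ hS0 hSt, ENNReal.rpow_one]
          ring
  have hAle : A ≤ S ^ (-(1 / r)) * ((2 * l) ^ (d * (1 - 1 / r)) * (d * l) ^ (κ / r) * I) :=
    (ENNReal.mul_le_mul_iff_right hS0 hSt).mp hSA
  refine hAle.trans ?_
  -- the constant is independent of `r`, as `(2 r) ^ (1 / r) ≤ 4`
  have hS1 : S ^ (-(1 / r)) ≤ 4 * ENNReal.ofReal ((1 - s) ^ (1 / r)) := by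
    rw [ENNReal.rpow_neg, ← ENNReal.inv_rpow]
    have h1 : S⁻¹ ≤ ENNReal.ofReal (2 * β) := by
      rw [ENNReal.inv_le_iff_inv_le, ← ENNReal.ofReal_inv_of_pos (by positivity)]
      simpa using hSl
    have h2 : 2 * r ≤ 4 ^ r := by
      have h3 := one_add_mul_self_le_rpow_one_add (show (-1 : ℝ) ≤ 3 by norm_num) hr
      norm_num at h3
      linarith
    calc S⁻¹ ^ (1 / r) ≤ ENNReal.ofReal (2 * β) ^ (1 / r) :=
          ENNReal.rpow_le_rpow h1 (by positivity)
      _ = ENNReal.ofReal ((2 * r) ^ (1 / r) * (1 - s) ^ (1 / r)) := by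
          rw [ENNReal.ofReal_rpow_of_nonneg (by positivity) (by positivity),
            ← Real.mul_rpow (by positivity) (by linarith), hβ]
          congr 2; ring
      _ ≤ ENNReal.ofReal (4 * (1 - s) ^ (1 / r)) := by
          refine ENNReal.ofReal_le_ofReal (mul_le_mul_of_nonneg_right ?_
            (Real.rpow_nonneg (by linarith) _))
          calc (2 * r) ^ (1 / r) ≤ ((4 : ℝ) ^ r) ^ (1 / r) :=
                Real.rpow_le_rpow (by positivity) h2 (by positivity)
            _ = 4 := by
                rw [← Real.rpow_mul (by norm_num), mul_one_div_cancel hr0.ne', Real.rpow_one]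
      _ = _ := by rw [ENNReal.ofReal_mul (by norm_num)]; simp
  have hcoef : (2 * l) ^ (d * (1 - 1 / r)) * (d * l) ^ (κ / r) ≤
      2 ^ (d : ℝ) * (d : ℝ≥0∞) ^ ((d : ℝ) + 1) * l ^ ((d : ℝ) + s) := by
    have hκr : κ / r = d / r + s := by rw [hκ]; field_simp
    have hdr : (d : ℝ) / r ≤ d := div_le_self (by positivity) hr
    rw [ENNReal.mul_rpow_of_nonneg _ _ (by positivity), ENNReal.mul_rpow_of_nonneg _ _
      (by positivity)]
    calc 2 ^ (d * (1 - 1 / r)) * l ^ (d * (1 - 1 / r)) * ((d : ℝ≥0∞) ^ (κ / r) * l ^ (κ / r))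
        = 2 ^ (d * (1 - 1 / r)) * (d : ℝ≥0∞) ^ (κ / r) *
          (l ^ (d * (1 - 1 / r)) * l ^ (κ / r)) := by ring
      _ ≤ _ := by
          refine mul_le_mul' (mul_le_mul' ?_ ?_) (le_of_eq ?_)
          · refine ENNReal.rpow_le_rpow_of_exponent_le (by norm_num) ?_
            have : 0 < 1 / r := by positivity
            nlinarith
          · exact ENNReal.rpow_le_rpow_of_exponent_le hd1 (by rw [hκr]; linarith)
          · rw [← ENNReal.rpow_add _ _ hl0 hlt, hκr]
            congr 1; field_simp; ring
  calc _ ≤ 4 * ENNReal.ofReal ((1 - s) ^ (1 / r)) *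
        (2 ^ (d : ℝ) * (d : ℝ≥0∞) ^ ((d : ℝ) + 1) * l ^ ((d : ℝ) + s) * I) :=
        mul_le_mul' hS1 (mul_le_mul' hcoef le_rfl)
    _ = _ := by rw [bbmConst]; ring

end Cube

/-! ### Mean oscillations and the sparse stopping rule -/

namespace PartitionTree

variable {X ι : Type*} [MeasurableSpace X] {t : PartitionTree X ι} [Countable ι]
variable {ν ω : Measure X} [IsFiniteMeasure ν] {f : X → ℂ}

variable (t) in
/-- The average of `f` over the cell of generation `k` containing `x`. -/
noncomputable def mean (ν : Measure X) (f : X → ℂ) (k : ℕ) (x : X) : ℂ :=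
  ⨍ y in t.cell k x, f y ∂ν

variable (t) in
/-- The mean oscillation of `f` over the cell of generation `k` containing `x`, that is, the average
of `|f - ⟨f⟩|` over the cell, where `⟨f⟩` is the mean of `f` over it. -/
noncomputable def osc (ν : Measure X) (f : X → ℂ) (k : ℕ) (x : X) : ℝ≥0∞ :=
  t.avg ν (fun y => ‖f y - t.mean ν f k x‖ₑ) k x

omit [Countable ι] [IsFiniteMeasure ν] in
lemma adapted_mean (ν : Measure X) (f : X → ℂ) (k : ℕ) : t.Adapted k (t.mean ν f k) :=
  adapted_cell k fun C => ⨍ y in C, f y ∂ν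

omit [Countable ι] [IsFiniteMeasure ν] in
lemma adapted_osc (ν : Measure X) (f : X → ℂ) (k : ℕ) : t.Adapted k (t.osc ν f k) :=
  fun x y h => by rw [osc, osc, adapted_mean ν f k x y h]; exact adapted_avg ν _ k x y h

omit [Countable ι] in
lemma enorm_mean_sub_le (hf : Integrable f ν) {k : ℕ} {x : X} (h0 : ν (t.cell k x) ≠ 0) (c : ℂ) :
    ‖t.mean ν f k x - c‖ₑ ≤ t.avg ν (fun y => ‖f y - c‖ₑ) k x := by
  have hν : ν.restrict (t.cell k x) ≠ 0 := by simpa using h0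
  have : NeZero (ν.restrict (t.cell k x)) := ⟨hν⟩
  have h1 : t.mean ν f k x - c = ⨍ y in t.cell k x, (f y - c) ∂ν := by
    rw [mean, average_eq, average_eq, integral_sub hf.integrableOn (integrable_const c), smul_sub,
      integral_const, smul_smul, inv_mul_cancel₀, one_smul]
    simp [measureReal_def, ENNReal.toReal_eq_zero_iff, h0]
  rw [h1, average_eq', avg]
  refine (enorm_integral_le_lintegral_enorm _).trans (le_of_eq ?_)
  rw [lintegral_smul_measure, smul_eq_mul, Measure.restrict_apply_univ, ENNReal.div_eq_inv_mul]

omit [Countable ι] in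
lemma avg_succ_le {c : ℝ≥0∞} {k : ℕ} {x : X}
    (hd : ν (t.cell k x) ≤ c * ν (t.cell (k + 1) x)) (h0 : ν (t.cell k x) ≠ 0) (h : X → ℝ≥0∞) :
    t.avg ν h (k + 1) x ≤ c * t.avg ν h k x := by
  have h1 : ν (t.cell (k + 1) x) ≠ 0 := by
    intro hz; rw [hz, mul_zero] at hd; exact h0 (le_antisymm hd zero_le)
  rw [avg, avg, ENNReal.div_le_iff h1 (measure_ne_top _ _)]
  have h2 : ∫⁻ y in t.cell (k + 1) x, h y ∂ν ≤ ∫⁻ y in t.cell k x, h y ∂ν :=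
    lintegral_mono_set (cell_subset (Nat.le_succ k) (self_mem_cell k x))
  refine h2.trans ?_
  set I := ∫⁻ y in t.cell k x, h y ∂ν
  calc I = I / ν (t.cell k x) * ν (t.cell k x) :=
        (ENNReal.div_mul_cancel h0 (measure_ne_top _ _)).symm
    _ ≤ I / ν (t.cell k x) * (c * ν (t.cell (k + 1) x)) := mul_le_mul' le_rfl hd
    _ = _ := by ring

omit [Countable ι] in
/-- Telescoping along the cells containing a point. -/
lemma enorm_sub_mean_le_tsum_osc (hf : Integrable f ν) {c : ℝ≥0∞} {x : X}
    (h0 : ∀ k, ν (t.cell k x) ≠ 0) (hd : ∀ k, ν (t.cell k x) ≤ c * ν (t.cell (k + 1) x))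
    (hlim : Filter.Tendsto (fun k => t.mean ν f k x) Filter.atTop (nhds (f x))) :
    ‖f x - t.mean ν f 0 x‖ₑ ≤ c * ∑' k, t.osc ν f k x := by
  have hfin : ∀ k, ‖t.mean ν f k x - t.mean ν f 0 x‖ₑ ≤
      c * ∑ j ∈ Finset.range k, t.osc ν f j x := by
    intro k
    induction k with
    | zero => simp
    | succ k ih =>
      rw [Finset.sum_range_succ, mul_add, add_comm (c * _)]
      calc _ = ‖(t.mean ν f (k + 1) x - t.mean ν f k x) + (t.mean ν f k x - t.mean ν f 0 x)‖ₑ := by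
            congr 1; ring
        _ ≤ _ := enorm_add_le _ _
        _ ≤ _ := add_le_add ((enorm_mean_sub_le hf (h0 (k + 1)) _).trans
            (avg_succ_le (hd k) (h0 k) _)) ih
  refine le_of_tendsto' ((hlim.sub_const (t.mean ν f 0 x)).enorm) fun k => (hfin k).trans ?_
  exact mul_le_mul' le_rfl (ENNReal.sum_le_tsum _)

variable (t) in
/-- The sparse stopping rule: the average of `|f - ⟨f⟩|` over the cell of generation `k` exceeds
twice the average over the cell of generation `j`, where `⟨f⟩` is the mean over the latter. -/
def OscDoubled (ν : Measure X) (f : X → ℂ) (j k : ℕ) (x : X) : Prop :=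
  2 * t.osc ν f j x < t.avg ν (fun y => ‖f y - t.mean ν f j x‖ₑ) k x

omit [Countable ι] [IsFiniteMeasure ν] in
lemma adapted_oscDoubled (ν : Measure X) (f : X → ℂ) (j k : ℕ) (h : j ≤ k) :
    t.Adapted k (t.OscDoubled ν f j k) := fun x y hxy => by
  have hj := idx_eq_of_le h hxy
  rw [OscDoubled, OscDoubled, adapted_osc ν f j x y hj, adapted_mean ν f j x y hj,
    adapted_avg ν _ k x y hxy]

open Classical

omit [Countable ι] in
/-- Pointwise sparse domination: telescoping along the stopping generations only. -/
lemma enorm_sub_mean_le_tsum_isStop (hf : Integrable f ν) {c : ℝ≥0∞} (hc : 1 ≤ c) {x : X}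
    (h0 : ∀ k, ν (t.cell k x) ≠ 0) (hd : ∀ k, ν (t.cell k x) ≤ c * ν (t.cell (k + 1) x))
    (hlim : Filter.Tendsto (fun k => t.mean ν f k x) Filter.atTop (nhds (f x))) :
    ‖f x - t.mean ν f 0 x‖ₑ ≤
      2 * c * ∑' k, if IsStop (t.OscDoubled ν f) k x then t.osc ν f k x else 0 := by
  set bad := t.OscDoubled ν f with hbad
  set b : ℕ → ℝ≥0∞ := fun k => if IsStop bad k x then t.osc ν f k x else 0 with hb
  -- between two stopping generations the averages stay below twice the oscillation at the
  -- first of them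
  have hgood : ∀ k, t.avg ν (fun y => ‖f y - t.mean ν f (lastStop bad k x) x‖ₑ) k x ≤
      2 * t.osc ν f (lastStop bad k x) x := by
    intro k
    rcases (lastStop_le (bad := bad) k x).eq_or_lt with h | h
    · rw [h, ← osc, two_mul]; exact le_self_add
    · exact not_lt.mp (not_bad_of_lastStop_lt h le_rfl)
  have hbl : ∀ k, b (lastStop bad k x) = t.osc ν f (lastStop bad k x) x := fun k =>
    if_pos (isStop_lastStop k x)
  have hfin : ∀ k, ‖t.mean ν f (lastStop bad k x) x - t.mean ν f 0 x‖ₑ ≤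
      2 * c * ∑ j ∈ Finset.range (lastStop bad k x), b j := by
    intro k
    induction k with
    | zero => simp [lastStop]
    | succ k ih =>
      by_cases hk : bad (lastStop bad k x) (k + 1) x
      · rw [lastStop_succ_of_bad hk]
        set m := lastStop bad k x with hm
        have hmk : m ≤ k := lastStop_le k x
        calc _ = ‖(t.mean ν f (k + 1) x - t.mean ν f m x) +
              (t.mean ν f m x - t.mean ν f 0 x)‖ₑ := by congr 1; ring
          _ ≤ _ := enorm_add_le _ _
          _ ≤ 2 * c * b m + 2 * c * ∑ j ∈ Finset.range m, b j := by
              refine add_le_add ?_ ih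
              refine (enorm_mean_sub_le hf (h0 (k + 1)) _).trans
                ((avg_succ_le (hd k) (h0 k) _).trans ?_)
              rw [hbl k, mul_comm 2 c, mul_assoc]
              exact mul_le_mul' le_rfl (hgood k)
          _ = 2 * c * ∑ j ∈ Finset.range (m + 1), b j := by
              rw [Finset.sum_range_succ]; ring
          _ ≤ _ := mul_le_mul' le_rfl (Finset.sum_le_sum_of_subset
              (Finset.range_mono (by omega)))
      · rw [lastStop_succ_of_not_bad hk]; exact ih
  refine le_of_tendsto' ((hlim.sub_const (t.mean ν f 0 x)).enorm) fun k => ?_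
  set m := lastStop bad k x with hm
  calc _ = ‖(t.mean ν f k x - t.mean ν f m x) + (t.mean ν f m x - t.mean ν f 0 x)‖ₑ := by
        congr 1; ring
    _ ≤ _ := enorm_add_le _ _
    _ ≤ 2 * c * b m + 2 * c * ∑ j ∈ Finset.range m, b j := by
        refine add_le_add ?_ (hfin k)
        refine (enorm_mean_sub_le hf (h0 k) _).trans ((hgood k).trans ?_)
        rw [hbl k]
        exact mul_le_mul' (le_mul_of_one_le_right' hc) le_rfl
    _ = 2 * c * ∑ j ∈ Finset.range (m + 1), b j := by rw [Finset.sum_range_succ]; ring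
    _ ≤ _ := mul_le_mul' le_rfl (ENNReal.sum_le_tsum _)

omit [Countable ι] in
lemma osc_ne_top (hf : Integrable f ν) (k : ℕ) (x : X) : t.osc ν f k x ≠ ∞ := by
  rcases eq_or_ne (ν (t.cell k x)) 0 with h0 | h0
  · rw [osc, avg, setLIntegral_measure_zero _ _ h0]; simp
  · refine ENNReal.div_ne_top ?_ h0
    exact ((hf.sub (integrable_const _)).integrableOn (s := t.cell k x)).2.ne

/-- The points of a stopping cell at which stopping does not occur again make up at least half of
the cell. -/
lemma measure_cell_le_two_mul_finalStop (hf : Integrable f ν) {k : ℕ} {x : X}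
    (hst : IsStop (t.OscDoubled ν f) k x) :
    ν (t.cell k x) ≤ 2 * ν (t.cell k x ∩ {y | FinalStop (t.OscDoubled ν f) k y}) := by
  set bad := t.OscDoubled ν f with hbad
  have hadp := adapted_oscDoubled (t := t) ν f
  set h : X → ℝ≥0∞ := fun y => ‖f y - t.mean ν f k x‖ₑ with hh
  set o := t.osc ν f k x with ho
  set B := {y | ∃ i, k ≤ i ∧ 2 * o < t.avg ν h i y} with hB
  set R := t.cell k x with hR
  have hint : ∫⁻ y in R, h y ∂ν = o * ν R := (avg_mul_measure ν h k x).symm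
  have hsub : R ⊆ (R ∩ B) ∪ (R ∩ {y | FinalStop bad k y}) := by
    intro y hy
    by_cases hF : FinalStop bad k y
    · exact Or.inr ⟨hy, hF⟩
    · refine Or.inl ⟨hy, ?_⟩
      have hsy : IsStop bad k y := by
        have := adapted_isStop hadp k y x hy
        exact this.mpr hst
      have hN : ∃ j, NextStop bad k j y := by
        by_contra hno
        exact hF ⟨hsy, not_exists.mp hno⟩
      obtain ⟨j, hj1, hj2⟩ := hN
      have hbj := isStop_succ_iff.mp hj1
      have hkj : k ≤ j := hj2 ▸ lastStop_le (bad := bad) j y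
      rw [hj2, hbad, OscDoubled, adapted_osc ν f k y x hy, adapted_mean ν f k y x hy] at hbj
      exact ⟨j + 1, by omega, hbj⟩
  -- weak type `(1,1)` of the maximal function; if the oscillation vanishes, so do all averages
  have hhalf : ν (R ∩ B) ≤ 2⁻¹ * ν R := by
    rcases eq_or_ne o 0 with h0 | h0
    · have : R ∩ B = ∅ := by
        ext y
        simp only [mem_inter_iff, mem_empty_iff_false, iff_false, not_and]
        rintro hy ⟨i, hi, hlt⟩
        have h1 : ∫⁻ z in t.cell i y, h z ∂ν ≤ 0 := by
          have := lintegral_mono_set (μ := ν) (f := h) (cell_subset hi hy)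
          rwa [← hR, hint, h0, zero_mul] at this
        rw [avg, le_antisymm h1 zero_le, ENNReal.zero_div] at hlt
        exact absurd hlt (not_lt.mpr zero_le)
      rw [this]; simp
    · have ht := osc_ne_top (t := t) hf k x
      have h1 := mul_measure_exists_avg_lt_le (t := t) ν h k x (2 * o)
      rw [← hR, hint, mul_comm 2 o, mul_assoc] at h1
      have h2 := (ENNReal.mul_le_mul_iff_right h0 ht).mp h1
      rw [mul_comm o 2] at h2
      calc ν (R ∩ B) = 2⁻¹ * (2 * ν (R ∩ B)) := by
            rw [← mul_assoc, ENNReal.inv_mul_cancel (by simp) (by simp), one_mul]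
        _ ≤ _ := mul_le_mul' le_rfl h2
  have h3 : ν R ≤ 2⁻¹ * ν R + ν (R ∩ {y | FinalStop bad k y}) :=
    (measure_mono hsub).trans ((measure_union_le _ _).trans (add_le_add hhalf le_rfl))
  have h4 : 2⁻¹ * ν R + 2⁻¹ * ν R ≤ 2⁻¹ * ν R + ν (R ∩ {y | FinalStop bad k y}) := by
    rwa [← add_mul, ENNReal.inv_two_add_inv_two, one_mul]
  have h5 := (ENNReal.add_le_add_iff_left
    (ENNReal.mul_ne_top (by simp) (measure_ne_top ν R))).mp h4
  calc ν R = 2 * (2⁻¹ * ν R) := by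
        rw [← mul_assoc, ENNReal.mul_inv_cancel (by simp) (by simp), one_mul]
    _ ≤ _ := mul_le_mul' le_rfl h5

/-- The stopping cells form a Carleson family for any measure `ω` whose averages over the cells
in question are controlled by a function `M`: the sets where the stopping ends are disjoint, and
they carry half of the measure `ν` of the stopping cells. -/
lemma lintegral_tsum_isStop_le (hf : Integrable f ν) {M : X → ℝ≥0∞} {m : ℕ} {x : X}
    (hM : ∀ j y, m ≤ j → y ∈ t.cell m x → ω (t.cell j y) ≤ M y * ν (t.cell j y)) :
    ∫⁻ y in t.cell m x, ∑' j, (if IsStop (t.OscDoubled ν f) (m + j) y then 1 else 0) ∂ω ≤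
      2 * ∫⁻ y in t.cell m x, M y ∂ν := by
  set bad := t.OscDoubled ν f with hbad
  have hadp := adapted_oscDoubled (t := t) ν f
  have hgens := fun k => adapted_isStop hadp k
  have hFm : ∀ j, MeasurableSet {y | FinalStop bad j y} := measurableSet_finalStop hadp
  have hone : ∀ k, t.Adapted k fun y => if IsStop bad k y then (1 : ℝ≥0∞) else 0 :=
    fun k y z h => by
      have : IsStop bad k y = IsStop bad k z := hgens k y z h
      simp only [this]
  set R := t.cell m x with hR
  rw [lintegral_tsum fun j => (hone (m + j)).measurable.aemeasurable]
  have hj : ∀ j, ∫⁻ y in R, (if IsStop bad (m + j) y then 1 else 0) ∂ω ≤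
      2 * ∫⁻ y in R ∩ {y | FinalStop bad (m + j) y}, M y ∂ν := by
    intro j
    have key := setLIntegral_le_of_cells (t := t) (k := m + j) (A := R) (ν := ω) (μ := ν)
      (f := fun y => if IsStop bad (m + j) y then 1 else 0)
      (g := {y | FinalStop bad (m + j) y}.indicator fun y => 2 * M y)
      (adapted_mem_cell (Nat.le_add_right m j) x) fun y hy => ?_
    · refine key.trans (le_of_eq ?_)
      rw [lintegral_indicator (hFm _), Measure.restrict_restrict (hFm _), inter_comm,
        lintegral_const_mul' _ _ (by simp)]
    · rw [setLIntegral_adapted (hone (m + j)), lintegral_indicator (hFm _),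
        Measure.restrict_restrict (hFm _), inter_comm]
      by_cases hs : IsStop bad (m + j) y
      swap
      · simp [hs]
      rw [if_pos hs, one_mul]
      set C := t.cell (m + j) y with hC
      rcases eq_or_ne (ν C) 0 with h0 | h0
      · have := hM (m + j) y (Nat.le_add_right m j) hy
        rw [← hC, h0, mul_zero] at this
        exact this.trans zero_le
      have hCR : C ⊆ R := cell_subset (Nat.le_add_right m j) hy
      calc ω C = ω C / ν C * ν C := (ENNReal.div_mul_cancel h0 (measure_ne_top _ _)).symm
        _ ≤ ω C / ν C * (2 * ν (C ∩ {y | FinalStop bad (m + j) y})) :=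
            mul_le_mul' le_rfl (measure_cell_le_two_mul_finalStop hf hs)
        _ = ∫⁻ z in C ∩ {y | FinalStop bad (m + j) y}, 2 * (ω C / ν C) ∂ν := by
            rw [setLIntegral_const]; ring
        _ ≤ _ := by
            refine setLIntegral_mono' ((measurableSet_cell _ _).inter (hFm _)) fun z hz => ?_
            refine mul_le_mul' le_rfl (ENNReal.div_le_of_le_mul ?_)
            have := hM (m + j) z (Nat.le_add_right m j) (hCR hz.1)
            rwa [cell_eq hz.1] at this
  calc _ ≤ ∑' j, 2 * ∫⁻ y in R ∩ {y | FinalStop bad (m + j) y}, M y ∂ν :=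
        ENNReal.tsum_le_tsum hj
    _ = 2 * ∫⁻ y in ⋃ j, R ∩ {y | FinalStop bad (m + j) y}, M y ∂ν := by
        rw [ENNReal.tsum_mul_left, lintegral_iUnion]
        · exact fun j => (measurableSet_cell m x).inter (hFm _)
        · intro i j hij
          rw [Function.onFun, Set.disjoint_left]
          rintro y ⟨-, hi⟩ ⟨-, hj⟩
          have := FinalStop.eq hi hj
          omega
    _ ≤ _ := mul_le_mul' le_rfl (lintegral_mono_set (iUnion_subset fun j => inter_subset_left))

end PartitionTree

/-! ### Dyadic trees of cubes -/

namespace Cube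

variable {d : ℕ}

/-- The half-open cube with the same corners, `∏ i, [corner i, corner i + side)`; it differs from the
closed cube by a null set, and the half-open cubes of a generation are disjoint. -/
def halfOpen (Q : Cube d) : Set (EuclideanSpace ℝ (Fin d)) :=
  {x | ∀ i, x i ∈ Ico (Q.corner i) (Q.corner i + Q.side)}

lemma halfOpen_eq_preimage (Q : Cube d) :
    Q.halfOpen = (WithLp.ofLp : EuclideanSpace ℝ (Fin d) → _) ⁻¹'
      (univ.pi fun i => Ico (Q.corner i) (Q.corner i + Q.side)) := by
  ext x; simp [halfOpen]

lemma measurableSet_halfOpen (Q : Cube d) : MeasurableSet Q.halfOpen := by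
  rw [halfOpen_eq_preimage]
  exact (PiLp.continuous_ofLp 2 _).measurable (MeasurableSet.univ_pi fun i => measurableSet_Ico)

lemma halfOpen_subset (Q : Cube d) : Q.halfOpen ⊆ Q.toSet := fun _ hx i => Ico_subset_Icc_self (hx i)

lemma halfOpen_ae_eq (Q : Cube d) : Q.halfOpen =ᵐ[volume] Q.toSet := by
  rw [halfOpen_eq_preimage, toSet_eq_preimage]
  exact (PiLp.volume_preserving_ofLp (Fin d)).quasiMeasurePreserving.preimage_ae_eq
    (Measure.univ_pi_Ico_ae_eq_Icc (f := fun i => Q.corner i)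
      (g := fun i => Q.corner i + Q.side))

lemma restrict_halfOpen (Q : Cube d) : volume.restrict Q.halfOpen = volume.restrict Q.toSet :=
  Measure.restrict_congr_set Q.halfOpen_ae_eq

lemma corner_mem_halfOpen (Q : Cube d) : Q.corner ∈ Q.halfOpen := fun i =>
  ⟨le_rfl, by linarith [Q.side_pos]⟩

lemma toSet_subset_of_halfOpen_subset {R Q : Cube d} (h : R.halfOpen ⊆ Q.halfOpen) :
    R.toSet ⊆ Q.toSet := by
  have hRs := R.side_pos
  intro x hx i
  refine ⟨((h R.corner_mem_halfOpen) i).1.trans (hx i).1, (hx i).2.trans ?_⟩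
  refine le_of_forall_pos_lt_add fun ε hε => ?_
  set c : EuclideanSpace ℝ (Fin d) :=
    WithLp.toLp 2 fun j => R.corner j + max 0 (R.side - ε) with hc
  have hcm : c ∈ R.halfOpen := fun j => by
    simp only [hc, mem_Ico]
    exact ⟨by linarith [le_max_left 0 (R.side - ε)],
      by linarith [max_lt hRs (show R.side - ε < R.side by linarith)]⟩
  have h1 := ((h hcm) i).2
  simp only [hc] at h1
  linarith [le_max_right 0 (R.side - ε)]

lemma edist_le_of_mem (R : Cube d) {x y : EuclideanSpace ℝ (Fin d)} (hx : x ∈ R.toSet)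
    (hy : y ∈ R.toSet) : edist x y ≤ d * ENNReal.ofReal R.side := by
  have : (x, y) ∈ R.near 1 := fun i => by
    have h1 := hx i
    have h2 := hy i
    simp only [mem_Icc, Nat.cast_one, mul_one] at *
    rw [abs_le]; constructor <;> linarith
  simpa using R.edist_mul_le_of_near this

/-- Lebesgue's differentiation theorem along cubes. -/
lemma ae_tendsto_setAverage (hd : 1 ≤ d) {f : EuclideanSpace ℝ (Fin d) → ℂ}
    (hf : LocallyIntegrable f) : ∀ᵐ x, ∀ R : ℕ → Cube d, (∀ k, x ∈ (R k).toSet) →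
      Filter.Tendsto (fun k => (R k).side) Filter.atTop (nhds 0) →
      Filter.Tendsto (fun k => ⨍ y in (R k).toSet, f y) Filter.atTop (nhds (f x)) := by
  have hdR : (1 : ℝ) ≤ d := by exact_mod_cast hd
  set V : ℝ≥0 := (volume (Metric.closedBall (0 : EuclideanSpace ℝ (Fin d)) 1)).toNNReal with hV
  have hVe : volume (Metric.closedBall (0 : EuclideanSpace ℝ (Fin d)) 1) = V :=
    (ENNReal.coe_toNNReal measure_closedBall_lt_top.ne).symm
  set C : ℝ≥0 := 3 ^ d + (3 * d) ^ d * V with hC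
  have hball : ∀ (x : EuclideanSpace ℝ (Fin d)) {ρ : ℝ}, 0 ≤ ρ →
      volume (Metric.closedBall x ρ) = ENNReal.ofReal ρ ^ d * V := fun x ρ hρ => by
    rw [Measure.addHaar_closedBall' _ x hρ, finrank_euclideanSpace_fin, hVe, ENNReal.ofReal_pow hρ]
  set v := Vitali.vitaliFamily (volume : Measure (EuclideanSpace ℝ (Fin d))) C (fun x => by
    refine Filter.Eventually.frequently (Filter.eventually_of_mem self_mem_nhdsWithin fun ρ hρ => ?_)
    have hρ0 : (0 : ℝ) < ρ := hρ
    rw [hball x (by positivity), hball x hρ0.le, ENNReal.ofReal_mul (by norm_num), mul_pow,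
      mul_assoc]
    refine mul_le_mul' ?_ le_rfl
    rw [hC]
    push_cast
    exact le_add_right (by simp)) with hv
  filter_upwards [v.ae_tendsto_average hf] with x hx R hxR hR
  refine hx.comp ?_
  rw [VitaliFamily.tendsto_filterAt_iff]
  have hsub : ∀ k, (R k).toSet ⊆ Metric.closedBall x (d * (R k).side) := fun k y hy => by
    have h1 := (R k).edist_le_of_mem hy (hxR k)
    rw [← ENNReal.ofReal_natCast, ← ENNReal.ofReal_mul (by positivity)] at h1
    rw [← Metric.closedEBall_ofReal (by have := (R k).side_pos; positivity)]
    exact h1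
  refine ⟨Filter.Eventually.of_forall fun k => ⟨(R k).isClosed_toSet, ?_,
    d * (R k).side, hsub k, ?_⟩, fun ε hε => ?_⟩
  · set U : Set (EuclideanSpace ℝ (Fin d)) := (WithLp.ofLp) ⁻¹'
      (univ.pi fun i => Ioo ((R k).corner i) ((R k).corner i + (R k).side)) with hU
    have hUo : IsOpen U := (isOpen_set_pi finite_univ fun i _ => isOpen_Ioo).preimage
      (PiLp.continuous_ofLp 2 _)
    refine ⟨WithLp.toLp 2 fun i => (R k).corner i + (R k).side / 2, ?_⟩
    refine mem_interior.mpr ⟨U, fun y hy i => Ioo_subset_Icc_self (hy i (mem_univ i)), hUo, ?_⟩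
    intro i _
    have := (R k).side_pos
    simp only [mem_Ioo]
    constructor <;> linarith
  · have hs := (R k).side_pos
    rw [hball x (by positivity), volume_toSet, ← mul_assoc 3, ENNReal.ofReal_mul (by positivity),
      mul_pow, hC]
    push_cast
    rw [ENNReal.ofReal_mul (by norm_num), ENNReal.ofReal_natCast, ENNReal.ofReal_ofNat, add_mul]
    refine le_add_left (le_of_eq ?_)
    ring
  · have h1 : Filter.Tendsto (fun k => d * (R k).side) Filter.atTop (nhds 0) := by
      simpa using hR.const_mul (d : ℝ)
    filter_upwards [h1.eventually (gt_mem_nhds hε)] with k hk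
    exact (hsub k).trans (Metric.closedBall_subset_closedBall hk.le)

/-- The dyadic grid of the cube `Q`, shifted by the proportion `θ` of its side length. It is a
partition of the whole space; the measures that are used live on `Q`. -/
noncomputable def dyadicTree (Q : Cube d) (θ : ℝ) :
    PartitionTree (EuclideanSpace ℝ (Fin d)) (Fin d → ℤ) where
  idx k x i := ⌊2 ^ k * ((x i - Q.corner i) / Q.side + θ)⌋
  measurableSet_fiber k m := by
    have : Measurable fun (x : EuclideanSpace ℝ (Fin d)) (i : Fin d) =>
        ⌊2 ^ k * ((x i - Q.corner i) / Q.side + θ)⌋ :=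
      measurable_pi_iff.mpr fun i => Int.measurable_floor.comp (by fun_prop)
    exact this (measurableSet_singleton m)
  refine' k x y h := by
    funext i
    have h1 := congrFun h i
    simp only [pow_succ'] at h1
    have key : ∀ z : ℝ, ⌊z⌋ = ⌊2 * z⌋ / 2 := fun z => by
      refine (Int.floor_eq_iff.mpr ⟨?_, ?_⟩)
      · have h2 := Int.floor_le (2 * z)
        have h3 : (⌊2 * z⌋ / 2 : ℤ) * 2 ≤ ⌊2 * z⌋ := Int.ediv_mul_le _ (by norm_num)
        have h4 : (((⌊2 * z⌋ / 2 : ℤ) : ℝ)) * 2 ≤ (⌊2 * z⌋ : ℝ) := by exact_mod_cast h3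
        linarith
      · have h2 := Int.lt_floor_add_one (2 * z)
        have h3 : ⌊2 * z⌋ + 1 ≤ ((⌊2 * z⌋ / 2 : ℤ) + 1) * 2 := by omega
        have h4 : (⌊2 * z⌋ : ℝ) + 1 ≤ (((⌊2 * z⌋ / 2 : ℤ) : ℝ) + 1) * 2 := by exact_mod_cast h3
        linarith
    rw [key, ← mul_assoc, h1, mul_assoc, ← key]

/-- The cells of `t` inside the half-open cube `Q` are half-open cubes, and the side length in
generation `k` is `2^{-k}` times that of `Q`, up to a factor `3`. -/
structure IsCubeTree (Q : Cube d) {ι : Type*} (t : PartitionTree (EuclideanSpace ℝ (Fin d)) ι) :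
    Prop where
  exists_cube : ∀ k, ∀ x ∈ Q.halfOpen, ∃ R : Cube d, R.halfOpen = t.cell k x ∩ Q.halfOpen ∧
    R.side ≤ Q.side / 2 ^ k ∧ Q.side / 2 ^ k ≤ 3 * R.side

lemma mem_cell_dyadicTree {Q : Cube d} {θ : ℝ} {k : ℕ} {x y : EuclideanSpace ℝ (Fin d)} :
    y ∈ (Q.dyadicTree θ).cell k x ↔ ∀ i, y i ∈ Ico
      (Q.corner i + Q.side * (((Q.dyadicTree θ).idx k x i : ℝ) / 2 ^ k - θ))
      (Q.corner i + Q.side * ((((Q.dyadicTree θ).idx k x i : ℝ) + 1) / 2 ^ k - θ)) := by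
  have hs := Q.side_pos
  have h2 : (0 : ℝ) < 2 ^ k := by positivity
  rw [PartitionTree.mem_cell, funext_iff]
  refine forall_congr' fun i => ?_
  set m := (Q.dyadicTree θ).idx k x i
  change ⌊2 ^ k * ((y i - Q.corner i) / Q.side + θ)⌋ = m ↔ _
  rw [Int.floor_eq_iff, mem_Ico]
  have e1 : (m : ℝ) ≤ 2 ^ k * ((y i - Q.corner i) / Q.side + θ) ↔
      Q.corner i + Q.side * ((m : ℝ) / 2 ^ k - θ) ≤ y i := by
    rw [← div_le_iff₀' h2, ← sub_le_iff_le_add, le_div_iff₀ hs]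
    constructor <;> intro h <;> linarith
  have e2 : 2 ^ k * ((y i - Q.corner i) / Q.side + θ) < (m : ℝ) + 1 ↔
      y i < Q.corner i + Q.side * (((m : ℝ) + 1) / 2 ^ k - θ) := by
    rw [← lt_div_iff₀' h2, ← lt_sub_iff_add_lt, div_lt_iff₀ hs]
    constructor <;> intro h <;> linarith
  rw [e1, e2]

lemma idx_dyadicTree_mem {Q : Cube d} {k : ℕ} {x : EuclideanSpace ℝ (Fin d)}
    (hx : x ∈ Q.halfOpen) (i : Fin d) :
    0 ≤ (Q.dyadicTree 0).idx k x i ∧ ((Q.dyadicTree 0).idx k x i : ℝ) + 1 ≤ 2 ^ k := by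
  have hs := Q.side_pos
  have h1 := hx i
  have h3 : 0 ≤ (x i - Q.corner i) / Q.side := div_nonneg (by linarith [h1.1]) hs.le
  have h4 : (x i - Q.corner i) / Q.side < 1 := by rw [div_lt_one hs]; linarith [h1.2]
  change 0 ≤ ⌊2 ^ k * ((x i - Q.corner i) / Q.side + 0)⌋ ∧ _
  rw [add_zero]
  refine ⟨Int.floor_nonneg.mpr (by positivity), ?_⟩
  have h5 : ⌊2 ^ k * ((x i - Q.corner i) / Q.side + 0)⌋ < 2 ^ k := by
    rw [Int.floor_lt, add_zero]
    push_cast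
    have : (0 : ℝ) < 2 ^ k := by positivity
    nlinarith
  have h6 : (Q.dyadicTree 0).idx k x i + 1 ≤ (2 : ℤ) ^ k := Int.add_one_le_iff.mpr h5
  exact_mod_cast h6

lemma isCubeTree_dyadicTree (Q : Cube d) : Q.IsCubeTree (Q.dyadicTree 0) where
  exists_cube k x hx := by
    have hs := Q.side_pos
    have h2 : (0 : ℝ) < 2 ^ k := by positivity
    refine ⟨⟨WithLp.toLp 2 fun i => Q.corner i + Q.side *
      (((Q.dyadicTree 0).idx k x i : ℝ) / 2 ^ k), Q.side / 2 ^ k, by positivity⟩, ?_, le_rfl, ?_⟩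
    · ext y
      rw [mem_inter_iff, mem_cell_dyadicTree]
      simp only [halfOpen, mem_ofPred_eq, sub_zero]
      have e : ∀ i, Q.corner i + Q.side * (((Q.dyadicTree 0).idx k x i : ℝ) / 2 ^ k) +
          Q.side / 2 ^ k = Q.corner i + Q.side *
            ((((Q.dyadicTree 0).idx k x i : ℝ) + 1) / 2 ^ k) := fun i => by ring
      simp only [e]
      refine ⟨fun h => ⟨h, fun i => ?_⟩, fun h => h.1⟩
      obtain ⟨h3, h4⟩ := idx_dyadicTree_mem (k := k) hx i
      have h5 : (0 : ℝ) ≤ (Q.dyadicTree 0).idx k x i := by exact_mod_cast h3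
      have h6 : (((Q.dyadicTree 0).idx k x i : ℝ) + 1) / 2 ^ k ≤ 1 := by
        rwa [div_le_one h2]
      have h7 : 0 ≤ Q.side * (((Q.dyadicTree 0).idx k x i : ℝ) / 2 ^ k) := by positivity
      have h8 := h i
      rw [mem_Ico] at h8 ⊢
      constructor
      · linarith [h8.1]
      · nlinarith [h8.2]
    · simp only
      have : 0 < Q.side / 2 ^ k := by positivity
      linarith

lemma cell_zero_dyadicTree {Q : Cube d} {x : EuclideanSpace ℝ (Fin d)} (hx : x ∈ Q.halfOpen) :
    Q.halfOpen ⊆ (Q.dyadicTree 0).cell 0 x := by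
  have h : ∀ z ∈ Q.halfOpen, (Q.dyadicTree 0).idx 0 z = 0 := fun z hz => by
    funext i
    obtain ⟨h1, h2⟩ := idx_dyadicTree_mem (k := 0) hz i
    have h3 : (Q.dyadicTree 0).idx 0 z i + 1 ≤ 1 := by
      have : ((Q.dyadicTree 0).idx 0 z i : ℝ) + 1 ≤ 1 := by simpa using h2
      exact_mod_cast this
    rw [Pi.zero_apply]; omega
  intro y hy
  rw [PartitionTree.mem_cell, h y hy, h x hx]

/-- On the line, the cells of a shifted grid are cut off at the endpoints of `Q`. For the shift by
a third, the pieces that remain are not too short. -/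
lemma isCubeTree_dyadicTree_third (Q : Cube 1) : Q.IsCubeTree (Q.dyadicTree (1 / 3)) where
  exists_cube k x hx := by
    have hs := Q.side_pos
    have h2 : (0 : ℝ) < 2 ^ k := by positivity
    set m : ℤ := (Q.dyadicTree (1 / 3)).idx k x 0 with hm
    set A : ℝ := (m : ℝ) / 2 ^ k - 1 / 3 with hA
    set B : ℝ := ((m : ℝ) + 1) / 2 ^ k - 1 / 3 with hB
    have hxc := (mem_cell_dyadicTree.mp (PartitionTree.self_mem_cell (t := Q.dyadicTree (1 / 3))
      k x)) 0
    rw [← hm, ← hA, ← hB, mem_Ico] at hxc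
    have hx0 := hx 0
    rw [mem_Ico] at hx0
    have hBA : B - A = 1 / 2 ^ k := by rw [hA, hB]; ring
    have h3 : (0 : ℝ) < 3 * 2 ^ k := by positivity
    -- both `B` and `1 - A` are positive integer multiples of `1 / (3 * 2 ^ k)`
    have hBpos : 1 / (3 * 2 ^ k) ≤ B := by
      have h4 : 0 < B := by
        have : 0 < Q.side * B := by linarith [hxc.2, hx0.1]
        exact (mul_pos_iff_of_pos_left hs).mp this
      have h5 : B = ((3 * (m + 1) - 2 ^ k : ℤ) : ℝ) / (3 * 2 ^ k) := by
        rw [hB]; push_cast; field_simp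
      rw [h5] at h4 ⊢
      have h6 : (0 : ℝ) < ((3 * (m + 1) - 2 ^ k : ℤ) : ℝ) := by
        have := (div_pos_iff_of_pos_right h3).mp h4
        exact this
      have h7 : 1 ≤ (3 * (m + 1) - 2 ^ k : ℤ) := by exact_mod_cast h6
      have h8 : (1 : ℝ) ≤ ((3 * (m + 1) - 2 ^ k : ℤ) : ℝ) := by exact_mod_cast h7
      gcongr
    have hApos : 1 / (3 * 2 ^ k) ≤ 1 - A := by
      have h4 : 0 < 1 - A := by
        have : 0 < Q.side * (1 - A) := by linarith [hxc.1, hx0.2]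
        exact (mul_pos_iff_of_pos_left hs).mp this
      have h5 : 1 - A = ((4 * 2 ^ k - 3 * m : ℤ) : ℝ) / (3 * 2 ^ k) := by
        rw [hA]; push_cast; field_simp; ring
      rw [h5] at h4 ⊢
      have h6 : (0 : ℝ) < ((4 * 2 ^ k - 3 * m : ℤ) : ℝ) := (div_pos_iff_of_pos_right h3).mp h4
      have h7 : 1 ≤ (4 * 2 ^ k - 3 * m : ℤ) := by exact_mod_cast h6
      have h8 : (1 : ℝ) ≤ ((4 * 2 ^ k - 3 * m : ℤ) : ℝ) := by exact_mod_cast h7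
      gcongr
    have h1k : 1 / (3 * 2 ^ k) ≤ (1 : ℝ) := by
      rw [div_le_one h3]
      have : (1 : ℝ) ≤ 2 ^ k := one_le_pow₀ (by norm_num)
      linarith
    have h1k' : 1 / (3 * 2 ^ k) ≤ B - A := by
      rw [hBA]
      exact one_div_le_one_div_of_le h2 (by linarith)
    have hlow : 1 / (3 * 2 ^ k) ≤ min 1 B - max 0 A := by
      rcases min_choice 1 B with h | h <;> rcases max_choice 0 A with h' | h' <;>
        rw [h, h'] <;> linarith
    have hlow0 : 0 < min 1 B - max 0 A := lt_of_lt_of_le (by positivity) hlow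
    refine ⟨⟨WithLp.toLp 2 fun i => Q.corner i + Q.side * max 0 A,
      Q.side * (min 1 B - max 0 A), by positivity⟩, ?_, ?_, ?_⟩
    · ext y
      rw [mem_inter_iff, mem_cell_dyadicTree]
      simp only [halfOpen, mem_ofPred_eq, Fin.forall_fin_one, ← hm, ← hA, ← hB, mem_Ico]
      rw [← and_and_and_comm, mul_sub, add_add_sub_cancel]
      rw [mul_max_of_nonneg _ _ hs.le, mul_min_of_nonneg _ _ hs.le, ← max_add_add_left,
        ← min_add_add_left, max_le_iff, lt_min_iff, mul_zero, add_zero, mul_one]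
      tauto
    · simp only
      have : min 1 B - max 0 A ≤ 1 / 2 ^ k := by
        rw [← hBA]; linarith [min_le_right 1 B, le_max_right 0 A]
      calc _ ≤ Q.side * (1 / 2 ^ k) := mul_le_mul_of_nonneg_left this hs.le
        _ = _ := by ring
    · simp only
      calc Q.side / 2 ^ k = 3 * (Q.side * (1 / (3 * 2 ^ k))) := by field_simp
        _ ≤ _ := mul_le_mul_of_nonneg_left (mul_le_mul_of_nonneg_left hlow hs.le) (by norm_num)

end Cube

/-! ### The Fujii–Wilson condition on a tree -/

namespace PartitionTree

variable {X ι : Type*} [MeasurableSpace X] {t : PartitionTree X ι}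

/-- A Fujii–Wilson condition for the measure `ω` relative to `ν`, with constant `B`: on every cell
there is a function `M` which dominates the averages of `ω` over all smaller cells, and whose
integral is at most `B` times the mass of the cell. -/
def FujiiWilson (t : PartitionTree X ι) (ν ω : Measure X) (B : ℝ≥0∞) : Prop :=
  ∀ k x, ∃ M : X → ℝ≥0∞,
    (∀ j y, k ≤ j → y ∈ t.cell k x → ω (t.cell j y) ≤ M y * ν (t.cell j y)) ∧
      ∫⁻ y in t.cell k x, M y ∂ν ≤ B * ω (t.cell k x)

variable {ν ω : Measure X} [IsFiniteMeasure ν] {B : ℝ≥0∞}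

open Classical in
/-- The stopping cells of the sparse stopping rule form a Carleson family. -/
lemma FujiiWilson.carleson [Countable ι] (h : t.FujiiWilson ν ω B) {f : X → ℂ}
    (hf : Integrable f ν) (k : ℕ) (x : X) :
    ∫⁻ y in t.cell k x, ∑' j, (if IsStop (t.OscDoubled ν f) (k + j) y then 1 else 0) ∂ω ≤
      2 * B * ω (t.cell k x) := by
  obtain ⟨M, hM, hMB⟩ := h k x
  rw [mul_assoc]
  exact (lintegral_tsum_isStop_le hf hM).trans (mul_le_mul' le_rfl hMB)

/-- The mass of the cells decays, at a rate given by the Fujii–Wilson constant. Otherwise a chain of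
`m` nested cells has nearly constant mass, and each of the disjoint differences of consecutive
cells contributes a quarter of it to the integral of the maximal function. -/
lemma FujiiWilson.measure_cell_le [IsFiniteMeasure ω] (h : t.FujiiWilson ν ω B)
    (hν : ∀ k x, 2 * ν (t.cell (k + 3) x) ≤ ν (t.cell k x)) {m : ℕ} (hm : 4 * B < m) (k : ℕ)
    (x : X) : ω (t.cell (k + 3 * m) x) ≤ 2⁻¹ * ω (t.cell k x) := by
  by_contra! hcon
  obtain ⟨M, hM, hMB⟩ := h k x
  set C : ℕ → Set X := fun j => t.cell (k + 3 * j) x with hC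
  have hCm : ∀ j, MeasurableSet (C j) := fun j => measurableSet_cell _ _
  have hanti : ∀ {i j : ℕ}, i ≤ j → C j ⊆ C i := fun hij =>
    cell_subset (by omega) (self_mem_cell _ x)
  have hC0 : C 0 = t.cell k x := rfl
  set W := ω (t.cell k x) with hW
  have hW0 : W ≠ 0 := by
    intro h0
    have h1 : ω (C m) ≤ ω (C 0) := measure_mono (hanti (Nat.zero_le m))
    rw [hC0, ← hW, h0] at h1
    rw [h0, mul_zero] at hcon
    exact absurd hcon (not_lt.mpr h1)
  have hWt : W ≠ ∞ := measure_ne_top _ _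
  have hstep : ∀ j < m, 4⁻¹ * W ≤ ∫⁻ y in C j \ C (j + 1), M y ∂ν := by
    intro j hj
    have h1 : 2⁻¹ * W ≤ ω (C j) := hcon.le.trans (measure_mono (hanti hj.le))
    have hνj : ν (C j) ≠ 0 := by
      intro h0
      have h2 := hM (k + 3 * j) x (by omega) (self_mem_cell k x)
      change ω (C j) ≤ M x * ν (C j) at h2
      rw [h0, mul_zero] at h2
      have h3 := h1.trans h2
      rw [nonpos_iff_eq_zero, mul_eq_zero] at h3
      rcases h3 with h3 | h3
      · simp at h3
      · exact hW0 h3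
    have hνt : ν (C j) ≠ ∞ := measure_ne_top _ _
    have hdiff : 2⁻¹ * ν (C j) ≤ ν (C j \ C (j + 1)) := by
      have h2 : 2 * ν (C (j + 1)) ≤ ν (C j) := by
        have := hν (k + 3 * j) x
        exact this
      have h3 : ν (C (j + 1)) ≤ 2⁻¹ * ν (C j) := by
        calc ν (C (j + 1)) = 2⁻¹ * (2 * ν (C (j + 1))) := by
              rw [← mul_assoc, ENNReal.inv_mul_cancel (by simp) (by simp), one_mul]
          _ ≤ _ := mul_le_mul' le_rfl h2
      have h4 : 2⁻¹ * ν (C j) + 2⁻¹ * ν (C j) ≤ 2⁻¹ * ν (C j) + ν (C j \ C (j + 1)) := by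
        rw [← add_mul, ENNReal.inv_two_add_inv_two, one_mul]
        calc ν (C j) = ν (C j ∩ C (j + 1)) + ν (C j \ C (j + 1)) :=
              (measure_inter_add_sdiff _ (hCm _)).symm
          _ ≤ _ := add_le_add ((measure_mono inter_subset_right).trans h3) le_rfl
      exact (ENNReal.add_le_add_iff_left
        (ENNReal.mul_ne_top (by simp) (measure_ne_top ν _))).mp h4
    calc 4⁻¹ * W = 2⁻¹ * (2⁻¹ * W) := by
          rw [← mul_assoc, ← ENNReal.mul_inv (by simp) (by simp)]; norm_num
      _ ≤ 2⁻¹ * ω (C j) := mul_le_mul' le_rfl h1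
      _ = ω (C j) / ν (C j) * (2⁻¹ * ν (C j)) := by
          rw [mul_left_comm, ENNReal.div_mul_cancel hνj hνt]
      _ ≤ ω (C j) / ν (C j) * ν (C j \ C (j + 1)) := mul_le_mul' le_rfl hdiff
      _ = ∫⁻ y in C j \ C (j + 1), ω (C j) / ν (C j) ∂ν := by rw [setLIntegral_const]
      _ ≤ _ := by
          refine setLIntegral_mono' ((hCm _).diff (hCm _)) fun y hy => ?_
          refine ENNReal.div_le_of_le_mul ?_
          have h2 := hM (k + 3 * j) y (by omega) (hanti (Nat.zero_le j) hy.1)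
          rwa [cell_eq (show t.idx (k + 3 * j) y = t.idx (k + 3 * j) x from hy.1)] at h2
  have hdisj : Pairwise (Function.onFun Disjoint fun j => C j \ C (j + 1)) := by
    have key : ∀ {i j : ℕ}, i < j → Disjoint (C i \ C (i + 1)) (C j \ C (j + 1)) := by
      intro i j hij
      rw [Set.disjoint_left]
      exact fun y hi hj => hi.2 (hanti hij hj.1)
    intro i j hij
    rcases lt_or_gt_of_ne hij with h | h
    · exact key h
    · exact (key h).symm
  have hsum : (m : ℝ≥0∞) * (4⁻¹ * W) ≤ B * W := by
    calc (m : ℝ≥0∞) * (4⁻¹ * W) = ∑ j ∈ Finset.range m, 4⁻¹ * W := by simp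
      _ ≤ ∑ j ∈ Finset.range m, ∫⁻ y in C j \ C (j + 1), M y ∂ν :=
          Finset.sum_le_sum fun j hj => hstep j (Finset.mem_range.mp hj)
      _ ≤ ∑' j, ∫⁻ y in C j \ C (j + 1), M y ∂ν := ENNReal.sum_le_tsum _
      _ = ∫⁻ y in ⋃ j, C j \ C (j + 1), M y ∂ν :=
          (lintegral_iUnion (fun j => (hCm _).diff (hCm _)) hdisj _).symm
      _ ≤ ∫⁻ y in t.cell k x, M y ∂ν := lintegral_mono_set (iUnion_subset fun j =>
          sdiff_subset.trans (hanti (Nat.zero_le j)))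
      _ ≤ _ := hMB
  rw [← mul_assoc] at hsum
  have h1 := (ENNReal.mul_le_mul_iff_left hW0 hWt).mp hsum
  have h2 : (m : ℝ≥0∞) ≤ 4 * B := by
    calc (m : ℝ≥0∞) = 4 * (m * 4⁻¹) := by
          rw [mul_left_comm, ENNReal.mul_inv_cancel (by simp) (by simp), mul_one]
      _ ≤ _ := mul_le_mul' le_rfl h1
  exact absurd hm (not_lt.mpr h2)

end PartitionTree

/-! ### Weights on cubes -/

namespace Cube

variable {d : ℕ} {Q : Cube d} {ι : Type*} {t : PartitionTree (EuclideanSpace ℝ (Fin d)) ι}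

/-- The measure with density `w` on the half-open cube `Q`. -/
noncomputable def wt (Q : Cube d) (w : EuclideanSpace ℝ (Fin d) → ℝ≥0∞) :
    Measure (EuclideanSpace ℝ (Fin d)) :=
  (volume.restrict Q.halfOpen).withDensity w

instance (Q : Cube d) : IsFiniteMeasure (volume.restrict Q.halfOpen) :=
  ⟨by rw [restrict_halfOpen, Measure.restrict_apply_univ]; exact Q.volume_ne_top.lt_top⟩

lemma isFiniteMeasure_wt {w : EuclideanSpace ℝ (Fin d) → ℝ≥0∞} (hw : ∫⁻ x in Q.toSet, w x ≠ ∞) :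
    IsFiniteMeasure (Q.wt w) :=
  isFiniteMeasure_withDensity (by rwa [restrict_halfOpen])

lemma lintegral_wt (Q : Cube d) {w : EuclideanSpace ℝ (Fin d) → ℝ≥0∞} (hw : Measurable w)
    {g : EuclideanSpace ℝ (Fin d) → ℝ≥0∞} (hg : Measurable g) :
    ∫⁻ x, g x ∂Q.wt w = ∫⁻ x in Q.toSet, w x * g x := by
  rw [wt, lintegral_withDensity_eq_lintegral_mul _ hw hg, restrict_halfOpen]; rfl

lemma setLIntegral_eq_of_halfOpen_eq {R : Cube d} {s : Set (EuclideanSpace ℝ (Fin d))}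
    (hs : MeasurableSet s) (hR : R.halfOpen = s ∩ Q.halfOpen)
    (g : EuclideanSpace ℝ (Fin d) → ℝ≥0∞) :
    ∫⁻ x in s, g x ∂(volume.restrict Q.halfOpen) = ∫⁻ x in R.toSet, g x := by
  rw [Measure.restrict_restrict hs, ← hR, restrict_halfOpen]

lemma wt_eq_of_halfOpen_eq {R : Cube d} {s : Set (EuclideanSpace ℝ (Fin d))}
    (hs : MeasurableSet s) (hR : R.halfOpen = s ∩ Q.halfOpen)
    (w : EuclideanSpace ℝ (Fin d) → ℝ≥0∞) : Q.wt w s = ∫⁻ x in R.toSet, w x := by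
  rw [wt, withDensity_apply _ hs, setLIntegral_eq_of_halfOpen_eq hs hR]

lemma restrict_eq_of_halfOpen_eq {R : Cube d} {s : Set (EuclideanSpace ℝ (Fin d))}
    (hs : MeasurableSet s) (hR : R.halfOpen = s ∩ Q.halfOpen) :
    volume.restrict Q.halfOpen s = volume R.toSet := by
  rw [Measure.restrict_apply hs, ← hR, measure_congr R.halfOpen_ae_eq]

/-- The cells that meet `Q` are given by cubes; the other cells are null sets. -/
lemma IsCubeTree.cases (h : Q.IsCubeTree t) (k : ℕ) (x : EuclideanSpace ℝ (Fin d)) :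
    t.cell k x ∩ Q.halfOpen = ∅ ∨ ∃ R : Cube d, R.halfOpen = t.cell k x ∩ Q.halfOpen ∧
      R.toSet ⊆ Q.toSet ∧ R.side ≤ Q.side / 2 ^ k ∧ Q.side / 2 ^ k ≤ 3 * R.side := by
  rcases (t.cell k x ∩ Q.halfOpen).eq_empty_or_nonempty with h0 | ⟨y, hy, hyQ⟩
  · exact Or.inl h0
  · obtain ⟨R, h1, h2, h3⟩ := h.exists_cube k y hyQ
    rw [PartitionTree.cell_eq hy] at h1
    exact Or.inr ⟨R, h1, toSet_subset_of_halfOpen_subset (h1 ▸ inter_subset_right), h2, h3⟩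

lemma restrict_cell_eq_zero {k : ℕ} {x : EuclideanSpace ℝ (Fin d)}
    (h : t.cell k x ∩ Q.halfOpen = ∅) : volume.restrict Q.halfOpen (t.cell k x) = 0 := by
  rw [Measure.restrict_apply (PartitionTree.measurableSet_cell k x), h, measure_empty]

lemma wt_cell_eq_zero {k : ℕ} {x : EuclideanSpace ℝ (Fin d)}
    (h : t.cell k x ∩ Q.halfOpen = ∅) (w : EuclideanSpace ℝ (Fin d) → ℝ≥0∞) :
    Q.wt w (t.cell k x) = 0 :=
  withDensity_absolutelyContinuous _ _ (restrict_cell_eq_zero h)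

lemma IsCubeTree.two_mul_measure_cell_le (h : Q.IsCubeTree t) (hd : 1 ≤ d) (k : ℕ)
    (x : EuclideanSpace ℝ (Fin d)) :
    2 * volume.restrict Q.halfOpen (t.cell (k + 3) x) ≤ volume.restrict Q.halfOpen (t.cell k x) := by
  rcases h.cases (k + 3) x with h0 | ⟨R', hR', -, hs', -⟩
  · rw [restrict_cell_eq_zero h0, mul_zero]; exact zero_le
  rcases h.cases k x with h0 | ⟨R, hR, -, -, hs⟩
  · exfalso
    have h1 : R'.halfOpen ⊆ t.cell k x ∩ Q.halfOpen := by
      rw [hR']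
      exact inter_subset_inter_left _
        (PartitionTree.cell_subset (by omega) (PartitionTree.self_mem_cell k x))
    exact (h0 ▸ h1 R'.corner_mem_halfOpen : _ ∈ (∅ : Set _))
  rw [restrict_eq_of_halfOpen_eq (PartitionTree.measurableSet_cell _ _) hR',
    restrict_eq_of_halfOpen_eq (PartitionTree.measurableSet_cell _ _) hR, volume_toSet, volume_toSet]
  have h2 : 2 * R'.side ≤ R.side := by
    rw [pow_add, ← div_div] at hs'
    have := R'.side_pos
    linarith
  obtain ⟨n, rfl⟩ : ∃ n, d = n + 1 := ⟨d - 1, by omega⟩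
  calc 2 * ENNReal.ofReal R'.side ^ (n + 1) ≤ 2 ^ (n + 1) * ENNReal.ofReal R'.side ^ (n + 1) := by
        refine mul_le_mul' ?_ le_rfl
        exact le_self_pow₀ (by norm_num) (by omega)
    _ = ENNReal.ofReal (2 * R'.side) ^ (n + 1) := by
        rw [ENNReal.ofReal_mul (by norm_num), mul_pow, ENNReal.ofReal_ofNat]
    _ ≤ _ := by gcongr

lemma IsCubeTree.measure_cell_le (h : Q.IsCubeTree t) {k : ℕ} {x : EuclideanSpace ℝ (Fin d)}
    (hx : x ∈ Q.halfOpen) : volume.restrict Q.halfOpen (t.cell k x) ≤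
      6 ^ d * volume.restrict Q.halfOpen (t.cell (k + 1) x) := by
  obtain ⟨R, hR, hs, -⟩ := h.exists_cube k x hx
  obtain ⟨R', hR', -, hs'⟩ := h.exists_cube (k + 1) x hx
  rw [restrict_eq_of_halfOpen_eq (PartitionTree.measurableSet_cell _ _) hR',
    restrict_eq_of_halfOpen_eq (PartitionTree.measurableSet_cell _ _) hR, volume_toSet, volume_toSet,
    ← mul_pow]
  have h2 : R.side ≤ 6 * R'.side := by
    rw [pow_succ, ← div_div] at hs'
    linarith
  calc ENNReal.ofReal R.side ^ d ≤ ENNReal.ofReal (6 * R'.side) ^ d := by gcongr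
    _ = _ := by rw [ENNReal.ofReal_mul (by norm_num), ENNReal.ofReal_ofNat]

lemma IsCubeTree.measure_cell_ne_zero (h : Q.IsCubeTree t) {k : ℕ} {x : EuclideanSpace ℝ (Fin d)}
    (hx : x ∈ Q.halfOpen) : volume.restrict Q.halfOpen (t.cell k x) ≠ 0 := by
  obtain ⟨R, hR, -, -⟩ := h.exists_cube k x hx
  rw [restrict_eq_of_halfOpen_eq (PartitionTree.measurableSet_cell _ _) hR]
  exact R.volume_ne_zero

/-- Lebesgue's differentiation theorem along a tree of cubes. -/
lemma IsCubeTree.ae_tendsto_mean (h : Q.IsCubeTree t) (hd : 1 ≤ d)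
    {f : EuclideanSpace ℝ (Fin d) → ℂ} (hf : Integrable f (volume.restrict Q.halfOpen)) :
    ∀ᵐ x ∂(volume.restrict Q.halfOpen), Filter.Tendsto
      (fun k => t.mean (volume.restrict Q.halfOpen) f k x) Filter.atTop (nhds (f x)) := by
  have hQm := Q.measurableSet_halfOpen
  have hfi : Integrable (Q.halfOpen.indicator f) := (integrable_indicator_iff hQm).mpr hf
  rw [ae_restrict_iff' hQm]
  filter_upwards [ae_tendsto_setAverage hd hfi.locallyIntegrable] with x hx hxQ
  choose R hR hs _ using fun k => h.exists_cube k x hxQ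
  have h1 : Filter.Tendsto (fun k => (R k).side) Filter.atTop (nhds 0) := by
    refine squeeze_zero (fun k => (R k).side_pos.le) hs ?_
    have := (tendsto_pow_atTop_nhds_zero_of_lt_one (show (0 : ℝ) ≤ 2⁻¹ by norm_num)
      (by norm_num)).const_mul Q.side
    simpa [div_eq_mul_inv] using this
  have h2 := hx R (fun k => (R k).halfOpen_subset (by rw [hR k]; exact ⟨rfl, hxQ⟩)) h1
  rw [indicator_of_mem hxQ] at h2
  refine h2.congr fun k => ?_
  rw [PartitionTree.mean, Measure.restrict_restrict (PartitionTree.measurableSet_cell k x), ← hR k,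
    ← restrict_halfOpen]
  refine setAverage_congr_fun (R k).measurableSet_halfOpen (Filter.Eventually.of_forall fun y hy => ?_)
  rw [hR k] at hy
  exact indicator_of_mem hy.2 f

end Cube

namespace Cube

variable {d : ℕ} {Q : Cube d} {ι : Type*} {t : PartitionTree (EuclideanSpace ℝ (Fin d)) ι}

/-! ### The characteristics of the weights -/

lemma setLIntegral_ne_zero (R : Cube d) {g : EuclideanSpace ℝ (Fin d) → ℝ≥0∞}
    (hg : AEMeasurable g (volume.restrict R.toSet)) (hpos : ∀ x ∈ R.toSet, g x ≠ 0) :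
    ∫⁻ x in R.toSet, g x ≠ 0 := by
  intro h0
  rw [lintegral_eq_zero_iff' hg, Filter.EventuallyEq, ae_restrict_iff' R.measurableSet_toSet] at h0
  have h1 : ∀ᵐ x, x ∉ R.toSet := h0.mono fun x hx hxR => hpos x hxR (hx hxR)
  exact R.volume_ne_zero (by simpa [ae_iff] using h1)

lemma pAverage_one_mul (S : Cube d) {w : EuclideanSpace ℝ (Fin d) → ℝ}
    (hw : ∀ x ∈ S.toSet, 0 ≤ w x) :
    pAverage 1 S w * volume S.toSet = ∫⁻ x in S.toSet, ENNReal.ofReal (w x) := by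
  rw [pAverage, eLpNorm_one_eq_lintegral_enorm, lintegral_smul_measure, smul_eq_mul,
    mul_right_comm, ENNReal.inv_mul_cancel S.volume_ne_zero S.volume_ne_top, one_mul]
  exact setLIntegral_congr_fun S.measurableSet_toSet fun x hx => Real.enorm_of_nonneg (hw x hx)

lemma lintegral_iSup_le_aInftyChar {w : EuclideanSpace ℝ (Fin d) → ℝ}
    (hw : AEMeasurable w (volume.restrict Q.toSet)) (hpos : ∀ x ∈ Q.toSet, 0 < w x)
    (hint : ∫⁻ x in Q.toSet, ENNReal.ofReal (w x) ≠ ∞) {R : Cube d} (hR : R.toSet ⊆ Q.toSet) :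
    ∫⁻ x in R.toSet, ⨆ (S : Cube d) (_ : S.toSet ⊆ R.toSet),
        S.toSet.indicator (fun _ => pAverage 1 S w) x ≤
      aInftyChar Q w * ∫⁻ x in R.toSet, ENNReal.ofReal (w x) := by
  refine (ENNReal.div_le_iff ?_ ?_).mp (le_iSup₂_of_le R hR le_rfl)
  · refine R.setLIntegral_ne_zero (hw.mono_measure (Measure.restrict_mono hR le_rfl)).ennreal_ofReal
      fun x hx => ?_
    simpa using hpos x (hR hx)
  · exact ne_top_of_le_ne_top hint (lintegral_mono_set hR)

lemma one_le_aInftyChar {w : EuclideanSpace ℝ (Fin d) → ℝ}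
    (hw : AEMeasurable w (volume.restrict Q.toSet)) (hpos : ∀ x ∈ Q.toSet, 0 < w x)
    (hint : ∫⁻ x in Q.toSet, ENNReal.ofReal (w x) ≠ ∞) : 1 ≤ aInftyChar Q w := by
  have h1 := lintegral_iSup_le_aInftyChar hw hpos hint (subset_refl Q.toSet)
  have h0 : ∫⁻ x in Q.toSet, ENNReal.ofReal (w x) ≠ 0 :=
    Q.setLIntegral_ne_zero hw.ennreal_ofReal fun x hx => by simpa using hpos x hx
  have h2 : ∫⁻ x in Q.toSet, ENNReal.ofReal (w x) ≤
      ∫⁻ x in Q.toSet, ⨆ (S : Cube d) (_ : S.toSet ⊆ Q.toSet),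
        S.toSet.indicator (fun _ => pAverage 1 S w) x := by
    rw [← pAverage_one_mul Q fun x hx => (hpos x hx).le, ← setLIntegral_const]
    refine setLIntegral_mono' Q.measurableSet_toSet fun x hx => ?_
    exact le_iSup₂_of_le Q (subset_refl _) (by rw [indicator_of_mem hx])
  have h3 := h2.trans h1
  conv_lhs at h3 => rw [← one_mul (∫⁻ x in Q.toSet, ENNReal.ofReal (w x))]
  exact (ENNReal.mul_le_mul_iff_left h0 hint).mp h3

/-- The local Fujii–Wilson characteristic controls the averages over the cells of a tree. -/
lemma IsCubeTree.fujiiWilson (h : Q.IsCubeTree t) {w : EuclideanSpace ℝ (Fin d) → ℝ}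
    (hw : AEMeasurable w (volume.restrict Q.toSet)) (hpos : ∀ x ∈ Q.toSet, 0 < w x)
    (hint : ∫⁻ x in Q.toSet, ENNReal.ofReal (w x) ≠ ∞) :
    t.FujiiWilson (volume.restrict Q.halfOpen) (Q.wt fun x => ENNReal.ofReal (w x))
      (aInftyChar Q w) := by
  classical
  intro k x
  have hcm := fun j y => PartitionTree.measurableSet_cell (t := t) j y
  rcases h.cases k x with h0 | ⟨R, hR, hRQ, -, -⟩
  · refine ⟨0, fun j y hj hy => ?_, by simp⟩
    rw [wt_cell_eq_zero]
    · exact zero_le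
    · rw [← subset_empty_iff, ← h0]
      exact inter_subset_inter_left _ (PartitionTree.cell_subset hj hy)
  set N : EuclideanSpace ℝ (Fin d) → ℝ≥0∞ := fun y => ⨆ (S : Cube d) (_ : S.toSet ⊆ R.toSet),
        S.toSet.indicator (fun _ => pAverage 1 S w) y with hN
  -- off the cube the value is irrelevant for the integral; `∞` makes the first condition trivial
  refine ⟨fun y => if y ∈ Q.halfOpen then N y else ∞, fun j y hj hy => ?_, ?_⟩
  · by_cases hyQ : y ∈ Q.halfOpen
    · simp only [if_pos hyQ]
      obtain ⟨S, hS, -⟩ := h.exists_cube j y hyQ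
      have hSR : S.toSet ⊆ R.toSet := toSet_subset_of_halfOpen_subset (by
        rw [hS, hR]
        exact inter_subset_inter_left _ (PartitionTree.cell_subset hj hy))
      rw [wt_eq_of_halfOpen_eq (hcm j y) hS, restrict_eq_of_halfOpen_eq (hcm j y) hS,
        ← pAverage_one_mul S fun z hz => (hpos z (hRQ (hSR hz))).le]
      refine mul_le_mul' ?_ le_rfl
      have hyS : y ∈ S.toSet := S.halfOpen_subset (hS ▸ ⟨rfl, hyQ⟩)
      exact le_iSup₂_of_le S hSR (by rw [indicator_of_mem hyS])
    · simp only [if_neg hyQ]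
      rcases eq_or_ne (volume.restrict Q.halfOpen (t.cell j y)) 0 with h0 | h0
      · have : Q.wt (fun x => ENNReal.ofReal (w x)) (t.cell j y) = 0 :=
          withDensity_absolutelyContinuous _ _ h0
        rw [this]; exact zero_le
      · rw [ENNReal.top_mul h0]; exact le_top
  · rw [wt_eq_of_halfOpen_eq (hcm k x) hR, Measure.restrict_restrict (hcm k x), ← hR]
    calc _ = ∫⁻ y in R.halfOpen, N y :=
          setLIntegral_congr_fun R.measurableSet_halfOpen fun y hy => by
            rw [hR] at hy
            exact if_pos hy.2
      _ = ∫⁻ y in R.toSet, N y := by rw [restrict_halfOpen]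
      _ ≤ _ := lintegral_iSup_le_aInftyChar hw hpos hint hRQ

/-- The two-weight condition in the form in which it is used: with `w = ω^q` and `τ = σ` it bounds
the integral of `G` over a cube by the weighted norm of `G` over it. The exponent `b` is the order
`d - s` of the fractional average and `ε` is the scaling deficit. -/
def TwoWeightOn (Q : Cube d) (w τ : EuclideanSpace ℝ (Fin d) → ℝ≥0∞) (p q b ε : ℝ) (K : ℝ≥0∞) :
    Prop :=
  ∀ R : Cube d, R.toSet ⊆ Q.toSet → ∀ G : EuclideanSpace ℝ (Fin d) → ℝ≥0∞, Measurable G →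
    (∫⁻ x in R.toSet, w x) ^ (1 / q) * ∫⁻ x in R.toSet, G x ≤
      K * volume R.toSet ^ ε * ENNReal.ofReal R.side ^ b *
        (∫⁻ x in R.toSet, G x ^ p * τ x ^ p) ^ (1 / p)

lemma conjExponent_ofReal {p : ℝ} (hp : 1 < p) :
    ENNReal.conjExponent (ENNReal.ofReal p) = ENNReal.ofReal p.conjExponent := by
  rw [ENNReal.conjExponent, Real.conjExponent, ← ENNReal.ofReal_one,
    ← ENNReal.ofReal_sub _ zero_le_one, ← ENNReal.ofReal_inv_of_pos (by linarith),
    ← ENNReal.ofReal_add zero_le_one (by rw [inv_nonneg]; linarith)]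
  congr 1
  have : p - 1 ≠ 0 := by linarith
  field_simp
  ring

/-- Hölder's inequality for averages, with `p'` possibly infinite. -/
lemma lintegral_le_pAverage_mul {R : Cube d} {σ : EuclideanSpace ℝ (Fin d) → ℝ}
    (hσ : AEMeasurable σ (volume.restrict R.toSet)) (hpos : ∀ x ∈ R.toSet, 0 < σ x) {p : ℝ}
    (hp : 1 ≤ p) {G : EuclideanSpace ℝ (Fin d) → ℝ≥0∞} (hG : Measurable G) :
    ∫⁻ x in R.toSet, G x ≤ volume R.toSet ^ (1 - 1 / p) *
      pAverage (ENNReal.conjExponent (ENNReal.ofReal p)) R (fun x => (σ x)⁻¹) *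
        (∫⁻ x in R.toSet, G x ^ p * ENNReal.ofReal (σ x) ^ p) ^ (1 / p) := by
  have hp0 : 0 < p := by linarith
  set V := volume R.toSet with hV
  have hV0 : V ≠ 0 := R.volume_ne_zero
  have hVt : V ≠ ∞ := R.volume_ne_top
  set μ := V⁻¹ • volume.restrict R.toSet with hμ
  have hae : ∀ {P : EuclideanSpace ℝ (Fin d) → Prop}, (∀ x ∈ R.toSet, P x) → ∀ᵐ x ∂μ, P x :=
    fun h => Measure.ae_smul_measure (ae_restrict_of_forall_mem R.measurableSet_toSet h) _
  have hσμ : AEMeasurable σ μ := hσ.smul_measure _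
  have hprod : ∀ᵐ x ∂μ, G x = (G x * ENNReal.ofReal (σ x)) * ‖(σ x)⁻¹‖ₑ := by
    refine hae fun x hx => ?_
    have h0 := hpos x hx
    rw [Real.enorm_of_nonneg (by positivity), ENNReal.ofReal_inv_of_pos h0, mul_assoc,
      ENNReal.mul_inv_cancel (by simpa using h0) ENNReal.ofReal_ne_top, mul_one]
  have key : ∫⁻ x, G x ∂μ ≤ pAverage (ENNReal.conjExponent (ENNReal.ofReal p)) R
      (fun x => (σ x)⁻¹) * (∫⁻ x, (G x * ENNReal.ofReal (σ x)) ^ p ∂μ) ^ (1 / p) := by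
    rw [pAverage, ← hV, ← hμ, lintegral_congr_ae hprod]
    rcases hp.eq_or_lt with rfl | hp1
    · have hc : ENNReal.conjExponent (ENNReal.ofReal 1) = ∞ := by simp [ENNReal.conjExponent]
      simp only [hc, eLpNorm_exponent_top, ENNReal.rpow_one, div_one]
      rw [← lintegral_const_mul'' _ (hG.aemeasurable.fun_mul hσμ.ennreal_ofReal)]
      refine lintegral_mono_ae ?_
      filter_upwards [ae_le_eLpNormEssSup (f := fun x => (σ x)⁻¹) (μ := μ)] with x hx
      rw [mul_comm]
      exact mul_le_mul' hx le_rfl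
    · have hc := Real.HolderConjugate.conjExponent hp1
      rw [conjExponent_ofReal hp1, eLpNorm_eq_lintegral_rpow_enorm_toReal (by simpa using hc.symm.pos) (by simp),
        ENNReal.toReal_ofReal hc.symm.nonneg, mul_comm]
      exact ENNReal.lintegral_mul_le_Lp_mul_Lq μ hc
        (hG.aemeasurable.mul hσμ.ennreal_ofReal) (hσμ.inv.enorm)
  rw [hμ, lintegral_smul_measure, lintegral_smul_measure, smul_eq_mul, smul_eq_mul,
    ENNReal.mul_rpow_of_nonneg _ _ (by positivity)] at key
  simp_rw [ENNReal.mul_rpow_of_nonneg _ _ hp0.le] at key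
  calc ∫⁻ x in R.toSet, G x = V * (V⁻¹ * ∫⁻ x in R.toSet, G x) := by
        rw [← mul_assoc, ENNReal.mul_inv_cancel hV0 hVt, one_mul]
    _ ≤ V * _ := mul_le_mul' le_rfl key
    _ = _ := by
        rw [sub_eq_add_neg, ENNReal.rpow_add _ _ hV0 hVt, ENNReal.rpow_one, ENNReal.rpow_neg,
          ENNReal.inv_rpow]
        ring

section Char

variable {p q s α : ℝ} {ω σ : EuclideanSpace ℝ (Fin d) → ℝ}

lemma pAverage_eq (R : Cube d) {q : ℝ} (hq : 0 < q) {ω : EuclideanSpace ℝ (Fin d) → ℝ}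
    (hω : ∀ x, 0 < ω x) : pAverage (ENNReal.ofReal q) R ω =
      (volume R.toSet)⁻¹ ^ (1 / q) * (∫⁻ x in R.toSet, ENNReal.ofReal (ω x ^ q)) ^ (1 / q) := by
  rw [pAverage, eLpNorm_eq_lintegral_rpow_enorm_toReal (by simpa using hq) (by simp),
    ENNReal.toReal_ofReal hq.le, lintegral_smul_measure, smul_eq_mul,
    ENNReal.mul_rpow_of_nonneg _ _ (by positivity)]
  congr 3
  funext x
  rw [Real.enorm_of_nonneg (hω x).le, ENNReal.ofReal_rpow_of_pos (hω x)]

/-- The characteristic controls fractional averages; the powers of the volume add up to the scaling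
deficit. -/
lemma twoWeightOn_of_apqChar (hd : 1 ≤ d) (hp : 1 ≤ p) (hq : 0 < q) (hσm : Measurable σ)
    (hω : ∀ x, 0 < ω x) (hσ : ∀ x, 0 < σ x) :
    Q.TwoWeightOn (fun x => ENNReal.ofReal (ω x ^ q)) (fun x => ENNReal.ofReal (σ x)) p q (d - s)
      (scalingDeficit d s p q α) (apqChar p q α Q ω σ) := by
  intro R hR G hG
  have hdR : (d : ℝ) ≠ 0 := by positivity
  set V := volume R.toSet with hV
  have hV0 : V ≠ 0 := R.volume_ne_zero
  have hVt : V ≠ ∞ := R.volume_ne_top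
  set A := ∫⁻ x in R.toSet, ENNReal.ofReal (ω x ^ q) with hA
  set I := (∫⁻ x in R.toSet, G x ^ p * ENNReal.ofReal (σ x) ^ p) ^ (1 / p) with hI
  set N := pAverage (ENNReal.conjExponent (ENNReal.ofReal p)) R (fun x => (σ x)⁻¹) with hN
  set Ω := pAverage (ENNReal.ofReal q) R ω with hΩ
  have hK : V ^ α * Ω * N ≤ apqChar p q α Q ω σ := le_iSup₂_of_le R hR le_rfl
  have hAΩ : A ^ (1 / q) = V ^ (1 / q) * Ω := by
    rw [hΩ, pAverage_eq R hq hω, ← mul_assoc, ← ENNReal.mul_rpow_of_nonneg _ _ (by positivity),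
      ENNReal.mul_inv_cancel hV0 hVt, ENNReal.one_rpow, one_mul]
  have hside : ENNReal.ofReal R.side ^ ((d : ℝ) - s) = V ^ (1 - s / d) := by
    rw [hV, volume_toSet, ← ENNReal.rpow_natCast, ← ENNReal.rpow_mul]
    congr 1; field_simp
  have hpow : V ^ (1 / q) * V ^ (1 - 1 / p) = V ^ α * (V ^ scalingDeficit d s p q α *
      V ^ (1 - s / d)) := by
    rw [← ENNReal.rpow_add _ _ hV0 hVt, ← ENNReal.rpow_add _ _ hV0 hVt,
      ← ENNReal.rpow_add _ _ hV0 hVt, scalingDeficit]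
    congr 1; ring
  calc A ^ (1 / q) * ∫⁻ x in R.toSet, G x ≤ V ^ (1 / q) * Ω * (V ^ (1 - 1 / p) * N * I) := by
        rw [hAΩ]
        exact mul_le_mul' le_rfl (lintegral_le_pAverage_mul hσm.aemeasurable (fun x _ => hσ x) hp hG)
    _ = (V ^ (1 / q) * V ^ (1 - 1 / p)) * Ω * N * I := by ring
    _ = (V ^ α * Ω * N) * V ^ scalingDeficit d s p q α * V ^ (1 - s / d) * I := by rw [hpow]; ring
    _ ≤ _ := by
        rw [hside]
        exact mul_le_mul' (mul_le_mul' (mul_le_mul' hK le_rfl) le_rfl) le_rfl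

lemma pAverage_ne_zero (R : Cube d) {e : ℝ≥0∞} (he : e ≠ 0)
    {g : EuclideanSpace ℝ (Fin d) → ℝ} (hg : Measurable g) (hpos : ∀ x, 0 < g x) :
    pAverage e R g ≠ 0 := by
  intro h0
  rw [pAverage, eLpNorm_eq_zero_iff hg.aestronglyMeasurable he] at h0
  have h1 : ∀ᵐ x ∂((volume R.toSet)⁻¹ • volume.restrict R.toSet), False :=
    h0.mono fun x hx => (hpos x).ne' hx
  have h2 : (volume R.toSet)⁻¹ • volume.restrict R.toSet = 0 := by
    rw [← Measure.measure_univ_eq_zero]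
    simpa [ae_iff] using h1
  have h3 := congrArg (fun m : Measure (EuclideanSpace ℝ (Fin d)) => m univ) h2
  simp [R.volume_ne_zero, R.volume_ne_top] at h3

/-- A finite characteristic forces `ω^q` to be integrable, as the other factor is positive. -/
lemma lintegral_weight_ne_top (hq : 0 < q) (hσm : Measurable σ)
    (hω : ∀ x, 0 < ω x) (hσ : ∀ x, 0 < σ x) (hK : apqChar p q α Q ω σ < ∞) :
    ∫⁻ x in Q.toSet, ENNReal.ofReal (ω x ^ q) ≠ ∞ := by
  intro htop
  have h1 : volume Q.toSet ^ α * pAverage (ENNReal.ofReal q) Q ω *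
      pAverage (ENNReal.conjExponent (ENNReal.ofReal p)) Q (fun x => (σ x)⁻¹) ≤
        apqChar p q α Q ω σ := le_iSup₂_of_le Q (subset_refl _) le_rfl
  rw [pAverage_eq Q hq hω, htop, ENNReal.top_rpow_of_pos (by positivity), ENNReal.mul_top,
    ENNReal.mul_top, ENNReal.top_mul] at h1
  · exact absurd hK (not_lt.mpr h1)
  · refine pAverage_ne_zero Q ?_ hσm.inv fun x => inv_pos.mpr (hσ x)
    rw [ENNReal.conjExponent]
    exact (zero_lt_one.trans_le le_self_add).ne'
  · exact (ENNReal.rpow_pos Q.volume_ne_zero.bot_lt Q.volume_ne_top).ne'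
  · exact (ENNReal.rpow_pos (by simp [Q.volume_ne_top]) (by simp [Q.volume_ne_zero])).ne'

lemma lintegral_dual_weight_ne_top (hp : 1 < p) (hq : 0 < q) (hωm : Measurable ω)
    (hω : ∀ x, 0 < ω x) (hσ : ∀ x, 0 < σ x) (hK : apqChar p q α Q ω σ < ∞) :
    ∫⁻ x in Q.toSet, ENNReal.ofReal (σ x ^ (-p.conjExponent)) ≠ ∞ := by
  intro htop
  have hp' : 0 < p.conjExponent := (Real.HolderConjugate.conjExponent hp).symm.pos
  have h1 : volume Q.toSet ^ α * pAverage (ENNReal.ofReal q) Q ω *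
      pAverage (ENNReal.conjExponent (ENNReal.ofReal p)) Q (fun x => (σ x)⁻¹) ≤
        apqChar p q α Q ω σ := le_iSup₂_of_le Q (subset_refl _) le_rfl
  have h2 : ∀ x, (σ x)⁻¹ ^ p.conjExponent = σ x ^ (-p.conjExponent) := fun x => by
    rw [Real.inv_rpow (hσ x).le, Real.rpow_neg (hσ x).le]
  rw [conjExponent_ofReal hp, pAverage_eq Q hp' fun x => inv_pos.mpr (hσ x)] at h1
  simp_rw [h2] at h1
  rw [htop, ENNReal.top_rpow_of_pos (by positivity), ENNReal.mul_top, ENNReal.mul_top] at h1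
  · exact absurd hK (not_lt.mpr h1)
  · refine mul_ne_zero (ENNReal.rpow_pos Q.volume_ne_zero.bot_lt Q.volume_ne_top).ne' ?_
    exact pAverage_ne_zero Q (by simpa using hq) hωm hω
  · exact (ENNReal.rpow_pos (by simp [Q.volume_ne_top]) (by simp [Q.volume_ne_zero])).ne'

/-- For `p > 1` the two-weight condition is a condition on the measures `ω^q` and `σ^{-p'}`. -/
lemma TwoWeightOn.measure_le {w : EuclideanSpace ℝ (Fin d) → ℝ≥0∞} {b ε : ℝ} {K : ℝ≥0∞}
    (h : Q.TwoWeightOn w (fun x => ENNReal.ofReal (σ x)) p q b ε K) (hp : 1 < p)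
    (hσm : Measurable σ) (hσ : ∀ x, 0 < σ x)
    (hfin : ∫⁻ x in Q.toSet, ENNReal.ofReal (σ x ^ (-p.conjExponent)) ≠ ∞) {R : Cube d}
    (hR : R.toSet ⊆ Q.toSet) :
    (∫⁻ x in R.toSet, ENNReal.ofReal (σ x ^ (-p.conjExponent))) ^ (1 - 1 / p) *
      (∫⁻ x in R.toSet, w x) ^ (1 / q) ≤
        K * volume R.toSet ^ ε * ENNReal.ofReal R.side ^ b := by
  have hp0 : 0 < p := by linarith
  have hc := Real.HolderConjugate.conjExponent hp
  have hGm : Measurable fun x => ENNReal.ofReal (σ x ^ (-p.conjExponent)) := by fun_prop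
  -- the two-weight condition for the extremal function `σ ^ (-p')` of Hölder's inequality
  have key := h R hR _ hGm
  have e1 : ∀ x, ENNReal.ofReal (σ x ^ (-p.conjExponent)) ^ p * ENNReal.ofReal (σ x) ^ p =
      ENNReal.ofReal (σ x ^ (-p.conjExponent)) := fun x => by
    rw [ENNReal.ofReal_rpow_of_pos (Real.rpow_pos_of_pos (hσ x) _),
      ENNReal.ofReal_rpow_of_pos (hσ x), ← ENNReal.ofReal_mul (Real.rpow_nonneg (by
        exact Real.rpow_nonneg (hσ x).le _) _), ← Real.rpow_mul (hσ x).le, ← Real.rpow_add (hσ x)]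
    congr 2
    have := hc.sub_one_mul_conj
    linarith
  simp_rw [e1] at key
  set S := ∫⁻ x in R.toSet, ENNReal.ofReal (σ x ^ (-p.conjExponent)) with hS
  have hS0 : S ≠ 0 := R.setLIntegral_ne_zero hGm.aemeasurable fun x _ => by
    simpa using Real.rpow_pos_of_pos (hσ x) _
  have hSt : S ≠ ∞ := ne_top_of_le_ne_top hfin (lintegral_mono_set hR)
  have hSp0 : S ^ (1 / p) ≠ 0 := (ENNReal.rpow_pos hS0.bot_lt hSt).ne'
  have hSpt : S ^ (1 / p) ≠ ∞ := ENNReal.rpow_ne_top_of_nonneg (by positivity) hSt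
  refine (ENNReal.mul_le_mul_iff_left hSp0 hSpt).mp ?_
  refine le_trans (le_of_eq ?_) key
  rw [mul_right_comm, ← ENNReal.rpow_add _ _ hS0 hSt, sub_add_cancel, ENNReal.rpow_one, mul_comm]

end Char

/-! ### Oscillations of functions with finite fractional seminorm -/

/-- The majorant of the oscillations: the inner integral of the seminorm, with the constant from
the Bourgain–Brezis–Mironescu inequality. -/
noncomputable def oscMajorant (s r : ℝ) (Q : Cube d) (f : EuclideanSpace ℝ (Fin d) → ℂ)
    (x : EuclideanSpace ℝ (Fin d)) : ℝ≥0∞ :=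
  bbmConst d * ENNReal.ofReal ((1 - s) ^ (1 / r)) * diffFn s r Q f x

lemma measurable_oscMajorant (s r : ℝ) (Q : Cube d) {f : EuclideanSpace ℝ (Fin d) → ℂ}
    (hf : Measurable f) : Measurable (oscMajorant s r Q f) :=
  (measurable_diffFn s r Q hf).const_mul _

lemma lintegral_lintegral_le_oscMajorant (hd : 1 ≤ d) {f : EuclideanSpace ℝ (Fin d) → ℂ}
    (hf : Measurable f) {r s : ℝ} (hr : 1 ≤ r) (hs0 : 0 < s) (hs1 : s < 1) {R : Cube d}
    (hR : R.toSet ⊆ Q.toSet) :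
    ∫⁻ x in R.toSet, ∫⁻ y in R.toSet, ‖f x - f y‖ₑ ≤
      ENNReal.ofReal R.side ^ ((d : ℝ) + s) * ∫⁻ x in R.toSet, oscMajorant s r Q f x := by
  refine (R.lintegral_enorm_sub_le_diffFn hd hf hr hs0 hs1).trans ?_
  simp_rw [oscMajorant]
  rw [lintegral_const_mul _ (measurable_diffFn s r Q hf)]
  calc _ ≤ bbmConst d * ENNReal.ofReal ((1 - s) ^ (1 / r)) *
        ENNReal.ofReal R.side ^ ((d : ℝ) + s) * ∫⁻ x in R.toSet, diffFn s r Q f x :=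
        mul_le_mul' le_rfl (lintegral_mono fun x => diffFn_mono (by linarith) hR f x)
    _ = _ := by ring

/-- The mean oscillation over a cell is controlled by the fractional average of the majorant. -/
lemma osc_le_oscMajorant [Countable ι] (hd : 1 ≤ d) {f : EuclideanSpace ℝ (Fin d) → ℂ}
    (hf : Measurable f) (hfi : Integrable f (volume.restrict Q.halfOpen)) {r s : ℝ} (hr : 1 ≤ r)
    (hs0 : 0 < s) (hs1 : s < 1) {k : ℕ} {x : EuclideanSpace ℝ (Fin d)} {R : Cube d}
    (hR : R.halfOpen = t.cell k x ∩ Q.halfOpen) :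
    t.osc (volume.restrict Q.halfOpen) f k x ≤
      ENNReal.ofReal R.side ^ (-((d : ℝ) - s)) * ∫⁻ y in R.toSet, oscMajorant s r Q f y := by
  have hcm := PartitionTree.measurableSet_cell (t := t) k x
  set ν := volume.restrict Q.halfOpen with hν
  have hνR : ν (t.cell k x) = volume R.toSet := restrict_eq_of_halfOpen_eq hcm hR
  have hν0 : ν (t.cell k x) ≠ 0 := hνR ▸ R.volume_ne_zero
  have hRQ : R.toSet ⊆ Q.toSet := toSet_subset_of_halfOpen_subset (hR ▸ inter_subset_right)
  set l := ENNReal.ofReal R.side with hl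
  have hl0 : l ≠ 0 := by simpa [hl] using R.side_pos
  have hlt : l ≠ ∞ := ENNReal.ofReal_ne_top
  set V := volume R.toSet with hV
  have hVt : V ≠ ∞ := R.volume_ne_top
  have hm : Measurable fun y => ∫⁻ z in R.toSet, ‖f z - f y‖ₑ := by
    have : Measurable fun p : EuclideanSpace ℝ (Fin d) × EuclideanSpace ℝ (Fin d) =>
        ‖f p.2 - f p.1‖ₑ := by fun_prop
    exact this.lintegral_prod_right'
  have h1 : ∀ y, ‖f y - t.mean ν f k x‖ₑ ≤ V⁻¹ * ∫⁻ z in R.toSet, ‖f z - f y‖ₑ := by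
    intro y
    rw [← enorm_neg, neg_sub]
    refine (PartitionTree.enorm_mean_sub_le hfi hν0 (f y)).trans (le_of_eq ?_)
    rw [PartitionTree.avg, hνR, setLIntegral_eq_of_halfOpen_eq hcm hR, ENNReal.div_eq_inv_mul]
  have hV2 : V⁻¹ * V⁻¹ = l ^ (-(2 * (d : ℝ))) := by
    rw [hV, volume_toSet, ← ENNReal.rpow_natCast, ← ENNReal.rpow_neg, ← ENNReal.rpow_add _ _ hl0 hlt]
    congr 1; ring
  calc t.osc ν f k x = V⁻¹ * ∫⁻ y in R.toSet, ‖f y - t.mean ν f k x‖ₑ := by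
        rw [PartitionTree.osc, PartitionTree.avg, hνR, setLIntegral_eq_of_halfOpen_eq hcm hR,
          ENNReal.div_eq_inv_mul]
    _ ≤ V⁻¹ * ∫⁻ y in R.toSet, V⁻¹ * ∫⁻ z in R.toSet, ‖f z - f y‖ₑ :=
        mul_le_mul' le_rfl (lintegral_mono h1)
    _ = V⁻¹ * V⁻¹ * ∫⁻ y in R.toSet, ∫⁻ z in R.toSet, ‖f y - f z‖ₑ := by
        rw [lintegral_const_mul _ hm, mul_assoc]
        simp_rw [fun y z => enorm_sub_rev (f z) (f y)]
    _ ≤ V⁻¹ * V⁻¹ * (l ^ ((d : ℝ) + s) * ∫⁻ y in R.toSet, oscMajorant s r Q f y) :=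
        mul_le_mul' le_rfl (lintegral_lintegral_le_oscMajorant hd hf hr hs0 hs1 hRQ)
    _ = _ := by
        rw [hV2, ← mul_assoc, ← ENNReal.rpow_add _ _ hl0 hlt]
        congr 2; ring

end Cube

/-- Minkowski's inequality for series of functions. -/
lemma ENNReal.lintegral_tsum_rpow_le {X : Type*} [MeasurableSpace X] {μ : Measure X} {q : ℝ}
    (hq : 1 ≤ q) {a : ℕ → X → ℝ≥0∞} (ha : ∀ k, Measurable (a k)) :
    (∫⁻ x, (∑' k, a k x) ^ q ∂μ) ^ (1 / q) ≤ ∑' k, (∫⁻ x, a k x ^ q ∂μ) ^ (1 / q) := by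
  have hq0 : 0 < q := by linarith
  have hfin : ∀ n, (∫⁻ x, (∑ k ∈ Finset.range n, a k x) ^ q ∂μ) ^ (1 / q) ≤
      ∑ k ∈ Finset.range n, (∫⁻ x, a k x ^ q ∂μ) ^ (1 / q) := by
    intro n
    induction n with
    | zero => simp [hq0]
    | succ n ih =>
      simp_rw [Finset.sum_range_succ]
      exact (ENNReal.lintegral_Lp_add_le (f := fun x => ∑ k ∈ Finset.range n, a k x)
        (Finset.measurable_fun_sum _ fun k _ => ha k).aemeasurable (ha n).aemeasurable hq).trans
        (add_le_add ih le_rfl)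
  have hlim : ∫⁻ x, (∑' k, a k x) ^ q ∂μ =
      ⨆ n, ∫⁻ x, (∑ k ∈ Finset.range n, a k x) ^ q ∂μ := by
    rw [← lintegral_iSup]
    · refine lintegral_congr fun x => ?_
      rw [ENNReal.tsum_eq_iSup_nat]
      exact (ENNReal.orderIsoRpow q hq0).map_iSup _
    · exact fun n => (Finset.measurable_fun_sum _ fun k _ => ha k).pow_const q
    · intro m n hmn x
      dsimp only
      gcongr
  rw [hlim, one_div, ENNReal.rpow_inv_le_iff hq0]
  refine iSup_le fun n => ?_
  rw [← ENNReal.rpow_inv_le_iff hq0, ← one_div]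
  exact (hfin n).trans (ENNReal.sum_le_tsum _)

namespace Cube

variable {d : ℕ} {Q : Cube d} {ι : Type*} {t : PartitionTree (EuclideanSpace ℝ (Fin d)) ι}

/-! ### Pointwise domination by oscillations; the subcritical estimate -/

/-- The standing assumptions on the function `f`, on the dimension and on the parameters `s`, `r` of
the seminorm under which the oscillations of `f` are controlled by its fractional differences. -/
structure Regular (Q : Cube d) (s r : ℝ) (f : EuclideanSpace ℝ (Fin d) → ℂ) : Prop where
  one_le_dim : 1 ≤ d
  measurable : Measurable f
  integrable : Integrable f (volume.restrict Q.halfOpen)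
  one_le_r : 1 ≤ r
  s_pos : 0 < s
  s_lt_one : s < 1

variable {s r : ℝ} {f : EuclideanSpace ℝ (Fin d) → ℂ} {w τ : EuclideanSpace ℝ (Fin d) → ℝ≥0∞}
  {p q b ε : ℝ} {K : ℝ≥0∞}

lemma ae_wt_mem (Q : Cube d) (w : EuclideanSpace ℝ (Fin d) → ℝ≥0∞) :
    ∀ᵐ x ∂Q.wt w, x ∈ Q.halfOpen :=
  (withDensity_absolutelyContinuous _ _).ae_le (ae_restrict_mem Q.measurableSet_halfOpen)

lemma mean_zero_dyadicTree {x : EuclideanSpace ℝ (Fin d)} (hx : x ∈ Q.halfOpen) :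
    (Q.dyadicTree 0).mean (volume.restrict Q.halfOpen) f 0 x = ⨍ y in Q.toSet, f y := by
  rw [PartitionTree.mean, Measure.restrict_restrict (PartitionTree.measurableSet_cell _ _),
    inter_eq_right.mpr (cell_zero_dyadicTree hx), restrict_halfOpen]

/-- Telescoping over the dyadic cubes containing a point. -/
lemma Regular.ae_enorm_sub_average_le_tsum_osc (h : Q.Regular s r f)
    (w : EuclideanSpace ℝ (Fin d) → ℝ≥0∞) :
    ∀ᵐ x ∂Q.wt w, ‖f x - ⨍ y in Q.toSet, f y‖ₑ ≤
      6 ^ d * ∑' k, (Q.dyadicTree 0).osc (volume.restrict Q.halfOpen) f k x := by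
  filter_upwards [Q.ae_wt_mem w, (withDensity_absolutelyContinuous _ _).ae_le
    (Q.isCubeTree_dyadicTree.ae_tendsto_mean h.one_le_dim h.integrable)] with x hx hlim
  rw [← mean_zero_dyadicTree hx]
  exact PartitionTree.enorm_sub_mean_le_tsum_osc h.integrable
    (fun k => Q.isCubeTree_dyadicTree.measure_cell_ne_zero hx)
    (fun k => Q.isCubeTree_dyadicTree.measure_cell_le hx) hlim

open Classical in
/-- Sparse domination. -/
lemma Regular.ae_enorm_sub_average_le_tsum_isStop (h : Q.Regular s r f)
    (w : EuclideanSpace ℝ (Fin d) → ℝ≥0∞) :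
    ∀ᵐ x ∂Q.wt w, ‖f x - ⨍ y in Q.toSet, f y‖ₑ ≤
      2 * 6 ^ d * ∑' k, if PartitionTree.IsStop
          ((Q.dyadicTree 0).OscDoubled (volume.restrict Q.halfOpen) f) k x
        then (Q.dyadicTree 0).osc (volume.restrict Q.halfOpen) f k x else 0 := by
  filter_upwards [Q.ae_wt_mem w, (withDensity_absolutelyContinuous _ _).ae_le
    (Q.isCubeTree_dyadicTree.ae_tendsto_mean h.one_le_dim h.integrable)] with x hx hlim
  rw [← mean_zero_dyadicTree hx]
  exact PartitionTree.enorm_sub_mean_le_tsum_isStop h.integrable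
    (one_le_pow₀ (by norm_num))
    (fun k => Q.isCubeTree_dyadicTree.measure_cell_ne_zero hx)
    (fun k => Q.isCubeTree_dyadicTree.measure_cell_le hx) hlim

/-- The two-weight condition, applied to the oscillation over one cell. -/
lemma Regular.osc_mul_measure_le [Countable ι] (h : Q.Regular s r f) (ht : Q.IsCubeTree t)
    (hK : Q.TwoWeightOn w τ p q (d - s) ε K) (hq : 0 < q) (k : ℕ)
    (x : EuclideanSpace ℝ (Fin d)) :
    t.osc (volume.restrict Q.halfOpen) f k x * Q.wt w (t.cell k x) ^ (1 / q) ≤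
      K * volume.restrict Q.halfOpen (t.cell k x) ^ ε *
        (∫⁻ y in t.cell k x, oscMajorant s r Q f y ^ p * τ y ^ p
          ∂(volume.restrict Q.halfOpen)) ^ (1 / p) := by
  have hcm := PartitionTree.measurableSet_cell (t := t) k x
  rcases ht.cases k x with h0 | ⟨R, hR, hRQ, -, -⟩
  · rw [wt_cell_eq_zero h0, ENNReal.zero_rpow_of_pos (by positivity), mul_zero]
    exact zero_le
  rw [wt_eq_of_halfOpen_eq hcm hR, restrict_eq_of_halfOpen_eq hcm hR,
    setLIntegral_eq_of_halfOpen_eq hcm hR]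
  have hl0 : ENNReal.ofReal R.side ≠ 0 := by simpa using R.side_pos
  calc _ ≤ ENNReal.ofReal R.side ^ (-((d : ℝ) - s)) *
        (∫⁻ y in R.toSet, oscMajorant s r Q f y) * (∫⁻ y in R.toSet, w y) ^ (1 / q) :=
        mul_le_mul' (osc_le_oscMajorant h.one_le_dim h.measurable h.integrable h.one_le_r h.s_pos
          h.s_lt_one hR) le_rfl
    _ = ENNReal.ofReal R.side ^ (-((d : ℝ) - s)) *
        ((∫⁻ y in R.toSet, w y) ^ (1 / q) * ∫⁻ y in R.toSet, oscMajorant s r Q f y) := by ring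
    _ ≤ ENNReal.ofReal R.side ^ (-((d : ℝ) - s)) * (K * volume R.toSet ^ ε *
        ENNReal.ofReal R.side ^ ((d : ℝ) - s) *
          (∫⁻ y in R.toSet, oscMajorant s r Q f y ^ p * τ y ^ p) ^ (1 / p)) :=
        mul_le_mul' le_rfl (hK R hRQ _ (measurable_oscMajorant s r Q h.measurable))
    _ = (ENNReal.ofReal R.side ^ (-((d : ℝ) - s)) * ENNReal.ofReal R.side ^ ((d : ℝ) - s)) *
        (K * volume R.toSet ^ ε *
          (∫⁻ y in R.toSet, oscMajorant s r Q f y ^ p * τ y ^ p) ^ (1 / p)) := by ring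
    _ = _ := by
        rw [← ENNReal.rpow_add _ _ hl0 ENNReal.ofReal_ne_top, neg_add_cancel, ENNReal.rpow_zero,
          one_mul]

lemma IsCubeTree.measure_cell_le_pow (ht : Q.IsCubeTree t) (hd : 1 ≤ d) (k : ℕ)
    (x : EuclideanSpace ℝ (Fin d)) :
    volume.restrict Q.halfOpen (t.cell k x) ≤ 2⁻¹ ^ k * volume Q.toSet := by
  rcases ht.cases k x with h0 | ⟨R, hR, -, hs, -⟩
  · rw [restrict_cell_eq_zero h0]; exact zero_le
  rw [restrict_eq_of_halfOpen_eq (PartitionTree.measurableSet_cell k x) hR, volume_toSet,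
    volume_toSet]
  have h1 : ENNReal.ofReal R.side ≤ 2⁻¹ ^ k * ENNReal.ofReal Q.side := by
    refine (ENNReal.ofReal_le_ofReal hs).trans (le_of_eq ?_)
    rw [ENNReal.ofReal_div_of_pos (by positivity), ENNReal.div_eq_inv_mul,
      ENNReal.ofReal_pow zero_le_two, ENNReal.ofReal_ofNat, ENNReal.inv_pow]
  calc ENNReal.ofReal R.side ^ d ≤ (2⁻¹ ^ k * ENNReal.ofReal Q.side) ^ d := by gcongr
    _ = (2⁻¹ ^ k) ^ d * ENNReal.ofReal Q.side ^ d := mul_pow _ _ _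
    _ ≤ _ := mul_le_mul' (pow_le_of_le_one zero_le
        (pow_le_one₀ zero_le (ENNReal.inv_le_one.mpr one_le_two)) (by omega)) le_rfl

lemma tsum_two_inv_rpow_pow_le (hε0 : 0 < ε) (hε1 : ε ≤ 1) :
    ∑' k : ℕ, ((2⁻¹ : ℝ≥0∞) ^ ε) ^ k ≤ 2 / ENNReal.ofReal ε := by
  have h1 : ((2⁻¹ : ℝ≥0∞) ^ ε) = ENNReal.ofReal ((1 / 2) ^ ε) := by
    rw [← ENNReal.ofReal_rpow_of_pos (by norm_num), one_div, ENNReal.ofReal_inv_of_pos two_pos,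
      ENNReal.ofReal_ofNat]
  -- Bernoulli's inequality
  have h2 : ((1 / 2 : ℝ)) ^ ε ≤ 1 - ε / 2 := by
    have := rpow_one_add_le_one_add_mul_self (s := -(1 / 2)) (p := ε) (by norm_num) hε0.le hε1
    norm_num at this ⊢
    linarith
  rw [ENNReal.tsum_geometric, h1]
  calc (1 - ENNReal.ofReal ((1 / 2) ^ ε))⁻¹ ≤ (ENNReal.ofReal (ε / 2))⁻¹ := by
        refine ENNReal.inv_le_inv.mpr ?_
        rw [← ENNReal.ofReal_one, ← ENNReal.ofReal_sub _ (by positivity)]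
        exact ENNReal.ofReal_le_ofReal (by linarith)
    _ = _ := by
        rw [ENNReal.ofReal_div_of_pos two_pos, ENNReal.ofReal_ofNat,
          ENNReal.inv_div (Or.inl (by simp)) (Or.inl (by simp))]

/-- The subcritical estimate: the `L^q`-norms of the oscillations of the generations form a
geometric series. -/
theorem Regular.subcritical (h : Q.Regular s r f)
    (hK : Q.TwoWeightOn w τ p q (d - s) ε K) (hp : 1 ≤ p) (hpq : p ≤ q) (hε0 : 0 < ε)
    (hε1 : ε ≤ 1) :
    (∫⁻ x, ‖f x - ⨍ y in Q.toSet, f y‖ₑ ^ q ∂Q.wt w) ^ (1 / q) ≤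
      6 ^ d * 2 * K * (volume Q.toSet ^ ε / ENNReal.ofReal ε) *
        (∫⁻ x in Q.toSet, oscMajorant s r Q f x ^ p * τ x ^ p) ^ (1 / p) := by
  have hp0 : 0 < p := by linarith
  have hq : 0 < q := by linarith
  set t := Q.dyadicTree 0 with ht
  have hct : Q.IsCubeTree t := Q.isCubeTree_dyadicTree
  set ν := volume.restrict Q.halfOpen with hν
  set n := fun x => oscMajorant s r Q f x ^ p * τ x ^ p with hn
  set N := ∫⁻ x, n x ∂ν with hN
  set V := volume Q.toSet with hV
  -- The cells of generation `k` have measure at most `2 ^ (-k) V`. As `q ≥ p`, the powers `q / p` of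
  -- the integrals over the cells sum up to the power of the sum.
  have hosc : ∀ k, (∫⁻ x, t.osc ν f k x ^ q ∂Q.wt w) ^ (1 / q) ≤
      (2⁻¹ ^ ε) ^ k * (K * V ^ ε * N ^ (1 / p)) := by
    intro k
    set M := K * (2⁻¹ ^ k * V) ^ ε with hM
    have hcell : ∀ x, ∫⁻ y in t.cell k x, t.osc ν f k y ^ q ∂Q.wt w ≤
        M ^ q * (N ^ (q / p - 1) * ∫⁻ y in t.cell k x, n y ∂ν) := by
      intro x
      have hadp : t.Adapted k fun y => t.osc ν f k y ^ q := fun y z hyz => by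
        simp only [PartitionTree.adapted_osc ν f k y z hyz]
      rw [PartitionTree.setLIntegral_adapted hadp]
      calc t.osc ν f k x ^ q * Q.wt w (t.cell k x)
          = (t.osc ν f k x * Q.wt w (t.cell k x) ^ (1 / q)) ^ q := by
            rw [ENNReal.mul_rpow_of_nonneg _ _ hq.le, ← ENNReal.rpow_mul, one_div_mul_cancel hq.ne',
              ENNReal.rpow_one]
        _ ≤ (M * (∫⁻ y in t.cell k x, n y ∂ν) ^ (1 / p)) ^ q := by
            refine ENNReal.rpow_le_rpow ((h.osc_mul_measure_le hct hK hq k x).trans ?_) hq.le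
            exact mul_le_mul' (mul_le_mul' le_rfl
              (ENNReal.rpow_le_rpow (hct.measure_cell_le_pow h.one_le_dim k x) hε0.le)) le_rfl
        _ = M ^ q * (∫⁻ y in t.cell k x, n y ∂ν) ^ (q / p) := by
            rw [ENNReal.mul_rpow_of_nonneg _ _ hq.le, ← ENNReal.rpow_mul]
            congr 2; field_simp
        _ ≤ M ^ q * (N ^ (q / p - 1) * ∫⁻ y in t.cell k x, n y ∂ν) :=
            mul_le_mul' le_rfl (setLIntegral_rpow_le ν n _
              (by rw [le_div_iff₀ hp0]; linarith))
    have hsum := PartitionTree.lintegral_le_of_cells (t := t) k (ν := Q.wt w) (μ := M ^ q • N ^ (q / p - 1) • ν)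
      (f := fun y => t.osc ν f k y ^ q) (g := n) ?_
    · rw [lintegral_smul_measure, lintegral_smul_measure, smul_eq_mul, smul_eq_mul, ← hN] at hsum
      have hN1 : N ^ (q / p - 1) * N ≤ N ^ (q / p) := by
        rcases eq_or_ne N 0 with h0 | h0
        · simp [h0]
        rcases eq_or_ne N ∞ with h1 | h1
        · rw [h1, ENNReal.top_rpow_of_pos (div_pos hq hp0)]; exact le_top
        · rw [ENNReal.rpow_sub_one_mul h0 h1]
      calc _ ≤ (M ^ q * N ^ (q / p)) ^ (1 / q) :=
            ENNReal.rpow_le_rpow (hsum.trans (mul_le_mul' le_rfl hN1)) (by positivity)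
        _ = M * N ^ (1 / p) := by
            rw [ENNReal.mul_rpow_of_nonneg _ _ (by positivity), ← ENNReal.rpow_mul,
              ← ENNReal.rpow_mul, mul_one_div_cancel hq.ne', ENNReal.rpow_one]
            congr 2; field_simp
        _ = _ := by
            rw [hM, ENNReal.mul_rpow_of_nonneg _ _ hε0.le, ← ENNReal.rpow_natCast,
              ← ENNReal.rpow_mul, mul_comm (k : ℝ), ENNReal.rpow_mul, ENNReal.rpow_natCast]
            ring
    · intro x
      rw [Measure.restrict_smul, Measure.restrict_smul, lintegral_smul_measure,
        lintegral_smul_measure, smul_eq_mul, smul_eq_mul]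
      exact hcell x
  calc _ ≤ (∫⁻ x, (6 ^ d * ∑' k, t.osc ν f k x) ^ q ∂Q.wt w) ^ (1 / q) := by
        refine ENNReal.rpow_le_rpow (lintegral_mono_ae ?_) (by positivity)
        filter_upwards [h.ae_enorm_sub_average_le_tsum_osc w] with x hx
        exact ENNReal.rpow_le_rpow hx hq.le
    _ = 6 ^ d * (∫⁻ x, (∑' k, t.osc ν f k x) ^ q ∂Q.wt w) ^ (1 / q) := by
        simp_rw [ENNReal.mul_rpow_of_nonneg _ _ hq.le]
        rw [lintegral_const_mul', ENNReal.mul_rpow_of_nonneg _ _ (by positivity),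
          ← ENNReal.rpow_mul, mul_one_div_cancel hq.ne', ENNReal.rpow_one]
        exact ENNReal.rpow_ne_top_of_nonneg hq.le (by finiteness)
    _ ≤ 6 ^ d * ∑' k, (2⁻¹ ^ ε) ^ k * (K * V ^ ε * N ^ (1 / p)) :=
        mul_le_mul' le_rfl ((ENNReal.lintegral_tsum_rpow_le (hp.trans hpq) fun k =>
          (PartitionTree.adapted_osc ν f k).measurable).trans (ENNReal.tsum_le_tsum hosc))
    _ ≤ 6 ^ d * (2 / ENNReal.ofReal ε * (K * V ^ ε * N ^ (1 / p))) := by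
        rw [ENNReal.tsum_mul_right]
        exact mul_le_mul' le_rfl (mul_le_mul' (tsum_two_inv_rpow_pow_le hε0 hε1) le_rfl)
    _ = _ := by
        rw [hN, hν, restrict_halfOpen, ENNReal.div_eq_inv_mul, ENNReal.div_eq_inv_mul]
        ring

end Cube

lemma ENNReal.tsum_rpow_le_rpow_tsum {ι : Type*} (a : ι → ℝ≥0∞) {e : ℝ} (he : 1 ≤ e) :
    ∑' i, a i ^ e ≤ (∑' i, a i) ^ e := by
  set S := ∑' i, a i with hS
  rcases eq_or_ne S 0 with h0 | h0
  · have : ∀ i, a i = 0 := fun i => ENNReal.tsum_eq_zero.mp h0 i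
    simp [this, ENNReal.zero_rpow_of_pos (by linarith : 0 < e)]
  rcases eq_or_ne S ∞ with h1 | h1
  · rw [h1, ENNReal.top_rpow_of_pos (by linarith)]; exact le_top
  calc ∑' i, a i ^ e ≤ ∑' i, S ^ (e - 1) * a i := by
        refine ENNReal.tsum_le_tsum fun i => ?_
        have hle : a i ≤ S := ENNReal.le_tsum i
        rcases eq_or_ne (a i) 0 with h2 | h2
        · rw [h2, ENNReal.zero_rpow_of_pos (by linarith)]; exact zero_le
        · rw [← ENNReal.rpow_sub_one_mul h2 (ne_top_of_le_ne_top h1 hle)]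
          exact mul_le_mul' (ENNReal.rpow_le_rpow hle (by linarith)) le_rfl
    _ = S ^ e := by rw [ENNReal.tsum_mul_left, ← hS, ENNReal.rpow_sub_one_mul h0 h1]

/-! ### From weak type to strong type by truncation -/

/-- The truncation of `x` to `[a, b]`, shifted so as to start at `0`. -/
def truncate (a b x : ℝ) : ℝ := max a (min x b) - a

lemma truncate_nonneg (a b x : ℝ) : 0 ≤ truncate a b x := by
  rw [truncate]; linarith [le_max_left a (min x b)]

lemma truncate_le {a b x : ℝ} (ha : 0 ≤ a) (hx : 0 ≤ x) : truncate a b x ≤ x := by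
  rw [truncate]
  have : max a (min x b) ≤ a + x := max_le (by linarith) ((min_le_left _ _).trans (by linarith))
  linarith

lemma truncate_of_le {a b x : ℝ} (hab : a ≤ b) (hx : b ≤ x) : truncate a b x = b - a := by
  rw [truncate, min_eq_right hx, max_eq_right hab]

lemma truncate_mono (a b : ℝ) : Monotone (truncate a b) := fun x y h => by
  simp only [truncate]
  gcongr

lemma truncate_add {a b c : ℝ} (hab : a ≤ b) (hbc : b ≤ c) (x : ℝ) :
    truncate a b x + truncate b c x = truncate a c x := by
  simp only [truncate]
  rcases le_total x b with h | h
  · rw [min_eq_left h, min_eq_left (h.trans hbc), max_eq_left h]; ring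
  · rw [min_eq_right h, max_eq_right hab, max_eq_right (le_min h hbc),
      max_eq_right (hab.trans (le_min h hbc))]; ring

lemma sum_truncate {u : ℕ → ℝ} (hu : Monotone u) (n : ℕ) (x : ℝ) :
    ∑ k ∈ Finset.range n, truncate (u k) (u (k + 1)) x = truncate (u 0) (u n) x := by
  induction n with
  | zero => simp [truncate]
  | succ n ih =>
    rw [Finset.sum_range_succ, ih, truncate_add (hu (Nat.zero_le n)) (hu (Nat.le_succ n))]

lemma abs_truncate_sub_le (a b x y : ℝ) : |truncate a b x - truncate a b y| ≤ |x - y| := by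
  simp only [truncate, sub_sub_sub_cancel_right]
  refine (abs_max_sub_max_le_max a (min x b) a (min y b)).trans ?_
  have := abs_min_sub_min_le_max x b y b
  simpa using max_le (abs_nonneg (x - y)) (by simpa using this)

lemma sum_abs_truncate_sub_le {u : ℕ → ℝ} (hu : Monotone u) (n : ℕ) (x y : ℝ) :
    ∑ k ∈ Finset.range n, |truncate (u k) (u (k + 1)) x - truncate (u k) (u (k + 1)) y| ≤
      |x - y| := by
  wlog hxy : y ≤ x generalizing x y with H
  · have := H y x (by linarith)
    simpa only [abs_sub_comm] using this
  calc _ = ∑ k ∈ Finset.range n,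
        (truncate (u k) (u (k + 1)) x - truncate (u k) (u (k + 1)) y) :=
        Finset.sum_congr rfl fun k _ => abs_of_nonneg (sub_nonneg.mpr (truncate_mono _ _ hxy))
    _ = truncate (u 0) (u n) x - truncate (u 0) (u n) y := by
        rw [Finset.sum_sub_distrib, sum_truncate hu, sum_truncate hu]
    _ ≤ _ := (le_abs_self _).trans (abs_truncate_sub_le _ _ _ _)

namespace Cube

variable {d : ℕ} {Q : Cube d}
variable {s r : ℝ} {f : EuclideanSpace ℝ (Fin d) → ℂ} {w τ : EuclideanSpace ℝ (Fin d) → ℝ≥0∞}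
  {p q : ℝ} {K A : ℝ≥0∞}

/-- The truncation of `‖f - m‖` to `[a, b]`, as a complex valued function. -/
noncomputable def truncFn (f : EuclideanSpace ℝ (Fin d) → ℂ) (m : ℂ) (a b : ℝ)
    (x : EuclideanSpace ℝ (Fin d)) : ℂ := (truncate a b ‖f x - m‖ : ℝ)

lemma Regular.truncFn (h : Q.Regular s r f) (m : ℂ) {a : ℝ} (ha : 0 ≤ a) (b : ℝ) :
    Q.Regular s r (truncFn f m a b) where
  one_le_dim := h.one_le_dim
  measurable := by
    have := h.measurable
    unfold Cube.truncFn truncate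
    fun_prop
  integrable := by
    have hm := h.measurable
    have hg : Measurable (Cube.truncFn f m a b) := by
      unfold Cube.truncFn truncate
      fun_prop
    refine (h.integrable.sub (integrable_const m)).mono hg.aestronglyMeasurable
      (ae_of_all _ fun x => ?_)
    rw [Cube.truncFn, Complex.norm_real, Real.norm_of_nonneg (truncate_nonneg _ _ _)]
    exact truncate_le ha (norm_nonneg _)
  one_le_r := h.one_le_r
  s_pos := h.s_pos
  s_lt_one := h.s_lt_one

/-- The difference seminorms of the truncations to consecutive intervals sum up: `p ≥ r ≥ 1` allows
taking the sum inside both powers. -/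
lemma tsum_oscMajorant_truncFn_le (hf : Measurable f) (hr : 1 ≤ r) (hrp : r ≤ p) (m : ℂ)
    {u : ℕ → ℝ} (hu : Monotone u) (x : EuclideanSpace ℝ (Fin d)) :
    ∑' k, oscMajorant s r Q (Cube.truncFn f m (u k) (u (k + 1))) x ^ p ≤
      oscMajorant s r Q f x ^ p := by
  have hr0 : 0 < r := by linarith
  have hp0 : 0 < p := by linarith
  have hterm : ∀ g : EuclideanSpace ℝ (Fin d) → ℂ, oscMajorant s r Q g x ^ p =
      (bbmConst d * ENNReal.ofReal ((1 - s) ^ (1 / r))) ^ p * (∫⁻ y in Q.toSet,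
        ‖g x - g y‖ₑ ^ r / edist x y ^ ((d : ℝ) + s * r)) ^ (p / r) := fun g => by
    rw [oscMajorant, ENNReal.mul_rpow_of_nonneg _ _ hp0.le, diffFn, ← ENNReal.rpow_mul]
    congr 2; ring
  simp_rw [hterm]
  rw [ENNReal.tsum_mul_left]
  refine mul_le_mul' le_rfl ?_
  refine (ENNReal.tsum_rpow_le_rpow_tsum _ (by rwa [le_div_iff₀ hr0, one_mul])).trans ?_
  refine ENNReal.rpow_le_rpow ?_ (by positivity)
  rw [← lintegral_tsum]
  · refine lintegral_mono fun y => ?_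
    simp_rw [ENNReal.div_eq_inv_mul]
    rw [ENNReal.tsum_mul_left]
    refine mul_le_mul' le_rfl ((ENNReal.tsum_rpow_le_rpow_tsum _ hr).trans ?_)
    refine ENNReal.rpow_le_rpow ?_ hr0.le
    rw [ENNReal.tsum_eq_iSup_nat]
    refine iSup_le fun n => ?_
    have h1 : ∀ k, ‖Cube.truncFn f m (u k) (u (k + 1)) x - Cube.truncFn f m (u k) (u (k + 1)) y‖ₑ =
        ENNReal.ofReal |truncate (u k) (u (k + 1)) ‖f x - m‖ -
          truncate (u k) (u (k + 1)) ‖f y - m‖| := fun k => by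
      rw [Cube.truncFn, Cube.truncFn, ← Complex.ofReal_sub, ← ofReal_norm, Complex.norm_real,
        Real.norm_eq_abs]
    simp_rw [h1]
    rw [← ENNReal.ofReal_sum_of_nonneg fun k _ => abs_nonneg _, ← ofReal_norm]
    refine ENNReal.ofReal_le_ofReal ((sum_abs_truncate_sub_le hu n _ _).trans ?_)
    refine (abs_norm_sub_norm_le _ _).trans (le_of_eq ?_)
    congr 1; ring
  · intro k
    have : Measurable (Cube.truncFn f m (u k) (u (k + 1))) := by
      unfold Cube.truncFn truncate
      fun_prop
    have h2 : Measurable fun y => edist x y ^ ((d : ℝ) + s * r) := by fun_prop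
    exact (Measurable.div (by fun_prop) h2).aemeasurable

/-- A number is dominated by the values of the dyadic layers that it reaches. -/
lemma two_pow_layer_le {v N : ℝ≥0∞} (hN : N ≠ 0) (hNt : N ≠ ∞) (hv : v ≠ ∞) (hq : 0 < q) :
    v ^ q ≤ (4 * N) ^ q + ∑' k : ℕ, (if N * 2 ^ (k + 2) < v then (N * 2 ^ (k + 3)) ^ q else 0) := by
  classical
  by_cases h4 : v ≤ 4 * N
  · exact (ENNReal.rpow_le_rpow h4 hq.le).trans le_self_add
  have hex : ∃ k : ℕ, v ≤ N * 2 ^ (k + 2) := by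
    obtain ⟨n, hn⟩ := ENNReal.exists_nat_gt (ENNReal.div_ne_top hv hN)
    refine ⟨n, ?_⟩
    rw [mul_comm, ← ENNReal.div_le_iff hN hNt]
    refine hn.le.trans ?_
    have : n ≤ 2 ^ (n + 2) := (Nat.lt_two_pow_self).le.trans (Nat.pow_le_pow_right two_pos (by omega))
    exact_mod_cast this
  obtain ⟨k, hk⟩ : ∃ k, Nat.find hex = k + 1 := by
    refine Nat.exists_eq_succ_of_ne_zero fun h0 => h4 ?_
    have := Nat.find_spec hex
    rw [h0] at this
    refine this.trans (le_of_eq ?_)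
    norm_num [mul_comm]
  have h1 : v ≤ N * 2 ^ (k + 3) := by
    have := Nat.find_spec hex
    rwa [hk] at this
  have h2 : N * 2 ^ (k + 2) < v := not_le.mp (Nat.find_min hex (by omega))
  refine le_trans ?_ (le_add_self.trans' (ENNReal.le_tsum k))
  rw [if_pos h2]
  exact ENNReal.rpow_le_rpow h1 hq.le

/-- Maz'ya's truncation principle: for `p ≥ r`, a weak type estimate that holds for all functions
self-improves to a strong type estimate. The truncations of `|f - ⟨f⟩|` to dyadic layers of values
satisfy the weak type estimate, each at its own level, and their seminorms sum up to that of `f`. -/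
theorem Regular.strongType_of_weakType (h : Q.Regular s r f) (hw : ∫⁻ x in Q.toSet, w x ≠ ∞)
    (hτ : Measurable τ)
    (hK : Q.TwoWeightOn w τ p q (d - s) 0 K) (hp : 0 < p) (hrp : r ≤ p) (hpq : p ≤ q)
    (hweak : ∀ g, Q.Regular s r g → ∀ l : ℝ≥0,
      (l : ℝ≥0∞) ^ q * Q.wt w {x | l < ‖g x - ⨍ y in Q.toSet, g y‖ₑ} ≤
        A ^ q * (∫⁻ x in Q.toSet, oscMajorant s r Q g x ^ p * τ x ^ p) ^ (q / p)) :
    (∫⁻ x, ‖f x - ⨍ y in Q.toSet, f y‖ₑ ^ q ∂Q.wt w) ^ (1 / q) ≤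
      (16 * (K + A)) * (∫⁻ x in Q.toSet, oscMajorant s r Q f x ^ p * τ x ^ p) ^ (1 / p) := by
  have hq : 0 < q := by linarith
  have := isFiniteMeasure_wt hw
  set t := Q.dyadicTree 0 with ht
  have hct : Q.IsCubeTree t := Q.isCubeTree_dyadicTree
  set ν := volume.restrict Q.halfOpen with hν
  set x₀ := Q.corner with hx₀
  have hx₀Q : x₀ ∈ Q.halfOpen := Q.corner_mem_halfOpen
  set m := ⨍ y in Q.toSet, f y with hm
  set F := ∫⁻ x in Q.toSet, oscMajorant s r Q f x ^ p * τ x ^ p with hF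
  have hν0 : ν (t.cell 0 x₀) ≠ 0 := hct.measure_cell_ne_zero hx₀Q
  have hmean : ∀ g, t.mean ν g 0 x₀ = ⨍ y in Q.toSet, g y := fun g => mean_zero_dyadicTree hx₀Q
  set N := t.osc ν f 0 x₀ with hN
  have hNt : N ≠ ∞ := PartitionTree.osc_ne_top h.integrable 0 x₀
  have hNeq : N = t.avg ν (fun y => ‖f y - m‖ₑ) 0 x₀ := by rw [hN, PartitionTree.osc, hmean]
  -- the first term: the oscillation over `Q` itself
  have hcell : Q.wt w (t.cell 0 x₀) = Q.wt w univ := by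
    refine measure_congr ?_
    filter_upwards [Q.ae_wt_mem w] with x hx
    exact propext ⟨fun _ => trivial, fun _ => cell_zero_dyadicTree hx₀Q hx⟩
  have hNW : N ^ q * Q.wt w univ ≤ K ^ q * F ^ (q / p) := by
    have h1 := h.osc_mul_measure_le hct hK hq 0 x₀
    rw [hcell, ENNReal.rpow_zero, mul_one] at h1
    have h2 : (∫⁻ y in t.cell 0 x₀, oscMajorant s r Q f y ^ p * τ y ^ p ∂ν) ≤ F := by
      rw [hF, ← restrict_halfOpen]; exact setLIntegral_le_lintegral _ _
    have h3 := ENNReal.rpow_le_rpow (h1.trans (mul_le_mul' le_rfl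
      (ENNReal.rpow_le_rpow h2 (by positivity : 0 ≤ 1 / p)))) hq.le
    rw [ENNReal.mul_rpow_of_nonneg _ _ hq.le, ENNReal.mul_rpow_of_nonneg _ _ hq.le,
      ← ENNReal.rpow_mul, ← ENNReal.rpow_mul, one_div_mul_cancel hq.ne', ENNReal.rpow_one] at h3
    refine h3.trans (le_of_eq ?_)
    congr 2; field_simp
  have hfm := h.measurable
  suffices hmain : ∫⁻ x, ‖f x - m‖ₑ ^ q ∂Q.wt w ≤ (16 * (K + A)) ^ q * F ^ (q / p) by
    refine (ENNReal.rpow_le_rpow hmain (by positivity)).trans (le_of_eq ?_)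
    rw [ENNReal.mul_rpow_of_nonneg _ _ (by positivity), ← ENNReal.rpow_mul, ← ENNReal.rpow_mul,
      mul_one_div_cancel hq.ne', ENNReal.rpow_one]
    congr 2; field_simp
  -- if the oscillation over `Q` vanishes, `f` is constant almost everywhere on `Q`
  rcases eq_or_ne N 0 with hN0 | hN0
  · have h0 : ∫⁻ y in t.cell 0 x₀, ‖f y - m‖ₑ ∂ν = 0 := by
      rw [← PartitionTree.avg_mul_measure ν (fun y => ‖f y - m‖ₑ) 0 x₀, ← hNeq, hN0, zero_mul]
    have h1 : ∫⁻ y, ‖f y - m‖ₑ ∂ν = 0 := by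
      rw [hν, Measure.restrict_restrict (PartitionTree.measurableSet_cell _ _),
        inter_eq_right.mpr (cell_zero_dyadicTree hx₀Q)] at h0
      exact h0
    rw [lintegral_eq_zero_iff (by fun_prop)] at h1
    have h2 : ∀ᵐ x ∂Q.wt w, ‖f x - m‖ₑ ^ q = 0 := by
      filter_upwards [(withDensity_absolutelyContinuous ν w).ae_le h1] with x hx
      rw [hx]; exact ENNReal.zero_rpow_of_pos hq
    rw [lintegral_congr_ae h2, lintegral_zero]
    exact zero_le
  -- The levels grow geometrically from twice the oscillation over `Q`; the averages of the
  -- truncations stay below half of the lowest level.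
  set u : ℕ → ℝ := fun k => N.toReal * 2 ^ (k + 1) with hu
  have hNr : 0 < N.toReal := ENNReal.toReal_pos hN0 hNt
  have hu0 : ∀ k, 0 < u k := fun k => by positivity
  have huS : ∀ k, u (k + 1) = 2 * u k := fun k => by simp only [hu]; ring
  have hum : Monotone u := monotone_nat_of_le_succ fun k => by linarith [huS k, hu0 k]
  have huE : ∀ k, ENNReal.ofReal (u k) = N * 2 ^ (k + 1) := fun k => by
    simp only [hu]
    rw [ENNReal.ofReal_mul hNr.le, ENNReal.ofReal_toReal hNt, ENNReal.ofReal_pow zero_le_two,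
      ENNReal.ofReal_ofNat]
  set g : ℕ → EuclideanSpace ℝ (Fin d) → ℂ := fun k => Cube.truncFn f m (u k) (u (k + 1)) with hg
  have hgR : ∀ k, Q.Regular s r (g k) := fun k => h.truncFn m (hu0 k).le _
  have hgn : ∀ k x, ‖g k x‖ = truncate (u k) (u (k + 1)) ‖f x - m‖ := fun k x => by
    simp only [hg, Cube.truncFn]
    rw [Complex.norm_real, Real.norm_of_nonneg (truncate_nonneg _ _ _)]
  have hgm : ∀ k, ‖⨍ y in Q.toSet, g k y‖ ≤ N.toReal := by
    intro k
    have h1 := PartitionTree.enorm_mean_sub_le (t := t) (hgR k).integrable hν0 0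
    rw [hmean, sub_zero] at h1
    rw [← toReal_enorm]
    refine ENNReal.toReal_mono hNt (h1.trans ?_)
    rw [hNeq, PartitionTree.avg, PartitionTree.avg]
    refine ENNReal.div_le_div (lintegral_mono fun y => ?_) le_rfl
    dsimp only
    rw [sub_zero, ← ofReal_norm, ← ofReal_norm, hgn]
    exact ENNReal.ofReal_le_ofReal (truncate_le (hu0 k).le (norm_nonneg _))
  -- where `‖f - m‖` exceeds twice the level, the truncation is far from its average
  have hlev : ∀ k, (N * 2 ^ (k + 3)) ^ q * Q.wt w {x | N * 2 ^ (k + 2) < ‖f x - m‖ₑ} ≤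
      (16 * A) ^ q * (∫⁻ x in Q.toSet, oscMajorant s r Q (g k) x ^ p * τ x ^ p) ^ (q / p) := by
    intro k
    have h1 := hweak (g k) (hgR k) (Real.toNNReal (u k / 4))
    have hl : N * 2 ^ (k + 3) = 16 * ((Real.toNNReal (u k / 4) : ℝ≥0) : ℝ≥0∞) := by
      change _ = 16 * ENNReal.ofReal (u k / 4)
      have e : (16 : ℝ≥0∞) = ENNReal.ofReal 16 := by norm_num
      rw [e, ← ENNReal.ofReal_mul (by norm_num), show 16 * (u k / 4) = u (k + 2) by
        rw [huS, huS]; ring, huE]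
    rw [hl, ENNReal.mul_rpow_of_nonneg _ _ hq.le, ENNReal.mul_rpow_of_nonneg _ _ hq.le, mul_assoc,
      mul_assoc]
    refine mul_le_mul' le_rfl (le_trans (mul_le_mul' le_rfl (measure_mono fun x hx => ?_)) h1)
    rw [mem_ofPred_eq] at hx ⊢
    rw [show k + 2 = (k + 1) + 1 by ring, ← huE, ← ofReal_norm,
      ENNReal.ofReal_lt_ofReal_iff_of_nonneg (hu0 _).le] at hx
    -- above the upper level the truncation has its maximal value `u (k + 1) - u k = u k`
    have h2 : ‖g k x‖ = u k := by
      rw [hgn, truncate_of_le (hum (Nat.le_succ k)) hx.le, huS]; ring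
    change ENNReal.ofReal (u k / 4) < _
    rw [← ofReal_norm, ENNReal.ofReal_lt_ofReal_iff_of_nonneg (by linarith [hu0 k])]
    have h3 := norm_sub_norm_le (g k x) (⨍ y in Q.toSet, g k y)
    have h4 : 2 * N.toReal ≤ u k := by
      simp only [hu, pow_succ]
      nlinarith [one_le_pow₀ (M₀ := ℝ) (n := k) (one_le_two)]
    linarith [hgm k, hu0 k]
  have hms : ∀ k, MeasurableSet {x | N * 2 ^ (k + 2) < ‖f x - m‖ₑ} := fun k =>
    measurableSet_lt measurable_const (by fun_prop)
  calc ∫⁻ x, ‖f x - m‖ₑ ^ q ∂Q.wt w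
      ≤ ∫⁻ x, ((4 * N) ^ q + ∑' k : ℕ, {x | N * 2 ^ (k + 2) < ‖f x - m‖ₑ}.indicator
          (fun _ => (N * 2 ^ (k + 3)) ^ q) x) ∂Q.wt w := by
        refine lintegral_mono fun x => ?_
        refine (two_pow_layer_le hN0 hNt enorm_ne_top hq).trans (le_of_eq ?_)
        congr 1
        refine tsum_congr fun k => ?_
        rw [indicator_apply]
        rfl
    _ = (4 * N) ^ q * Q.wt w univ + ∑' k : ℕ, (N * 2 ^ (k + 3)) ^ q *
          Q.wt w {x | N * 2 ^ (k + 2) < ‖f x - m‖ₑ} := by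
        rw [lintegral_add_left measurable_const, lintegral_const, lintegral_tsum
          fun k => (measurable_const.indicator (hms k)).aemeasurable]
        simp_rw [lintegral_indicator_const (hms _)]
    _ ≤ (16 * K) ^ q * F ^ (q / p) + ∑' k : ℕ, (16 * A) ^ q *
          (∫⁻ x in Q.toSet, oscMajorant s r Q (g k) x ^ p * τ x ^ p) ^ (q / p) := by
        refine add_le_add ?_ (ENNReal.tsum_le_tsum hlev)
        rw [ENNReal.mul_rpow_of_nonneg _ _ hq.le, mul_assoc,
          ENNReal.mul_rpow_of_nonneg _ _ hq.le, mul_assoc]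
        exact mul_le_mul' (ENNReal.rpow_le_rpow (by norm_num) hq.le) hNW
    _ ≤ (16 * K) ^ q * F ^ (q / p) + (16 * A) ^ q * F ^ (q / p) := by
        rw [ENNReal.tsum_mul_left]
        refine add_le_add le_rfl (mul_le_mul' le_rfl ?_)
        refine (ENNReal.tsum_rpow_le_rpow_tsum _ (by rwa [le_div_iff₀ hp, one_mul])).trans ?_
        refine ENNReal.rpow_le_rpow ?_ (by positivity)
        rw [← lintegral_tsum]
        · refine lintegral_mono fun x => ?_
          rw [ENNReal.tsum_mul_right]
          exact mul_le_mul' (tsum_oscMajorant_truncFn_le h.measurable h.one_le_r hrp m hum x) le_rfl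
        · exact fun k => (((measurable_oscMajorant s r Q (hgR k).measurable).pow_const p).mul
            (hτ.pow_const p)).aemeasurable
    _ ≤ _ := by
        rw [← add_mul]
        refine mul_le_mul' ?_ le_rfl
        rw [mul_add]
        exact ENNReal.add_rpow_le_rpow_add _ _ (by linarith [h.one_le_r])

end Cube

namespace Cube

variable {d : ℕ} {Q : Cube d} {ι : Type*} {t : PartitionTree (EuclideanSpace ℝ (Fin d)) ι}
variable {s r : ℝ} {f : EuclideanSpace ℝ (Fin d) → ℂ} {w τ z : EuclideanSpace ℝ (Fin d) → ℝ≥0∞}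
  {p q b : ℝ} {K B : ℝ≥0∞}

/-! ### Critical case: weak type by sparse domination -/

/-- Rescaling of weak type estimates. -/
lemma rpow_mul_measure_lt_le {X : Type*} [MeasurableSpace X] {μ : Measure X} {g h : X → ℝ≥0∞}
    {c : ℝ≥0} (hc : c ≠ 0) (hgh : ∀ᵐ x ∂μ, g x ≤ c * h x) (hq : 0 < q) {D : ℝ≥0∞}
    (hD : ∀ l : ℝ≥0, (l : ℝ≥0∞) ^ q * μ {x | l < h x} ≤ D) (l : ℝ≥0) :
    (l : ℝ≥0∞) ^ q * μ {x | l < g x} ≤ (c : ℝ≥0∞) ^ q * D := by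
  have h1 := hD (l / c)
  have hl : (l : ℝ≥0∞) = c * ((l / c : ℝ≥0) : ℝ≥0∞) := by
    rw [← ENNReal.coe_mul, mul_div_cancel₀ _ hc]
  calc (l : ℝ≥0∞) ^ q * μ {x | l < g x}
      ≤ (l : ℝ≥0∞) ^ q * μ {x | ((l / c : ℝ≥0) : ℝ≥0∞) < h x} := by
        refine mul_le_mul' le_rfl (measure_mono_ae ?_)
        filter_upwards [hgh] with x hx (hlx : l < g x)
        change ((l / c : ℝ≥0) : ℝ≥0∞) < h x
        by_contra! hcon
        refine absurd (hlx.trans_le (hx.trans (mul_le_mul' le_rfl hcon))) ?_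
        rw [← hl]; exact lt_irrefl _
    _ = (c : ℝ≥0∞) ^ q * (((l / c : ℝ≥0) : ℝ≥0∞) ^ q *
          μ {x | ((l / c : ℝ≥0) : ℝ≥0∞) < h x}) := by
        conv_lhs => rw [hl, ENNReal.mul_rpow_of_nonneg _ _ hq.le, mul_assoc]
    _ ≤ _ := mul_le_mul' le_rfl h1

/-- The constant in the weak type estimate by sparse domination. -/
noncomputable def sparseConst (d : ℕ) (q : ℝ) : ℝ≥0∞ :=
  2 * (2 * 6 ^ d) * 2 ^ ((q + 1) * (q + 1) / q)

/-- The critical weak type estimate, linear in the Fujii–Wilson constant of `w`: sparse domination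
and the Carleson property of the stopping cells with respect to `w`. -/
theorem Regular.weakType_sparse (h : Q.Regular s r f) (hw : ∫⁻ x in Q.toSet, w x ≠ ∞)
    (hK : Q.TwoWeightOn w τ p q (d - s) 0 K) (hp : 0 < p) (hpq : p ≤ q)
    (hB0 : B ≠ 0) (hBt : B ≠ ∞)
    (hB : (Q.dyadicTree 0).FujiiWilson (volume.restrict Q.halfOpen) (Q.wt w) B) (l : ℝ≥0) :
    (l : ℝ≥0∞) ^ q * Q.wt w {x | l < ‖f x - ⨍ y in Q.toSet, f y‖ₑ} ≤
      (sparseConst d q * (B * K)) ^ q *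
        (∫⁻ x in Q.toSet, oscMajorant s r Q f x ^ p * τ x ^ p) ^ (q / p) := by
  classical
  have hq : 0 < q := by linarith
  have := isFiniteMeasure_wt hw
  set t := Q.dyadicTree 0 with ht
  set ν := volume.restrict Q.halfOpen with hν
  have hadp := PartitionTree.adapted_oscDoubled (t := t) ν f
  have key := rpow_mul_measure_lt_le (μ := Q.wt w) (c := 2 * 6 ^ d) (by positivity)
    (g := fun x => ‖f x - ⨍ y in Q.toSet, f y‖ₑ) (h := fun x => ∑' k,
      if PartitionTree.IsStop (t.OscDoubled ν f) k x then t.osc ν f k x else 0) ?_ hq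
    (PartitionTree.weakType_sparse (PartitionTree.adapted_osc ν f)
      (fun k => PartitionTree.adapted_isStop hadp k) hp hpq (mul_ne_zero two_ne_zero hB0)
      (ENNReal.mul_ne_top (by simp) hBt) (hB.carleson h.integrable)
      (fun k x => by
        have h1 := h.osc_mul_measure_le Q.isCubeTree_dyadicTree hK hq k x
        rwa [ENNReal.rpow_zero, mul_one] at h1)) l
  · refine key.trans (le_of_eq ?_)
    have e : ((2 * 6 ^ d : ℝ≥0) : ℝ≥0∞) = 2 * 6 ^ d := by push_cast; rfl
    rw [restrict_halfOpen, sparseConst, e]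
    simp only [ENNReal.mul_rpow_of_nonneg _ _ hq.le, ← ENNReal.rpow_mul, div_mul_cancel₀ _ hq.ne']
    ring
  · filter_upwards [h.ae_enorm_sub_average_le_tsum_isStop w] with x hx
    refine hx.trans (le_of_eq ?_)
    push_cast
    rfl

/-! ### Two-weight pairs with a dual weight -/

/-- The weights `w = ω^q` and `z = σ^{-p'}` as measures, where `τ = σ`: the two-weight condition in
the form used for integral operators that act on `L^p(z)`. The field `dual` says that the function
`z⁻¹ G` has the same norm in `L^p(z)` as `G` has in `L^p(τ^p)`. -/
structure DualPair (Q : Cube d) (w z τ : EuclideanSpace ℝ (Fin d) → ℝ≥0∞) (p q b : ℝ) (K : ℝ≥0∞) :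
    Prop where
  one_lt_p : 1 < p
  p_le_q : p ≤ q
  b_nonneg : 0 ≤ b
  measurable : Measurable z
  ne_zero : ∀ x, z x ≠ 0
  ne_top : ∀ x, z x ≠ ∞
  dual : ∀ x, (z x)⁻¹ ^ p * z x = τ x ^ p
  lintegral_w_ne_top : ∫⁻ x in Q.toSet, w x ≠ ∞
  lintegral_z_ne_top : ∫⁻ x in Q.toSet, z x ≠ ∞
  measure_le : ∀ R : Cube d, R.toSet ⊆ Q.toSet →
    (∫⁻ x in R.toSet, z x) ^ (1 - 1 / p) * (∫⁻ x in R.toSet, w x) ^ (1 / q) ≤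
      K * ENNReal.ofReal R.side ^ b

/-- The power `-b` of the side length `2^{-k} side` of the dyadic cubes of generation `k`. -/
noncomputable def genScale (Q : Cube d) (b : ℝ) (k : ℕ) : ℝ≥0∞ :=
  (2⁻¹ ^ k * ENNReal.ofReal Q.side) ^ (-b)

lemma two_inv_pow_mul_side_ne_zero (Q : Cube d) (k : ℕ) :
    (2⁻¹ : ℝ≥0∞) ^ k * ENNReal.ofReal Q.side ≠ 0 :=
  mul_ne_zero (pow_ne_zero _ (by simp)) (by simpa using Q.side_pos)

lemma two_inv_pow_mul_side_ne_top (Q : Cube d) (k : ℕ) :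
    (2⁻¹ : ℝ≥0∞) ^ k * ENNReal.ofReal Q.side ≠ ∞ := by finiteness

lemma ofReal_side_div (Q : Cube d) (k : ℕ) :
    ENNReal.ofReal (Q.side / 2 ^ k) = 2⁻¹ ^ k * ENNReal.ofReal Q.side := by
  rw [ENNReal.ofReal_div_of_pos (by positivity), ENNReal.div_eq_inv_mul,
    ENNReal.ofReal_pow zero_le_two, ENNReal.ofReal_ofNat, ENNReal.inv_pow]

lemma DualPair.char_le (hD : Q.DualPair w z τ p q b K) (ht : Q.IsCubeTree t) (k : ℕ)
    (x : EuclideanSpace ℝ (Fin d)) :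
    Q.genScale b k * Q.wt z (t.cell k x) ^ (1 - 1 / p) * Q.wt w (t.cell k x) ^ (1 / q) ≤ K := by
  have hcm := PartitionTree.measurableSet_cell (t := t) k x
  have hq : 0 < q := by linarith [hD.one_lt_p, hD.p_le_q]
  rcases ht.cases k x with h0 | ⟨R, hR, hRQ, hs, -⟩
  · rw [wt_cell_eq_zero h0 w, ENNReal.zero_rpow_of_pos (by positivity), mul_zero]
    exact zero_le
  rw [wt_eq_of_halfOpen_eq hcm hR, wt_eq_of_halfOpen_eq hcm hR, mul_assoc]
  calc _ ≤ Q.genScale b k * (K * ENNReal.ofReal R.side ^ b) :=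
        mul_le_mul' le_rfl (hD.measure_le R hRQ)
    _ ≤ Q.genScale b k * (K * (2⁻¹ ^ k * ENNReal.ofReal Q.side) ^ b) := by
        refine mul_le_mul' le_rfl (mul_le_mul' le_rfl (ENNReal.rpow_le_rpow ?_ hD.b_nonneg))
        rw [← ofReal_side_div]; exact ENNReal.ofReal_le_ofReal hs
    _ = (Q.genScale b k * (2⁻¹ ^ k * ENNReal.ofReal Q.side) ^ b) * K := by ring
    _ = K := by
        rw [genScale, ← ENNReal.rpow_add _ _ (Q.two_inv_pow_mul_side_ne_zero k)
          (Q.two_inv_pow_mul_side_ne_top k), neg_add_cancel, ENNReal.rpow_zero, one_mul]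

lemma DualPair.measurable_inv (hD : Q.DualPair w z τ p q b K) : Measurable fun x => (z x)⁻¹ :=
  hD.measurable.inv

lemma DualPair.setLIntegral_div (hD : Q.DualPair w z τ p q b K)
    {g : EuclideanSpace ℝ (Fin d) → ℝ≥0∞} (hg : Measurable g) {A : Set (EuclideanSpace ℝ (Fin d))}
    (hA : MeasurableSet A) :
    ∫⁻ x in A, g x * (z x)⁻¹ ∂Q.wt z = ∫⁻ x in A, g x ∂(volume.restrict Q.halfOpen) := by
  rw [wt, setLIntegral_withDensity_eq_setLIntegral_mul _ hD.measurable
    (hg.fun_mul hD.measurable_inv) hA]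
  refine lintegral_congr fun x => ?_
  rw [Pi.mul_apply, mul_comm, mul_assoc, ENNReal.inv_mul_cancel (hD.ne_zero x) (hD.ne_top x),
    mul_one]

lemma DualPair.lintegral_div_rpow (hD : Q.DualPair w z τ p q b K)
    {g : EuclideanSpace ℝ (Fin d) → ℝ≥0∞} (hg : Measurable g) :
    ∫⁻ x, (g x * (z x)⁻¹) ^ p ∂Q.wt z = ∫⁻ x in Q.toSet, g x ^ p * τ x ^ p := by
  rw [lintegral_wt Q hD.measurable ((hg.fun_mul hD.measurable_inv).pow_const p)]
  refine lintegral_congr fun x => ?_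
  rw [ENNReal.mul_rpow_of_nonneg _ _ (by linarith [hD.one_lt_p]), ← hD.dual x]
  ring

/-- The oscillations are terms of a fractional integral of the majorant. -/
lemma Regular.osc_le_term [Countable ι] (h : Q.Regular s r f) (ht : Q.IsCubeTree t)
    (hD : Q.DualPair w z τ p q (d - s) K) (k : ℕ) (x : EuclideanSpace ℝ (Fin d)) :
    t.osc (volume.restrict Q.halfOpen) f k x ≤
      3 ^ d * t.term (Q.genScale (d - s)) (Q.wt z) (fun y => oscMajorant s r Q f y * (z y)⁻¹) k x := by
  have hcm := PartitionTree.measurableSet_cell (t := t) k x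
  have hG := measurable_oscMajorant s r Q h.measurable
  rcases ht.cases k x with h0 | ⟨R, hR, hRQ, -, hs⟩
  · rw [PartitionTree.osc, PartitionTree.avg, setLIntegral_measure_zero _ _
      (restrict_cell_eq_zero h0), ENNReal.zero_div]
    exact zero_le
  rw [PartitionTree.term, hD.setLIntegral_div hG hcm, setLIntegral_eq_of_halfOpen_eq hcm hR,
    ← mul_assoc]
  refine (osc_le_oscMajorant h.one_le_dim h.measurable h.integrable h.one_le_r h.s_pos
    h.s_lt_one hR).trans (mul_le_mul' ?_ le_rfl)
  have hds : 0 ≤ (d : ℝ) - s := hD.b_nonneg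
  have h1 : 2⁻¹ ^ k * ENNReal.ofReal Q.side ≤ 3 * ENNReal.ofReal R.side := by
    rw [← ofReal_side_div, ← ENNReal.ofReal_ofNat, ← ENNReal.ofReal_mul (by norm_num)]
    exact ENNReal.ofReal_le_ofReal hs
  have hR0 : ENNReal.ofReal R.side ≠ 0 := by simpa using R.side_pos
  calc ENNReal.ofReal R.side ^ (-((d : ℝ) - s))
      = 3 ^ ((d : ℝ) - s) * (3 * ENNReal.ofReal R.side) ^ (-((d : ℝ) - s)) := by
        rw [ENNReal.mul_rpow_of_ne_zero (by simp) hR0, ← mul_assoc,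
          ← ENNReal.rpow_add _ _ (by simp) (by simp), add_neg_cancel, ENNReal.rpow_zero, one_mul]
    _ ≤ 3 ^ d * Q.genScale (d - s) k := by
        refine mul_le_mul' ?_ ?_
        · rw [← ENNReal.rpow_natCast]
          exact ENNReal.rpow_le_rpow_of_exponent_le (by norm_num) (by linarith [h.s_pos])
        · rw [genScale, ENNReal.rpow_neg, ENNReal.rpow_neg]
          exact ENNReal.inv_le_inv.mpr (ENNReal.rpow_le_rpow h1 hds)

/-! ### Critical case with equal exponents: strong type by sparse domination -/

/-- The constant in the strong type estimate by sparse domination. -/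
noncomputable def sparseStrongConst (d : ℕ) (p : ℝ) : ℝ≥0∞ :=
  2 * 6 ^ d * 3 ^ d * (2 ^ p * PartitionTree.principalConst p +
    2 ^ p.conjExponent * PartitionTree.principalConst p.conjExponent) * 2

/-- The critical strong type estimate for equal exponents, with the geometric mean of the two
Fujii–Wilson constants. -/
theorem Regular.strongType_sparse (h : Q.Regular s r f) (hD : Q.DualPair w z τ p p (d - s) K)
    {B' : ℝ≥0∞} (hB0 : B ≠ 0) (hBt : B ≠ ∞) (hB0' : B' ≠ 0) (hBt' : B' ≠ ∞)
    (hB : (Q.dyadicTree 0).FujiiWilson (volume.restrict Q.halfOpen) (Q.wt z) B)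
    (hB' : (Q.dyadicTree 0).FujiiWilson (volume.restrict Q.halfOpen) (Q.wt w) B')
    (hfin : ∫⁻ x in Q.toSet, oscMajorant s r Q f x ^ p * τ x ^ p ≠ ∞) :
    (∫⁻ x, ‖f x - ⨍ y in Q.toSet, f y‖ₑ ^ p ∂Q.wt w) ^ (1 / p) ≤
      sparseStrongConst d p * (K * (B' ^ (1 - 1 / p) * B ^ (1 / p))) *
        (∫⁻ x in Q.toSet, oscMajorant s r Q f x ^ p * τ x ^ p) ^ (1 / p) := by
  classical
  have hp := Real.HolderConjugate.conjExponent hD.one_lt_p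
  have hp0 := hp.pos
  have hp' : 1 / p.conjExponent = 1 - 1 / p := by
    rw [one_div, one_div]; linarith [hp.inv_add_inv_eq_one]
  have := isFiniteMeasure_wt hD.lintegral_w_ne_top
  have := isFiniteMeasure_wt hD.lintegral_z_ne_top
  have hG := measurable_oscMajorant s r Q h.measurable
  set t := Q.dyadicTree 0 with ht
  set ν := volume.restrict Q.halfOpen with hν
  have hadp := PartitionTree.adapted_oscDoubled (t := t) ν f
  set φ := fun y => oscMajorant s r Q f y * (z y)⁻¹ with hφ
  have key := PartitionTree.strongType_sparse (t := t) (σ := Q.wt z) (ω := Q.wt w)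
    (γ := Q.genScale (d - s)) (st := PartitionTree.IsStop (t.OscDoubled ν f))
    (fun k => PartitionTree.adapted_isStop hadp k) hp (K := K) (mul_ne_zero two_ne_zero hB0)
    (ENNReal.mul_ne_top (by simp) hBt) (mul_ne_zero two_ne_zero hB0')
    (ENNReal.mul_ne_top (by simp) hBt')
    (fun k x => by rw [hp']; exact hD.char_le Q.isCubeTree_dyadicTree k x)
    (hB.carleson h.integrable) (hB'.carleson h.integrable) (f := φ)
    (hG.fun_mul hD.measurable_inv) (by rw [hφ, hD.lintegral_div_rpow hG]; exact hfin)
  rw [hφ, hD.lintegral_div_rpow hG, hp', ← hφ] at key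
  have hpt : ∀ᵐ x ∂Q.wt w, ‖f x - ⨍ y in Q.toSet, f y‖ₑ ≤ 2 * 6 ^ d * 3 ^ d *
      ∑' k, if PartitionTree.IsStop (t.OscDoubled ν f) k x
        then t.term (Q.genScale (d - s)) (Q.wt z) φ k x else 0 := by
    filter_upwards [h.ae_enorm_sub_average_le_tsum_isStop w] with x hx
    refine hx.trans ?_
    rw [mul_assoc (2 * 6 ^ d), ← ENNReal.tsum_mul_left (a := 3 ^ d)]
    refine mul_le_mul' le_rfl (ENNReal.tsum_le_tsum fun k => ?_)
    split_ifs
    · exact h.osc_le_term Q.isCubeTree_dyadicTree hD k x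
    · exact zero_le
  calc _ ≤ (∫⁻ x, (2 * 6 ^ d * 3 ^ d * ∑' k, if PartitionTree.IsStop (t.OscDoubled ν f) k x
        then t.term (Q.genScale (d - s)) (Q.wt z) φ k x else 0) ^ p ∂Q.wt w) ^ (1 / p) := by
        refine ENNReal.rpow_le_rpow (lintegral_mono_ae ?_) (by positivity)
        filter_upwards [hpt] with x hx
        exact ENNReal.rpow_le_rpow hx hp0.le
    _ = 2 * 6 ^ d * 3 ^ d * (∫⁻ x, (∑' k, if PartitionTree.IsStop (t.OscDoubled ν f) k x
        then t.term (Q.genScale (d - s)) (Q.wt z) φ k x else 0) ^ p ∂Q.wt w) ^ (1 / p) := by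
        simp_rw [ENNReal.mul_rpow_of_nonneg (2 * 6 ^ d * 3 ^ d) _ hp0.le]
        rw [lintegral_const_mul', ENNReal.mul_rpow_of_nonneg _ _ (by positivity),
          ← ENNReal.rpow_mul, mul_one_div_cancel hp0.ne', ENNReal.rpow_one]
        exact ENNReal.rpow_ne_top_of_nonneg hp0.le (by finiteness)
    _ ≤ _ := mul_le_mul' le_rfl key
    _ = _ := by
        have h2 : (2 * B') ^ (1 - 1 / p) * (2 * B) ^ (1 / p) =
            2 * (B' ^ (1 - 1 / p) * B ^ (1 / p)) := by
          rw [ENNReal.mul_rpow_of_nonneg _ _ (by rw [← hp']; exact one_div_nonneg.mpr hp.symm.nonneg),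
            ENNReal.mul_rpow_of_nonneg _ _ (by positivity), mul_mul_mul_comm,
            ← ENNReal.rpow_add _ _ (by simp) (by simp), sub_add_cancel, ENNReal.rpow_one]
        rw [h2, sparseStrongConst]
        ring

end Cube

namespace PartitionTree

variable {X ι : Type*} [MeasurableSpace X] {t : PartitionTree X ι} [Countable ι]
variable {ν σ ω : Measure X} [IsFiniteMeasure σ] [IsFiniteMeasure ω] {ρ γ : ℕ → ℝ≥0∞}

/-! ### Testing conditions from the Fujii–Wilson characteristic -/

/-- The number of iterations in the testing estimate with exponent `q = 1 / v`: the least integer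
`n ≥ q - 1`. -/
noncomputable def testingSteps (v : ℝ) : ℕ := ⌈1 / v - 1⌉₊

/-- An exponent `τ > 1` with `τ (u + v) ≤ 1` and `testingSteps v * τ * v < 1`. -/
noncomputable def testingExp (u v : ℝ) : ℝ := 2 / (1 + max (u + v) (testingSteps v * v))

/-- The constant in the testing estimate with exponent `q = 1 / v`. -/
noncomputable def testingConst (u v : ℝ) : ℝ≥0∞ :=
  15 * (ENNReal.ofReal (1 / v) * ((testingSteps v).factorial *
    ENNReal.ofReal (2 / (testingExp u v - 1) + 2) ^ testingSteps v) ^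
      ((1 / v - 1) / testingSteps v) * (1 - 2⁻¹ ^ (1 / v * (1 - u) - 1))⁻¹) ^ v

section

variable {u v : ℝ}

lemma testingSteps_pos (hv : 0 < v) (hv1 : v < 1) : 0 < testingSteps v := by
  rw [testingSteps, Nat.ceil_pos, sub_pos, lt_div_iff₀ hv]; linarith

lemma testingSteps_mul_lt (hv : 0 < v) (hv1 : v < 1) : testingSteps v * v < 1 := by
  have h1 : 0 ≤ 1 / v - 1 := by rw [sub_nonneg, le_div_iff₀ hv]; linarith
  have h2 : (testingSteps v : ℝ) < 1 / v - 1 + 1 := Nat.ceil_lt_add_one h1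
  rwa [sub_add_cancel, lt_div_iff₀ hv] at h2

lemma testingExp_spec (hu : 0 < u) (hv : 0 < v) (huv : u + v < 1) :
    1 < testingExp u v ∧ testingExp u v * (u + v) ≤ 1 ∧
      testingSteps v * (testingExp u v * v) < 1 := by
  have h1 := testingSteps_mul_lt hv (by linarith)
  set m := max (u + v) (testingSteps v * v) with hm
  have hm1 : m < 1 := max_lt huv h1
  have hm0 : 0 < m := lt_max_of_lt_left (by linarith)
  -- the choice of `2 / (1 + m)` for `τ` makes both `τ > 1` and `τ m < 1` out of `m < 1`
  have hτ : testingExp u v = 2 / (1 + m) := rfl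
  have hτm : testingExp u v * m < 1 := by
    rw [hτ, div_mul_eq_mul_div, div_lt_one (by linarith)]; linarith
  have hτ0 : 0 < testingExp u v := by rw [hτ]; positivity
  refine ⟨by rw [hτ, lt_div_iff₀ (by linarith)]; linarith, ?_, ?_⟩
  · exact (mul_le_mul_of_nonneg_left (le_max_left _ _) hτ0.le).trans hτm.le
  · calc _ = testingExp u v * (testingSteps v * v) := by ring
      _ ≤ testingExp u v * m := mul_le_mul_of_nonneg_left (le_max_right _ _) hτ0.le
      _ < 1 := hτm

lemma testingConst_ne_top (hu : 0 < u) (hv : 0 < v) (huv : u + v < 1) :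
    testingConst u v ≠ ∞ := by
  have hκ : 0 < 1 / v * (1 - u) - 1 := by
    rw [sub_pos, one_div, inv_mul_eq_div, lt_div_iff₀ hv]; linarith
  have h1 : (2⁻¹ : ℝ≥0∞) ^ (1 / v * (1 - u) - 1) < 1 :=
    ENNReal.rpow_lt_one (ENNReal.inv_lt_one.mpr ENNReal.one_lt_two) hκ
  have h2 : (1 - (2⁻¹ : ℝ≥0∞) ^ (1 / v * (1 - u) - 1))⁻¹ ≠ ∞ :=
    ENNReal.inv_ne_top.mpr (tsub_pos_of_lt h1).ne'
  refine ENNReal.mul_ne_top (by simp) (ENNReal.rpow_ne_top_of_nonneg hv.le ?_)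
  refine ENNReal.mul_ne_top (ENNReal.mul_ne_top (by simp) ?_) h2
  have h3 : 0 ≤ 1 / v - 1 := by rw [sub_nonneg, le_div_iff₀ hv]; linarith
  exact ENNReal.rpow_ne_top_of_nonneg (div_nonneg h3 (Nat.cast_nonneg _)) (by finiteness)

/-- The testing estimate, with the number of generations in which `σ` is halved expressed by its
Fujii–Wilson constant. -/
lemma TwoWeight.testing [IsFiniteMeasure ν] {c K B : ℝ≥0∞} (hu : 0 < u) (hv : 0 < v)
    (huv : u + v < 1) (hc : c ≤ 1)
    (h : ∀ τ₀, 0 < τ₀ → TwoWeight t σ ω ρ γ u v τ₀ c (ENNReal.ofReal (2 / τ₀ + 2)) K)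
    (hν : ∀ k x, 2 * ν (t.cell (k + 3) x) ≤ ν (t.cell k x)) (hF : t.FujiiWilson ν σ B)
    (hB1 : 1 ≤ B) (hB : B ≠ ∞) (k : ℕ) (x : X) :
    (∫⁻ y in t.cell k x, t.tail γ σ k y ^ (1 / v) ∂ω) ^ v ≤
      testingConst u v * (B ^ v * K) * σ (t.cell k x) ^ (1 - u) := by
  obtain ⟨hτ1, hτ2, hτ3⟩ := testingExp_spec hu hv huv
  have hv1 : v < 1 := by linarith
  have hq : 1 < 1 / v := by rwa [lt_div_iff₀ hv, one_mul]
  -- after `3 m` generations the measure `σ` is halved, and `3 m` is at most a multiple of `B`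
  set m : ℕ := ⌊(4 * B).toReal⌋₊ + 1 with hm
  have h4B : 4 * B ≠ ∞ := by finiteness
  have hm4 : 4 * B < m := by
    rw [← ENNReal.ofReal_toReal h4B, ← ENNReal.ofReal_natCast]
    refine (ENNReal.ofReal_lt_ofReal_iff (by positivity)).mpr ?_
    rw [hm]; push_cast
    exact Nat.lt_floor_add_one _
  have hm5 : ((3 * m : ℕ) : ℝ≥0∞) ≤ 15 * B := by
    have h1 : (m : ℝ≥0∞) ≤ 4 * B + 1 := by
      rw [hm]; push_cast
      refine add_le_add ?_ le_rfl
      rw [← ENNReal.ofReal_natCast]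
      exact (ENNReal.ofReal_le_ofReal (Nat.floor_le ENNReal.toReal_nonneg)).trans
        (ENNReal.ofReal_toReal h4B).le
    calc ((3 * m : ℕ) : ℝ≥0∞) = 3 * m := by push_cast; rfl
      _ ≤ 3 * (4 * B + B) := mul_le_mul' le_rfl (h1.trans (add_le_add le_rfl hB1))
      _ = 15 * B := by ring
  have key := (h (testingExp u v - 1) (by linarith)).lintegral_tail_testing hτ1 hq
    (one_div_mul_cancel hv.ne') hτ2 (testingSteps_pos hv hv1) (Nat.le_ceil _) hτ3
    (n₀ := 3 * m) (by omega) (hF.measure_cell_le hν hm4) k x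
  set M := ENNReal.ofReal (1 / v) * ((testingSteps v).factorial *
    ENNReal.ofReal (2 / (testingExp u v - 1) + 2) ^ testingSteps v) ^
      ((1 / v - 1) / testingSteps v) * (1 - 2⁻¹ ^ (1 / v * (1 - u) - 1))⁻¹ with hM
  have h1 : ∫⁻ y in t.cell k x, t.tail γ σ k y ^ (1 / v) ∂ω ≤
      M * (15 * B) * K ^ (1 / v) * σ (t.cell k x) ^ (1 / v * (1 - u)) := by
    refine key.trans (mul_le_mul' (mul_le_mul' ?_ le_rfl) le_rfl)
    calc _ ≤ ENNReal.ofReal (1 / v) * 1 * ((testingSteps v).factorial *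
          ENNReal.ofReal (2 / (testingExp u v - 1) + 2) ^ testingSteps v) ^
          ((1 / v - 1) / testingSteps v) * (1 - 2⁻¹ ^ (1 / v * (1 - u) - 1))⁻¹ * (15 * B) :=
          mul_le_mul' (mul_le_mul' (mul_le_mul' (mul_le_mul' le_rfl hc) le_rfl) le_rfl) hm5
      _ = _ := by rw [hM, mul_one]
  have hT : testingConst u v = 15 * M ^ v := rfl
  clear_value M
  refine (ENNReal.rpow_le_rpow h1 hv.le).trans ?_
  rw [ENNReal.mul_rpow_of_nonneg _ _ hv.le, ENNReal.mul_rpow_of_nonneg _ _ hv.le,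
    ENNReal.mul_rpow_of_nonneg _ _ hv.le, ENNReal.mul_rpow_of_nonneg _ _ hv.le, ← ENNReal.rpow_mul,
    ← ENNReal.rpow_mul, one_div_mul_cancel hv.ne', ENNReal.rpow_one, mul_right_comm (1 / v),
    one_div_mul_cancel hv.ne', one_mul, hT]
  have h15 : (15 : ℝ≥0∞) ^ v ≤ 15 := by
    conv_rhs => rw [← ENNReal.rpow_one 15]
    exact ENNReal.rpow_le_rpow_of_exponent_le (by norm_num) hv1.le
  calc _ ≤ M ^ v * (15 * B ^ v) * K * σ (t.cell k x) ^ (1 - u) :=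
        mul_le_mul' (mul_le_mul' (mul_le_mul' le_rfl (mul_le_mul' h15 le_rfl)) le_rfl) le_rfl
    _ = _ := by ring

end

end PartitionTree

namespace Cube

open PartitionTree

variable {d : ℕ} {Q : Cube d} {ι : Type*} {t : PartitionTree (EuclideanSpace ℝ (Fin d)) ι}
variable {w τ z : EuclideanSpace ℝ (Fin d) → ℝ≥0∞} {p q b : ℝ} {K B B' : ℝ≥0∞}

/-! ### Dyadic fractional integrals -/

/-- The coefficients of the dyadic fractional integral; the factor `b / d` makes its norm bounded
as `b → 0`. -/
noncomputable def fracCoeff (Q : Cube d) (b : ℝ) (k : ℕ) : ℝ≥0∞ :=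
  ENNReal.ofReal (b / d) * Q.genScale b k

lemma genScale_rpow_neg (Q : Cube d) (b : ℝ) (k j : ℕ) (θ : ℝ) :
    Q.genScale b (k + j) ^ (-θ) = (2⁻¹ ^ (b * θ)) ^ j * Q.genScale b k ^ (-θ) := by
  rw [genScale, genScale, ← ENNReal.rpow_mul, ← ENNReal.rpow_mul, pow_add, mul_comm (2⁻¹ ^ k),
    mul_assoc, ENNReal.mul_rpow_of_ne_zero (pow_ne_zero _ (by simp))
      (Q.two_inv_pow_mul_side_ne_zero k)]
  congr 1
  rw [← ENNReal.rpow_natCast, ← ENNReal.rpow_natCast, ← ENNReal.rpow_mul, ← ENNReal.rpow_mul]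
  congr 1; ring

lemma genScale_tsum_le (hd : 1 ≤ d) (hb : 0 < b) (hbd : b ≤ d) {τ₀ θ : ℝ} (hτ₀ : 0 < τ₀)
    (hθ : τ₀ ≤ θ) (k : ℕ) :
    ENNReal.ofReal (b / d) * ∑' j, Q.genScale b (k + j) ^ (-θ) ≤
      ENNReal.ofReal (2 / τ₀ + 2) * Q.genScale b k ^ (-θ) := by
  have hdR : (1 : ℝ) ≤ d := by exact_mod_cast hd
  simp_rw [genScale_rpow_neg]
  rw [ENNReal.tsum_mul_right, ← mul_assoc]
  refine mul_le_mul' ?_ le_rfl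
  have hbθ : 0 < b * θ := mul_pos hb (by linarith)
  -- for small `b θ` the sum is of order `1 / (b θ)`, which the factor `b / d` compensates
  rcases le_total (b * θ) 1 with h1 | h1
  · calc _ ≤ ENNReal.ofReal (b / d) * (2 / ENNReal.ofReal (b * θ)) :=
          mul_le_mul' le_rfl (tsum_two_inv_rpow_pow_le hbθ h1)
      _ = ENNReal.ofReal (b / d * (2 / (b * θ))) := by
          rw [← ENNReal.ofReal_ofNat, ← ENNReal.ofReal_div_of_pos hbθ,
            ← ENNReal.ofReal_mul (by positivity)]
      _ ≤ _ := by
          refine ENNReal.ofReal_le_ofReal ?_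
          have h2 : b / d * (2 / (b * θ)) = 2 / (d * θ) := by
            have : (d : ℝ) ≠ 0 := by linarith
            have : θ ≠ 0 := by linarith
            field_simp
          rw [h2]
          have h3 : 2 / (d * θ) ≤ 2 / τ₀ := by
            gcongr
            nlinarith
          linarith
  · calc _ ≤ 1 * ∑' j : ℕ, ((2⁻¹ : ℝ≥0∞) ^ (1 : ℝ)) ^ j := by
          refine mul_le_mul' ?_ (ENNReal.tsum_le_tsum fun j => ?_)
          · rw [← ENNReal.ofReal_one]
            exact ENNReal.ofReal_le_ofReal (by rw [div_le_one (by linarith)]; exact hbd)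
          · refine pow_le_pow_left' ?_ j
            exact ENNReal.rpow_le_rpow_of_exponent_ge (ENNReal.inv_le_one.mpr one_le_two) h1
      _ ≤ 2 / ENNReal.ofReal 1 := by
          rw [one_mul]; exact tsum_two_inv_rpow_pow_le one_pos le_rfl
      _ ≤ _ := by
          rw [ENNReal.ofReal_one, div_one, ← ENNReal.ofReal_ofNat]
          exact ENNReal.ofReal_le_ofReal (by linarith [div_pos two_pos hτ₀])

lemma DualPair.twoWeight (hD : Q.DualPair w z τ p q b K) (ht : Q.IsCubeTree t) (hd : 1 ≤ d)
    (hb : 0 < b) (hbd : b ≤ d) (N : ℕ) {τ₀ : ℝ} (hτ₀ : 0 < τ₀) :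
    TwoWeight t (Q.wt z) (Q.wt w) (Q.genScale b) (fun k => if k < N then Q.fracCoeff b k else 0)
      (1 - 1 / p) (1 / q) τ₀ (ENNReal.ofReal (b / d)) (ENNReal.ofReal (2 / τ₀ + 2)) K where
  ne_zero k := (ENNReal.rpow_pos (Q.two_inv_pow_mul_side_ne_zero k).bot_lt
    (Q.two_inv_pow_mul_side_ne_top k)).ne'
  ne_top k := by
    rw [genScale, ENNReal.rpow_neg]
    exact ENNReal.inv_ne_top.mpr (ENNReal.rpow_pos (Q.two_inv_pow_mul_side_ne_zero k).bot_lt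
      (Q.two_inv_pow_mul_side_ne_top k)).ne'
  le k := by
    split_ifs
    · exact le_rfl
    · exact zero_le
  finite := ⟨N, fun k hk => if_neg (not_lt.mpr hk)⟩
  sum_le k θ hθ := genScale_tsum_le hd hb hbd hτ₀ hθ k
  char_le k x := hD.char_le ht k x

/-- The constant in the estimates for dyadic fractional integrals. -/
noncomputable def fracConst (p q : ℝ) : ℝ≥0∞ :=
  2 * testingConst (1 - 1 / p) (1 / q) *
      (principalConst p + (1 + principalConst p) ^ (p.conjExponent / q.conjExponent)) +
    2 * testingConst (1 / q) (1 - 1 / p) *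
      (principalConst q.conjExponent + (1 + principalConst q.conjExponent) ^ (q / p))

/-- The constant in the weak type estimate for dyadic fractional integrals. -/
noncomputable def fracWeakConst (p q : ℝ) : ℝ≥0∞ :=
  2 ^ (q + 1) * testingConst (1 / q) (1 - 1 / p)

lemma tsum_term_ite (γ : ℕ → ℝ≥0∞) (S : Measure (EuclideanSpace ℝ (Fin d)))
    (φ : EuclideanSpace ℝ (Fin d) → ℝ≥0∞) (N : ℕ) (x : EuclideanSpace ℝ (Fin d)) :
    ∑' k, t.term (fun k => if k < N then γ k else 0) S φ k x =
      ∑ k ∈ Finset.range N, t.term γ S φ k x := by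
  rw [tsum_eq_sum (s := Finset.range N)]
  · refine Finset.sum_congr rfl fun k hk => ?_
    rw [term, term, if_pos (Finset.mem_range.mp hk)]
  · intro k hk
    rw [term, if_neg (by simpa using hk), zero_mul]

section Frac

variable [Countable ι]

/-- The testing condition for `z`, from the Fujii–Wilson condition on `z`. -/
lemma DualPair.tail_testing (hD : Q.DualPair w z τ p q b K) (ht : Q.IsCubeTree t) (hd : 1 ≤ d)
    (hb : 0 < b) (hbd : b ≤ d) (hpq : p < q)
    (hF : t.FujiiWilson (volume.restrict Q.halfOpen) (Q.wt z) B) (hB1 : 1 ≤ B) (hB : B ≠ ∞) (N k : ℕ)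
    (x : EuclideanSpace ℝ (Fin d)) :
    (∫⁻ y in t.cell k x, t.tail (fun k => if k < N then Q.fracCoeff b k else 0) (Q.wt z) k y ^ q
      ∂Q.wt w) ^ (1 / q) ≤ testingConst (1 - 1 / p) (1 / q) * (B ^ (1 / q) * K) *
        Q.wt z (t.cell k x) ^ (1 / p) := by
  have hp := hD.one_lt_p
  have hq : 0 < q := by linarith
  have := isFiniteMeasure_wt hD.lintegral_w_ne_top
  have := isFiniteMeasure_wt hD.lintegral_z_ne_top
  have h1 : 1 / q < 1 / p := one_div_lt_one_div_of_lt (by linarith) hpq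
  have h2 : 1 / p < 1 := by rw [div_lt_one (by linarith)]; exact hp
  have key := TwoWeight.testing (u := 1 - 1 / p) (v := 1 / q) (by linarith) (by positivity)
    (by linarith) (ENNReal.ofReal_le_one.mpr (by rw [div_le_one (by positivity)]; exact hbd))
    (fun τ₀ hτ₀ => hD.twoWeight ht hd hb hbd N hτ₀) (ht.two_mul_measure_cell_le hd) hF hB1 hB k x
  simpa only [one_div_one_div, sub_sub_cancel] using key

/-- The dual testing condition, from the Fujii–Wilson condition on `w`. -/
lemma DualPair.tail_testing_dual (hD : Q.DualPair w z τ p q b K) (ht : Q.IsCubeTree t) (hd : 1 ≤ d)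
    (hb : 0 < b) (hbd : b ≤ d) (hpq : p < q)
    (hF : t.FujiiWilson (volume.restrict Q.halfOpen) (Q.wt w) B) (hB1 : 1 ≤ B) (hB : B ≠ ∞) (N k : ℕ)
    (x : EuclideanSpace ℝ (Fin d)) :
    (∫⁻ y in t.cell k x, t.tail (fun k => if k < N then Q.fracCoeff b k else 0) (Q.wt w) k y ^
      p.conjExponent ∂Q.wt z) ^ (1 / p.conjExponent) ≤
        testingConst (1 / q) (1 - 1 / p) * (B ^ (1 - 1 / p) * K) *
          Q.wt w (t.cell k x) ^ (1 - 1 / q) := by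
  have hp := hD.one_lt_p
  have hq : 0 < q := by linarith
  have := isFiniteMeasure_wt hD.lintegral_w_ne_top
  have := isFiniteMeasure_wt hD.lintegral_z_ne_top
  have h1 : 1 / q < 1 / p := one_div_lt_one_div_of_lt (by linarith) hpq
  have h2 : 1 / p < 1 := by rw [div_lt_one (by linarith)]; exact hp
  have hp' : 1 / p.conjExponent = 1 - 1 / p := by
    rw [one_div, one_div]; linarith [(Real.HolderConjugate.conjExponent hp).inv_add_inv_eq_one]
  have key := TwoWeight.testing (u := 1 / q) (v := 1 / p.conjExponent) (by positivity)
    (by linarith) (by linarith)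
    (ENNReal.ofReal_le_one.mpr (by rw [div_le_one (by positivity)]; exact hbd))
    (fun τ₀ hτ₀ => hp' ▸ (hD.twoWeight ht hd hb hbd N hτ₀).symm) (ht.two_mul_measure_cell_le hd)
    hF hB1 hB k x
  rw [one_div_one_div] at key
  simpa only [hp'] using key

/-- Strong type estimate for dyadic fractional integrals. -/
theorem DualPair.strongType (hD : Q.DualPair w z τ p q b K) (ht : Q.IsCubeTree t) (hd : 1 ≤ d)
    (hb : 0 < b) (hbd : b ≤ d) (hpq : p < q)
    (hF : t.FujiiWilson (volume.restrict Q.halfOpen) (Q.wt z) B) (hB1 : 1 ≤ B) (hB : B ≠ ∞)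
    (hF' : t.FujiiWilson (volume.restrict Q.halfOpen) (Q.wt w) B') (hB1' : 1 ≤ B') (hB' : B' ≠ ∞)
    {φ : EuclideanSpace ℝ (Fin d) → ℝ≥0∞} (hφ : Measurable φ)
    (hfin : ∫⁻ x, φ x ^ p ∂Q.wt z ≠ ∞) :
    (∫⁻ x, (∑' k, t.term (Q.fracCoeff b) (Q.wt z) φ k x) ^ q ∂Q.wt w) ^ (1 / q) ≤
      fracConst p q * (K * (B' ^ (1 - 1 / p) + B ^ (1 / q))) *
        (∫⁻ x, φ x ^ p ∂Q.wt z) ^ (1 / p) := by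
  have hp := hD.one_lt_p
  have hq : 0 < q := by linarith
  have := isFiniteMeasure_wt hD.lintegral_w_ne_top
  have := isFiniteMeasure_wt hD.lintegral_z_ne_top
  have hcp := Real.HolderConjugate.conjExponent hp
  have hcq := Real.HolderConjugate.conjExponent (hp.trans hpq)
  have hq' : 1 / q.conjExponent = 1 - 1 / q := by
    rw [one_div, one_div]; linarith [hcq.inv_add_inv_eq_one]
  -- the testing estimates hold for finitely many generations, uniformly in their number
  have hfinite : ∀ N, (∫⁻ x, (∑ k ∈ Finset.range N, t.term (Q.fracCoeff b) (Q.wt z) φ k x) ^ q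
      ∂Q.wt w) ^ (1 / q) ≤ fracConst p q * (K * (B' ^ (1 - 1 / p) + B ^ (1 / q))) *
        (∫⁻ x, φ x ^ p ∂Q.wt z) ^ (1 / p) := by
    intro N
    have key := strongType_of_testing (t := t) hcp hcq hD.p_le_q
      (hD.tail_testing ht hd hb hbd hpq hF hB1 hB N)
      (fun k x => by rw [hq']; exact hD.tail_testing_dual ht hd hb hbd hpq hF' hB1' hB' N k x)
      hφ hfin
    simp_rw [tsum_term_ite] at key
    refine key.trans (mul_le_mul' ?_ le_rfl)
    rw [fracConst]
    calc _ = 2 * testingConst (1 - 1 / p) (1 / q) *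
          (principalConst p + (1 + principalConst p) ^ (p.conjExponent / q.conjExponent)) *
            (K * B ^ (1 / q)) + 2 * testingConst (1 / q) (1 - 1 / p) *
          (principalConst q.conjExponent + (1 + principalConst q.conjExponent) ^ (q / p)) *
            (K * B' ^ (1 - 1 / p)) := by ring
      _ ≤ _ := by
          rw [add_mul]
          exact add_le_add (mul_le_mul' le_rfl (mul_le_mul' le_rfl le_add_self))
            (mul_le_mul' le_rfl (mul_le_mul' le_rfl le_self_add))
  have hlim : ∫⁻ x, (∑' k, t.term (Q.fracCoeff b) (Q.wt z) φ k x) ^ q ∂Q.wt w =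
      ⨆ n, ∫⁻ x, (∑ k ∈ Finset.range n, t.term (Q.fracCoeff b) (Q.wt z) φ k x) ^ q ∂Q.wt w := by
    rw [← lintegral_iSup]
    · refine lintegral_congr fun x => ?_
      rw [ENNReal.tsum_eq_iSup_nat]
      exact (ENNReal.orderIsoRpow q hq).map_iSup _
    · exact fun n => (Finset.measurable_fun_sum _ fun k _ =>
        (adapted_term _ φ k).measurable).pow_const q
    · intro m n hmn x
      dsimp only
      gcongr
  rw [hlim, one_div, ENNReal.rpow_inv_le_iff hq]
  refine iSup_le fun n => ?_
  rw [← ENNReal.rpow_inv_le_iff hq, ← one_div]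
  exact hfinite n

/-- Weak type estimate for dyadic fractional integrals; only `w` enters. -/
theorem DualPair.weakType (hD : Q.DualPair w z τ p q b K) (ht : Q.IsCubeTree t) (hd : 1 ≤ d)
    (hb : 0 < b) (hbd : b ≤ d) (hpq : p < q)
    (hF' : t.FujiiWilson (volume.restrict Q.halfOpen) (Q.wt w) B') (hB1' : 1 ≤ B') (hB' : B' ≠ ∞)
    {φ : EuclideanSpace ℝ (Fin d) → ℝ≥0∞} (hφ : Measurable φ) (l : ℝ≥0) :
    (l : ℝ≥0∞) ^ q * Q.wt w {x | l < ∑' k, t.term (Q.fracCoeff b) (Q.wt z) φ k x} ≤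
      (fracWeakConst p q * (K * B' ^ (1 - 1 / p))) ^ q * (∫⁻ x, φ x ^ p ∂Q.wt z) ^ (q / p) := by
  have hp := hD.one_lt_p
  have hq : 0 < q := by linarith
  have := isFiniteMeasure_wt hD.lintegral_w_ne_top
  have := isFiniteMeasure_wt hD.lintegral_z_ne_top
  have hcp := Real.HolderConjugate.conjExponent hp
  have hU : {x | (l : ℝ≥0∞) < ∑' k, t.term (Q.fracCoeff b) (Q.wt z) φ k x} =
      ⋃ N, {x | (l : ℝ≥0∞) < ∑ k ∈ Finset.range N, t.term (Q.fracCoeff b) (Q.wt z) φ k x} := by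
    ext x
    simp only [mem_ofPred_eq, mem_iUnion]
    rw [ENNReal.tsum_eq_iSup_nat, lt_iSup_iff]
  have hmono : Monotone fun N => {x | (l : ℝ≥0∞) < ∑ k ∈ Finset.range N,
      t.term (Q.fracCoeff b) (Q.wt z) φ k x} := by
    intro m n hmn x (hx : (l : ℝ≥0∞) < _)
    exact hx.trans_le (Finset.sum_le_sum_of_subset (Finset.range_mono hmn))
  rw [hU, hmono.measure_iUnion, ENNReal.mul_iSup]
  refine iSup_le fun N => ?_
  have key := weakType_of_testing (t := t) hcp hD.p_le_q
    (hD.tail_testing_dual ht hd hb hbd hpq hF' hB1' hB' N) hφ l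
  simp_rw [tsum_term_ite] at key
  refine key.trans (le_of_eq ?_)
  rw [fracWeakConst]
  simp only [ENNReal.mul_rpow_of_nonneg _ _ hq.le, ← ENNReal.rpow_mul]
  ring

end Frac

end Cube

namespace Cube

/-! ### Dimension one: a potential estimate by one-sided shells -/

lemma enorm_setAverage_sub_le {d : ℕ} {A : Cube d} {f : EuclideanSpace ℝ (Fin d) → ℂ}
    (hf : IntegrableOn f A.toSet) (c : ℂ) :
    ‖(⨍ y in A.toSet, f y) - c‖ₑ ≤ (volume A.toSet)⁻¹ * ∫⁻ y in A.toSet, ‖f y - c‖ₑ := by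
  have hA0 := A.volume_ne_zero
  have : IsFiniteMeasure (volume.restrict A.toSet) := ⟨by
    rw [Measure.restrict_apply_univ]; exact A.volume_ne_top.lt_top⟩
  have h1 : (⨍ y in A.toSet, f y) - c = ⨍ y in A.toSet, (f y - c) := by
    rw [average_eq, average_eq, integral_sub hf (integrable_const c), smul_sub,
      integral_const, smul_smul, inv_mul_cancel₀, one_smul]
    simp [measureReal_def, ENNReal.toReal_eq_zero_iff, hA0, A.volume_ne_top]
  rw [h1, average_eq']
  refine (enorm_integral_le_lintegral_enorm _).trans (le_of_eq ?_)
  rw [lintegral_smul_measure, smul_eq_mul, Measure.restrict_apply_univ]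

variable {Q : Cube 1} {s r : ℝ} {f : EuclideanSpace ℝ (Fin 1) → ℂ}

/-- The averages over two subintervals of `R` of comparable length differ by at most the part over
`R` of the potential at `x`, since the kernel is at least `(4 |R|)^{-(1-s)}` there. -/
lemma Regular.enorm_setAverage_sub_setAverage_le (h : Q.Regular s r f) {A B R : Cube 1}
    (hAR : A.toSet ⊆ R.toSet) (hBR : B.toSet ⊆ R.toSet) (hR : R.toSet ⊆ Q.toSet)
    (hA : R.side ≤ 8 * A.side) (hB : R.side ≤ 8 * B.side) {x : EuclideanSpace ℝ (Fin 1)}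
    (hx : ∀ y ∈ R.toSet, edist x y ≤ 4 * ENNReal.ofReal R.side) :
    ‖(⨍ y in A.toSet, f y) - ⨍ y in B.toSet, f y‖ₑ ≤
      256 * ∫⁻ y in R.toSet, oscMajorant s r Q f y * edist x y ^ (-(1 - s)) := by
  have hf := h.measurable
  have hfQ : IntegrableOn f Q.toSet := by
    rw [IntegrableOn, ← restrict_halfOpen]; exact h.integrable
  have hfA := hfQ.mono_set (hAR.trans hR)
  have hfB := hfQ.mono_set (hBR.trans hR)
  set l := ENNReal.ofReal R.side with hl
  have hl0 : l ≠ 0 := by simpa [hl] using R.side_pos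
  have hlt : l ≠ ∞ := ENNReal.ofReal_ne_top
  have hvol : ∀ S : Cube 1, R.side ≤ 8 * S.side → (volume S.toSet)⁻¹ ≤ 8 * l⁻¹ := fun S hS => by
    rw [volume_toSet, pow_one, ← div_eq_mul_inv, ENNReal.le_div_iff_mul_le (Or.inl hl0) (Or.inl hlt),
      mul_comm, ← div_eq_mul_inv, ENNReal.div_le_iff (by simpa using S.side_pos) (by simp), hl,
      ← ENNReal.ofReal_ofNat, ← ENNReal.ofReal_mul (by norm_num)]
    exact ENNReal.ofReal_le_ofReal hS
  have h1 : ∀ y, ‖f y - ⨍ z in B.toSet, f z‖ₑ ≤ 8 * l⁻¹ * ∫⁻ z in R.toSet, ‖f y - f z‖ₑ := by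
    intro y
    rw [enorm_sub_rev]
    refine (enorm_setAverage_sub_le hfB (f y)).trans (mul_le_mul' (hvol B hB) ?_)
    simp_rw [fun z => enorm_sub_rev (f z) (f y)]
    exact lintegral_mono_set hBR
  have hm : Measurable fun y => ∫⁻ z in R.toSet, ‖f y - f z‖ₑ := by
    have : Measurable fun p : EuclideanSpace ℝ (Fin 1) × EuclideanSpace ℝ (Fin 1) =>
        ‖f p.1 - f p.2‖ₑ := by fun_prop
    exact this.lintegral_prod_right'
  have hG := measurable_oscMajorant s r Q hf
  calc _ ≤ 8 * l⁻¹ * ∫⁻ y in R.toSet, 8 * l⁻¹ * ∫⁻ z in R.toSet, ‖f y - f z‖ₑ := by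
        refine (enorm_setAverage_sub_le hfA _).trans (mul_le_mul' (hvol A hA) ?_)
        exact (lintegral_mono h1).trans (lintegral_mono_set hAR)
    _ = 64 * (l⁻¹ * l⁻¹) * ∫⁻ y in R.toSet, ∫⁻ z in R.toSet, ‖f y - f z‖ₑ := by
        rw [lintegral_const_mul _ hm]; ring
    _ ≤ 64 * (l⁻¹ * l⁻¹) * (l ^ (((1 : ℕ) : ℝ) + s) * ∫⁻ y in R.toSet, oscMajorant s r Q f y) :=
        mul_le_mul' le_rfl (lintegral_lintegral_le_oscMajorant le_rfl hf h.one_le_r h.s_pos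
          h.s_lt_one hR)
    _ = 64 * (l ^ (-(1 - s)) * ∫⁻ y in R.toSet, oscMajorant s r Q f y) := by
        rw [mul_assoc, ← mul_assoc (l⁻¹ * l⁻¹)]
        congr 2
        rw [← ENNReal.rpow_neg_one, ← ENNReal.rpow_add _ _ hl0 hlt, ← ENNReal.rpow_add _ _ hl0 hlt]
        congr 1; push_cast; ring
    _ ≤ 64 * (4 * ∫⁻ y in R.toSet, oscMajorant s r Q f y * edist x y ^ (-(1 - s))) := by
        refine mul_le_mul' le_rfl ?_
        have hm2 : Measurable fun y => oscMajorant s r Q f y * edist x y ^ (-(1 - s)) := by fun_prop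
        rw [← lintegral_const_mul _ hG, ← lintegral_const_mul _ hm2]
        refine setLIntegral_mono' R.measurableSet_toSet fun y hy => ?_
        have hs1 : 0 ≤ 1 - s := by linarith [h.s_lt_one]
        have h4 : l ^ (-(1 - s)) ≤ 4 * edist x y ^ (-(1 - s)) := by
          calc l ^ (-(1 - s)) = 4 ^ (1 - s) * (4 * l) ^ (-(1 - s)) := by
                rw [ENNReal.mul_rpow_of_ne_zero (by simp) hl0, ← mul_assoc,
                  ← ENNReal.rpow_add _ _ (by simp) (by simp), add_neg_cancel, ENNReal.rpow_zero,
                  one_mul]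
            _ ≤ 4 ^ (1 : ℝ) * edist x y ^ (-(1 - s)) := by
                refine mul_le_mul' ?_ ?_
                · exact ENNReal.rpow_le_rpow_of_exponent_le (by norm_num) (by linarith [h.s_pos])
                · rw [ENNReal.rpow_neg, ENNReal.rpow_neg]
                  exact ENNReal.inv_le_inv.mpr (ENNReal.rpow_le_rpow (hx y hy) hs1)
            _ = _ := by rw [ENNReal.rpow_one]
        calc _ ≤ 4 * edist x y ^ (-(1 - s)) * oscMajorant s r Q f y := mul_le_mul' h4 le_rfl
          _ = _ := by ring
    _ = _ := by ring

/-- The interval `[x + c l, x + (c + m) l]`. -/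
noncomputable def shell (x : EuclideanSpace ℝ (Fin 1)) (c m l : ℝ) (hm : 0 < m) (hl : 0 < l) :
    Cube 1 where
  corner := WithLp.toLp 2 fun _ => x 0 + c * l
  side := m * l
  side_pos := mul_pos hm hl

lemma mem_shell {x y : EuclideanSpace ℝ (Fin 1)} {c m l : ℝ} (hm : 0 < m) (hl : 0 < l) :
    y ∈ (shell x c m l hm hl).toSet ↔ c * l ≤ y 0 - x 0 ∧ y 0 - x 0 ≤ (c + m) * l := by
  change (∀ i, y i ∈ Icc (x 0 + c * l) (x 0 + c * l + m * l)) ↔ _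
  simp only [Fin.forall_fin_one, mem_Icc]
  constructor
  · rintro ⟨h1, h2⟩; constructor <;> linarith
  · rintro ⟨h1, h2⟩; constructor <;> linarith

lemma mem_halfOpen_shell {x y : EuclideanSpace ℝ (Fin 1)} {c m l : ℝ} (hm : 0 < m) (hl : 0 < l) :
    y ∈ (shell x c m l hm hl).halfOpen ↔ c * l ≤ y 0 - x 0 ∧ y 0 - x 0 < (c + m) * l := by
  change (∀ i, y i ∈ Ico (x 0 + c * l) (x 0 + c * l + m * l)) ↔ _
  simp only [Fin.forall_fin_one, mem_Ico]
  constructor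
  · rintro ⟨h1, h2⟩; constructor <;> linarith
  · rintro ⟨h1, h2⟩; constructor <;> linarith

lemma dist_fin_one (x y : EuclideanSpace ℝ (Fin 1)) : dist x y = |y 0 - x 0| := by
  rw [EuclideanSpace.dist_eq]
  simp [Real.sqrt_sq_eq_abs, Real.dist_eq, abs_sub_comm]

lemma edist_fin_one (x y : EuclideanSpace ℝ (Fin 1)) :
    edist x y = ENNReal.ofReal |y 0 - x 0| := by
  rw [edist_dist, dist_fin_one]

/-- Lebesgue's differentiation theorem along one-sided shells. -/
lemma ae_tendsto_setAverage_shell {f : EuclideanSpace ℝ (Fin 1) → ℂ} (hf : LocallyIntegrable f) :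
    ∀ᵐ x, ∀ (c : ℝ) (l : ℕ → ℝ) (hl : ∀ k, 0 < l k), |c + 1 / 2| ≤ 3 / 2 →
      Filter.Tendsto l Filter.atTop (nhds 0) →
      Filter.Tendsto (fun k => ⨍ y in (shell x c 1 (l k) one_pos (hl k)).toSet, f y) Filter.atTop
        (nhds (f x)) := by
  filter_upwards [IsUnifLocDoublingMeasure.ae_tendsto_average (volume : Measure
    (EuclideanSpace ℝ (Fin 1))) hf 3] with x hx c l hl hc hlim
  have hset : ∀ k, (shell x c 1 (l k) one_pos (hl k)).toSet =
      Metric.closedBall (WithLp.toLp 2 fun _ => x 0 + (c + 1 / 2) * l k) (l k / 2) := by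
    intro k
    ext y
    rw [mem_shell, Metric.mem_closedBall', dist_fin_one, abs_le]
    dsimp only
    constructor
    · rintro ⟨h1, h2⟩; constructor <;> linarith
    · rintro ⟨h1, h2⟩; constructor <;> linarith
  simp_rw [hset]
  refine hx _ _ ?_ (Filter.Eventually.of_forall fun k => ?_)
  · refine tendsto_nhdsWithin_iff.mpr ⟨by simpa using hlim.div_const 2, ?_⟩
    exact Filter.Eventually.of_forall fun k => by simpa using hl k
  · rw [Metric.mem_closedBall', dist_fin_one]
    dsimp only
    rw [sub_add_cancel_left, abs_neg, abs_mul, abs_of_pos (hl k)]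
    nlinarith [hl k]

/-- In dimension one, `f - ⟨f⟩_Q` is dominated by the Riesz potential of the majorant. The averages
over shells on one side of `x`, at distances comparable to `2^{-k}`, telescope; as the shells are
disjoint, their contributions add up to one potential and not to a geometric series, whose sum
would blow up as `s → 1`. -/
lemma Regular.ae_enorm_sub_average_le_potential (h : Q.Regular s r f) :
    ∀ᵐ x ∂(volume.restrict Q.halfOpen), ‖f x - ⨍ y in Q.toSet, f y‖ₑ ≤
      768 * ∫⁻ y in Q.toSet, oscMajorant s r Q f y * edist x y ^ (-(1 - s)) := by
  have hQm := Q.measurableSet_halfOpen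
  have hfi : Integrable (Q.halfOpen.indicator f) := (integrable_indicator_iff hQm).mpr h.integrable
  rw [ae_restrict_iff' hQm]
  filter_upwards [ae_tendsto_setAverage_shell hfi.locallyIntegrable] with x hx hxQ
  have hℓ := Q.side_pos
  have hxc := hxQ 0
  -- the shells lie on the side of `x` on which `Q` is longer
  obtain ⟨c, c', L, hcc, hL, hL4⟩ : ∃ c c' L : ℝ,
      (c = 1 ∧ c' = 1 / 2 ∧ x 0 + 2 * L ≤ Q.corner 0 + Q.side ∨
        c = -2 ∧ c' = -2 ∧ Q.corner 0 ≤ x 0 - 2 * L) ∧ 0 < L ∧ Q.side ≤ 4 * L := by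
    rcases le_total (x 0) (Q.corner 0 + Q.side / 2) with hx2 | hx2
    · exact ⟨1, 1 / 2, (Q.corner 0 + Q.side - x 0) / 2, Or.inl ⟨rfl, rfl, by linarith⟩,
        by linarith, by linarith⟩
    · exact ⟨-2, -2, (x 0 - Q.corner 0) / 2, Or.inr ⟨rfl, rfl, by linarith⟩, by linarith,
        by linarith⟩
  set l : ℕ → ℝ := fun k => L / 2 ^ k with hl
  have hl0 : ∀ k, 0 < l k := fun k => by positivity
  have hlS : ∀ k, l (k + 1) = l k / 2 := fun k => by simp only [hl, pow_succ]; field_simp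
  have hlL : ∀ k, l k ≤ L := fun k => div_le_self hL.le (one_le_pow₀ one_le_two)
  have hlim : Filter.Tendsto l Filter.atTop (nhds 0) := by
    have := (tendsto_pow_atTop_nhds_zero_of_lt_one (r := (1 / 2 : ℝ)) (by norm_num)
      (by norm_num)).const_mul L
    rw [mul_zero] at this
    refine this.congr fun k => ?_
    simp only [hl, one_div, inv_pow]; rfl
  -- the shells, and the unions of two consecutive ones
  set A : ℕ → Cube 1 := fun k => shell x c 1 (l k) one_pos (hl0 k) with hA
  set R : ℕ → Cube 1 := fun k => shell x c' (3 / 2) (l k) (by norm_num) (hl0 k) with hR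
  have hAR : ∀ k, (R k).toSet = (A k).toSet ∪ (A (k + 1)).toSet := by
    intro k
    ext y
    simp only [hA, hR, mem_union, mem_shell, hlS]
    have := hl0 k
    rcases hcc with ⟨rfl, rfl, -⟩ | ⟨rfl, rfl, -⟩
    · constructor
      · rintro ⟨h1, h2⟩
        rcases le_total (l k) (y 0 - x 0) with h3 | h3
        · left; constructor <;> linarith
        · right; constructor <;> linarith
      · rintro (⟨h1, h2⟩ | ⟨h1, h2⟩) <;> constructor <;> linarith
    · constructor
      · rintro ⟨h1, h2⟩
        rcases le_total (y 0 - x 0) (-(l k)) with h3 | h3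
        · left; constructor <;> linarith
        · right; constructor <;> linarith
      · rintro (⟨h1, h2⟩ | ⟨h1, h2⟩) <;> constructor <;> linarith
  have hRQ : ∀ k, (R k).toSet ⊆ Q.toSet := by
    intro k y hy
    rw [mem_shell] at hy
    have h2 := hl0 k
    have h3 := hlL k
    intro i
    rw [Fin.fin_one_eq_zero i]
    rcases hcc with ⟨-, rfl, h4⟩ | ⟨-, rfl, h4⟩ <;> constructor <;>
      linarith [hy.1, hy.2, hxc.1, hxc.2]
  have hAQ : ∀ k, (A k).toSet ⊆ Q.toSet := fun k =>
    (subset_union_left.trans (hAR k).superset).trans (hRQ k)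
  have hdisj : Pairwise fun i j => Disjoint (A i).halfOpen (A j).halfOpen := by
    have key : ∀ i j, i < j → Disjoint (A i).halfOpen (A j).halfOpen := by
      intro i j hij
      have h1 : l j ≤ l i / 2 := by
        rw [← hlS]
        simp only [hl]
        exact div_le_div_of_nonneg_left hL.le (by positivity) (pow_le_pow_right₀ one_le_two hij)
      rw [Set.disjoint_left]
      intro y hy hy'
      rw [mem_halfOpen_shell] at hy hy'
      have := hl0 i
      have := hl0 j
      rcases hcc with ⟨rfl, -, -⟩ | ⟨rfl, -, -⟩ <;> linarith [hy.1, hy.2, hy'.1, hy'.2]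
    intro i j hij
    rcases lt_or_gt_of_ne hij with h1 | h1
    · exact key i j h1
    · exact (key j i h1).symm
  set g := fun y => oscMajorant s r Q f y * edist x y ^ (-(1 - s)) with hg
  have hsum : ∑' k, ∫⁻ y in (A k).toSet, g y ≤ ∫⁻ y in Q.toSet, g y := by
    simp_rw [← restrict_halfOpen (A _)]
    rw [← lintegral_iUnion (fun k => (A k).measurableSet_halfOpen) hdisj]
    exact lintegral_mono_set (iUnion_subset fun k => (halfOpen_subset _).trans (hAQ k))
  have hstep : ∀ k, edist (⨍ y in (A k).toSet, f y) (⨍ y in (A (k + 1)).toSet, f y) ≤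
      256 * ((∫⁻ y in (A k).toSet, g y) + ∫⁻ y in (A (k + 1)).toSet, g y) := by
    intro k
    rw [edist_eq_enorm_sub]
    refine (h.enorm_setAverage_sub_setAverage_le (R := R k) (x := x)
      (subset_union_left.trans (hAR k).superset) (subset_union_right.trans (hAR k).superset)
      (hRQ k) ?_ ?_ fun y hy => ?_).trans (mul_le_mul' le_rfl ?_)
    · change 3 / 2 * l k ≤ 8 * (1 * l k)
      linarith [hl0 k]
    · change 3 / 2 * l k ≤ 8 * (1 * l (k + 1))
      linarith [hl0 k, hlS k]
    · rw [mem_shell] at hy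
      have e : 4 * ENNReal.ofReal (R k).side = ENNReal.ofReal (4 * (3 / 2 * l k)) := by
        rw [ENNReal.ofReal_mul (p := 4) (by norm_num), ENNReal.ofReal_ofNat]; rfl
      rw [edist_fin_one, e]
      refine ENNReal.ofReal_le_ofReal ?_
      have := hl0 k
      rw [abs_le]
      rcases hcc with ⟨-, rfl, -⟩ | ⟨-, rfl, -⟩ <;> constructor <;> linarith [hy.1, hy.2]
    · rw [hAR k]
      exact lintegral_union_le _ _ _
  -- the first shell is comparable to `Q`
  have hzero : ‖(⨍ y in (A 0).toSet, f y) - ⨍ y in Q.toSet, f y‖ₑ ≤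
      256 * ∫⁻ y in Q.toSet, g y := by
    refine h.enorm_setAverage_sub_setAverage_le (R := Q) (x := x) (hAQ 0) subset_rfl subset_rfl ?_ ?_
      fun y hy => ?_
    · change Q.side ≤ 8 * (1 * l 0)
      simp only [hl]; linarith
    · linarith
    · refine (Q.edist_le_of_mem (Q.halfOpen_subset hxQ) hy).trans ?_
      refine mul_le_mul' (by norm_num) le_rfl
  have hconv : Filter.Tendsto (fun k => ⨍ y in (A k).toSet, f y) Filter.atTop (nhds (f x)) := by
    have h1 := hx c l hl0 (by rcases hcc with ⟨rfl, -, -⟩ | ⟨rfl, -, -⟩ <;> norm_num [abs_le]) hlim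
    rw [indicator_of_mem hxQ] at h1
    refine h1.congr fun k => average_congr ?_
    filter_upwards [ae_restrict_mem (A k).measurableSet_toSet,
      ae_restrict_of_ae Q.halfOpen_ae_eq.mem_iff] with y hy hyQ
    exact indicator_of_mem (hyQ.mpr (hAQ k hy)) f
  have htel := edist_le_tsum_of_edist_le_of_tendsto₀ _ hstep hconv
  rw [edist_comm, edist_eq_enorm_sub] at htel
  calc ‖f x - ⨍ y in Q.toSet, f y‖ₑ
      = ‖(f x - ⨍ y in (A 0).toSet, f y) + ((⨍ y in (A 0).toSet, f y) - ⨍ y in Q.toSet, f y)‖ₑ := by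
        congr 1; ring
    _ ≤ _ := (enorm_add_le _ _).trans (add_le_add htel hzero)
    _ ≤ 256 * ((∫⁻ y in Q.toSet, g y) + ∫⁻ y in Q.toSet, g y) + 256 * ∫⁻ y in Q.toSet, g y := by
        refine add_le_add ?_ le_rfl
        rw [ENNReal.tsum_mul_left, ENNReal.tsum_add]
        refine mul_le_mul' le_rfl (add_le_add hsum (le_trans ?_ hsum))
        exact ENNReal.tsum_comp_le_tsum_of_injective (add_left_injective 1) _
    _ = _ := by ring

end Cube

namespace Cube

open PartitionTree

section Line

variable {Q : Cube 1} {s r b : ℝ} {f : EuclideanSpace ℝ (Fin 1) → ℂ}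

/-- The one-third trick: close points lie in a common interval of the dyadic grid or of the grid
shifted by `1/3`. -/
lemma mem_cell_or_mem_cell_third {k : ℕ} {x y : EuclideanSpace ℝ (Fin 1)}
    (hxy : 3 * |y 0 - x 0| < Q.side / 2 ^ k) :
    y ∈ (Q.dyadicTree 0).cell k x ∨ y ∈ (Q.dyadicTree (1 / 3)).cell k x := by
  have hℓ := Q.side_pos
  by_contra! hcon
  have hidx : ∀ θ : ℝ, y ∉ (Q.dyadicTree θ).cell k x →
      ⌊2 ^ k * ((y 0 - Q.corner 0) / Q.side + θ)⌋ ≠ ⌊2 ^ k * ((x 0 - Q.corner 0) / Q.side + θ)⌋ := by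
    intro θ hθ he
    refine hθ ?_
    rw [mem_cell]
    funext i
    rw [Fin.fin_one_eq_zero i]
    exact he
  -- points with different integer parts are separated by an integer
  have hsep : ∀ X Y : ℝ, ⌊Y⌋ ≠ ⌊X⌋ → ∃ m : ℤ, min X Y < m ∧ m ≤ max X Y := by
    intro X Y hne
    rcases lt_or_gt_of_ne hne with hlt | hlt
    · have h1 : Y < ⌊X⌋ := Int.floor_lt.mp hlt
      exact ⟨⌊X⌋, (min_le_right _ _).trans_lt h1, (Int.floor_le X).trans (le_max_left _ _)⟩
    · have h1 : X < ⌊Y⌋ := Int.floor_lt.mp hlt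
      exact ⟨⌊Y⌋, (min_le_left _ _).trans_lt h1, (Int.floor_le Y).trans (le_max_right _ _)⟩
  set X := 2 ^ k * ((x 0 - Q.corner 0) / Q.side) with hX
  set Y := 2 ^ k * ((y 0 - Q.corner 0) / Q.side) with hY
  have hXY : 3 * |Y - X| < 1 := by
    have e : Y - X = 2 ^ k / Q.side * (y 0 - x 0) := by rw [hX, hY]; field_simp; ring
    rw [e, abs_mul, abs_of_pos (by positivity)]
    rw [lt_div_iff₀ (by positivity)] at hxy
    calc _ = (3 * |y 0 - x 0| * 2 ^ k) / Q.side := by ring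
      _ < 1 := by rwa [div_lt_one hℓ]
  obtain ⟨m, hm1, hm2⟩ := hsep X Y (by
    have := hidx 0 hcon.1
    rwa [add_zero, add_zero] at this)
  obtain ⟨n, hn1, hn2⟩ := hsep (X + 2 ^ k / 3) (Y + 2 ^ k / 3) (by
    have := hidx (1 / 3) hcon.2
    rwa [mul_add, mul_add, mul_one_div] at this)
  rw [min_add_add_right] at hn1
  rw [max_add_add_right] at hn2
  have hmm : max X Y - min X Y = |Y - X| := by rw [max_sub_min_eq_abs]
  -- separating integers `m` and `n` for both grids would force `2 ^ k = 3 * (n - m)`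
  have h1 : (3 * (n - m) - 2 ^ k : ℝ) < 1 := by linarith
  have h2 : (-1 : ℝ) < 3 * (n - m) - 2 ^ k := by linarith
  have h3 : (3 * (n - m) - 2 ^ k : ℤ) < 1 := by exact_mod_cast h1
  have h4 : (-1 : ℤ) < 3 * (n - m) - 2 ^ k := by exact_mod_cast h2
  have h5 : (2 : ℤ) ^ k = 3 * (n - m) := by linarith
  have h6 : (3 : ℤ) ∣ 2 ^ k := ⟨_, h5⟩
  have h7 : (3 : ℤ) ∣ 2 := Int.Prime.dvd_pow' (by norm_num) h6
  omega

/-- Since `2 ^ b ≤ 1 + b`, the scale grows from one generation to the next by at most the fractional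
coefficient, which is small for small `b`. -/
lemma genScale_succ_le (Q : Cube 1) (hb0 : 0 ≤ b) (hb1 : b ≤ 1) (k : ℕ) :
    Q.genScale b (k + 1) ≤ Q.genScale b k + Q.fracCoeff b k := by
  have h1 := Q.genScale_rpow_neg b k 1 (-1)
  rw [neg_neg, ENNReal.rpow_one, ENNReal.rpow_one, pow_one, mul_neg_one, ENNReal.inv_rpow,
    ← ENNReal.rpow_neg, neg_neg] at h1
  have h2 : (2 : ℝ≥0∞) ^ b ≤ 1 + ENNReal.ofReal b := by
    have h3 := rpow_one_add_le_one_add_mul_self (s := 1) (p := b) (by norm_num) hb0 hb1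
    rw [← ENNReal.ofReal_ofNat, ENNReal.ofReal_rpow_of_pos two_pos, ← ENNReal.ofReal_one,
      ← ENNReal.ofReal_add zero_le_one hb0]
    refine ENNReal.ofReal_le_ofReal ?_
    norm_num at h3
    exact h3
  rw [h1, fracCoeff, Nat.cast_one, div_one]
  calc _ ≤ (1 + ENNReal.ofReal b) * Q.genScale b k := mul_le_mul' h2 le_rfl
    _ = _ := by ring

lemma genScale_le_sum (Q : Cube 1) (hb0 : 0 ≤ b) (hb1 : b ≤ 1) (N : ℕ) :
    Q.genScale b N ≤ Q.genScale b 0 + ∑ k ∈ Finset.range N, Q.fracCoeff b k := by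
  induction N with
  | zero => simp
  | succ N ih =>
    rw [Finset.sum_range_succ, ← add_assoc]
    exact (Q.genScale_succ_le hb0 hb1 N).trans (add_le_add ih le_rfl)

/-- The Riesz kernel is dominated by the kernels of two dyadic fractional integrals. -/
lemma edist_rpow_neg_le (hb0 : 0 ≤ b) (hb1 : b ≤ 1) {x y : EuclideanSpace ℝ (Fin 1)}
    (hxy : y ≠ x) :
    edist x y ^ (-b) ≤ 3 * (Q.genScale b 0 +
      (∑' k, Q.fracCoeff b k * ((Q.dyadicTree 0).cell k x).indicator 1 y +
        ∑' k, Q.fracCoeff b k * ((Q.dyadicTree (1 / 3)).cell k x).indicator 1 y)) := by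
  classical
  have hℓ := Q.side_pos
  set D := |y 0 - x 0| with hD
  have hD0 : 0 < D := by
    rw [hD, abs_pos, sub_ne_zero]
    intro he
    refine hxy ?_
    ext i
    rw [Fin.fin_one_eq_zero i]
    exact he
  have hex : ∃ N : ℕ, Q.side / 2 ^ N ≤ 3 * D := by
    obtain ⟨N, hN⟩ := pow_unbounded_of_one_lt (Q.side / (3 * D)) one_lt_two
    refine ⟨N, ?_⟩
    rw [div_lt_iff₀ (by positivity)] at hN
    rw [div_le_iff₀ (by positivity)]
    linarith
  -- all generations before `N` have a cell in one of the grids that holds both points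
  obtain ⟨N, hN, hmin⟩ : ∃ N : ℕ, Q.side / 2 ^ N ≤ 3 * D ∧ ∀ k < N, 3 * D < Q.side / 2 ^ k :=
    ⟨Nat.find hex, Nat.find_spec hex, fun k hk => not_le.mp (Nat.find_min hex hk)⟩
  have h1 : edist x y ^ (-b) ≤ 3 * Q.genScale b N := by
    have h2 : 2⁻¹ ^ N * ENNReal.ofReal Q.side ≤ 3 * edist x y := by
      rw [← ofReal_side_div, edist_fin_one, ← hD, ← ENNReal.ofReal_ofNat,
        ← ENNReal.ofReal_mul (by norm_num)]
      exact ENNReal.ofReal_le_ofReal hN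
    have h3 : edist x y ≠ 0 := by rw [edist_fin_one, ← hD]; simpa using hD0
    calc edist x y ^ (-b) = 3 ^ b * (3 * edist x y) ^ (-b) := by
          rw [ENNReal.mul_rpow_of_ne_zero (by simp) h3, ← mul_assoc,
            ← ENNReal.rpow_add _ _ (by simp) (by simp), add_neg_cancel, ENNReal.rpow_zero, one_mul]
      _ ≤ 3 ^ (1 : ℝ) * Q.genScale b N := by
          refine mul_le_mul' (ENNReal.rpow_le_rpow_of_exponent_le (by norm_num) hb1) ?_
          rw [genScale, ENNReal.rpow_neg, ENNReal.rpow_neg]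
          exact ENNReal.inv_le_inv.mpr (ENNReal.rpow_le_rpow h2 hb0)
      _ = _ := by rw [ENNReal.rpow_one]
  refine h1.trans (mul_le_mul' le_rfl ((Q.genScale_le_sum hb0 hb1 N).trans
    (add_le_add le_rfl ?_)))
  calc ∑ k ∈ Finset.range N, Q.fracCoeff b k
      ≤ ∑ k ∈ Finset.range N, (Q.fracCoeff b k * ((Q.dyadicTree 0).cell k x).indicator 1 y +
        Q.fracCoeff b k * ((Q.dyadicTree (1 / 3)).cell k x).indicator 1 y) := by
        refine Finset.sum_le_sum fun k hk => ?_
        rcases mem_cell_or_mem_cell_third (hmin k (Finset.mem_range.mp hk)) with hc | hc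
        · rw [indicator_of_mem hc, Pi.one_apply, mul_one]
          exact le_self_add
        · rw [indicator_of_mem hc, Pi.one_apply, mul_one]
          exact le_add_self
    _ ≤ _ := by
        rw [Finset.sum_add_distrib]
        exact add_le_add (ENNReal.sum_le_tsum _) (ENNReal.sum_le_tsum _)

/-- The Riesz potential is dominated by two dyadic fractional integrals and a multiple of the
integral. -/
lemma lintegral_potential_le (hb0 : 0 ≤ b) (hb1 : b ≤ 1) {G : EuclideanSpace ℝ (Fin 1) → ℝ≥0∞}
    (hG : Measurable G) (x : EuclideanSpace ℝ (Fin 1)) :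
    ∫⁻ y in Q.toSet, G y * edist x y ^ (-b) ≤ 3 * (Q.genScale b 0 * (∫⁻ y in Q.toSet, G y) +
      (∑' k, (Q.dyadicTree 0).term (Q.fracCoeff b) (volume.restrict Q.halfOpen) G k x +
        ∑' k, (Q.dyadicTree (1 / 3)).term (Q.fracCoeff b) (volume.restrict Q.halfOpen) G k x)) := by
  have hcm : ∀ θ k, MeasurableSet ((Q.dyadicTree θ).cell k x) := fun θ k => measurableSet_cell k x
  have hm : ∀ θ k, Measurable fun y =>
      Q.fracCoeff b k * ((Q.dyadicTree θ).cell k x).indicator 1 y := fun θ k =>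
    (measurable_one.indicator (hcm θ k)).const_mul _
  have hterm : ∀ θ, ∫⁻ y in Q.toSet, G y *
      ∑' k, Q.fracCoeff b k * ((Q.dyadicTree θ).cell k x).indicator 1 y =
        ∑' k, (Q.dyadicTree θ).term (Q.fracCoeff b) (volume.restrict Q.halfOpen) G k x := by
    intro θ
    simp_rw [← ENNReal.tsum_mul_left]
    rw [lintegral_tsum fun k => (hG.fun_mul (hm θ k)).aemeasurable]
    refine tsum_congr fun k => ?_
    rw [term, restrict_halfOpen, ← lintegral_indicator (hcm θ k),
      ← lintegral_const_mul _ (hG.indicator (hcm θ k))]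
    refine lintegral_congr fun y => ?_
    by_cases hy : y ∈ (Q.dyadicTree θ).cell k x
    · rw [indicator_of_mem hy, indicator_of_mem hy, Pi.one_apply]; ring
    · rw [indicator_of_notMem hy, indicator_of_notMem hy]; ring
  have hms : ∀ θ, Measurable fun y =>
      ∑' k, Q.fracCoeff b k * ((Q.dyadicTree θ).cell k x).indicator 1 y := fun θ =>
    Measurable.tsum (hm θ)
  have hne : ∀ᵐ y ∂(volume.restrict Q.toSet), y ≠ x := by
    refine ae_restrict_of_ae ?_
    rw [ae_iff]
    simp
  calc _ ≤ ∫⁻ y in Q.toSet, 3 * (Q.genScale b 0 * G y + (G y *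
        ∑' k, Q.fracCoeff b k * ((Q.dyadicTree 0).cell k x).indicator 1 y + G y *
        ∑' k, Q.fracCoeff b k * ((Q.dyadicTree (1 / 3)).cell k x).indicator 1 y)) := by
        refine lintegral_mono_ae ?_
        filter_upwards [hne] with y hy
        refine (mul_le_mul' le_rfl (edist_rpow_neg_le (Q := Q) hb0 hb1 hy)).trans (le_of_eq ?_)
        ring
    _ = _ := by
        rw [lintegral_const_mul _ (by
            have := hms 0
            have := hms (1 / 3)
            fun_prop), lintegral_add_left (hG.const_mul _), lintegral_const_mul _ hG,
          lintegral_add_left (hG.fun_mul (hms 0)), hterm, hterm]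

end Line

/-! ### Domination by dyadic fractional integrals in all dimensions -/

variable {d : ℕ} {Q : Cube d} {s r : ℝ} {f : EuclideanSpace ℝ (Fin d) → ℂ}
  {w τ z : EuclideanSpace ℝ (Fin d) → ℝ≥0∞} {p q : ℝ} {K B B' : ℝ≥0∞}

/-- The shift of the second dyadic grid; only in dimension one it differs from the first one. -/
noncomputable def gridShift (d : ℕ) : ℝ := if d = 1 then 1 / 3 else 0

lemma isCubeTree_dyadicTree_gridShift (Q : Cube d) : Q.IsCubeTree (Q.dyadicTree (gridShift d)) := by
  rcases eq_or_ne d 1 with rfl | hd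
  · rw [gridShift, if_pos rfl]; exact Q.isCubeTree_dyadicTree_third
  · rw [gridShift, if_neg hd]; exact Q.isCubeTree_dyadicTree

/-- The sum of the fractional integrals that dominates `f - ⟨f⟩_Q`. -/
noncomputable def fracMajorant (Q : Cube d) (b : ℝ) (z G : EuclideanSpace ℝ (Fin d) → ℝ≥0∞)
    (x : EuclideanSpace ℝ (Fin d)) : ℝ≥0∞ :=
  Q.genScale b 0 * (∫⁻ y in Q.toSet, G y) +
    (∑' k, (Q.dyadicTree 0).term (Q.fracCoeff b) (Q.wt z) (fun y => G y * (z y)⁻¹) k x +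
      ∑' k, (Q.dyadicTree (gridShift d)).term (Q.fracCoeff b) (Q.wt z)
        (fun y => G y * (z y)⁻¹) k x)

/-- In dimension one this combines the potential estimate with the two grids. In higher dimensions
telescoping over the dyadic cubes suffices: as `d - s ≥ d / 2`, the factor `(d - s) / d` in the
coefficients of the fractional integral costs at most `2`. -/
theorem Regular.ae_enorm_sub_average_le_fracMajorant (h : Q.Regular s r f)
    (hD : Q.DualPair w z τ p q (d - s) K) :
    ∀ᵐ x ∂Q.wt w, ‖f x - ⨍ y in Q.toSet, f y‖ₑ ≤
      (2304 * 18 ^ d : ℝ≥0) * Q.fracMajorant (d - s) z (oscMajorant s r Q f) x := by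
  have hG := measurable_oscMajorant s r Q h.measurable
  rcases eq_or_ne d 1 with rfl | hd
  · filter_upwards [(withDensity_absolutelyContinuous _ w).ae_le
      h.ae_enorm_sub_average_le_potential] with x hx
    have h1 := lintegral_potential_le (Q := Q) (b := 1 - s) (by linarith [h.s_lt_one])
      (by linarith [h.s_pos]) hG x
    have h2 : ∀ θ k, (Q.dyadicTree θ).term (Q.fracCoeff (1 - s)) (volume.restrict Q.halfOpen)
        (oscMajorant s r Q f) k x = (Q.dyadicTree θ).term (Q.fracCoeff (1 - s)) (Q.wt z)
          (fun y => oscMajorant s r Q f y * (z y)⁻¹) k x := fun θ k => by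
      rw [term, term, hD.setLIntegral_div hG (measurableSet_cell k x)]
    simp_rw [h2] at h1
    rw [fracMajorant, gridShift, if_pos rfl, Nat.cast_one]
    refine hx.trans ((mul_le_mul' le_rfl h1).trans ?_)
    rw [← mul_assoc]
    refine mul_le_mul' ?_ le_rfl
    push_cast
    norm_num
  · have hd2 : (2 : ℝ) ≤ d := by
      have h1 := h.one_le_dim
      have : 2 ≤ d := by omega
      exact_mod_cast this
    filter_upwards [h.ae_enorm_sub_average_le_tsum_osc w] with x hx
    set S := ∑' k, (Q.dyadicTree 0).term (Q.fracCoeff (d - s)) (Q.wt z)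
      (fun y => oscMajorant s r Q f y * (z y)⁻¹) k x with hS
    have h1 : ∀ k, (Q.dyadicTree 0).osc (volume.restrict Q.halfOpen) f k x ≤
        3 ^ d * (2 * (Q.dyadicTree 0).term (Q.fracCoeff (d - s)) (Q.wt z)
          (fun y => oscMajorant s r Q f y * (z y)⁻¹) k x) := by
      intro k
      refine (h.osc_le_term Q.isCubeTree_dyadicTree hD k x).trans (mul_le_mul' le_rfl ?_)
      rw [term, term, ← mul_assoc 2]
      refine mul_le_mul' ?_ le_rfl
      rw [fracCoeff, ← mul_assoc]
      conv_lhs => rw [← one_mul (Q.genScale (d - s) k)]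
      refine mul_le_mul' ?_ le_rfl
      rw [← ENNReal.ofReal_ofNat, ← ENNReal.ofReal_mul (by norm_num), ← ENNReal.ofReal_one]
      refine ENNReal.ofReal_le_ofReal ?_
      rw [← mul_div_assoc, le_div_iff₀ (by linarith)]
      linarith [h.s_lt_one]
    calc _ ≤ 6 ^ d * ∑' k, (3 ^ d * (2 * (Q.dyadicTree 0).term (Q.fracCoeff (d - s)) (Q.wt z)
          (fun y => oscMajorant s r Q f y * (z y)⁻¹) k x)) :=
          hx.trans (mul_le_mul' le_rfl (ENNReal.tsum_le_tsum h1))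
      _ = 2 * 18 ^ d * S := by
          rw [ENNReal.tsum_mul_left, ENNReal.tsum_mul_left, ← hS,
            show (18 : ℝ≥0∞) = 6 * 3 by norm_num, mul_pow]
          ring
      _ ≤ (2304 * 18 ^ d : ℝ≥0) * S := by
          refine mul_le_mul' ?_ le_rfl
          push_cast
          exact mul_le_mul' (by norm_num) le_rfl
      _ ≤ _ := mul_le_mul' le_rfl (le_add_self.trans' le_self_add)

end Cube

namespace Cube

open PartitionTree

/-! ### Critical case with different exponents -/

variable {d : ℕ} {Q : Cube d} {s r : ℝ} {f : EuclideanSpace ℝ (Fin d) → ℂ}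
  {w τ z : EuclideanSpace ℝ (Fin d) → ℝ≥0∞} {p q : ℝ} {K B B' : ℝ≥0∞}

lemma wt_univ (Q : Cube d) (w : EuclideanSpace ℝ (Fin d) → ℝ≥0∞) :
    Q.wt w univ = ∫⁻ x in Q.toSet, w x := by
  rw [wt, withDensity_apply _ MeasurableSet.univ, Measure.restrict_univ, restrict_halfOpen]

/-- The two-weight condition on `Q` itself bounds the non-dyadic term of the majorant. -/
lemma genScale_zero_mul_lintegral_le
    (hK : Q.TwoWeightOn w τ p q (d - s) 0 K) {G : EuclideanSpace ℝ (Fin d) → ℝ≥0∞}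
    (hG : Measurable G) :
    Q.genScale (d - s) 0 * (∫⁻ y in Q.toSet, G y) * Q.wt w univ ^ (1 / q) ≤
      K * (∫⁻ x in Q.toSet, G x ^ p * τ x ^ p) ^ (1 / p) := by
  have h1 := hK Q subset_rfl G hG
  have hl0 : ENNReal.ofReal Q.side ≠ 0 := by simpa using Q.side_pos
  rw [ENNReal.rpow_zero, mul_one] at h1
  rw [wt_univ, genScale, pow_zero, one_mul]
  calc _ = ENNReal.ofReal Q.side ^ (-((d : ℝ) - s)) *
        ((∫⁻ x in Q.toSet, w x) ^ (1 / q) * ∫⁻ x in Q.toSet, G x) := by ring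
    _ ≤ _ := mul_le_mul' le_rfl h1
    _ = (ENNReal.ofReal Q.side ^ (-((d : ℝ) - s)) * ENNReal.ofReal Q.side ^ ((d : ℝ) - s)) *
        (K * (∫⁻ x in Q.toSet, G x ^ p * τ x ^ p) ^ (1 / p)) := by ring
    _ = _ := by
        rw [← ENNReal.rpow_add _ _ hl0 ENNReal.ofReal_ne_top, neg_add_cancel, ENNReal.rpow_zero,
          one_mul]

lemma measurable_tsum_term {ι : Type*} [Countable ι] {t : PartitionTree (EuclideanSpace ℝ (Fin d)) ι}
    (γ : ℕ → ℝ≥0∞) (S : Measure (EuclideanSpace ℝ (Fin d))) (φ : EuclideanSpace ℝ (Fin d) → ℝ≥0∞) :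
    Measurable fun x => ∑' k, t.term γ S φ k x :=
  Measurable.tsum fun k => (adapted_term γ φ k).measurable

/-- The Fujii–Wilson condition with constant `B` on every tree of cubes in `Q`. -/
def GridFujiiWilson (Q : Cube d) (w : EuclideanSpace ℝ (Fin d) → ℝ≥0∞) (B : ℝ≥0∞) : Prop :=
  ∀ {ι : Type} (t : PartitionTree (EuclideanSpace ℝ (Fin d)) ι), Q.IsCubeTree t →
    t.FujiiWilson (volume.restrict Q.halfOpen) (Q.wt w) B

lemma one_le_rpow {B : ℝ≥0∞} (hB : 1 ≤ B) {e : ℝ} (he : 0 ≤ e) : 1 ≤ B ^ e := by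
  rw [← ENNReal.one_rpow e]
  exact ENNReal.rpow_le_rpow hB he

/-- The strong type estimate for different exponents. -/
theorem Regular.strongType_frac (h : Q.Regular s r f) (hD : Q.DualPair w z τ p q (d - s) K)
    (hK : Q.TwoWeightOn w τ p q (d - s) 0 K) (hpq : p < q)
    (hF : Q.GridFujiiWilson z B) (hB1 : 1 ≤ B) (hB : B ≠ ∞)
    (hF' : Q.GridFujiiWilson w B') (hB1' : 1 ≤ B') (hB' : B' ≠ ∞)
    (hfin : ∫⁻ x in Q.toSet, oscMajorant s r Q f x ^ p * τ x ^ p ≠ ∞) :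
    (∫⁻ x, ‖f x - ⨍ y in Q.toSet, f y‖ₑ ^ q ∂Q.wt w) ^ (1 / q) ≤
      2304 * 18 ^ d * (1 + 2 * fracConst p q) * (K * (B' ^ (1 - 1 / p) + B ^ (1 / q))) *
        (∫⁻ x in Q.toSet, oscMajorant s r Q f x ^ p * τ x ^ p) ^ (1 / p) := by
  have hp := hD.one_lt_p
  have hq : 0 < q := by linarith
  have hds : 0 < (d : ℝ) - s := by
    have : (1 : ℝ) ≤ d := by exact_mod_cast h.one_le_dim
    linarith [h.s_lt_one]
  have hds' : (d : ℝ) - s ≤ d := by linarith [h.s_pos]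
  set G := oscMajorant s r Q f with hGdef
  have hG : Measurable G := measurable_oscMajorant s r Q h.measurable
  set F := ∫⁻ x in Q.toSet, G x ^ p * τ x ^ p with hFdef
  set H := K * (B' ^ (1 - 1 / p) + B ^ (1 / q)) with hH
  have hKH : K ≤ H := by
    have h0 : 0 ≤ 1 - 1 / p := by rw [sub_nonneg, div_le_one (by linarith)]; exact hp.le
    calc K = K * 1 := (mul_one K).symm
      _ ≤ _ := mul_le_mul' le_rfl ((one_le_rpow hB1' h0).trans le_self_add)
  have hφ : ∫⁻ x, (G x * (z x)⁻¹) ^ p ∂Q.wt z = F := hD.lintegral_div_rpow hG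
  have hT : ∀ θ, Q.IsCubeTree (Q.dyadicTree θ) →
      (∫⁻ x, (∑' k, (Q.dyadicTree θ).term (Q.fracCoeff (d - s)) (Q.wt z)
        (fun y => G y * (z y)⁻¹) k x) ^ q ∂Q.wt w) ^ (1 / q) ≤ fracConst p q * H * F ^ (1 / p) := by
    intro θ hθ
    have := hD.strongType hθ h.one_le_dim hds hds' hpq (hF _ hθ) hB1 hB (hF' _ hθ) hB1' hB'
      (hG.fun_mul hD.measurable_inv) (by rw [hφ]; exact hfin)
    rwa [hφ] at this
  have hm : ∀ θ, Measurable fun x => ∑' k, (Q.dyadicTree θ).term (Q.fracCoeff (d - s)) (Q.wt z)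
      (fun y => G y * (z y)⁻¹) k x := fun θ => measurable_tsum_term _ _ _
  have hmaj : (∫⁻ x, Q.fracMajorant (d - s) z G x ^ q ∂Q.wt w) ^ (1 / q) ≤
      (1 + 2 * fracConst p q) * H * F ^ (1 / p) := by
    have e0 := ENNReal.lintegral_Lp_add_le (μ := Q.wt w)
      (f := fun _ => Q.genScale (d - s) 0 * (∫⁻ y in Q.toSet, G y))
      (g := fun x => ∑' k, (Q.dyadicTree 0).term (Q.fracCoeff (d - s)) (Q.wt z)
        (fun y => G y * (z y)⁻¹) k x + ∑' k, (Q.dyadicTree (gridShift d)).term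
          (Q.fracCoeff (d - s)) (Q.wt z) (fun y => G y * (z y)⁻¹) k x)
      aemeasurable_const ((hm 0).add (hm _)).aemeasurable (hp.le.trans hD.p_le_q)
    have e1 := ENNReal.lintegral_Lp_add_le (μ := Q.wt w) (hm 0).aemeasurable
      (hm (gridShift d)).aemeasurable (hp.le.trans hD.p_le_q)
    have e2 : (∫⁻ _, (Q.genScale (d - s) 0 * (∫⁻ y in Q.toSet, G y)) ^ q ∂Q.wt w) ^ (1 / q) ≤
        H * F ^ (1 / p) := by
      rw [lintegral_const, ENNReal.mul_rpow_of_nonneg _ _ (by positivity), ← ENNReal.rpow_mul,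
        mul_one_div_cancel hq.ne', ENNReal.rpow_one]
      exact (genScale_zero_mul_lintegral_le hK hG).trans (mul_le_mul' hKH le_rfl)
    calc _ ≤ H * F ^ (1 / p) + (fracConst p q * H * F ^ (1 / p) +
          fracConst p q * H * F ^ (1 / p)) :=
          e0.trans (add_le_add e2 (e1.trans (add_le_add (hT 0 Q.isCubeTree_dyadicTree)
            (hT _ Q.isCubeTree_dyadicTree_gridShift))))
      _ = _ := by ring
  calc _ ≤ (∫⁻ x, ((2304 * 18 ^ d : ℝ≥0) * Q.fracMajorant (d - s) z G x) ^ q ∂Q.wt w) ^ (1 / q) := by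
        refine ENNReal.rpow_le_rpow (lintegral_mono_ae ?_) (by positivity)
        filter_upwards [h.ae_enorm_sub_average_le_fracMajorant hD] with x hx
        exact ENNReal.rpow_le_rpow hx hq.le
    _ = (2304 * 18 ^ d : ℝ≥0) * (∫⁻ x, Q.fracMajorant (d - s) z G x ^ q ∂Q.wt w) ^ (1 / q) := by
        simp_rw [ENNReal.mul_rpow_of_nonneg ((2304 * 18 ^ d : ℝ≥0) : ℝ≥0∞) _ hq.le]
        rw [lintegral_const_mul', ENNReal.mul_rpow_of_nonneg _ _ (by positivity),
          ← ENNReal.rpow_mul, mul_one_div_cancel hq.ne', ENNReal.rpow_one]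
        exact ENNReal.rpow_ne_top_of_nonneg hq.le ENNReal.coe_ne_top
    _ ≤ (2304 * 18 ^ d : ℝ≥0) * ((1 + 2 * fracConst p q) * H * F ^ (1 / p)) :=
        mul_le_mul' le_rfl hmaj
    _ = _ := by push_cast; ring

/-- The constant in the weak type estimate for different exponents. -/
noncomputable def weakConst (d : ℕ) (p q : ℝ) : ℝ≥0∞ :=
  2304 * 18 ^ d * 3 * (1 + 2 * fracWeakConst p q)

/-- The weak type estimate for different exponents; only the characteristic of `w` enters. -/
theorem Regular.weakType_frac (h : Q.Regular s r f) (hD : Q.DualPair w z τ p q (d - s) K)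
    (hK : Q.TwoWeightOn w τ p q (d - s) 0 K) (hpq : p < q)
    (hF' : Q.GridFujiiWilson w B') (hB1' : 1 ≤ B') (hB' : B' ≠ ∞) (l : ℝ≥0) :
    (l : ℝ≥0∞) ^ q * Q.wt w {x | l < ‖f x - ⨍ y in Q.toSet, f y‖ₑ} ≤
      (weakConst d p q * (B' ^ (1 - 1 / p) * K)) ^ q *
        (∫⁻ x in Q.toSet, oscMajorant s r Q f x ^ p * τ x ^ p) ^ (q / p) := by
  have hp := hD.one_lt_p
  have hq : 0 < q := by linarith
  have hds : 0 < (d : ℝ) - s := by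
    have : (1 : ℝ) ≤ d := by exact_mod_cast h.one_le_dim
    linarith [h.s_lt_one]
  have hds' : (d : ℝ) - s ≤ d := by linarith [h.s_pos]
  set G := oscMajorant s r Q f with hGdef
  have hG : Measurable G := measurable_oscMajorant s r Q h.measurable
  set F := ∫⁻ x in Q.toSet, G x ^ p * τ x ^ p with hFdef
  set H := K * B' ^ (1 - 1 / p) with hH
  have hKH : K ≤ H := by
    have h0 : 0 ≤ 1 - 1 / p := by rw [sub_nonneg, div_le_one (by linarith)]; exact hp.le
    calc K = K * 1 := (mul_one K).symm
      _ ≤ _ := mul_le_mul' le_rfl (one_le_rpow hB1' h0)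
  have hφ : ∫⁻ x, (G x * (z x)⁻¹) ^ p ∂Q.wt z = F := hD.lintegral_div_rpow hG
  set T := fun θ x => ∑' k, (Q.dyadicTree θ).term (Q.fracCoeff (d - s)) (Q.wt z)
        (fun y => G y * (z y)⁻¹) k x with hTdef
  have hT : ∀ θ, Q.IsCubeTree (Q.dyadicTree θ) → ∀ l : ℝ≥0,
      (l : ℝ≥0∞) ^ q * Q.wt w {x | l < T θ x} ≤ (fracWeakConst p q * H) ^ q * F ^ (q / p) := by
    intro θ hθ l
    have := hD.weakType hθ h.one_le_dim hds hds' hpq (hF' _ hθ) hB1' hB'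
      (hG.fun_mul hD.measurable_inv) l
    rwa [hφ] at this
  have h0 : ∀ l : ℝ≥0, (l : ℝ≥0∞) ^ q * Q.wt w {_x | (l : ℝ≥0∞) <
      Q.genScale (d - s) 0 * (∫⁻ y in Q.toSet, G y)} ≤ H ^ q * F ^ (q / p) := by
    intro l
    by_cases hl : (l : ℝ≥0∞) < Q.genScale (d - s) 0 * (∫⁻ y in Q.toSet, G y)
    · calc _ ≤ (Q.genScale (d - s) 0 * (∫⁻ y in Q.toSet, G y) * Q.wt w univ ^ (1 / q)) ^ q := by
            rw [ENNReal.mul_rpow_of_nonneg _ _ hq.le, ← ENNReal.rpow_mul, one_div_mul_cancel hq.ne',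
              ENNReal.rpow_one]
            exact mul_le_mul' (ENNReal.rpow_le_rpow hl.le hq.le) (measure_mono (subset_univ _))
        _ ≤ (H * F ^ (1 / p)) ^ q := ENNReal.rpow_le_rpow
            ((genScale_zero_mul_lintegral_le hK hG).trans (mul_le_mul' hKH le_rfl)) hq.le
        _ = _ := by
            rw [ENNReal.mul_rpow_of_nonneg _ _ hq.le, ← ENNReal.rpow_mul]
            congr 2; ring
    · simp [hl]
  have key := rpow_mul_measure_lt_le (μ := Q.wt w) (c := 2304 * 18 ^ d * 3) (by positivity)
    (g := fun x => ‖f x - ⨍ y in Q.toSet, f y‖ₑ)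
    (h := fun x => 3⁻¹ * Q.fracMajorant (d - s) z G x) ?_ hq
    (D := ((1 + 2 * fracWeakConst p q) * H) ^ q * F ^ (q / p)) ?_ l
  · refine key.trans (le_of_eq ?_)
    rw [← mul_assoc, ← ENNReal.mul_rpow_of_nonneg _ _ hq.le, weakConst, hH]
    push_cast
    congr 2
    ring
  · filter_upwards [h.ae_enorm_sub_average_le_fracMajorant hD] with x hx
    refine hx.trans (le_of_eq ?_)
    push_cast
    rw [mul_assoc _ 3, ← mul_assoc 3, ENNReal.mul_inv_cancel (by simp) (by simp), one_mul]
  · intro l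
    have hsub : {x | (l : ℝ≥0∞) < 3⁻¹ * Q.fracMajorant (d - s) z G x} ⊆
        {_x | (l : ℝ≥0∞) < Q.genScale (d - s) 0 * (∫⁻ y in Q.toSet, G y)} ∪
          ({x | (l : ℝ≥0∞) < T 0 x} ∪ {x | (l : ℝ≥0∞) < T (gridShift d) x}) := by
      intro x (hx : (l : ℝ≥0∞) < _)
      by_contra hcon
      simp only [mem_union, mem_ofPred_eq, not_or, not_lt] at hcon
      refine absurd hx (not_lt.mpr ?_)
      calc 3⁻¹ * Q.fracMajorant (d - s) z G x ≤ 3⁻¹ * ((l : ℝ≥0∞) + (l + l)) :=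
            mul_le_mul' le_rfl (add_le_add hcon.1 (add_le_add hcon.2.1 hcon.2.2))
        _ = 3⁻¹ * 3 * l := by ring
        _ = l := by rw [ENNReal.inv_mul_cancel (by simp) (by simp), one_mul]
    have hq1 : 1 ≤ q := by linarith
    calc _ ≤ (l : ℝ≥0∞) ^ q * (Q.wt w {_x | (l : ℝ≥0∞) <
            Q.genScale (d - s) 0 * (∫⁻ y in Q.toSet, G y)} +
          (Q.wt w {x | (l : ℝ≥0∞) < T 0 x} + Q.wt w {x | (l : ℝ≥0∞) < T (gridShift d) x})) :=
          mul_le_mul' le_rfl ((measure_mono hsub).trans ((measure_union_le _ _).trans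
            (add_le_add le_rfl (measure_union_le _ _))))
      _ ≤ H ^ q * F ^ (q / p) + ((fracWeakConst p q * H) ^ q * F ^ (q / p) +
          (fracWeakConst p q * H) ^ q * F ^ (q / p)) := by
          rw [mul_add, mul_add]
          exact add_le_add (h0 l) (add_le_add (hT 0 Q.isCubeTree_dyadicTree l)
            (hT _ Q.isCubeTree_dyadicTree_gridShift l))
      _ = (H ^ q + ((fracWeakConst p q * H) ^ q + (fracWeakConst p q * H) ^ q)) * F ^ (q / p) := by
          ring
      _ ≤ (H + (fracWeakConst p q * H + fracWeakConst p q * H)) ^ q * F ^ (q / p) := by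
          refine mul_le_mul' ?_ le_rfl
          exact (add_le_add le_rfl (ENNReal.add_rpow_le_rpow_add _ _ hq1)).trans
            (ENNReal.add_rpow_le_rpow_add _ _ hq1)
      _ = _ := by congr 2; ring

end Cube

namespace Cube

open PartitionTree

/-! ### Finiteness of the constants -/

lemma sparseConst_ne_top (d : ℕ) {q : ℝ} (hq : 0 < q) : sparseConst d q ≠ ∞ := by
  have : (2 : ℝ≥0∞) ^ ((q + 1) * (q + 1) / q) ≠ ∞ :=
    ENNReal.rpow_ne_top_of_nonneg (by positivity) (by simp)
  rw [sparseConst]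
  finiteness

lemma sparseStrongConst_ne_top (d : ℕ) {p : ℝ} (hp : 1 < p) : sparseStrongConst d p ≠ ∞ := by
  have hc := Real.HolderConjugate.conjExponent hp
  have h1 : (2 : ℝ≥0∞) ^ p ≠ ∞ := ENNReal.rpow_ne_top_of_nonneg hc.nonneg (by simp)
  have h2 : (2 : ℝ≥0∞) ^ p.conjExponent ≠ ∞ :=
    ENNReal.rpow_ne_top_of_nonneg hc.symm.nonneg (by simp)
  have h3 := principalConst_ne_top p
  have h4 := principalConst_ne_top p.conjExponent
  rw [sparseStrongConst]
  finiteness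

section

variable {p q : ℝ}

lemma one_div_lt_one_div_lt_one (hp : 1 < p) (hpq : p < q) :
    0 < 1 / q ∧ 1 / q < 1 / p ∧ 1 / p < 1 :=
  ⟨by have : 0 < q := by linarith
      positivity, one_div_lt_one_div_of_lt (by linarith) hpq, by
    rw [div_lt_one (by linarith)]; exact hp⟩

lemma fracConst_ne_top (hp : 1 < p) (hpq : p < q) : fracConst p q ≠ ∞ := by
  obtain ⟨h1, h2, h3⟩ := one_div_lt_one_div_lt_one hp hpq
  have hc := Real.HolderConjugate.conjExponent hp
  have hc' := Real.HolderConjugate.conjExponent (hp.trans hpq)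
  have e1 : testingConst (1 - 1 / p) (1 / q) ≠ ∞ :=
    testingConst_ne_top (by linarith) h1 (by linarith)
  have e2 : testingConst (1 / q) (1 - 1 / p) ≠ ∞ :=
    testingConst_ne_top h1 (by linarith) (by linarith)
  have e3 := principalConst_ne_top p
  have e4 := principalConst_ne_top q.conjExponent
  have e5 : (1 + principalConst p) ^ (p.conjExponent / q.conjExponent) ≠ ∞ :=
    ENNReal.rpow_ne_top_of_nonneg (div_nonneg hc.symm.nonneg hc'.symm.nonneg) (by finiteness)
  have e6 : (1 + principalConst q.conjExponent) ^ (q / p) ≠ ∞ :=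
    ENNReal.rpow_ne_top_of_nonneg (div_nonneg hc'.nonneg hc.nonneg) (by finiteness)
  rw [fracConst]
  finiteness

lemma weakConst_ne_top (d : ℕ) (hp : 1 < p) (hpq : p < q) : weakConst d p q ≠ ∞ := by
  obtain ⟨h1, h2, h3⟩ := one_div_lt_one_div_lt_one hp hpq
  have e1 : testingConst (1 / q) (1 - 1 / p) ≠ ∞ :=
    testingConst_ne_top h1 (by linarith) (by linarith)
  have e2 : (2 : ℝ≥0∞) ^ (q + 1) ≠ ∞ := ENNReal.rpow_ne_top_of_nonneg (by linarith) (by simp)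
  rw [weakConst, fracWeakConst]
  finiteness

end

/-! ### Reduction to regular representatives -/

variable {d : ℕ} {Q : Cube d} {p q r s α : ℝ} {ω σ ω' σ' : EuclideanSpace ℝ (Fin d) → ℝ}
  {f f' : EuclideanSpace ℝ (Fin d) → ℂ}

lemma pAverage_congr (e : ℝ≥0∞) {R : Cube d} (hR : R.toSet ⊆ Q.toSet)
    (h : ω =ᵐ[volume.restrict Q.toSet] ω') : pAverage e R ω = pAverage e R ω' :=
  eLpNorm_congr_ae (Measure.ae_smul_measure (ae_restrict_of_ae_restrict_of_subset hR h) _)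

lemma apqChar_congr (hω : ω =ᵐ[volume.restrict Q.toSet] ω')
    (hσ : σ =ᵐ[volume.restrict Q.toSet] σ') : apqChar p q α Q ω σ = apqChar p q α Q ω' σ' := by
  refine iSup_congr fun R => iSup_congr fun hR => ?_
  rw [pAverage_congr _ hR hω, pAverage_congr (ω := fun x => (σ x)⁻¹) (ω' := fun x => (σ' x)⁻¹) _ hR]
  filter_upwards [hσ] with x hx
  rw [hx]

lemma aInftyChar_congr (h : ω =ᵐ[volume.restrict Q.toSet] ω') :
    aInftyChar Q ω = aInftyChar Q ω' := by
  refine iSup_congr fun R => iSup_congr fun hR => ?_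
  congr 1
  · refine lintegral_congr fun x => iSup_congr fun S => iSup_congr fun hS => ?_
    rw [pAverage_congr 1 (hS.trans hR) h]
  · refine lintegral_congr_ae ?_
    filter_upwards [ae_restrict_of_ae_restrict_of_subset hR h] with x hx
    rw [hx]

lemma oscNorm_congr (hω : ω =ᵐ[volume.restrict Q.toSet] ω')
    (hf : f =ᵐ[volume.restrict Q.toSet] f') : oscNorm q Q ω f = oscNorm q Q ω' f' := by
  rw [oscNorm, oscNorm, wLpNorm, wLpNorm, average_congr hf]
  congr 1
  refine lintegral_congr_ae ?_
  filter_upwards [hω, hf] with x hx hx'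
  rw [hx, hx']

lemma wLpNorm_congr (hσ : σ =ᵐ[volume.restrict Q.toSet] σ')
    (hf : f =ᵐ[volume.restrict Q.toSet] f') : wLpNorm p Q σ f = wLpNorm p Q σ' f' := by
  rw [wLpNorm, wLpNorm]
  congr 1
  refine lintegral_congr_ae ?_
  filter_upwards [hσ, hf] with x hx hx'
  rw [hx, hx']

lemma tlSeminorm_congr (hσ : σ =ᵐ[volume.restrict Q.toSet] σ')
    (hf : f =ᵐ[volume.restrict Q.toSet] f') :
    tlSeminorm s p r Q σ f = tlSeminorm s p r Q σ' f' := by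
  rw [tlSeminorm, tlSeminorm]
  congr 1
  refine lintegral_congr_ae ?_
  filter_upwards [hσ, hf] with x hx hx'
  rw [hx, hx']
  congr 2
  refine lintegral_congr_ae ?_
  filter_upwards [hf] with y hy
  rw [hy]

/-- A setting in which the weights and the function are measurable, and the weights are positive,
on the whole space. -/
structure NiceSetting (p q r s α : ℝ) (Q : Cube d) (ω σ : EuclideanSpace ℝ (Fin d) → ℝ)
    (f : EuclideanSpace ℝ (Fin d) → ℂ) : Prop extends Setting p q r s α Q ω σ f where
  one_le_dim : 1 ≤ d
  measurable_ω : Measurable ω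
  measurable_σ : Measurable σ
  measurable_f : Measurable f
  ω_pos : ∀ x, 0 < ω x
  σ_pos : ∀ x, 0 < σ x

lemma exists_measurable_pos (h : IsWeightOn Q ω) : ∃ ω' : EuclideanSpace ℝ (Fin d) → ℝ,
    Measurable ω' ∧ (∀ x, 0 < ω' x) ∧ ω =ᵐ[volume.restrict Q.toSet] ω' := by
  classical
  obtain ⟨hm, hpos⟩ := h
  refine ⟨fun x => if 0 < hm.mk ω x then hm.mk ω x else 1, ?_, fun x => ?_, ?_⟩
  · exact Measurable.ite (measurableSet_lt measurable_const hm.measurable_mk) hm.measurable_mk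
      measurable_const
  · dsimp only
    split_ifs with hx
    · exact hx
    · exact one_pos
  · filter_upwards [hm.ae_eq_mk, ae_restrict_mem Q.measurableSet_toSet] with x hx hxQ
    rw [← hx, if_pos (hpos x hxQ)]

/-- Weights and function can be replaced by regular representatives almost everywhere on `Q`, which
does not change norms and characteristics. -/
lemma exists_niceSetting (hd : 1 ≤ d) (h : Setting p q r s α Q ω σ f) :
    ∃ (ω' σ' : EuclideanSpace ℝ (Fin d) → ℝ) (f' : EuclideanSpace ℝ (Fin d) → ℂ),
      NiceSetting p q r s α Q ω' σ' f' ∧ oscNorm q Q ω f = oscNorm q Q ω' f' ∧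
      tlSeminorm s p r Q σ f = tlSeminorm s p r Q σ' f' ∧
      apqChar p q α Q ω σ = apqChar p q α Q ω' σ' ∧
      (∀ e : ℝ, aInftyChar Q (fun x => ω x ^ e) = aInftyChar Q (fun x => ω' x ^ e)) ∧
      ∀ e : ℝ, aInftyChar Q (fun x => σ x ^ e) = aInftyChar Q (fun x => σ' x ^ e) := by
  obtain ⟨ω', hω', hω0, hω⟩ := exists_measurable_pos h.weight_ω
  obtain ⟨σ', hσ', hσ0, hσ⟩ := exists_measurable_pos h.weight_σ
  have hfm := h.memTL.aestronglyMeasurable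
  have hf := hfm.ae_eq_mk
  have hpow : ∀ {g g' : EuclideanSpace ℝ (Fin d) → ℝ}, g =ᵐ[volume.restrict Q.toSet] g' → ∀ e : ℝ,
      aInftyChar Q (fun x => g x ^ e) = aInftyChar Q (fun x => g' x ^ e) := fun hg e =>
    aInftyChar_congr (hg.mono fun x hx => by dsimp only; rw [hx])
  refine ⟨ω', σ', hfm.mk f, ⟨{ h with
      weight_ω := ⟨hω'.aemeasurable, fun x _ => hω0 x⟩
      weight_σ := ⟨hσ'.aemeasurable, fun x _ => hσ0 x⟩
      apq := apqChar_congr hω hσ ▸ h.apq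
      memTL := ⟨hfm.stronglyMeasurable_mk.aestronglyMeasurable,
        wLpNorm_congr hσ hf ▸ h.memTL.wLpNorm_lt_top,
        tlSeminorm_congr hσ hf ▸ h.memTL.tlSeminorm_lt_top⟩ }, hd, hω', hσ',
      hfm.stronglyMeasurable_mk.measurable, hω0, hσ0⟩, oscNorm_congr hω hf, tlSeminorm_congr hσ hf,
    apqChar_congr hω hσ, hpow hω, hpow hσ⟩

/-! ### The estimates in terms of the characteristics of the weights -/

namespace NiceSetting

variable (h : NiceSetting p q r s α Q ω σ f)

include h

lemma p_pos : 0 < p := by linarith [h.one_le_p]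

lemma q_pos : 0 < q := by linarith [h.p_pos, h.p_le_q]

lemma twoWeightOn : Q.TwoWeightOn (fun x => ENNReal.ofReal (ω x ^ q))
    (fun x => ENNReal.ofReal (σ x)) p q (d - s) (scalingDeficit d s p q α)
      (apqChar p q α Q ω σ) :=
  twoWeightOn_of_apqChar h.one_le_dim h.one_le_p h.q_pos h.measurable_σ h.ω_pos h.σ_pos

lemma lintegral_ω_ne_top : ∫⁻ x in Q.toSet, ENNReal.ofReal (ω x ^ q) ≠ ∞ :=
  lintegral_weight_ne_top h.q_pos h.measurable_σ h.ω_pos h.σ_pos h.apq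

/-- Functions in the weighted space are integrable, by Hölder's inequality. -/
lemma regular : Q.Regular s r f where
  one_le_dim := h.one_le_dim
  measurable := h.measurable_f
  integrable := by
    rw [restrict_halfOpen]
    refine ⟨h.measurable_f.aestronglyMeasurable, ?_⟩
    have hf := h.measurable_f
    have h1 := h.twoWeightOn Q subset_rfl (fun x => ‖f x‖ₑ) (by fun_prop)
    have hW0 : ∫⁻ x in Q.toSet, ENNReal.ofReal (ω x ^ q) ≠ 0 := by
      refine Q.setLIntegral_ne_zero (by have := h.measurable_ω; fun_prop) fun x _ => ?_
      simpa using Real.rpow_pos_of_pos (h.ω_pos x) q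
    have h2 : (∫⁻ x in Q.toSet, ENNReal.ofReal (ω x ^ q)) ^ (1 / q) ≠ 0 :=
      (ENNReal.rpow_pos hW0.bot_lt h.lintegral_ω_ne_top).ne'
    rw [HasFiniteIntegral, lt_top_iff_ne_top]
    intro htop
    rw [htop, ENNReal.mul_top h2, top_le_iff] at h1
    refine ENNReal.mul_ne_top (ENNReal.mul_ne_top (ENNReal.mul_ne_top h.apq.ne ?_) ?_)
      h.memTL.wLpNorm_lt_top.ne h1
    · exact ENNReal.rpow_ne_top_of_ne_zero Q.volume_ne_zero Q.volume_ne_top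
    · exact ENNReal.rpow_ne_top_of_ne_zero (by simpa using Q.side_pos) ENNReal.ofReal_ne_top
  one_le_r := h.one_le_r
  s_pos := h.s_pos
  s_lt_one := h.s_lt_one

lemma oscNorm_eq : oscNorm q Q ω f =
    (∫⁻ x, ‖f x - ⨍ y in Q.toSet, f y‖ₑ ^ q ∂Q.wt fun x => ENNReal.ofReal (ω x ^ q)) ^ (1 / q) := by
  have hf := h.measurable_f
  have hω := h.measurable_ω
  rw [lintegral_wt Q (by fun_prop) (by fun_prop), oscNorm, wLpNorm]
  congr 1
  refine lintegral_congr fun x => ?_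
  rw [ENNReal.ofReal_rpow_of_pos (h.ω_pos x), mul_comm]

/-- The weighted norm of the majorant is the seminorm of `f`, with the factor `(1 - s)^{1/r}`. -/
lemma lintegral_oscMajorant_eq :
    (∫⁻ x in Q.toSet, oscMajorant s r Q f x ^ p * ENNReal.ofReal (σ x) ^ p) ^ (1 / p) =
      bbmConst d * ENNReal.ofReal ((1 - s) ^ (1 / r)) * tlSeminorm s p r Q σ f := by
  have hp := h.p_pos
  have hσ := h.measurable_σ
  have hdiff := measurable_diffFn s r Q h.measurable_f
  have h1 : ∀ x, oscMajorant s r Q f x ^ p * ENNReal.ofReal (σ x) ^ p =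
      (bbmConst d * ENNReal.ofReal ((1 - s) ^ (1 / r))) ^ p *
        (diffFn s r Q f x ^ p * ENNReal.ofReal (σ x) ^ p) := fun x => by
    rw [oscMajorant, ENNReal.mul_rpow_of_nonneg _ _ hp.le, mul_assoc]
  have h2 : ∀ x, diffFn s r Q f x ^ p =
      (∫⁻ y in Q.toSet, ‖f x - f y‖ₑ ^ r / edist x y ^ ((d : ℝ) + s * r)) ^ (p / r) := fun x => by
    rw [diffFn, ← ENNReal.rpow_mul]
    congr 1; ring
  simp_rw [h1]
  rw [lintegral_const_mul _ (by fun_prop), ENNReal.mul_rpow_of_nonneg _ _ (by positivity),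
    ← ENNReal.rpow_mul, mul_one_div_cancel hp.ne', ENNReal.rpow_one, tlSeminorm]
  simp_rw [h2]

lemma lintegral_oscMajorant_ne_top :
    ∫⁻ x in Q.toSet, oscMajorant s r Q f x ^ p * ENNReal.ofReal (σ x) ^ p ≠ ∞ := by
  intro htop
  have h1 := h.lintegral_oscMajorant_eq
  rw [htop, ENNReal.top_rpow_of_pos (by have := h.p_pos; positivity)] at h1
  exact ENNReal.mul_ne_top (ENNReal.mul_ne_top (bbmConst_ne_top d) ENNReal.ofReal_ne_top)
    h.memTL.tlSeminorm_lt_top.ne h1.symm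

lemma scalingDeficit_le_one : scalingDeficit d s p q α ≤ 1 := by
  have h1 : (1 : ℝ) ≤ d := by exact_mod_cast h.one_le_dim
  have h2 : s / d ≤ 1 := by
    rw [div_le_one (by linarith)]; linarith [h.s_lt_one]
  have h3 : 1 / q ≤ 1 / p := one_div_le_one_div_of_le h.p_pos h.p_le_q
  rw [scalingDeficit]
  linarith [h.α_nonneg]

lemma gridFujiiWilson_ω :
    Q.GridFujiiWilson (fun x => ENNReal.ofReal (ω x ^ q)) (aInftyChar Q fun x => ω x ^ q) :=
  fun _ ht => ht.fujiiWilson (by have := h.measurable_ω; fun_prop)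
    (fun x _ => Real.rpow_pos_of_pos (h.ω_pos x) q) h.lintegral_ω_ne_top

lemma one_le_aInftyChar_ω : 1 ≤ aInftyChar Q fun x => ω x ^ q :=
  one_le_aInftyChar (by have := h.measurable_ω; fun_prop)
    (fun x _ => Real.rpow_pos_of_pos (h.ω_pos x) q) h.lintegral_ω_ne_top

lemma lintegral_σ_ne_top (hp : 1 < p) :
    ∫⁻ x in Q.toSet, ENNReal.ofReal (σ x ^ (-p.conjExponent)) ≠ ∞ :=
  lintegral_dual_weight_ne_top hp h.q_pos h.measurable_ω h.ω_pos h.σ_pos h.apq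

lemma gridFujiiWilson_σ (hp : 1 < p) :
    Q.GridFujiiWilson (fun x => ENNReal.ofReal (σ x ^ (-p.conjExponent)))
      (aInftyChar Q fun x => σ x ^ (-p.conjExponent)) :=
  fun _ ht => ht.fujiiWilson (by have := h.measurable_σ; fun_prop)
    (fun x _ => Real.rpow_pos_of_pos (h.σ_pos x) _) (h.lintegral_σ_ne_top hp)

lemma one_le_aInftyChar_σ (hp : 1 < p) : 1 ≤ aInftyChar Q fun x => σ x ^ (-p.conjExponent) :=
  one_le_aInftyChar (by have := h.measurable_σ; fun_prop)
    (fun x _ => Real.rpow_pos_of_pos (h.σ_pos x) _) (h.lintegral_σ_ne_top hp)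

lemma dualPair (hp : 1 < p) (hε : scalingDeficit d s p q α = 0) :
    Q.DualPair (fun x => ENNReal.ofReal (ω x ^ q))
      (fun x => ENNReal.ofReal (σ x ^ (-p.conjExponent))) (fun x => ENNReal.ofReal (σ x)) p q (d - s)
      (apqChar p q α Q ω σ) where
  one_lt_p := hp
  p_le_q := h.p_le_q
  b_nonneg := by
    have h1 : (1 : ℝ) ≤ d := by exact_mod_cast h.one_le_dim
    linarith [h.s_lt_one]
  measurable := by have := h.measurable_σ; fun_prop
  ne_zero x := by simpa using Real.rpow_pos_of_pos (h.σ_pos x) _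
  ne_top x := ENNReal.ofReal_ne_top
  dual x := by
    have h0 := h.σ_pos x
    have h1 : 0 < σ x ^ (-p.conjExponent) := Real.rpow_pos_of_pos h0 _
    rw [← ENNReal.ofReal_inv_of_pos h1, ENNReal.ofReal_rpow_of_pos (inv_pos.mpr h1),
      ← ENNReal.ofReal_mul (by positivity), ENNReal.ofReal_rpow_of_pos h0,
      ← Real.rpow_neg h0.le, neg_neg, ← Real.rpow_mul h0.le, ← Real.rpow_add h0]
    congr 2
    have := (Real.HolderConjugate.conjExponent hp).sub_one_mul_conj
    linarith
  lintegral_w_ne_top := h.lintegral_ω_ne_top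
  lintegral_z_ne_top := h.lintegral_σ_ne_top hp
  measure_le R hR := by
    have h1 := h.twoWeightOn.measure_le hp h.measurable_σ h.σ_pos (h.lintegral_σ_ne_top hp) hR
    rwa [hε, ENNReal.rpow_zero, mul_one] at h1

lemma subcritical (hε : 0 < scalingDeficit d s p q α) :
    oscNorm q Q ω f ≤ 6 ^ d * 2 * bbmConst d * apqChar p q α Q ω σ *
      ENNReal.ofReal ((1 - s) ^ (1 / r)) *
      (volume Q.toSet ^ scalingDeficit d s p q α / ENNReal.ofReal (scalingDeficit d s p q α)) *
        tlSeminorm s p r Q σ f := by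
  rw [h.oscNorm_eq]
  refine (h.regular.subcritical h.twoWeightOn h.one_le_p h.p_le_q hε
    h.scalingDeficit_le_one).trans (le_of_eq ?_)
  rw [h.lintegral_oscMajorant_eq]
  ring

lemma critical_sparse (hε : scalingDeficit d s p q α = 0) (hrp : r ≤ p)
    (hB : aInftyChar Q (fun x => ω x ^ q) < ∞) :
    oscNorm q Q ω f ≤ 16 * (1 + sparseConst d q) * bbmConst d * apqChar p q α Q ω σ *
      ENNReal.ofReal ((1 - s) ^ (1 / r)) * tlSeminorm s p r Q σ f *
        aInftyChar Q (fun x => ω x ^ q) := by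
  have hK := hε ▸ h.twoWeightOn
  have hB1 := h.one_le_aInftyChar_ω
  set B := aInftyChar Q (fun x => ω x ^ q) with hBdef
  set K := apqChar p q α Q ω σ with hKdef
  rw [h.oscNorm_eq]
  refine (h.regular.strongType_of_weakType h.lintegral_ω_ne_top
    h.measurable_σ.ennreal_ofReal hK h.p_pos hrp h.p_le_q
    fun g hg l => hg.weakType_sparse h.lintegral_ω_ne_top hK h.p_pos h.p_le_q
      (zero_lt_one.trans_le hB1).ne' hB.ne (h.gridFujiiWilson_ω _ Q.isCubeTree_dyadicTree) l).trans ?_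
  rw [h.lintegral_oscMajorant_eq]
  calc _ ≤ 16 * (B * K + sparseConst d q * (B * K)) *
        (bbmConst d * ENNReal.ofReal ((1 - s) ^ (1 / r)) * tlSeminorm s p r Q σ f) := by
        refine mul_le_mul' (mul_le_mul' le_rfl (add_le_add ?_ le_rfl)) le_rfl
        calc K = 1 * K := (one_mul K).symm
          _ ≤ B * K := mul_le_mul' hB1 le_rfl
    _ = _ := by ring

lemma critical_weak (hε : scalingDeficit d s p q α = 0) (hrp : r ≤ p) (hp : 1 < p) (hpq : p < q)
    (hB : aInftyChar Q (fun x => ω x ^ q) < ∞) :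
    oscNorm q Q ω f ≤ 16 * (1 + weakConst d p q) * bbmConst d * apqChar p q α Q ω σ *
      ENNReal.ofReal ((1 - s) ^ (1 / r)) * tlSeminorm s p r Q σ f *
        aInftyChar Q (fun x => ω x ^ q) ^ (1 - 1 / p) := by
  have hK := hε ▸ h.twoWeightOn
  have hB1 := h.one_le_aInftyChar_ω
  set B := aInftyChar Q (fun x => ω x ^ q) with hBdef
  set K := apqChar p q α Q ω σ with hKdef
  rw [h.oscNorm_eq]
  refine (h.regular.strongType_of_weakType h.lintegral_ω_ne_top
    h.measurable_σ.ennreal_ofReal hK h.p_pos hrp h.p_le_q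
    fun g hg l => hg.weakType_frac (h.dualPair hp hε) hK hpq h.gridFujiiWilson_ω hB1 hB.ne l).trans ?_
  rw [h.lintegral_oscMajorant_eq]
  calc _ ≤ 16 * (B ^ (1 - 1 / p) * K + weakConst d p q * (B ^ (1 - 1 / p) * K)) *
        (bbmConst d * ENNReal.ofReal ((1 - s) ^ (1 / r)) * tlSeminorm s p r Q σ f) := by
        refine mul_le_mul' (mul_le_mul' le_rfl (add_le_add ?_ le_rfl)) le_rfl
        calc K = 1 * K := (one_mul K).symm
          _ ≤ B ^ (1 - 1 / p) * K := mul_le_mul' (one_le_rpow hB1 (by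
            linarith [one_div_lt_one_div_lt_one hp hpq])) le_rfl
    _ = _ := by ring

lemma critical_strong_of_lt (hε : scalingDeficit d s p q α = 0) (hp : 1 < p) (hpq : p < q)
    (hB' : aInftyChar Q (fun x => ω x ^ q) < ∞)
    (hB : aInftyChar Q (fun x => σ x ^ (-p.conjExponent)) < ∞) :
    oscNorm q Q ω f ≤ 2304 * 18 ^ d * (1 + 2 * fracConst p q) * bbmConst d *
      apqChar p q α Q ω σ * ENNReal.ofReal ((1 - s) ^ (1 / r)) * tlSeminorm s p r Q σ f *
        (aInftyChar Q (fun x => ω x ^ q) ^ (1 - 1 / p) +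
          aInftyChar Q (fun x => σ x ^ (-p.conjExponent)) ^ (1 / q)) := by
  rw [h.oscNorm_eq]
  refine (h.regular.strongType_frac (h.dualPair hp hε) (hε ▸ h.twoWeightOn) hpq
    (h.gridFujiiWilson_σ hp) (h.one_le_aInftyChar_σ hp) hB.ne h.gridFujiiWilson_ω
    h.one_le_aInftyChar_ω hB'.ne h.lintegral_oscMajorant_ne_top).trans (le_of_eq ?_)
  rw [h.lintegral_oscMajorant_eq]
  ring

lemma critical_strong_of_eq (hε : scalingDeficit d s p q α = 0) (hp : 1 < p) (hpq : p = q)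
    (hB' : aInftyChar Q (fun x => ω x ^ q) < ∞)
    (hB : aInftyChar Q (fun x => σ x ^ (-p.conjExponent)) < ∞) :
    oscNorm q Q ω f ≤ sparseStrongConst d p * bbmConst d *
      apqChar p q α Q ω σ * ENNReal.ofReal ((1 - s) ^ (1 / r)) * tlSeminorm s p r Q σ f *
        (aInftyChar Q (fun x => ω x ^ q) ^ (1 - 1 / p) *
          aInftyChar Q (fun x => σ x ^ (-p.conjExponent)) ^ (1 / q)) := by
  subst hpq
  rw [h.oscNorm_eq]
  refine (h.regular.strongType_sparse (h.dualPair hp hε)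
    (zero_lt_one.trans_le (h.one_le_aInftyChar_σ hp)).ne' hB.ne
    (zero_lt_one.trans_le h.one_le_aInftyChar_ω).ne' hB'.ne
    (h.gridFujiiWilson_σ hp _ Q.isCubeTree_dyadicTree)
    (h.gridFujiiWilson_ω _ Q.isCubeTree_dyadicTree) h.lintegral_oscMajorant_ne_top).trans
    (le_of_eq ?_)
  rw [h.lintegral_oscMajorant_eq]
  ring

end NiceSetting

end Cube

theorem theorem5p1 (d : ℕ) (hd : 1 ≤ d) :
    -- Subcritical case: the constant depends only on `d`.
    (∃ C : ℝ≥0, ∀ (p q r s α : ℝ) (Q : Cube d) (ω σ : EuclideanSpace ℝ (Fin d) → ℝ)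
        (f : EuclideanSpace ℝ (Fin d) → ℂ),
        Setting p q r s α Q ω σ f →
        0 < scalingDeficit d s p q α →
        oscNorm q Q ω f ≤
          C * apqChar p q α Q ω σ * ENNReal.ofReal ((1 - s) ^ (1 / r)) *
            (volume Q.toSet ^ scalingDeficit d s p q α /
              ENNReal.ofReal (scalingDeficit d s p q α)) *
            tlSeminorm s p r Q σ f) ∧
    -- Critical case I: the constant depends only on `p, q, r, d`.
    (∀ p q r : ℝ, ∃ C : ℝ≥0, ∀ (s α : ℝ) (Q : Cube d) (ω σ : EuclideanSpace ℝ (Fin d) → ℝ)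
        (f : EuclideanSpace ℝ (Fin d) → ℂ),
        Setting p q r s α Q ω σ f →
        scalingDeficit d s p q α = 0 →
        r ≤ p →
        aInftyChar Q (fun x => ω x ^ q) < ∞ →
        oscNorm q Q ω f ≤
          C * apqChar p q α Q ω σ * ENNReal.ofReal ((1 - s) ^ (1 / r)) *
            tlSeminorm s p r Q σ f *
            (if 1 < p ∧ p < q then aInftyChar Q (fun x => ω x ^ q) ^ (1 - 1 / p)
              else aInftyChar Q (fun x => ω x ^ q))) ∧
    -- Critical case II: the constant depends only on `p, q, r, d`.
    (∀ p q r : ℝ, ∃ C : ℝ≥0, ∀ (s α : ℝ) (Q : Cube d) (ω σ : EuclideanSpace ℝ (Fin d) → ℝ)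
        (f : EuclideanSpace ℝ (Fin d) → ℂ),
        Setting p q r s α Q ω σ f →
        scalingDeficit d s p q α = 0 →
        1 < p →
        aInftyChar Q (fun x => ω x ^ q) < ∞ →
        aInftyChar Q (fun x => σ x ^ (-Real.conjExponent p)) < ∞ →
        oscNorm q Q ω f ≤
          C * apqChar p q α Q ω σ * ENNReal.ofReal ((1 - s) ^ (1 / r)) *
            tlSeminorm s p r Q σ f *
            (if p < q then
              aInftyChar Q (fun x => ω x ^ q) ^ (1 - 1 / p) +
                aInftyChar Q (fun x => σ x ^ (-Real.conjExponent p)) ^ (1 / q)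
              else
              aInftyChar Q (fun x => ω x ^ q) ^ (1 - 1 / p) *
                aInftyChar Q (fun x => σ x ^ (-Real.conjExponent p)) ^ (1 / q))) := by
  refine ⟨⟨(6 ^ d * 2 * bbmConst d).toNNReal, ?_⟩, fun p q r => ?_, fun p q r => ?_⟩
  · intro p q r s α Q ω σ f hS hε
    obtain ⟨ω', σ', f', h, h1, h2, h3, -, -⟩ := Cube.exists_niceSetting hd hS
    have hC := bbmConst_ne_top d
    rw [h1, h2, h3, ENNReal.coe_toNNReal (by finiteness)]
    exact h.subcritical hε
  · by_cases hpq : 1 < p ∧ p < q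
    · refine ⟨(16 * (1 + Cube.weakConst d p q) * bbmConst d).toNNReal, ?_⟩
      intro s α Q ω σ f hS hε hrp hB
      obtain ⟨ω', σ', f', h, h1, h2, h3, h4, -⟩ := Cube.exists_niceSetting hd hS
      have hC := bbmConst_ne_top d
      have hC' := Cube.weakConst_ne_top d hpq.1 hpq.2
      rw [h4] at hB
      rw [h1, h2, h3, h4, ENNReal.coe_toNNReal (by finiteness), if_pos hpq]
      exact h.critical_weak hε hrp hpq.1 hpq.2 hB
    · refine ⟨(16 * (1 + Cube.sparseConst d q) * bbmConst d).toNNReal, ?_⟩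
      intro s α Q ω σ f hS hε hrp hB
      obtain ⟨ω', σ', f', h, h1, h2, h3, h4, -⟩ := Cube.exists_niceSetting hd hS
      have hC := bbmConst_ne_top d
      have hC' := Cube.sparseConst_ne_top d h.q_pos
      rw [h4] at hB
      rw [h1, h2, h3, h4, ENNReal.coe_toNNReal (by finiteness), if_neg hpq]
      exact h.critical_sparse hε hrp hB
  · by_cases hpq : p < q
    · refine ⟨(2304 * 18 ^ d * (1 + 2 * Cube.fracConst p q) * bbmConst d).toNNReal, ?_⟩
      intro s α Q ω σ f hS hε hp hB hB'
      obtain ⟨ω', σ', f', h, h1, h2, h3, h4, h5⟩ := Cube.exists_niceSetting hd hS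
      have hC := bbmConst_ne_top d
      have hC' := Cube.fracConst_ne_top hp hpq
      rw [h4] at hB
      rw [h5] at hB'
      rw [h1, h2, h3, h4, h5, ENNReal.coe_toNNReal (by finiteness), if_pos hpq]
      exact h.critical_strong_of_lt hε hp hpq hB hB'
    · refine ⟨(Cube.sparseStrongConst d p * bbmConst d).toNNReal, ?_⟩
      intro s α Q ω σ f hS hε hp hB hB'
      obtain ⟨ω', σ', f', h, h1, h2, h3, h4, h5⟩ := Cube.exists_niceSetting hd hS
      have hC := bbmConst_ne_top d
      have hC' := Cube.sparseStrongConst_ne_top d hp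
      rw [h4] at hB
      rw [h5] at hB'
      rw [h1, h2, h3, h4, h5, ENNReal.coe_toNNReal (by finiteness), if_neg hpq]
      exact h.critical_strong_of_eq hε hp (le_antisymm hS.p_le_q (not_lt.mp hpq)) hB hB'
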